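/- **Setting.** Let $\mathcal H$ be a separable complex Hilbert space, $\tau c(\mathcal H)$ its trace class with norm $\|X\|_1=\mathrm{tr}\,|X|$, $\Theta\subseteq\mathbb R^m$ open and convex, and $\mathcal M=\{\rho_\theta\}_{\theta\in\Theta}$ a family of density operators on $\mathcal H$. Derivatives and continuity of $\theta\mapsto\rho_\theta$ refer to $\|\cdot\|_1$. *Instruments.* An instrument $\mathsf M$ with outcomes in $\Omega=\mathbb R^l$ is a map $\Delta\mapsto\mathsf M[\Delta]$ from Borel sets to completely positive linear maps of $\tau c(\mathcal H)$, $\sigma$-additive pointwise in trace norm, with $\mathsf M[\Omega]$ trace preserving. Its outcome in the state $\sigma$ has the law $\Delta\mapsto\mathrm{tr}\,\mathsf M[\Delta](\sigma)$, and its a posteriori states are density operators $\sigma_\omega$, depending measurably on $\omega$, with $\int_\Delta \mathrm{tr}(A\sigma_\omega)\,P(d\omega)=\mathrm{tr}\,A\,\mathsf M[\Delta](\sigma)$ for all bounded $A$ and Borel $\Delta$, where $P$ is the law of the outcome. An estimator $\mathcal E_n=\{\mathsf M^n,T_n\}$ on $n$ samples consists of a measurement $\mathsf M^n$ on $\mathcal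 H^{\otimes n}$ with outcome $\omega_n$ and effects $M^n(\Delta)$, so that the input $\tau$ gives the law $\mathrm{tr}\,\tau M^n(d\omega_n)$, and of a measurable estimate $T_n(\omega_n)\in\mathbb R^m$. $\mathrm E_\theta$, $\mathrm V_\theta[\mathcal E_n]$ and $\mathrm{MSE}_\theta[\mathcal E_n]$ denote expectation, covariance matrix and mean square error matrix of $T_n$ under the input $\rho_\theta^{\otimes n}$, and $(B_\theta[\mathcal E_n])^i_j:=\partial_j\mathrm E_\theta[T_n^i]$. *Semi-classical measurements.* A semi-classical measurement on $n$ samples consists of finitely many rounds. In each round every sample is measured separately by an instrument with outcome in $\mathbb R^l$ that depends on the data of all previous rounds, strongly measurably with respect to the completely bounded norm (for every $\Delta$, $z\mapsto\mathsf M^z[\Delta]$ is a pointwise limit of simple functions); every measurement is applied to the a posteriori states left by the previous ones. It is one-way if there are $n$ rounds and in the $r$-th round only the $r$-th sample is measured. *Conditions on the model.* - (M.1) $\partial_i\rho_\theta$ and $\partial_i\partial_j\rho_\theta$ exist and are locally uniformly continuous on $\Theta$, and $\|\partial_i\rho_\theta\|_1,\ \|\partial_i\partial_j\rho_\theta\|_1\le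 a_1<\infty$. - (M.2) For all $\theta\in\Theta$ and $i$ there is a (possibly unbounded, densely defined) symmetric operator $L_{\theta,i}$ with $\partial_i\rho_\theta=\frac12(L_{\theta,i}\rho_\theta+\rho_\theta L_{\theta,i})$ and $\mathrm{tr}\,\rho_\theta L_{\theta,i}^2<\infty$. Precisely: $L_{\theta,i}\sqrt{\rho_\theta}$ is everywhere defined and Hilbert–Schmidt, and $\partial_i\rho_\theta=\frac12\big(K\sqrt{\rho_\theta}+\sqrt{\rho_\theta}K^*\big)$ with $K=L_{\theta,i}\sqrt{\rho_\theta}$. - Fix a bounded function $r:\Theta\to(0,\infty)$ such that $\theta+te_i\in\Theta$ for all $\theta\in\Theta$, all $i$ and $|t|\le r(\theta)$, and put $$\Diamond_{i,\theta}:=\big|\partial_i\rho_{\theta-r(\theta)e_i}\big|+\int_{-r(\theta)}^{r(\theta)}\big|\partial_i^2\rho_{\theta+te_i}\big|\,dt,\qquad \Diamond^{(1)}_{i,\theta,n}:=\sum_{\kappa=1}^n\rho_\theta^{\otimes(\kappa-1)}\otimes\Diamond_{i,\theta}\otimes\rho_\theta^{\otimes(n-\kappa)}.$$ - (M.3) There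 are an instrument $\tilde{\mathsf M}$ on $\mathcal H$ with outcomes in some $\mathbb R^l$ and measurable $\tilde T_n:(\mathbb R^l)^n\to\mathbb R^m$ such that the estimators $\tilde{\mathcal E}_n=\{\tilde{\mathsf M}^n,\tilde T_n\}$, where $\tilde{\mathsf M}^n$ is the $n$-fold repetition of $\tilde{\mathsf M}$, one on each sample, are asymptotically unbiased and satisfy (E) for all $n\ge1$ (both defined below), and such that for every $\theta\in\Theta$ there is $D_\theta$ with $\mathrm E_\theta\|\tilde T_n-\theta\|^4\le D_\theta/n^2$ for all $n\ge1$. *Conditions on estimators.* - (E) There is $a_{4,n}<\infty$ such that for all $\theta\in\Theta$ and all $i$: $\int\|T_n-\theta\|\,\mathrm{tr}\,\Diamond^{(1)}_{i,\theta,n}M^n(d\omega_n)\le n\,a_1a_{4,n}$ and $\mathrm E_\theta\|T_n-\theta\|^2\le n\,a_{4,n}^2$. - (E′) $T_n$ takes values in a set of finite diameter. - *Local unbiasedness* at $\theta$: $\mathrm E_\theta[T_n]=\theta$, and $B_\theta[\mathcal E_n]$ exists and is the identity. - *Asymptotic unbiasedness* of a sequence $\{\mathcal E_n\}_{n\ge1}$: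 for all $\theta\in\Theta$, $\mathrm E_\theta[T_n]\to\theta$, the matrices $B_\theta[\mathcal E_n]$ exist, and $B_\theta[\mathcal E_n]\to I$. *Bounds.* For a positive semidefinite real $m\times m$ matrix $G$ let $$C_\theta(G,\mathcal M):=\inf\Big\{\limsup_{n\to\infty} n\,\mathrm{Tr}\,G\,\mathrm{MSE}_\theta[\mathcal E_n]\Big\},$$ the infimum (in $[-\infty,\infty]$) being over all asymptotically unbiased sequences of semi-classical estimators that satisfy (E) for all $n\ge1$; let $C^{\to}_\theta(G,\mathcal M)$ be the same infimum over the sequences whose measurements are moreover one-way semi-classical. **Theorem.** Suppose that (M.1), (M.2) and (M.3) hold. Then for all $\theta\in\Theta$ and all positive semidefinite $G$, $$C_\theta(G,\mathcal M)=\inf\big\{\mathrm{Tr}\,G\,\mathrm V_\theta[\mathcal E_1]\,;\ \mathcal E_1\text{ on one sample, locally unbiased at }\theta,\ \text{(E′)}\big\}$$ $$=\inf\big\{\mathrm{Tr}\,G\,\mathrm V_\theta[\mathcal E_1]\,;\ \mathcal E_1\text{ on one sample, locally unbiased at }\theta,\ \text{(E)}\big\},$$ where $\mathcal E_1$ runs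 over the estimators given by an instrument on $\mathcal H$ with outcomes in some $\mathbb R^l$ and a measurable function of the outcome. Moreover one-way semi-classical measurements are already optimal: $C^{\to}_\theta(G,\mathcal M)=C_\theta(G,\mathcal M)$. -/

import Mathlib

open MeasureTheory Filter Topology
open scoped ENNReal ComplexOrder
noncomputable section
namespace QuantumEstimation
variable {H : Type*} [NormedAddCommGroup H] [InnerProductSpace ℂ H] [CompleteSpace H]

theorem norm_mul_eq_norm_abs_mul (A X : H →L[ℂ] H) : ‖A * X‖ = ‖CFC.abs A * X‖ := by
  have h : ‖A * X‖ * ‖A * X‖ = ‖CFC.abs A * X‖ * ‖CFC.abs A * X‖ := by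
    rw [← CStarRing.norm_star_mul_self, ← CStarRing.norm_star_mul_self]
    have hs : star (CFC.abs A) = CFC.abs A := (CFC.abs_nonneg A).isSelfAdjoint
    have h1 : star (A * X) * (A * X) = star X * (star A * A) * X := by
      rw [star_mul]; simp only [mul_assoc]
    have h2 : star (CFC.abs A * X) * (CFC.abs A * X)
        = star X * (CFC.abs A * CFC.abs A) * X := by
      rw [star_mul, hs]; simp only [mul_assoc]
    rw [h1, h2, CFC.abs_mul_abs]
  exact (mul_self_inj (norm_nonneg _) (norm_nonneg _)).1 h

theorem exists_approx_polar (A : H →L[ℂ] H) {ε : ℝ} (hε : 0 < ε) :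
    ∃ W : H →L[ℂ] H, ‖W‖ ≤ 1 ∧ ‖A - W * CFC.abs A‖ ≤ ε ∧ ‖CFC.abs A - star W * A‖ ≤ ε := by
  set P := CFC.abs A with hP
  have hP0 : 0 ≤ P := CFC.abs_nonneg A
  have hPs : IsSelfAdjoint P := hP0.isSelfAdjoint
  have hspec : ∀ t ∈ spectrum ℝ P, 0 ≤ t := fun t ht => spectrum_nonneg_of_nonneg hP0 ht
  have hcont : ContinuousOn (fun t : ℝ => (t + ε)⁻¹) (spectrum ℝ P) := by
    refine ContinuousOn.inv₀ (by fun_prop) ?_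
    intro t ht
    have := hspec t ht
    positivity
  set g := cfc (fun t : ℝ => (t + ε)⁻¹) P with hg
  have hPg : P * g = cfc (fun t : ℝ => t * (t + ε)⁻¹) P := by
    rw [cfc_mul (fun t : ℝ => t) (fun t : ℝ => (t + ε)⁻¹) P (by fun_prop) hcont,
      cfc_id' ℝ P]
  have hgs : star g = g := (IsSelfAdjoint.cfc (f := fun t : ℝ => (t + ε)⁻¹) (a := P))
  have hgP : g * P = P * g := by
    have := congrArg star hPg
    rw [star_mul, hgs, hPs.star_eq] at this
    rw [this, hPg]
    exact (IsSelfAdjoint.cfc (f := fun t : ℝ => t * (t + ε)⁻¹) (a := P))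
  have hc2 : ContinuousOn (fun t : ℝ => t * (t + ε)⁻¹) (spectrum ℝ P) :=
    continuousOn_id.mul hcont
  have hbd : ‖P * (1 - g * P)‖ ≤ ε := by
    have : P * (1 - g * P) = cfc (fun t : ℝ => t * (1 - t * (t + ε)⁻¹)) P := by
      rw [cfc_mul (fun t : ℝ => t) (fun t : ℝ => 1 - t * (t + ε)⁻¹) P (by fun_prop)
        (continuousOn_const.sub hc2),
        cfc_sub (fun _ : ℝ => (1 : ℝ)) (fun t : ℝ => t * (t + ε)⁻¹) P (by fun_prop) hc2,
        cfc_id' ℝ P, cfc_const_one ℝ P, ← hPg, hgP]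
    rw [this]
    refine norm_cfc_le hε.le fun t ht => ?_
    have h0 := hspec t ht
    have h1 : t * (1 - t * (t + ε)⁻¹) = ε * (t / (t + ε)) := by
      field_simp; ring
    rw [h1, Real.norm_of_nonneg (by positivity)]
    have : t / (t + ε) ≤ 1 := (div_le_one (by positivity)).2 (by linarith)
    nlinarith
  refine ⟨A * g, ?_, ?_, ?_⟩
  · rw [norm_mul_eq_norm_abs_mul, ← hP, hPg]
    refine norm_cfc_le zero_le_one fun t ht => ?_
    have h0 := hspec t ht
    rw [Real.norm_of_nonneg (by positivity), ← div_eq_mul_inv]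
    exact (div_le_one (by positivity)).2 (by linarith)
  · have : A - A * g * P = A * (1 - g * P) := by rw [mul_sub, mul_one, mul_assoc]
    rw [this, norm_mul_eq_norm_abs_mul]
    exact hbd
  · have : P - star (A * g) * A = P * (1 - g * P) := by
      rw [star_mul, hgs, mul_assoc, ← CFC.abs_mul_abs A, ← hP, mul_sub, mul_one, ← mul_assoc,
        ← mul_assoc, hgP]
    rw [this]; exact hbd


variable (H) in
/-- The index set of a fixed complete orthonormal system of `H`. -/
def onbIndex : Set H := (exists_hilbertBasis ℂ H).choose

variable (H) in
/-- A fixed complete orthonormal system of `H`. -/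
def onb : HilbertBasis (onbIndex H) ℂ H := (exists_hilbertBasis ℂ H).choose_spec.choose

/-- The trace norm `‖A‖₁ = tr |A|`, as an extended nonnegative number. -/
def traceNorm (A : H →L[ℂ] H) : ℝ≥0∞ :=
  ∑' k, ENNReal.ofReal (inner ℂ (onb H k) (CFC.abs A (onb H k))).re

/-- The squared Hilbert-Schmidt norm. -/
def hsSq (A : H →L[ℂ] H) : ℝ≥0∞ := ∑' k, ‖A (onb H k)‖ₑ ^ 2

/-- The trace of an operator, computed in the fixed complete orthonormal system. -/
def opTrace (A : H →L[ℂ] H) : ℂ := ∑' k, inner ℂ (onb H k) (A (onb H k))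

theorem tsum_enorm_inner_sq (x : H) : ∑' k, ‖inner ℂ (onb H k) x‖ₑ ^ 2 = ‖x‖ₑ ^ 2 := by
  have h := (onb H).hasSum_inner_mul_inner x x
  have h2 : HasSum (fun k => ‖inner ℂ (onb H k) x‖ ^ 2) (‖x‖ ^ 2) := by
    have := h.mapL Complex.reCLM
    simp only [Complex.reCLM_apply] at this
    convert this using 1
    · ext k
      rw [← inner_conj_symm x, ← Complex.normSq_eq_conj_mul_self, Complex.normSq_eq_norm_sq]
      exact (Complex.ofReal_re _).symm
    · rw [inner_self_eq_norm_sq_to_K]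
      norm_cast
  have h3 : ∀ y : ℂ, ‖y‖ₑ ^ 2 = ENNReal.ofReal (‖y‖ ^ 2) := fun y => by
    rw [ENNReal.ofReal_pow (norm_nonneg _), ofReal_norm]
  simp_rw [h3]
  rw [← ENNReal.ofReal_tsum_of_nonneg (fun _ => by positivity) h2.summable, h2.tsum_eq,
    ENNReal.ofReal_pow (norm_nonneg _), ofReal_norm]

theorem hsSq_star (A : H →L[ℂ] H) : hsSq (star A) = hsSq A := by
  unfold hsSq
  calc ∑' k, ‖star A (onb H k)‖ₑ ^ 2
      = ∑' k, ∑' j, ‖inner ℂ (onb H j) (star A (onb H k))‖ₑ ^ 2 := by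
        simp_rw [tsum_enorm_inner_sq]
    _ = ∑' j, ∑' k, ‖inner ℂ (onb H j) (star A (onb H k))‖ₑ ^ 2 := ENNReal.tsum_comm
    _ = ∑' j, ∑' k, ‖inner ℂ (onb H k) (A (onb H j))‖ₑ ^ 2 := by
        congr 1; ext j; congr 1; ext k
        rw [ContinuousLinearMap.star_eq_adjoint, ContinuousLinearMap.adjoint_inner_right,
          ← inner_conj_symm, RCLike.enorm_conj]
    _ = _ := by simp_rw [tsum_enorm_inner_sq]

theorem hsSq_mul_le (V A : H →L[ℂ] H) (hV : ‖V‖ ≤ 1) : hsSq (V * A) ≤ hsSq A := by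
  refine ENNReal.tsum_le_tsum fun k => ?_
  gcongr
  rw [enorm_le_iff_norm_le]
  calc ‖(V * A) (onb H k)‖ ≤ ‖V‖ * ‖A (onb H k)‖ := V.le_opNorm _
    _ ≤ 1 * ‖A (onb H k)‖ := by gcongr
    _ = _ := one_mul _

theorem hsSq_mul_le' (A V : H →L[ℂ] H) (hA : star A = A) (hV : ‖V‖ ≤ 1) :
    hsSq (A * V) ≤ hsSq A := by
  rw [← hsSq_star, star_mul, hA]
  exact hsSq_mul_le _ _ (by rwa [norm_star])

theorem traceNorm_eq_hsSq (A : H →L[ℂ] H) :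
    traceNorm A = hsSq (CFC.sqrt (CFC.abs A)) := by
  have hs : star (CFC.sqrt (CFC.abs A)) = CFC.sqrt (CFC.abs A) :=
    (CFC.sqrt_nonneg _).isSelfAdjoint
  unfold traceNorm hsSq
  congr 1; ext k
  have h : CFC.abs A (onb H k)
      = CFC.sqrt (CFC.abs A) (CFC.sqrt (CFC.abs A) (onb H k)) := by
    conv_lhs => rw [← CFC.sqrt_mul_sqrt_self (CFC.abs A) (CFC.abs_nonneg A)]
    rfl
  rw [h, ← ContinuousLinearMap.adjoint_inner_left, ← ContinuousLinearMap.star_eq_adjoint, hs,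
    inner_self_eq_norm_sq_to_K]
  rw [← ofReal_norm, ← ENNReal.ofReal_pow (norm_nonneg _)]
  congr 1
  norm_cast

set_option linter.unusedSectionVars false in
theorem enorm_inner_le_half (x y : H) :
    ‖inner ℂ x y‖ₑ ≤ (‖x‖ₑ ^ 2 + ‖y‖ₑ ^ 2) / 2 := by
  have h : ‖inner ℂ x y‖ ≤ (‖x‖ ^ 2 + ‖y‖ ^ 2) / 2 := by
    have := norm_inner_le_norm (𝕜 := ℂ) x y
    nlinarith [sq_nonneg (‖x‖ - ‖y‖)]
  have h2 := ENNReal.ofReal_le_ofReal h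
  rw [ENNReal.ofReal_div_of_pos (by norm_num), ENNReal.ofReal_add (by positivity) (by positivity),
    ENNReal.ofReal_pow (norm_nonneg _), ENNReal.ofReal_pow (norm_nonneg _)] at h2
  simpa using h2

set_option linter.unusedSectionVars false in
theorem enorm_inner_le_add {A B V : H →L[ℂ] H} {ε : ℝ} (hV : ‖V‖ ≤ 1) (h : ‖A - B‖ ≤ ε)
    {x : H} (hx : ‖x‖ = 1) :
    ‖inner ℂ (V x) (A x)‖ₑ ≤ ‖inner ℂ (V x) (B x)‖ₑ + ENNReal.ofReal ε := by
  have h1 : ‖inner ℂ (V x) (A x)‖ ≤ ‖inner ℂ (V x) (B x)‖ + ε := by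
    have e : inner ℂ (V x) (A x) = inner ℂ (V x) (B x) + inner ℂ (V x) ((A - B) x) := by
      simp
    rw [e]
    refine (norm_add_le _ _).trans (add_le_add le_rfl ?_)
    refine (norm_inner_le_norm _ _).trans ?_
    have a1 : ‖V x‖ ≤ 1 := (V.le_opNorm x).trans (by rw [hx, mul_one]; exact hV)
    have a2 : ‖(A - B) x‖ ≤ ε := ((A - B).le_opNorm x).trans (by rw [hx, mul_one]; exact h)
    calc ‖V x‖ * ‖(A - B) x‖ ≤ 1 * ε :=
          mul_le_mul a1 a2 (norm_nonneg _) zero_le_one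
      _ = ε := one_mul _
  have h2 := (ENNReal.ofReal_le_ofReal h1).trans ENNReal.ofReal_add_le
  simpa using h2

theorem le_of_forall_card {a b : ℝ≥0∞} (n : ℕ)
    (h : ∀ ε : ℝ, 0 < ε → a ≤ b + n * ENNReal.ofReal ε) : a ≤ b := by
  refine ENNReal.le_of_forall_pos_le_add fun δ hδ _ => ?_
  refine (h (δ / (n + 1)) (by positivity)).trans (add_le_add le_rfl ?_)
  have h1 : (n : ℝ≥0∞) = ENNReal.ofReal n := (ENNReal.ofReal_natCast n).symm
  rw [h1, ← ENNReal.ofReal_mul (by positivity), ← ENNReal.ofReal_coe_nnreal]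
  refine ENNReal.ofReal_le_ofReal ?_
  rw [mul_div_assoc', div_le_iff₀ (by positivity)]
  nlinarith [δ.coe_nonneg]

theorem sum_enorm_inner_le {A V : H →L[ℂ] H} (hV : ‖V‖ ≤ 1) (F : Finset (onbIndex H)) :
    ∑ k ∈ F, ‖inner ℂ (V (onb H k)) (A (onb H k))‖ₑ ≤ traceNorm A := by
  set S := CFC.sqrt (CFC.abs A) with hS
  have hs : star S = S := (CFC.sqrt_nonneg _).isSelfAdjoint
  have hSS : S * S = CFC.abs A := CFC.sqrt_mul_sqrt_self _ (CFC.abs_nonneg A)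
  refine le_of_forall_card F.card fun ε hε => ?_
  obtain ⟨W, hW, hA, -⟩ := exists_approx_polar A hε
  have hU : ‖star W * V‖ ≤ 1 := (norm_mul_le _ _).trans (by
    rw [norm_star]; exact mul_le_one₀ hW (norm_nonneg _) hV)
  have key : ∀ k, ‖inner ℂ (V (onb H k)) ((W * CFC.abs A) (onb H k))‖ₑ
      ≤ (‖(S * (star W * V)) (onb H k)‖ₑ ^ 2 + ‖S (onb H k)‖ₑ ^ 2) / 2 := fun k => by
    have e : inner ℂ (V (onb H k)) ((W * CFC.abs A) (onb H k))
        = inner ℂ ((S * (star W * V)) (onb H k)) (S (onb H k)) := by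
      rw [← hSS]
      simp only [mul_apply_eq_comp]
      rw [← ContinuousLinearMap.adjoint_inner_left, ← ContinuousLinearMap.star_eq_adjoint,
        ← ContinuousLinearMap.adjoint_inner_left, ← ContinuousLinearMap.star_eq_adjoint S, hs]
    rw [e]; exact enorm_inner_le_half _ _
  calc ∑ k ∈ F, ‖inner ℂ (V (onb H k)) (A (onb H k))‖ₑ
      ≤ ∑ k ∈ F, ((‖(S * (star W * V)) (onb H k)‖ₑ ^ 2 + ‖S (onb H k)‖ₑ ^ 2) / 2
          + ENNReal.ofReal ε) := Finset.sum_le_sum fun k _ =>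
        (enorm_inner_le_add hV hA ((onb H).orthonormal.1 k)).trans (add_le_add (key k) le_rfl)
    _ = (∑ k ∈ F, ‖(S * (star W * V)) (onb H k)‖ₑ ^ 2 + ∑ k ∈ F, ‖S (onb H k)‖ₑ ^ 2) / 2
          + F.card * ENNReal.ofReal ε := by
        rw [Finset.sum_add_distrib, Finset.sum_const, nsmul_eq_mul]
        congr 1
        simp only [div_eq_mul_inv]
        rw [← Finset.sum_mul, Finset.sum_add_distrib]
    _ ≤ (hsSq (S * (star W * V)) + hsSq S) / 2 + F.card * ENNReal.ofReal ε := by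
        gcongr <;> exact ENNReal.sum_le_tsum F
    _ ≤ (hsSq S + hsSq S) / 2 + F.card * ENNReal.ofReal ε := by
        gcongr; exact hsSq_mul_le' _ _ hs hU
    _ = traceNorm A + F.card * ENNReal.ofReal ε := by
        rw [ENNReal.add_div, ENNReal.add_halves, traceNorm_eq_hsSq]

theorem traceNorm_add_le (A B : H →L[ℂ] H) : traceNorm (A + B) ≤ traceNorm A + traceNorm B := by
  rw [traceNorm, ENNReal.tsum_eq_iSup_sum]
  refine iSup_le fun F => le_of_forall_card F.card fun ε hε => ?_
  obtain ⟨W, hW, -, hA⟩ := exists_approx_polar (A + B) hε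
  calc ∑ k ∈ F, ENNReal.ofReal (inner ℂ (onb H k) (CFC.abs (A + B) (onb H k))).re
      ≤ ∑ k ∈ F, (‖inner ℂ (W (onb H k)) (A (onb H k))‖ₑ
          + ‖inner ℂ (W (onb H k)) (B (onb H k))‖ₑ + ENNReal.ofReal ε) := by
        refine Finset.sum_le_sum fun k _ => ?_
        have h1 : ENNReal.ofReal (inner ℂ (onb H k) (CFC.abs (A + B) (onb H k))).re
            ≤ ‖inner ℂ (onb H k) (CFC.abs (A + B) (onb H k))‖ₑ := by
          rw [← ofReal_norm]
          exact ENNReal.ofReal_le_ofReal (Complex.re_le_norm _)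
        have h2 := enorm_inner_le_add (V := (1 : H →L[ℂ] H))
          (ContinuousLinearMap.norm_id_le) hA ((onb H).orthonormal.1 k)
        refine h1.trans (h2.trans (add_le_add ?_ le_rfl))
        have e : inner ℂ ((1 : H →L[ℂ] H) (onb H k)) ((star W * (A + B)) (onb H k))
            = inner ℂ (W (onb H k)) (A (onb H k)) + inner ℂ (W (onb H k)) (B (onb H k)) := by
          rw [← inner_add_right]
          simp only [mul_apply_eq_comp, one_apply_eq_self,
            ContinuousLinearMap.star_eq_adjoint, ContinuousLinearMap.adjoint_inner_right,
            add_apply]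
        rw [e]
        exact enorm_add_le _ _
    _ = ∑ k ∈ F, ‖inner ℂ (W (onb H k)) (A (onb H k))‖ₑ
          + ∑ k ∈ F, ‖inner ℂ (W (onb H k)) (B (onb H k))‖ₑ + F.card * ENNReal.ofReal ε := by
        rw [Finset.sum_add_distrib, Finset.sum_add_distrib, Finset.sum_const, nsmul_eq_mul]
    _ ≤ _ := by gcongr <;> exact sum_enorm_inner_le hW F

theorem traceNorm_zero : traceNorm (0 : H →L[ℂ] H) = 0 := by simp [traceNorm]

theorem traceNorm_smul (c : ℂ) (A : H →L[ℂ] H) : traceNorm (c • A) = ‖c‖ₑ * traceNorm A := by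
  unfold traceNorm
  rw [← ENNReal.tsum_mul_left]
  congr 1; ext k
  rw [CFC.abs_smul, ← ofReal_norm, ← ENNReal.ofReal_mul (norm_nonneg _)]
  congr 1
  rw [smul_apply, ← Complex.coe_smul, inner_smul_right, Complex.re_ofReal_mul]

theorem traceNorm_neg (A : H →L[ℂ] H) : traceNorm (-A) = traceNorm A := by
  simp [traceNorm]

theorem eq_zero_of_traceNorm_eq_zero {A : H →L[ℂ] H} (h : traceNorm A = 0) : A = 0 := by
  rw [traceNorm_eq_hsSq, hsSq, ENNReal.tsum_eq_zero] at h
  have h1 : CFC.sqrt (CFC.abs A) = 0 := by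
    have h2 : star (CFC.sqrt (CFC.abs A)) = CFC.sqrt (CFC.abs A) :=
      (CFC.sqrt_nonneg _).isSelfAdjoint
    ext x
    have : ∀ k, inner ℂ (onb H k) (CFC.sqrt (CFC.abs A) x) = 0 := fun k => by
      rw [← h2, ContinuousLinearMap.star_eq_adjoint, ContinuousLinearMap.adjoint_inner_right]
      have := h k
      simp at this
      simp [this]
    have h3 := tsum_enorm_inner_sq (CFC.sqrt (CFC.abs A) x)
    simp [this] at h3
    simpa using h3.symm
  have h4 := CFC.sqrt_mul_sqrt_self (CFC.abs A) (CFC.abs_nonneg A)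
  rw [h1, zero_mul] at h4
  exact CFC.abs_eq_zero_iff.1 h4.symm

theorem traceNorm_abs (A : H →L[ℂ] H) : traceNorm (CFC.abs A) = traceNorm A := by
  simp [traceNorm]

variable (H) in
/-- The trace class operators, `tr |A| < ∞`, as a subspace of the bounded operators. -/
def traceClassSubmodule : Submodule ℂ (H →L[ℂ] H) where
  carrier := {A | traceNorm A ≠ ⊤}
  zero_mem' := by simp [traceNorm_zero]
  add_mem' {A B} hA hB :=
    ((traceNorm_add_le A B).trans_lt (ENNReal.add_lt_top.2 ⟨hA.lt_top, hB.lt_top⟩)).ne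
  smul_mem' c A hA := by
    simp only [Set.mem_ofPred_eq, traceNorm_smul] at hA ⊢
    exact ENNReal.mul_ne_top (by simp) hA

variable (H) in
/-- The Banach space of trace class operators on `H`, with the trace norm. -/
def TraceClass : Type _ := traceClassSubmodule H

namespace TraceClass

instance : AddCommGroup (TraceClass H) := inferInstanceAs (AddCommGroup (traceClassSubmodule H))
instance : Module ℂ (TraceClass H) := inferInstanceAs (Module ℂ (traceClassSubmodule H))

/-- The bounded operator underlying a trace class operator. -/
def op : TraceClass H →ₗ[ℂ] (H →L[ℂ] H) := (traceClassSubmodule H).subtype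

theorem op_injective : Function.Injective (op : TraceClass H → (H →L[ℂ] H)) :=
  Subtype.val_injective

theorem traceNorm_ne_top (A : TraceClass H) : traceNorm A.op ≠ ⊤ := A.2

/-- A bounded operator of finite trace norm, as a trace class operator. -/
def ofOp (A : H →L[ℂ] H) (hA : traceNorm A ≠ ⊤) : TraceClass H :=
  (⟨A, hA⟩ : traceClassSubmodule H)

theorem op_ofOp (A : H →L[ℂ] H) (hA : traceNorm A ≠ ⊤) : (ofOp A hA).op = A := rfl

/-- The absolute value `|A|` of a trace class operator. -/
def abs (A : TraceClass H) : TraceClass H :=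
  ofOp (CFC.abs A.op) (by rw [traceNorm_abs]; exact A.traceNorm_ne_top)

instance : Norm (TraceClass H) := ⟨fun A => (traceNorm A.op).toReal⟩

theorem norm_def (A : TraceClass H) : ‖A‖ = (traceNorm A.op).toReal := rfl

theorem normCore : NormedSpace.Core ℂ (TraceClass H) where
  norm_nonneg A := ENNReal.toReal_nonneg
  norm_smul c A := by
    rw [norm_def, norm_def, map_smul, traceNorm_smul, ENNReal.toReal_mul, toReal_enorm]
  norm_triangle A B := by
    rw [norm_def, norm_def, norm_def, map_add,
      ← ENNReal.toReal_add A.traceNorm_ne_top B.traceNorm_ne_top]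
    exact ENNReal.toReal_mono (ENNReal.add_ne_top.2 ⟨A.traceNorm_ne_top, B.traceNorm_ne_top⟩)
      (traceNorm_add_le _ _)
  norm_eq_zero_iff A := by
    rw [norm_def, ENNReal.toReal_eq_zero_iff]
    constructor
    · rintro (h | h)
      · exact op_injective (by rw [eq_zero_of_traceNorm_eq_zero h, map_zero])
      · exact absurd h A.traceNorm_ne_top
    · rintro rfl
      left; rw [map_zero, traceNorm_zero]

instance : NormedAddCommGroup (TraceClass H) := NormedAddCommGroup.ofCore normCore
instance : NormedSpace ℂ (TraceClass H) := NormedSpace.ofCore normCore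

theorem summable_trace (A : TraceClass H) :
    Summable fun k => ‖inner ℂ (onb H k) (A.op (onb H k))‖ := by
  have h : ∑' k, ‖inner ℂ (onb H k) (A.op (onb H k))‖ₑ ≤ traceNorm A.op := by
    rw [ENNReal.tsum_eq_iSup_sum]
    refine iSup_le fun F => ?_
    simpa using sum_enorm_inner_le (V := (1 : H →L[ℂ] H)) (A := A.op)
      ContinuousLinearMap.norm_id_le F
  have h2 := ENNReal.summable_toReal (h.trans_lt A.traceNorm_ne_top.lt_top).ne
  simpa using h2

theorem norm_opTrace_le (A : TraceClass H) : ‖opTrace A.op‖ ≤ ‖A‖ := by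
  refine (norm_tsum_le_tsum_norm A.summable_trace).trans ?_
  refine A.summable_trace.tsum_le_of_sum_le fun F => ?_
  have := sum_enorm_inner_le (V := (1 : H →L[ℂ] H)) (A := A.op)
      ContinuousLinearMap.norm_id_le F
  have h2 := ENNReal.toReal_mono A.traceNorm_ne_top this
  rw [ENNReal.toReal_sum (fun _ _ => by simp)] at h2
  simpa [norm_def] using h2

variable (H) in
/-- The trace as a continuous linear functional on the trace class. -/
def traceCLM : TraceClass H →L[ℂ] ℂ :=
  LinearMap.mkContinuous
    { toFun := fun A => opTrace A.op
      map_add' := fun A B => by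
        simp only [opTrace, map_add, add_apply, inner_add_right]
        exact (A.summable_trace.of_norm).tsum_add (B.summable_trace.of_norm)
      map_smul' := fun c A => by
        simp only [opTrace, map_smul, smul_apply, inner_smul_right,
          RingHom.id_apply, smul_eq_mul]
        exact tsum_mul_left }
    1 fun A => by rw [one_mul]; exact A.norm_opTrace_le


theorem norm_op_le (A : TraceClass H) : ‖A.op‖ ≤ ‖A‖ := by
  set S := CFC.sqrt (CFC.abs A.op) with hS
  have hs : star S = S := (CFC.sqrt_nonneg _).isSelfAdjoint
  have hSS : S * S = CFC.abs A.op := CFC.sqrt_mul_sqrt_self _ (CFC.abs_nonneg _)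
  have h1 : ∀ x : H, ‖S x‖ ^ 2 ≤ ‖A‖ * ‖x‖ ^ 2 := fun x => by
    have h2 : ‖S x‖ₑ ^ 2 ≤ traceNorm A.op * ‖x‖ₑ ^ 2 := by
      rw [← tsum_enorm_inner_sq (S x), traceNorm_eq_hsSq, hsSq, ← ENNReal.tsum_mul_right]
      refine ENNReal.tsum_le_tsum fun k => ?_
      rw [← mul_pow, ← hS]
      gcongr
      rw [← hs, ContinuousLinearMap.star_eq_adjoint, ContinuousLinearMap.adjoint_inner_right,
        ← ContinuousLinearMap.star_eq_adjoint, hs, ← ofReal_norm, ← ofReal_norm, ← ofReal_norm,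
        ← ENNReal.ofReal_mul (norm_nonneg _)]
      exact ENNReal.ofReal_le_ofReal (norm_inner_le_norm _ _)
    have h3 := ENNReal.toReal_mono
      (ENNReal.mul_ne_top A.traceNorm_ne_top (by simp)) h2
    simpa [norm_def] using h3
  have h4 : ‖S‖ ^ 2 = ‖A.op‖ := by
    rw [← CFC.norm_abs (a := A.op), ← hSS]
    conv_rhs => rw [← hs]
    rw [hs, sq]
    conv_rhs => arg 1; arg 1; rw [← hs]
    rw [CStarRing.norm_star_mul_self]
  rw [← h4]
  have h5 : ‖S‖ ≤ Real.sqrt ‖A‖ := by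
    refine S.opNorm_le_bound (Real.sqrt_nonneg _) fun x => ?_
    refine abs_le_of_sq_le_sq' ?_ (by positivity) |>.2
    rw [mul_pow, Real.sq_sqrt (norm_nonneg _)]
    exact h1 x
  calc ‖S‖ ^ 2 ≤ Real.sqrt ‖A‖ ^ 2 := by gcongr
    _ = ‖A‖ := Real.sq_sqrt (norm_nonneg _)

theorem traceNorm_le_of_tendsto {B : ℕ → H →L[ℂ] H} {A : H →L[ℂ] H} {c : ℝ≥0∞}
    (hB : Tendsto B atTop (𝓝 A)) (hc : ∀ᶠ j in atTop, traceNorm (B j) ≤ c) :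
    traceNorm A ≤ c := by
  rw [traceNorm, ENNReal.tsum_eq_iSup_sum]
  refine iSup_le fun F => ?_
  have h1 : Continuous fun X : H →L[ℂ] H =>
      ∑ k ∈ F, ENNReal.ofReal (inner ℂ (onb H k) (CFC.abs X (onb H k))).re := by
    refine continuous_finsetSum F fun k _ => ENNReal.continuous_ofReal.comp ?_
    refine Complex.continuous_re.comp (Continuous.inner continuous_const ?_)
    exact (CFC.continuous_abs (A := H →L[ℂ] H)).clm_apply continuous_const
  refine le_of_tendsto ((h1.tendsto A).comp hB) ?_
  filter_upwards [hc] with j hj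
  exact (ENNReal.sum_le_tsum F).trans hj

instance : CompleteSpace (TraceClass H) := by
  refine Metric.complete_of_cauchySeq_tendsto fun u hu => ?_
  have hop : CauchySeq fun j => (u j).op := by
    refine Metric.cauchySeq_iff.2 fun ε hε => ?_
    obtain ⟨N, hN⟩ := Metric.cauchySeq_iff.1 hu ε hε
    refine ⟨N, fun i hi j hj => ?_⟩
    have := hN i hi j hj
    rw [dist_eq_norm] at this ⊢
    rw [← map_sub]
    exact (norm_op_le _).trans_lt this
  obtain ⟨A, hA⟩ := cauchySeq_tendsto_of_complete hop
  have key : ∀ ε : ℝ, 0 < ε → ∃ N, ∀ i ≥ N,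
      traceNorm (A - (u i).op) ≤ ENNReal.ofReal ε := fun ε hε => by
    obtain ⟨N, hN⟩ := Metric.cauchySeq_iff.1 hu ε hε
    refine ⟨N, fun i hi => traceNorm_le_of_tendsto (hA.sub_const (u i).op) ?_⟩
    filter_upwards [eventually_ge_atTop N] with j hj
    have := (hN j hj i hi).le
    rw [dist_eq_norm, norm_def, map_sub] at this
    rw [ENNReal.le_ofReal_iff_toReal_le _ hε.le]
    · exact this
    · rw [← map_sub]; exact traceNorm_ne_top _
  obtain ⟨N, hN⟩ := key 1 one_pos
  have hA' : traceNorm A ≠ ⊤ := by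
    have h1 : A = (A - (u N).op) + (u N).op := by abel
    rw [h1]
    exact ((traceNorm_add_le _ _).trans_lt (ENNReal.add_lt_top.2
      ⟨(hN N le_rfl).trans_lt ENNReal.ofReal_lt_top, (u N).traceNorm_ne_top.lt_top⟩)).ne
  refine ⟨ofOp A hA', Metric.tendsto_atTop.2 fun ε hε => ?_⟩
  obtain ⟨N, hN⟩ := key (ε / 2) (by positivity)
  refine ⟨N, fun i hi => ?_⟩
  rw [dist_comm, dist_eq_norm, norm_def, map_sub, op_ofOp]
  have h1 := ENNReal.toReal_mono ENNReal.ofReal_ne_top (hN i hi)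
  rw [ENNReal.toReal_ofReal (by positivity)] at h1
  exact lt_of_le_of_lt h1 (by linarith)

/-- The trace of a trace class operator. -/
def tr (A : TraceClass H) : ℂ := traceCLM H A

/-- Positivity `A ≥ 0`. -/
def IsPos (A : TraceClass H) : Prop := 0 ≤ A.op

/-- Density operators: `ρ ≥ 0` and `tr ρ = 1`. -/
def IsDensity (A : TraceClass H) : Prop := A.IsPos ∧ A.tr = 1

theorem IsPos.tr_re_nonneg {A : TraceClass H} (hA : A.IsPos) : 0 ≤ A.tr.re := by
  have h : A.tr.re = ∑' k, (inner ℂ (onb H k) (A.op (onb H k))).re :=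
    Complex.re_tsum A.summable_trace.of_norm
  rw [h]
  refine tsum_nonneg fun k => ?_
  exact ((ContinuousLinearMap.nonneg_iff_isPositive _).1 hA).re_inner_nonneg_right _

end TraceClass

/-! ### Completely positive maps and instruments -/

/-- A `k × k` array of trace class operators is positive as an operator on `H ⊗ ℂᵏ`. -/
def IsBlockPos {k : ℕ} (A : Fin k → Fin k → TraceClass H) : Prop :=
  ∀ x : Fin k → H, 0 ≤ ∑ i, ∑ j, inner ℂ (x i) ((A i j).op (x j))

/-- Complete positivity of a linear transform of the trace class. -/
def IsCompletelyPositive (Λ : TraceClass H →ₗ[ℂ] TraceClass H) : Prop :=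
  ∀ (k : ℕ) (A : Fin k → Fin k → TraceClass H), IsBlockPos A → IsBlockPos fun i j => Λ (A i j)

/-- The operator on `H ⊗ ℂᵏ`, realized as the `k`-fold Hilbert sum of `H`, with blocks `A i j`. -/
def blockOp {k : ℕ} (A : Fin k → Fin k → TraceClass H) :
    PiLp 2 (fun _ : Fin k => H) →L[ℂ] PiLp 2 (fun _ : Fin k => H) :=
  ∑ i, ∑ j, ContinuousLinearMap.adjoint (PiLp.proj (𝕜 := ℂ) 2 (fun _ : Fin k => H) i) ∘L
    (A i j).op ∘L PiLp.proj (𝕜 := ℂ) 2 (fun _ : Fin k => H) j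

/-- The completely bounded norm `sup ‖(Λ ⊗ I)(X)‖₁` over `X` on `H ⊗ ℂᵏ` with `‖X‖₁ ≤ 1` and over
all `k`. -/
def cbNorm (Λ : TraceClass H →ₗ[ℂ] TraceClass H) : ℝ≥0∞ :=
  ⨆ (k : ℕ) (A : Fin k → Fin k → TraceClass H) (_ : traceNorm (blockOp A) ≤ 1),
    traceNorm (blockOp fun i j => Λ (A i j))

/-- Strong measurability for the completely bounded norm: pointwise approximability by simple
functions. -/
def CbMeasurable {Z : Type*} [MeasurableSpace Z]
    (f : Z → TraceClass H →ₗ[ℂ] TraceClass H) : Prop :=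
  ∃ s : ℕ → SimpleFunc Z (TraceClass H →ₗ[ℂ] TraceClass H),
    ∀ z, Tendsto (fun j => cbNorm (s j z - f z)) atTop (𝓝 0)

variable (H) in
/-- An instrument with outcomes in `Ω`: a σ-additive map from measurable sets to completely positive
linear transforms of the trace class whose value on the whole space is trace preserving. -/
structure Instrument (Ω : Type*) [MeasurableSpace Ω] where
  /-- `toFun Δ τ` is the unnormalized state after the outcome was found in `Δ`. -/
  toFun : Set Ω → TraceClass H →ₗ[ℂ] TraceClass H
  completelyPositive : ∀ Δ, MeasurableSet Δ → IsCompletelyPositive (toFun Δ)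
  tracePreserving : ∀ τ, (toFun Set.univ τ).tr = τ.tr
  sigmaAdditive : ∀ Δ : ℕ → Set Ω, (∀ j, MeasurableSet (Δ j)) →
    Pairwise (fun i j => Disjoint (Δ i) (Δ j)) →
    ∀ τ, HasSum (fun j => toFun (Δ j) τ) (toFun (⋃ j, Δ j) τ)

namespace Instrument

variable {Ω : Type*} [MeasurableSpace Ω]

theorem isPos_toFun (M : Instrument H Ω) {Δ : Set Ω} (hΔ : MeasurableSet Δ) {τ : TraceClass H}
    (hτ : τ.IsPos) : (M.toFun Δ τ).IsPos := by
  have h1 : IsBlockPos (fun _ _ : Fin 1 => τ) := fun x => by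
    simpa using ((ContinuousLinearMap.nonneg_iff_isPositive _).1 hτ).inner_nonneg_right (x 0)
  have h2 := M.completelyPositive Δ hΔ 1 _ h1
  refine (ContinuousLinearMap.nonneg_iff_isPositive _).2
    ((ContinuousLinearMap.isPositive_iff_complex _).2 fun x => ?_)
  have h3 := h2 fun _ => x
  simp only [Finset.univ_unique, Finset.sum_singleton] at h3
  obtain ⟨h4, h5⟩ := Complex.nonneg_iff.1 h3
  have e : inner ℂ ((M.toFun Δ τ).op x) x
      = starRingEnd ℂ (inner ℂ x ((M.toFun Δ τ).op x)) := (inner_conj_symm _ _).symm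
  rw [e]
  refine ⟨Complex.ext (by rw [Complex.ofReal_re]; rfl) ?_, h4⟩
  rw [Complex.ofReal_im, Complex.conj_im, ← h5, neg_zero]

theorem toFun_empty (M : Instrument H Ω) (τ : TraceClass H) : M.toFun ∅ τ = 0 := by
  have h := M.sigmaAdditive (fun _ => ∅) (fun _ => MeasurableSet.empty)
    (fun _ _ _ => disjoint_bot_left) τ
  have h2 := h.summable.tendsto_atTop_zero
  exact tendsto_nhds_unique tendsto_const_nhds h2

open Classical in
/-- The distribution `Δ ↦ tr M[Δ](τ)` of the outcome for a positive input `τ`. -/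
def outcome (M : Instrument H Ω) (τ : TraceClass H) : Measure Ω :=
  if hτ : τ.IsPos then
    Measure.ofMeasurable (fun Δ _ => ENNReal.ofReal (M.toFun Δ τ).tr.re)
      (by simp [M.toFun_empty, TraceClass.tr])
      (fun Δ hΔ hd => by
        have h := (M.sigmaAdditive Δ hΔ hd τ).mapL (TraceClass.traceCLM H)
        have h2 := Complex.hasSum_re h
        have h3 : (M.toFun (⋃ j, Δ j) τ).tr.re = ∑' j, (M.toFun (Δ j) τ).tr.re := h2.tsum_eq.symm
        rw [h3, ENNReal.ofReal_tsum_of_nonneg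
          (fun j => (M.isPos_toFun (hΔ j) hτ).tr_re_nonneg) h2.summable])
  else 0

/-- The instrument that does nothing and reports a constant. -/
def IsTrivial (M : Instrument H Ω) : Prop :=
  ∃ x₀ : Ω, ∀ Δ, MeasurableSet Δ → ∀ τ, (x₀ ∈ Δ → M.toFun Δ τ = τ) ∧ (x₀ ∉ Δ → M.toFun Δ τ = 0)

end Instrument

/-! ### Estimators -/

/-- The parameter space `ℝᵐ`. -/
abbrev Param (m : ℕ) : Type := EuclideanSpace ℝ (Fin m)

/-- The `i`-th coordinate vector of the parameter space. -/
def coordVec {m : ℕ} (i : Fin m) : Param m := EuclideanSpace.single i 1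

variable (H) in
/-- The statistical content of an estimator on `n` samples: the law of the data when the `n` samples
are prepared in the product `τ₁ ⊗ ⋯ ⊗ τₙ` of positive trace class operators, and the estimate as a
measurable function of the data. -/
structure Estimator (n m : ℕ) (Ω : Type*) [MeasurableSpace Ω] where
  /-- `law τ (Δ) = tr (τ₁ ⊗ ⋯ ⊗ τₙ) Mⁿ(Δ)`. -/
  law : (Fin n → TraceClass H) → Measure Ω
  /-- The estimate. -/
  est : Ω → Param m
  measurable_est : Measurable est

namespace Estimator

variable {n m : ℕ} {Ω : Type*} [MeasurableSpace Ω]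

/-- The law of the data for `n` identical samples in the state `σ`. -/
def iidLaw (e : Estimator H n m Ω) (σ : TraceClass H) : Measure Ω := e.law fun _ => σ

/-- The expectation `E_θ[Tⁱ]`. -/
def mean (e : Estimator H n m Ω) (ρ : Param m → TraceClass H) (θ : Param m) (i : Fin m) : ℝ :=
  ∫ ω, e.est ω i ∂e.iidLaw (ρ θ)

/-- The mean square error matrix at `θ`. -/
def mse (e : Estimator H n m Ω) (ρ : Param m → TraceClass H) (θ : Param m) :
    Matrix (Fin m) (Fin m) ℝ :=
  Matrix.of fun i j => ∫ ω, (e.est ω i - θ i) * (e.est ω j - θ j) ∂e.iidLaw (ρ θ)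

/-- The covariance matrix `V_θ`. -/
def cov (e : Estimator H n m Ω) (ρ : Param m → TraceClass H) (θ : Param m) :
    Matrix (Fin m) (Fin m) ℝ :=
  Matrix.of fun i j =>
    ∫ ω, (e.est ω i - e.mean ρ θ i) * (e.est ω j - e.mean ρ θ j) ∂e.iidLaw (ρ θ)

/-- The partial derivatives of the expectation exist at `θ` and form the matrix
`Bⁱⱼ = ∂ⱼ E_θ[Tⁱ]`. -/
def HasMeanDeriv (e : Estimator H n m Ω) (ρ : Param m → TraceClass H) (θ : Param m)
    (B : Matrix (Fin m) (Fin m) ℝ) : Prop :=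
  ∀ i j, HasDerivAt (fun t : ℝ => e.mean ρ (θ + t • coordVec j) i) (B i j) 0

/-- Local unbiasedness at `θ`: `E_θ[T] = θ` and `∂ⱼ E_θ[Tⁱ] = δⁱⱼ`. -/
def LocallyUnbiased (e : Estimator H n m Ω) (ρ : Param m → TraceClass H) (θ : Param m) : Prop :=
  (∀ i, e.mean ρ θ i = θ i) ∧ e.HasMeanDeriv ρ θ 1

/-- The estimate takes values in a set of finite diameter. -/
def BoundedRange (e : Estimator H n m Ω) : Prop :=
  ∃ a : ℝ, ∀ ω ω', ‖e.est ω - e.est ω'‖ ≤ a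

/-- The moment condition on estimators relative to trace class operators `D i θ` that dominate the
derivatives of the model: for some `a` and all `θ ∈ Θ`,
`∫ ‖T - θ‖ tr D⁽¹⁾ Mⁿ(dω) ≤ n a₁ a`, with `D⁽¹⁾ = ∑_κ ρ_θ ⊗ ⋯ ⊗ D i θ ⊗ ⋯ ⊗ ρ_θ`
(the factor `D i θ` in place `κ`), for every `i`, and `E_θ ‖T - θ‖² ≤ n a²`. -/
def MomentBound (e : Estimator H n m Ω) (Θ : Set (Param m)) (ρ : Param m → TraceClass H)
    (D : Fin m → Param m → TraceClass H) (a₁ : ℝ) : Prop :=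
  ∃ a : ℝ, ∀ θ ∈ Θ,
    (∀ i, ∑ κ : Fin n, ∫⁻ ω, ‖e.est ω - θ‖ₑ
        ∂e.law (Function.update (fun _ => ρ θ) κ (D i θ)) ≤ ENNReal.ofReal (n * a₁ * a)) ∧
    ∫⁻ ω, ‖e.est ω - θ‖ₑ ^ 2 ∂e.iidLaw (ρ θ) ≤ ENNReal.ofReal (n * a ^ 2)

end Estimator

/-- Asymptotic unbiasedness of a sequence of estimators: for all `θ ∈ Θ`, `E_θ[Tₙ] → θ` and
`∂ⱼ E_θ[Tₙⁱ] → δⁱⱼ`, where the derivatives exist. -/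
def AsymptoticallyUnbiased {m : ℕ} {Ω : ℕ → Type*} [∀ n, MeasurableSpace (Ω n)]
    (Θ : Set (Param m)) (ρ : Param m → TraceClass H) (e : ∀ n, Estimator H n m (Ω n)) : Prop :=
  ∀ θ ∈ Θ, (∀ i, Tendsto (fun n => (e n).mean ρ θ i) atTop (𝓝 (θ i))) ∧
    ∃ B : ℕ → Matrix (Fin m) (Fin m) ℝ,
      (∀ n, 0 < n → (e n).HasMeanDeriv ρ θ (B n)) ∧ Tendsto B atTop (𝓝 1)

/-- The estimator on one sample given by an instrument and a function of its outcome. -/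
def Instrument.singleEstimator {m : ℕ} {Ω : Type*} [MeasurableSpace Ω] (M : Instrument H Ω)
    (T : Ω → Param m) (hT : Measurable T) : Estimator H 1 m Ω where
  law τ := M.outcome (τ 0)
  est := T
  measurable_est := hT

/-- The estimator on `n` samples given by `n` independent repetitions of an instrument, one on each
sample, and a function of the `n` outcomes. -/
def Instrument.repeatedEstimator {n m : ℕ} {Ω : Type*} [MeasurableSpace Ω] (M : Instrument H Ω)
    (T : (Fin n → Ω) → Param m) (hT : Measurable T) : Estimator H n m (Fin n → Ω) where
  law τ := Measure.pi fun κ => M.outcome (τ κ)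
  est := T
  measurable_est := hT

/-! ### Adaptive sample-by-sample measurements -/

/-- The data `z_{r,κ} ∈ ℝˡ` of the first `r` rounds of measurements on `n` samples. -/
abbrev History (n l r : ℕ) : Type := Fin r → Fin n → Fin l → ℝ

variable (H) in
/-- A semi-classical measurement on `n` samples: finitely many rounds, in each of which every sample
is measured separately, by an instrument that depends on the data of the previous rounds. -/
structure SemiClassical (n : ℕ) where
  /-- The dimension of a single datum. -/
  l : ℕ
  /-- The number of rounds. -/
  rounds : ℕ
  /-- `inst r z κ` acts on sample `κ` in round `r` (counted from `0`) after the data `z`. -/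
  inst : (r : ℕ) → History n l r → Fin n → Instrument H (Fin l → ℝ)
  measurable_inst : ∀ r < rounds, ∀ κ Δ, MeasurableSet Δ →
    CbMeasurable fun z => (inst r z κ).toFun Δ

namespace SemiClassical

variable {n : ℕ}

/-- A realization of a semi-classical measurement on the product input `τ₁ ⊗ ⋯ ⊗ τₙ`: the joint law
of the data of the first `r` rounds together with the a posteriori states of the samples. Given the
data `z` of the first `r` rounds, the samples are in the product of the states `state r z κ`, and
the outcomes of the next round are independent with the laws that the instruments assign to these
states. The a posteriori states of an instrument `M` in a prior state `σ` are the density operators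
`g x` with `∫_Δ tr (A g x) P(dx) = tr (A M[Δ](σ))` for all bounded `A` and all measurable `Δ`, where
`P` is the law of the outcome `x`. -/
structure Realization (M : SemiClassical H n) (τ : Fin n → TraceClass H) where
  /-- The law of the data of the first `r` rounds. -/
  law : (r : ℕ) → Measure (History n M.l r)
  /-- The a posteriori states after `r` rounds. -/
  state : (r : ℕ) → History n M.l r → Fin n → TraceClass H
  measurable_state : ∀ r ≤ M.rounds, ∀ κ, StronglyMeasurable fun z => state r z κ
  isDensity_state : ∀ r ≤ M.rounds, ∀ z κ, (state r z κ).IsDensity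
  law_zero : law 0 = ENNReal.ofReal (∏ κ, (τ κ).tr.re) • Measure.dirac default
  state_zero : ∀ κ, τ κ = (τ κ).tr • state 0 default κ
  law_succ : ∀ r < M.rounds, ∀ S : Set (History n M.l (r + 1)), MeasurableSet S →
    law (r + 1) S = ∫⁻ z, (Measure.pi fun κ => (M.inst r z κ).outcome (state r z κ))
      {w | Fin.snoc (α := fun _ => Fin n → Fin M.l → ℝ) z w ∈ S} ∂law r
  state_succ : ∀ r < M.rounds, ∀ κ, ∀ᵐ z ∂law r, ∃ g : (Fin M.l → ℝ) → TraceClass H,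
    (∀ w, state (r + 1) (Fin.snoc (α := fun _ => Fin n → Fin M.l → ℝ) z w) κ = g (w κ)) ∧
    ∀ (A : H →L[ℂ] H) (Δ : Set (Fin M.l → ℝ)), MeasurableSet Δ →
      ∫ x in Δ, opTrace (A ∘L (g x).op) ∂(M.inst r z κ).outcome (state r z κ)
        = opTrace (A ∘L ((M.inst r z κ).toFun Δ (state r z κ)).op)

/-- `P` is the law of the data of all rounds on the product input `τ₁ ⊗ ⋯ ⊗ τₙ`. -/
def IsLaw (M : SemiClassical H n) (τ : Fin n → TraceClass H)
    (P : Measure (History n M.l M.rounds)) : Prop :=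
  ∃ R : M.Realization τ, R.law M.rounds = P

/-- One-way semi-classical measurements: there are `n` rounds, and in the `r`-th round only the
`r`-th sample is measured. -/
def IsOneWay (M : SemiClassical H n) : Prop :=
  M.rounds = n ∧ ∀ r < M.rounds, ∀ z (κ : Fin n), (κ : ℕ) ≠ r → (M.inst r z κ).IsTrivial

end SemiClassical

variable (H) in
/-- A semi-classical estimator: a semi-classical measurement, the law of its data, and the estimate
as a measurable function of the data. -/
structure SemiClassicalEstimator (n m : ℕ) where
  /-- The measurement. -/
  meas : SemiClassical H n
  /-- The law of the data for the product inputs. -/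
  law : (Fin n → TraceClass H) → Measure (History n meas.l meas.rounds)
  isLaw : ∀ τ, (∀ κ, (τ κ).IsPos) → meas.IsLaw τ (law τ)
  /-- The estimate. -/
  est : History n meas.l meas.rounds → Param m
  measurable_est : Measurable est

/-- The statistical content of a semi-classical estimator. -/
def SemiClassicalEstimator.toEstimator {n m : ℕ} (e : SemiClassicalEstimator H n m) :
    Estimator H n m (History n e.meas.l e.meas.rounds) where
  law := e.law
  est := e.est
  measurable_est := e.measurable_est

/-! ### Conditions on the model -/

section Model

variable {m : ℕ}

/-- The partial derivative `∂ᵢ f` of a function of the parameter with values in the trace class, in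
the sense of the trace norm. -/
def pderiv (i : Fin m) (f : Param m → TraceClass H) (θ : Param m) : TraceClass H :=
  lineDeriv ℝ f θ (coordVec i)

/-- Local uniform continuity on `Θ`. -/
def LocallyUniformContinuousOn (Θ : Set (Param m)) (f : Param m → TraceClass H) : Prop :=
  ∀ θ ∈ Θ, ∃ U ∈ 𝓝 θ, UniformContinuousOn f (U ∩ Θ)

/-- Smoothness of the model: the partial derivatives of first and second order exist in trace norm,
are locally uniformly continuous, and have trace norm at most `a₁`. -/
structure SmoothModel (Θ : Set (Param m)) (ρ : Param m → TraceClass H) (a₁ : ℝ) : Prop where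
  differentiable : ∀ θ ∈ Θ, ∀ i, LineDifferentiableAt ℝ ρ θ (coordVec i)
  differentiable₂ : ∀ θ ∈ Θ, ∀ i j, LineDifferentiableAt ℝ (pderiv j ρ) θ (coordVec i)
  continuous : ∀ i, LocallyUniformContinuousOn Θ (pderiv i ρ)
  continuous₂ : ∀ i j, LocallyUniformContinuousOn Θ (pderiv i (pderiv j ρ))
  bound : ∀ θ ∈ Θ, ∀ i, ‖pderiv i ρ θ‖ ≤ a₁
  bound₂ : ∀ θ ∈ Θ, ∀ i j, ‖pderiv i (pderiv j ρ) θ‖ ≤ a₁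

/-- There is a Hermitian (densely defined, symmetric) operator `L`, not necessarily bounded, with
`D = (L σ + σ L) / 2` and `tr σ L² < ∞`. Here `K` is the everywhere defined operator `L √σ`, so that
`L σ = K √σ`, `σ L = √σ K*`, and `tr σ L²` is the squared Hilbert-Schmidt norm of `K`. -/
def HasLogDerivative (σ D : TraceClass H) : Prop :=
  ∃ L : H →ₗ.[ℂ] H, Dense (L.domain : Set H) ∧ L.IsFormalAdjoint L ∧
    ∃ K : H →L[ℂ] H,
      (∀ x, ∃ hx : CFC.sqrt σ.op x ∈ L.domain, L ⟨CFC.sqrt σ.op x, hx⟩ = K x) ∧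
      hsSq K ≠ ⊤ ∧
      D.op = (2⁻¹ : ℂ) • (K ∘L CFC.sqrt σ.op + CFC.sqrt σ.op ∘L ContinuousLinearMap.adjoint K)

/-- A bounded choice `r θ > 0` of radii such that the segments from `θ - r θ eᵢ` to `θ + r θ eᵢ` lie
in `Θ`. -/
structure IsRadius (Θ : Set (Param m)) (r : Param m → ℝ) : Prop where
  pos : ∀ θ ∈ Θ, 0 < r θ
  bounded : ∃ R : ℝ, ∀ θ ∈ Θ, r θ ≤ R
  mem : ∀ θ ∈ Θ, ∀ i : Fin m, ∀ t ∈ Set.Icc (-r θ) (r θ), θ + t • coordVec i ∈ Θ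

/-- The operator `|∂ᵢρ_{θ - r eᵢ}| + ∫_{-r}^{r} |∂ᵢ²ρ_{θ + t eᵢ}| dt` with `r = r θ`, which dominates
`±∂ᵢρ` on the segment between `θ - r eᵢ` and `θ + r eᵢ`. The integral is a Bochner integral in the
trace class. -/
def dominant (ρ : Param m → TraceClass H) (r : Param m → ℝ) (i : Fin m) (θ : Param m) :
    TraceClass H :=
  (pderiv i ρ (θ - r θ • coordVec i)).abs
    + ∫ t in (-r θ)..(r θ), (pderiv i (pderiv i ρ) (θ + t • coordVec i)).abs

/-- There is an instrument whose `n`-fold repetition on `n` samples, with suitable estimates `Tₙ`,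
is asymptotically unbiased, satisfies the moment condition for every `n`, and has
`E_θ ‖Tₙ - θ‖⁴ ≤ C_θ / n²`. -/
def HasPilotEstimator (Θ : Set (Param m)) (ρ : Param m → TraceClass H)
    (D : Fin m → Param m → TraceClass H) (a₁ : ℝ) : Prop :=
  ∃ (l : ℕ) (M : Instrument H (Fin l → ℝ)) (T : ∀ n, (Fin n → Fin l → ℝ) → Param m)
    (hT : ∀ n, Measurable (T n)),
    AsymptoticallyUnbiased Θ ρ (fun n => M.repeatedEstimator (T n) (hT n)) ∧
    (∀ n, 0 < n → (M.repeatedEstimator (T n) (hT n)).MomentBound Θ ρ D a₁) ∧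
    ∀ θ ∈ Θ, ∃ C : ℝ, ∀ n : ℕ, 0 < n →
      ∫⁻ ω, ‖T n ω - θ‖ₑ ^ 4 ∂(M.repeatedEstimator (T n) (hT n)).iidLaw (ρ θ)
        ≤ ENNReal.ofReal (C / n ^ 2)

/-! ### The bounds -/

/-- The smallest value of `limsup n Tr G MSE_θ[Eₙ]` over the sequences of semi-classical estimators
whose measurements are admissible, that are asymptotically unbiased, and that satisfy the moment
condition for every `n ≥ 1`. -/
def asymptoticBound (admissible : ∀ n, SemiClassical H n → Prop) (Θ : Set (Param m))
    (ρ : Param m → TraceClass H) (D : Fin m → Param m → TraceClass H) (a₁ : ℝ)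
    (G : Matrix (Fin m) (Fin m) ℝ) (θ : Param m) : EReal :=
  ⨅ (e : ∀ n, SemiClassicalEstimator H n m)
    (_ : ∀ n, 0 < n → admissible n (e n).meas)
    (_ : AsymptoticallyUnbiased Θ ρ fun n => (e n).toEstimator)
    (_ : ∀ n, 0 < n → (e n).toEstimator.MomentBound Θ ρ D a₁),
    limsup (fun n : ℕ => ((n * (G * (e n).toEstimator.mse ρ θ).trace : ℝ) : EReal)) atTop

/-- The asymptotic semi-classical Cramér-Rao type bound. -/
def semiClassicalBound (Θ : Set (Param m)) (ρ : Param m → TraceClass H)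
    (D : Fin m → Param m → TraceClass H) (a₁ : ℝ) (G : Matrix (Fin m) (Fin m) ℝ)
    (θ : Param m) : EReal :=
  asymptoticBound (fun _ _ => True) Θ ρ D a₁ G θ

/-- The asymptotic Cramér-Rao type bound for one-way semi-classical measurements. -/
def oneWayBound (Θ : Set (Param m)) (ρ : Param m → TraceClass H)
    (D : Fin m → Param m → TraceClass H) (a₁ : ℝ) (G : Matrix (Fin m) (Fin m) ℝ)
    (θ : Param m) : EReal :=
  asymptoticBound (fun _ M => M.IsOneWay) Θ ρ D a₁ G θ

/-- The smallest value of `Tr G V_θ[E]` over the estimators `E` on a single sample that are locally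
unbiased at `θ` and satisfy the condition `cond`. -/
def singleSampleBound (cond : ∀ l : ℕ, Estimator H 1 m (Fin l → ℝ) → Prop)
    (ρ : Param m → TraceClass H) (G : Matrix (Fin m) (Fin m) ℝ) (θ : Param m) : EReal :=
  ⨅ (l : ℕ) (M : Instrument H (Fin l → ℝ)) (T : (Fin l → ℝ) → Param m) (hT : Measurable T)
    (_ : (M.singleEstimator T hT).LocallyUnbiased ρ θ) (_ : cond l (M.singleEstimator T hT)),
    (((G * (M.singleEstimator T hT).cov ρ θ).trace : ℝ) : EReal)

end Model

end QuantumEstimation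

end

open QuantumEstimation

/-!
The four quantities are compared in the cycle (bounded range, one sample) ≤ (semi-classical) ≤
(one-way) ≤ (bounded range, one sample); the estimators on one sample with the moment condition are
compared with those of bounded range separately.

*Scores.* The existence of `L √σ` makes `Q + 2 t X + t² σ` positive for all real `t`, with `X` the
derivative of the state and `Q` of trace class (`IsTangent`). Applied to the laws of any measurement
this is a Cauchy-Schwarz inequality between densities, which yields a score `ℓ` with Fisher
information at most `tr Q` (`IsPovm.exists_score`). Derivatives of expectations are integrals
against scores, for statistics with locally bounded second moments too
(`hasDerivAt_integral_of_quadratic`).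

*Lower bound.* In a semi-classical measurement, changing the input of one sample multiplies the law
of the data by a density that does not depend on another sample (`IsLocalLaw`). Hence the scores of
different samples are orthogonal (`IsLocalLaw.integral_score_mul_score`). The estimate is projected,
for each sample, on the scores of this sample. These projections are statistics of measurements on
one sample; performing one of them at random (`IsLocalMoment.mixture`), scaled by `n`, preserves the
derivatives of the mean, and by orthogonality costs at most `n` times the mean square error
(`exists_isLocalMoment`). Truncation makes the statistic bounded, and mixing in another measurement
with small probability removes what is left of the bias
(`IsLocalMoment.singleSampleBound_le_of_approx`).

*Upper bound.* A preliminary estimate is made from `N ∼ n ^ (2 / 3)` samples. If it is near `θ₀`,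
then the other samples are measured with an estimator that is good at `θ₀` and the results are
averaged; otherwise the preliminary estimate is kept (`hybridEstimator`). All samples are measured
in any case, so that the measurement is one-way. The fourth moments of the preliminary estimate, of
order `N ^ (-2)`, bound the errors of the wrong decision, and the bound on the Fisher information
turns `L²` estimates into estimates for the derivatives of the mean.

*Moment condition on one sample.* From moments to bounded range, the lower bound for `n = 1`
applies. Conversely, a bounded estimator need not satisfy the moment condition, which refers to all
parameters. Let `E` be the operator of the effect that a preliminary estimate is within the distance
`R` of `θ`. The bounded estimator is applied to the part `E x E` of the state, and the preliminary
estimate is kept when it is far from `θ` (`splice`); the remaining probability goes to a fixed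
outcome. As `R → ∞` one has `E x E → x` in trace norm (`IsPovm.exists_compress`), so a small affine
correction restores local unbiasedness (`exists_affine_correction`) and the covariances converge.
-/

noncomputable section

namespace QuantumEstimation

set_option linter.unusedSectionVars false
variable {H : Type*} [NormedAddCommGroup H] [InnerProductSpace ℂ H] [CompleteSpace H]
variable {Ω : Type*} [MeasurableSpace Ω]
open TraceClass
open TopologicalSpace (SeparableSpace denseSeq)

/-! ### The trace class -/

section

/-- By the polar decomposition, `|A B| = W* A B` up to a small error; the rest is the inequality of
the arithmetic and geometric means. -/
theorem traceNorm_mul_le_hsSq (A B : H →L[ℂ] H) :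
    traceNorm (A * B) ≤ (hsSq A + hsSq B) / 2 := by
  rw [traceNorm, ENNReal.tsum_eq_iSup_sum]
  refine iSup_le fun F => le_of_forall_card F.card fun ε hε => ?_
  obtain ⟨W, hW, -, hA⟩ := exists_approx_polar (A * B) hε
  calc ∑ k ∈ F, ENNReal.ofReal (inner ℂ (onb H k) (CFC.abs (A * B) (onb H k))).re
      ≤ ∑ k ∈ F, ((‖(star A * W) (onb H k)‖ₑ ^ 2 + ‖B (onb H k)‖ₑ ^ 2) / 2
          + ENNReal.ofReal ε) := by
        refine Finset.sum_le_sum fun k _ => ?_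
        have h1 : ENNReal.ofReal (inner ℂ (onb H k) (CFC.abs (A * B) (onb H k))).re
            ≤ ‖inner ℂ (onb H k) (CFC.abs (A * B) (onb H k))‖ₑ := by
          rw [← ofReal_norm]
          exact ENNReal.ofReal_le_ofReal (Complex.re_le_norm _)
        have h2 := enorm_inner_le_add (V := (1 : H →L[ℂ] H))
          (ContinuousLinearMap.norm_id_le) hA ((onb H).orthonormal.1 k)
        refine h1.trans (h2.trans (add_le_add ?_ le_rfl))
        have e : inner ℂ ((1 : H →L[ℂ] H) (onb H k)) ((star W * (A * B)) (onb H k))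
            = inner ℂ ((star A * W) (onb H k)) (B (onb H k)) := by
          simp only [mul_apply_eq_comp, one_apply_eq_self,
            ContinuousLinearMap.star_eq_adjoint, ContinuousLinearMap.adjoint_inner_right,
            ContinuousLinearMap.adjoint_inner_left]
        rw [e]
        exact enorm_inner_le_half _ _
    _ = (∑ k ∈ F, ‖(star A * W) (onb H k)‖ₑ ^ 2 + ∑ k ∈ F, ‖B (onb H k)‖ₑ ^ 2) / 2
          + F.card * ENNReal.ofReal ε := by
        rw [Finset.sum_add_distrib, Finset.sum_const, nsmul_eq_mul]
        congr 1
        simp only [div_eq_mul_inv]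
        rw [← Finset.sum_mul, Finset.sum_add_distrib]
    _ ≤ (hsSq (star A * W) + hsSq B) / 2 + F.card * ENNReal.ofReal ε := by
        gcongr <;> exact ENNReal.sum_le_tsum F
    _ ≤ (hsSq A + hsSq B) / 2 + F.card * ENNReal.ofReal ε := by
        gcongr
        rw [← hsSq_star (star A * W), star_mul, star_star]
        exact hsSq_mul_le _ _ (by rwa [norm_star])

theorem traceNorm_star_le (A : H →L[ℂ] H) : traceNorm (star A) ≤ traceNorm A := by
  set S := CFC.sqrt (CFC.abs A) with hS
  have hs : star S = S := (CFC.sqrt_nonneg _).isSelfAdjoint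
  have hSS : S * S = CFC.abs A := CFC.sqrt_mul_sqrt_self _ (CFC.abs_nonneg A)
  have hex : ∀ j : ℕ, ∃ W : H →L[ℂ] H, ‖W‖ ≤ 1 ∧ ‖A - W * CFC.abs A‖ ≤ 1 / ((j : ℝ) + 1) :=
    fun j => by
      obtain ⟨W, h1, h2, -⟩ := exists_approx_polar A (ε := 1 / ((j : ℝ) + 1)) (by positivity)
      exact ⟨W, h1, h2⟩
  choose W hW hA using hex
  refine TraceClass.traceNorm_le_of_tendsto (B := fun j => CFC.abs A * star (W j)) ?_ ?_
  · rw [tendsto_iff_norm_sub_tendsto_zero]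
    refine squeeze_zero (fun _ => norm_nonneg _) (fun j => ?_)
      tendsto_one_div_add_atTop_nhds_zero_nat
    have : CFC.abs A * star (W j) - star A = star (-(A - W j * CFC.abs A)) := by
      rw [star_neg, star_sub, star_mul, (CFC.abs_nonneg A).isSelfAdjoint.star_eq]; abel
    rw [this, norm_star, norm_neg]
    exact hA j
  · refine Eventually.of_forall fun j => ?_
    rw [← hSS, mul_assoc]
    refine (traceNorm_mul_le_hsSq _ _).trans ?_
    rw [traceNorm_eq_hsSq, ← hS]
    calc (hsSq S + hsSq (S * star (W j))) / 2 ≤ (hsSq S + hsSq S) / 2 := by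
          gcongr; exact hsSq_mul_le' _ _ hs (by rw [norm_star]; exact hW j)
      _ = hsSq S := by rw [ENNReal.add_div, ENNReal.add_halves]

theorem nonneg_iff_inner (A : H →L[ℂ] H) : 0 ≤ A ↔ ∀ v, 0 ≤ inner ℂ v (A v) := by
  rw [ContinuousLinearMap.nonneg_iff_isPositive]
  constructor
  · intro h v; exact h.inner_nonneg_right v
  · intro h
    refine (ContinuousLinearMap.isPositive_iff_complex _).2 fun x => ?_
    obtain ⟨h4, h5⟩ := Complex.nonneg_iff.1 (h x)
    have e : inner ℂ (A x) x = starRingEnd ℂ (inner ℂ x (A x)) := (inner_conj_symm _ _).symm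
    rw [e]
    refine ⟨Complex.ext (by rw [Complex.ofReal_re]; rfl) ?_, h4⟩
    rw [Complex.ofReal_im, Complex.conj_im, ← h5, neg_zero]

theorem mul_star_nonneg (K : H →L[ℂ] H) : 0 ≤ K * star K := mul_star_self_nonneg K

theorem traceNorm_mul_star (K : H →L[ℂ] H) : traceNorm (K * star K) = hsSq K := by
  rw [traceNorm, CFC.abs_of_nonneg _ (mul_star_nonneg K), ← hsSq_star]
  unfold hsSq
  congr 1; ext k
  rw [mul_apply_eq_comp]
  conv_lhs => rw [← star_star K]
  rw [star_star K, ContinuousLinearMap.star_eq_adjoint, ← ContinuousLinearMap.adjoint_inner_left,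
    inner_self_eq_norm_sq_to_K, ← ofReal_norm, ← ENNReal.ofReal_pow (norm_nonneg _)]
  congr 1
  norm_cast

namespace TraceClass

theorem real_smul_op (c : ℝ) (A : TraceClass H) : (c • A).op = (c : ℂ) • A.op := by
  rw [← Complex.coe_smul, map_smul]

theorem tr_add (A B : TraceClass H) : (A + B).tr = A.tr + B.tr := map_add (traceCLM H) A B
theorem tr_sub (A B : TraceClass H) : (A - B).tr = A.tr - B.tr := map_sub (traceCLM H) A B
theorem tr_smul (c : ℂ) (A : TraceClass H) : (c • A).tr = c * A.tr := map_smul (traceCLM H) c A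
theorem tr_zero : (0 : TraceClass H).tr = 0 := map_zero (traceCLM H)
theorem tr_real_smul_re (c : ℝ) (A : TraceClass H) : (c • A).tr.re = c * A.tr.re := by
  rw [← Complex.coe_smul, tr_smul, Complex.re_ofReal_mul]

theorem isPos_zero : (0 : TraceClass H).IsPos := by simp [IsPos]
theorem IsPos.add {A B : TraceClass H} (hA : A.IsPos) (hB : B.IsPos) : (A + B).IsPos := by
  unfold IsPos at *; rw [map_add]; exact add_nonneg hA hB

theorem isPos_iff_inner {A : TraceClass H} : A.IsPos ↔ ∀ v, 0 ≤ inner ℂ v (A.op v) :=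
  nonneg_iff_inner _

theorem IsPos.smul {A : TraceClass H} (hA : A.IsPos) {c : ℝ} (hc : 0 ≤ c) : (c • A).IsPos := by
  rw [isPos_iff_inner] at *
  intro v
  rw [real_smul_op, smul_apply, inner_smul_right]
  exact mul_nonneg (by exact_mod_cast hc) (hA v)

theorem IsPos.traceNorm_eq {A : TraceClass H} (hA : A.IsPos) :
    ENNReal.ofReal A.tr.re = traceNorm A.op := by
  have h : A.tr.re = ∑' k, (inner ℂ (onb H k) (A.op (onb H k))).re :=
    Complex.re_tsum A.summable_trace.of_norm
  rw [traceNorm, CFC.abs_of_nonneg _ hA, h, ENNReal.ofReal_tsum_of_nonneg]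
  · intro k
    exact (Complex.nonneg_iff.1 (isPos_iff_inner.1 hA _)).1
  · exact (Complex.hasSum_re A.summable_trace.of_norm.hasSum).summable

theorem IsPos.norm_eq {A : TraceClass H} (hA : A.IsPos) : ‖A‖ = A.tr.re := by
  rw [norm_def, ← hA.traceNorm_eq, ENNReal.toReal_ofReal hA.tr_re_nonneg]

/-- The positive trace class operator `K K*`, for a Hilbert-Schmidt operator `K`. -/
def ofSq (K : H →L[ℂ] H) (hK : hsSq K ≠ ⊤) : TraceClass H :=
  ofOp (K * star K) (by rwa [traceNorm_mul_star])

theorem isPos_ofSq (K : H →L[ℂ] H) (hK : hsSq K ≠ ⊤) : (ofSq K hK).IsPos := mul_star_nonneg K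

theorem ofReal_tr_ofSq (K : H →L[ℂ] H) (hK : hsSq K ≠ ⊤) :
    ENNReal.ofReal (ofSq K hK).tr.re = hsSq K := by
  rw [(isPos_ofSq K hK).traceNorm_eq]; exact traceNorm_mul_star K

/-- The adjoint of a trace class operator. -/
def adj (A : TraceClass H) : TraceClass H :=
  ofOp (star A.op) ((traceNorm_star_le _).trans_lt A.traceNorm_ne_top.lt_top).ne

theorem op_adj (A : TraceClass H) : A.adj.op = star A.op := rfl
theorem norm_adj_le (A : TraceClass H) : ‖A.adj‖ ≤ ‖A‖ :=
  ENNReal.toReal_mono A.traceNorm_ne_top (traceNorm_star_le _)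

theorem adj_add (A B : TraceClass H) : (A + B).adj = A.adj + B.adj :=
  op_injective (by simp [op_adj])

/-- The selfadjoint part of a trace class operator. -/
def rePart (A : TraceClass H) : TraceClass H := (2⁻¹ : ℝ) • (A + A.adj)

theorem rePart_add (A B : TraceClass H) : (A + B).rePart = A.rePart + B.rePart := by
  unfold rePart; rw [adj_add, ← smul_add]; congr 1; abel

theorem norm_rePart_le (A : TraceClass H) : ‖A.rePart‖ ≤ ‖A‖ := by
  unfold rePart
  rw [norm_smul]
  have h1 := norm_add_le A A.adj
  have h2 := A.norm_adj_le
  norm_num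
  linarith

theorem isSelfAdjoint_rePart (A : TraceClass H) : IsSelfAdjoint A.rePart.op := by
  have : A.rePart.op = ((2⁻¹ : ℝ) : ℂ) • (A.op + star A.op) := by
    rw [rePart, real_smul_op, map_add, op_adj]
  rw [this]
  refine IsSelfAdjoint.smul ?_ (IsSelfAdjoint.add_star_self _)
  exact Complex.conj_ofReal _

theorem rePart_of_isSelfAdjoint {A : TraceClass H} (hA : IsSelfAdjoint A.op) : A.rePart = A := by
  apply op_injective
  rw [rePart, real_smul_op, map_add, op_adj, hA.star_eq, ← two_smul ℂ, smul_smul]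
  norm_num

theorem IsPos.isSelfAdjoint {A : TraceClass H} (hA : A.IsPos) : IsSelfAdjoint A.op :=
  LE.le.isSelfAdjoint hA

theorem op_abs (A : TraceClass H) : A.abs.op = CFC.abs A.op := rfl
theorem isPos_abs (A : TraceClass H) : A.abs.IsPos := CFC.abs_nonneg _
theorem norm_abs (A : TraceClass H) : ‖A.abs‖ = ‖A‖ := by
  rw [norm_def, norm_def, op_abs, traceNorm_abs]

/-- The positive part of the selfadjoint part of a trace class operator. -/
def posP (A : TraceClass H) : TraceClass H := (2⁻¹ : ℝ) • (A.rePart.abs + A.rePart)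

/-- The negative part of the selfadjoint part of a trace class operator. -/
def negP (A : TraceClass H) : TraceClass H := (2⁻¹ : ℝ) • (A.rePart.abs - A.rePart)

theorem isPos_posP (A : TraceClass H) : A.posP.IsPos := by
  refine IsPos.smul ?_ (by norm_num)
  change 0 ≤ (A.rePart.abs + A.rePart).op
  rw [map_add, op_abs, CFC.abs_add_self _ A.isSelfAdjoint_rePart]
  exact nsmul_nonneg (CFC.posPart_nonneg _) 2

theorem isPos_negP (A : TraceClass H) : A.negP.IsPos := by
  refine IsPos.smul ?_ (by norm_num)
  change 0 ≤ (A.rePart.abs - A.rePart).op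
  rw [map_sub, op_abs, CFC.abs_sub_self _ A.isSelfAdjoint_rePart]
  exact nsmul_nonneg (CFC.negPart_nonneg _) 2

theorem posP_sub_negP (A : TraceClass H) : A.posP - A.negP = A.rePart := by
  unfold posP negP
  rw [← smul_sub]
  have : A.rePart.abs + A.rePart - (A.rePart.abs - A.rePart) = (2 : ℝ) • A.rePart := by
    rw [two_smul]; abel
  rw [this, smul_smul]; norm_num

theorem norm_posP_le (A : TraceClass H) : ‖A.posP‖ ≤ ‖A‖ := by
  unfold posP
  rw [norm_smul]
  have h1 := norm_add_le A.rePart.abs A.rePart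
  rw [norm_abs] at h1
  have h2 := A.norm_rePart_le
  norm_num
  linarith

theorem norm_negP_le (A : TraceClass H) : ‖A.negP‖ ≤ ‖A‖ := by
  unfold negP
  rw [norm_smul]
  have h1 := norm_sub_le A.rePart.abs A.rePart
  rw [norm_abs] at h1
  have h2 := A.norm_rePart_le
  norm_num
  linarith

theorem posP_add_parts (A B : TraceClass H) :
    (A + B).posP + (A.negP + B.negP) = (A + B).negP + (A.posP + B.posP) := by
  have h := (A + B).posP_sub_negP
  rw [rePart_add, ← A.posP_sub_negP, ← B.posP_sub_negP] at h
  have h2 : (A + B).posP = A.posP - A.negP + (B.posP - B.negP) + (A + B).negP := by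
    rw [← h]; abel
  rw [h2]; abel

theorem IsPos.posP_sub_negP {A : TraceClass H} (hA : A.IsPos) : A.posP = A + A.negP := by
  have h := A.posP_sub_negP
  rw [rePart_of_isSelfAdjoint hA.isSelfAdjoint] at h
  nth_rw 2 [← h]; abel

/-- A function that is additive and bounded relative to the trace on the cone of positive trace
class operators extends to a continuous real-linear functional. -/
theorem exists_ext (g : TraceClass H → ℝ) (hadd : ∀ x y, x.IsPos → y.IsPos → g (x + y) = g x + g y)
    (C : ℝ) (hC : ∀ x, x.IsPos → |g x| ≤ C * x.tr.re) :
    ∃ F : TraceClass H →L[ℝ] ℝ, (∀ x, x.IsPos → F x = g x) ∧ (∀ x, F x = g x.posP - g x.negP) := by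
  let f : TraceClass H →+ ℝ :=
    { toFun := fun x => g x.posP - g x.negP
      map_zero' := by
        have h : (0 : TraceClass H).posP = (0 : TraceClass H).negP := by
          have := isPos_zero (H := H).posP_sub_negP; rwa [zero_add] at this
        rw [h, sub_self]
      map_add' := fun x y => by
        have h := congrArg g (posP_add_parts x y)
        rw [hadd _ _ (isPos_posP _) ((isPos_negP _).add (isPos_negP _)),
          hadd _ _ (isPos_negP _) ((isPos_posP _).add (isPos_posP _)),
          hadd _ _ (isPos_negP _) (isPos_negP _), hadd _ _ (isPos_posP _) (isPos_posP _)] at h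
        linarith }
  have hbound : ∀ x, ‖f x‖ ≤ (2 * |C|) * ‖x‖ := fun x => by
    have h1 : ∀ y : TraceClass H, y.IsPos → ‖y‖ ≤ ‖x‖ → |g y| ≤ |C| * ‖x‖ := fun y hy hyx => by
      refine (hC y hy).trans ?_
      rw [← hy.norm_eq]
      exact mul_le_mul (le_abs_self C) hyx (norm_nonneg _) (abs_nonneg _)
    have h2 := h1 _ (isPos_posP x) (norm_posP_le x)
    have h3 := h1 _ (isPos_negP x) (norm_negP_le x)
    calc ‖f x‖ = |g x.posP - g x.negP| := rfl
      _ ≤ |g x.posP| + |g x.negP| := abs_sub _ _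
      _ ≤ _ := by linarith
  have hcont : Continuous f := AddMonoidHomClass.continuous_of_bound f _ hbound
  refine ⟨f.toRealLinearMap hcont, fun x hx => ?_, fun x => rfl⟩
  change g x.posP - g x.negP = g x
  rw [hx.posP_sub_negP, hadd _ _ hx (isPos_negP _)]; ring

end TraceClass

end

/-! ### Laws of measurements and of product inputs -/

section

/-- A positive operator valued measure, encoded by the laws `N x` that it assigns to the positive
trace class operators `x`: these are additive in `x` and have total mass `tr x`. The values of `N`
at other trace class operators are irrelevant. -/
structure IsPovm (N : TraceClass H → Measure Ω) : Prop where
  add : ∀ x y, x.IsPos → y.IsPos → N (x + y) = N x + N y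
  mass : ∀ x, x.IsPos → N x Set.univ = ENNReal.ofReal x.tr.re

theorem IsPovm.isFiniteMeasure {N : TraceClass H → Measure Ω} (hN : IsPovm N) {x : TraceClass H}
    (hx : x.IsPos) : IsFiniteMeasure (N x) := ⟨by rw [hN.mass x hx]; exact ENNReal.ofReal_lt_top⟩

theorem IsPovm.real_univ {N : TraceClass H → Measure Ω} (hN : IsPovm N) {x : TraceClass H}
    (hx : x.IsPos) : (N x).real Set.univ = x.tr.re := by
  rw [Measure.real, hN.mass x hx, ENNReal.toReal_ofReal hx.tr_re_nonneg]

theorem IsPovm.isProbabilityMeasure {N : TraceClass H → Measure Ω} (hN : IsPovm N)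
    {x : TraceClass H} (hx : x.IsDensity) : IsProbabilityMeasure (N x) :=
  ⟨by rw [hN.mass x hx.1, hx.2]; simp⟩

theorem integrable_of_abs_le {μ : Measure Ω} [IsFiniteMeasure μ] {φ : Ω → ℝ} (hφ : Measurable φ)
    {c : ℝ} (hc : ∀ ω, |φ ω| ≤ c) : Integrable φ μ :=
  Integrable.of_bound hφ.aestronglyMeasurable c (Eventually.of_forall hc)

theorem abs_integral_le_of_abs_le {μ : Measure Ω} [IsFiniteMeasure μ] {φ : Ω → ℝ}
    {c : ℝ} (hc : ∀ ω, |φ ω| ≤ c) : |∫ ω, φ ω ∂μ| ≤ c * μ.real Set.univ :=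
  (Real.norm_eq_abs _).symm.trans_le (norm_integral_le_of_norm_le_const (Eventually.of_forall hc))

/-- Integration of a bounded function extends to a continuous functional on the trace class. -/
theorem IsPovm.exists_ext {N : TraceClass H → Measure Ω} (hN : IsPovm N) {φ : Ω → ℝ}
    (hφ : Measurable φ) {c : ℝ} (hc : ∀ ω, |φ ω| ≤ c) :
    ∃ F : TraceClass H →L[ℝ] ℝ, ∀ x, x.IsPos → F x = ∫ ω, φ ω ∂N x := by
  obtain ⟨F, hF, -⟩ := TraceClass.exists_ext (fun x => ∫ ω, φ ω ∂N x) (fun x y hx hy => by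
    have := hN.isFiniteMeasure hx
    have := hN.isFiniteMeasure hy
    rw [hN.add x y hx hy, integral_add_measure (integrable_of_abs_le hφ hc)
      (integrable_of_abs_le hφ hc)]) c (fun x hx => by
    have := hN.isFiniteMeasure hx
    rw [← hN.real_univ hx]
    exact abs_integral_le_of_abs_le hc)
  exact ⟨F, hF⟩

/-- The law of the data of a measurement on `n` samples as a function of positive product inputs:
additive in each factor, with total mass the product of the traces. -/
structure IsProductLaw {n : ℕ} (law : (Fin n → TraceClass H) → Measure Ω) : Prop where
  add : ∀ (τ : Fin n → TraceClass H) (κ : Fin n) (x y : TraceClass H), (∀ k, (τ k).IsPos) →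
    x.IsPos → y.IsPos →
    law (Function.update τ κ (x + y)) = law (Function.update τ κ x) + law (Function.update τ κ y)
  mass : ∀ τ : Fin n → TraceClass H, (∀ k, (τ k).IsPos) →
    law τ Set.univ = ∏ k, ENNReal.ofReal (τ k).tr.re

theorem isPos_update {n : ℕ} {τ : Fin n → TraceClass H} (hτ : ∀ k, (τ k).IsPos) (κ : Fin n)
    {x : TraceClass H} (hx : x.IsPos) (k : Fin n) : (Function.update τ κ x k).IsPos := by
  rcases eq_or_ne k κ with rfl | h
  · simpa using hx
  · simpa [h] using hτ k

namespace IsProductLaw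

variable {n : ℕ} {law : (Fin n → TraceClass H) → Measure Ω}

theorem isFiniteMeasure (h : IsProductLaw law) {τ : Fin n → TraceClass H}
    (hτ : ∀ k, (τ k).IsPos) : IsFiniteMeasure (law τ) :=
  ⟨by rw [h.mass τ hτ]; exact ENNReal.prod_lt_top fun _ _ => ENNReal.ofReal_lt_top⟩

theorem real_univ (h : IsProductLaw law) {τ : Fin n → TraceClass H}
    (hτ : ∀ k, (τ k).IsPos) : (law τ).real Set.univ = ∏ k, ‖τ k‖ := by
  rw [Measure.real, h.mass τ hτ, ENNReal.toReal_prod]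
  refine Finset.prod_congr rfl fun k _ => ?_
  rw [ENNReal.toReal_ofReal (hτ k).tr_re_nonneg, (hτ k).norm_eq]

theorem isPovm_slot (h : IsProductLaw law) {τ : Fin n → TraceClass H}
    (hτ : ∀ k, (τ k).IsDensity) (κ : Fin n) :
    IsPovm fun x => law (Function.update τ κ x) where
  add x y hx hy := h.add τ κ x y (fun k => (hτ k).1) hx hy
  mass x hx := by
    rw [h.mass _ (isPos_update (fun k => (hτ k).1) κ hx), Finset.prod_eq_single κ]
    · simp
    · intro b _ hb
      simp [hb, (hτ b).2]
    · simp

theorem isProbabilityMeasure (h : IsProductLaw law) {τ : Fin n → TraceClass H}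
    (hτ : ∀ k, (τ k).IsDensity) : IsProbabilityMeasure (law τ) :=
  ⟨by rw [h.mass τ fun k => (hτ k).1]; simp [(hτ _).2]⟩

/-- The input with factors the positive parts of the factors of `x`, except for the negative parts
in the places `s`. -/
def parts (x : Fin n → TraceClass H) (s : Finset (Fin n)) : Fin n → TraceClass H :=
  s.piecewise (fun k => (x k).negP) fun k => (x k).posP

theorem isPos_parts (x : Fin n → TraceClass H) (s : Finset (Fin n)) (k : Fin n) :
    (parts x s k).IsPos := by
  unfold parts
  by_cases hk : k ∈ s
  · rw [Finset.piecewise_eq_of_mem _ _ _ hk]; exact isPos_negP _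
  · rw [Finset.piecewise_eq_of_notMem _ _ _ hk]; exact isPos_posP _

theorem norm_parts_le (x : Fin n → TraceClass H) (s : Finset (Fin n)) (k : Fin n) :
    ‖parts x s k‖ ≤ ‖x k‖ := by
  unfold parts
  by_cases hk : k ∈ s
  · rw [Finset.piecewise_eq_of_mem _ _ _ hk]; exact norm_negP_le _
  · rw [Finset.piecewise_eq_of_notMem _ _ _ hk]; exact norm_posP_le _

/-- Inclusion-exclusion formula for the extension of `∫ φ d(law τ)` to all product inputs. -/
def ext (law : (Fin n → TraceClass H) → Measure Ω) (φ : Ω → ℝ) (x : Fin n → TraceClass H) : ℝ :=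
  ∑ s : Finset (Fin n), (-1) ^ s.card * ∫ ω, φ ω ∂law (parts x s)

theorem abs_ext_le {φ : Ω → ℝ} (x : Fin n → TraceClass H) :
    |ext law φ x| ≤ ∑ s : Finset (Fin n), ∫ ω, |φ ω| ∂law (parts x s) := by
  refine (Finset.abs_sum_le_sum_abs _ _).trans (Finset.sum_le_sum fun s _ => ?_)
  rw [abs_mul, abs_pow, abs_neg, abs_one, one_pow, one_mul]
  exact abs_integral_le_integral_abs

theorem abs_ext_le_prod (h : IsProductLaw law) {φ : Ω → ℝ} {c : ℝ} (hc : ∀ ω, |φ ω| ≤ c)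
    (hc0 : 0 ≤ c) (x : Fin n → TraceClass H) : |ext law φ x| ≤ 2 ^ n * c * ∏ k, ‖x k‖ := by
  refine (abs_ext_le x).trans ?_
  calc ∑ s : Finset (Fin n), ∫ ω, |φ ω| ∂law (parts x s)
      ≤ ∑ s : Finset (Fin n), c * ∏ k, ‖x k‖ := by
        refine Finset.sum_le_sum fun s _ => ?_
        have := h.isFiniteMeasure (isPos_parts x s)
        have h1 := abs_integral_le_of_abs_le (μ := law (parts x s)) (φ := fun ω => |φ ω|) (c := c)
          (fun ω => by rw [abs_abs]; exact hc ω)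
        refine (le_abs_self _).trans (h1.trans ?_)
        rw [h.real_univ (isPos_parts x s)]
        gcongr
        exact norm_parts_le _ _ _
    _ = _ := by
        rw [Finset.sum_const, Finset.card_univ, Fintype.card_finset, Fintype.card_fin,
          nsmul_eq_mul]
        push_cast; ring

theorem ext_update (φ : Ω → ℝ) (m : Fin n → TraceClass H) (i : Fin n) (v : TraceClass H) :
    ext law φ (Function.update m i v) = ∑ t ∈ (Finset.univ.erase i).powerset, (-1) ^ t.card *
      (∫ ω, φ ω ∂law (Function.update (parts m t) i v.posP)
        - ∫ ω, φ ω ∂law (Function.update (parts m t) i v.negP)) := by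
  have e1 : ∀ t ∈ (Finset.univ.erase i).powerset,
      parts (Function.update m i v) t = Function.update (parts m t) i v.posP := by
    intro t ht
    have hi : i ∉ t := fun hh => by simpa using Finset.mem_powerset.1 ht hh
    funext k
    rcases eq_or_ne k i with rfl | hk
    · simp [parts, Finset.piecewise, hi]
    · simp [parts, Finset.piecewise, hk]
  have e2 : ∀ t ∈ (Finset.univ.erase i).powerset,
      parts (Function.update m i v) (insert i t) = Function.update (parts m t) i v.negP := by
    intro t ht
    funext k
    rcases eq_or_ne k i with rfl | hk
    · simp [parts, Finset.piecewise]
    · simp [parts, Finset.piecewise, hk]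
  unfold ext
  rw [← Finset.powerset_univ, ← Finset.insert_erase (Finset.mem_univ i),
    Finset.sum_powerset_insert (Finset.notMem_erase i _), Finset.insert_erase (Finset.mem_univ i),
    ← Finset.sum_add_distrib]
  refine Finset.sum_congr rfl fun t ht => ?_
  have hi : i ∉ t := fun hh => by simpa using Finset.mem_powerset.1 ht hh
  rw [e1 t ht, e2 t ht, Finset.card_insert_of_notMem hi]
  ring

/-- The law of a measurement on `n` samples extends to a multilinear map. -/
theorem exists_multilinear (h : IsProductLaw law) {φ : Ω → ℝ} (hφ : Measurable φ) {c : ℝ}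
    (hc : ∀ ω, |φ ω| ≤ c) : ∃ Φ : MultilinearMap ℝ (fun _ : Fin n => TraceClass H) ℝ,
      ∀ x, Φ x = ext law φ x := by
  have hadd : ∀ (m : Fin n → TraceClass H) (i : Fin n) (x y : TraceClass H),
      ext law φ (Function.update m i (x + y))
        = ext law φ (Function.update m i x) + ext law φ (Function.update m i y) := by
    intro m i x y
    rw [ext_update, ext_update, ext_update, ← Finset.sum_add_distrib]
    refine Finset.sum_congr rfl fun t _ => ?_
    have hJ : ∀ a b : TraceClass H, a.IsPos → b.IsPos →
        ∫ ω, φ ω ∂law (Function.update (parts m t) i (a + b))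
          = ∫ ω, φ ω ∂law (Function.update (parts m t) i a)
            + ∫ ω, φ ω ∂law (Function.update (parts m t) i b) := fun a b ha hb => by
      have := h.isFiniteMeasure (isPos_update (isPos_parts m t) i ha)
      have := h.isFiniteMeasure (isPos_update (isPos_parts m t) i hb)
      rw [h.add _ _ _ _ (isPos_parts m t) ha hb, integral_add_measure (integrable_of_abs_le hφ hc)
        (integrable_of_abs_le hφ hc)]
    have e := congrArg (fun a => ∫ ω, φ ω ∂law (Function.update (parts m t) i a))
      (posP_add_parts x y)
    rw [hJ _ _ (isPos_posP _) ((isPos_negP _).add (isPos_negP _)),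
      hJ _ _ (isPos_negP _) ((isPos_posP _).add (isPos_posP _)),
      hJ _ _ (isPos_negP _) (isPos_negP _), hJ _ _ (isPos_posP _) (isPos_posP _)] at e
    rw [← mul_add]
    congr 1
    linarith
  have hsmul : ∀ (m : Fin n → TraceClass H) (i : Fin n) (a : ℝ) (x : TraceClass H),
      ext law φ (Function.update m i (a • x)) = a • ext law φ (Function.update m i x) := by
    intro m i a x
    let f : TraceClass H →+ ℝ := AddMonoidHom.mk' (fun v => ext law φ (Function.update m i v))
      (hadd m i)
    have hf : Continuous f := by
      refine AddMonoidHomClass.continuous_of_bound f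
        (2 ^ n * |c| * ∏ k ∈ Finset.univ.erase i, ‖m k‖) fun v => ?_
      refine (h.abs_ext_le_prod (fun ω => (hc ω).trans (le_abs_self c)) (abs_nonneg c) _).trans ?_
      rw [← Finset.mul_prod_erase _ _ (Finset.mem_univ i), Function.update_self, mul_assoc,
        mul_comm ‖v‖]
      refine le_of_eq ?_
      have : ∏ k ∈ Finset.univ.erase i, ‖Function.update m i v k‖
          = ∏ k ∈ Finset.univ.erase i, ‖m k‖ := by
        refine Finset.prod_congr rfl fun k hk => ?_
        rw [Function.update_of_ne (Finset.ne_of_mem_erase hk)]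
      rw [this]; ring
    exact (f.toRealLinearMap hf).map_smul a x
  refine ⟨{ toFun := ext law φ, map_update_add' := ?_, map_update_smul' := ?_ }, fun x => rfl⟩
  · intro inst m i x y
    convert hadd m i x y
  · intro inst m i a x
    convert hsmul m i a x

/-- Replacing the positive factors in the places `u` by the differences of their positive and
negative parts does not change the integral. -/
theorem sum_parts_of_isPos (h : IsProductLaw law) {φ : Ω → ℝ} (hφ : Measurable φ) {c : ℝ}
    (hc : ∀ ω, |φ ω| ≤ c) {x : Fin n → TraceClass H} (hx : ∀ k, (x k).IsPos)
    (u : Finset (Fin n)) :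
    ∑ s ∈ u.powerset, (-1) ^ s.card * ∫ ω, φ ω ∂law (u.piecewise (parts x s) x)
      = ∫ ω, φ ω ∂law x := by
  induction u using Finset.induction_on with
  | empty => simp
  | insert i u hi ih =>
    rw [← ih, Finset.sum_powerset_insert hi, ← Finset.sum_add_distrib]
    refine Finset.sum_congr rfl fun t ht => ?_
    have hit : i ∉ t := fun hh => hi (Finset.mem_powerset.1 ht hh)
    have hpos : ∀ k, (u.piecewise (parts x t) x k).IsPos := fun k => by
      by_cases hk : k ∈ u
      · rw [Finset.piecewise_eq_of_mem _ _ _ hk]; exact isPos_parts x t k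
      · rw [Finset.piecewise_eq_of_notMem _ _ _ hk]; exact hx k
    have e1 : (insert i u).piecewise (parts x t) x
        = Function.update (u.piecewise (parts x t) x) i (x i + (x i).negP) := by
      funext k
      rcases eq_or_ne k i with rfl | hk
      · simp [parts, Finset.piecewise, hit, (hx k).posP_sub_negP]
      · simp [parts, Finset.piecewise, hk]
    have e2 : (insert i u).piecewise (parts x (insert i t)) x
        = Function.update (u.piecewise (parts x t) x) i (x i).negP := by
      funext k
      rcases eq_or_ne k i with rfl | hk
      · simp [parts, Finset.piecewise]
      · simp [parts, Finset.piecewise, hk]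
    have e3 : u.piecewise (parts x t) x = Function.update (u.piecewise (parts x t) x) i (x i) := by
      funext k
      rcases eq_or_ne k i with rfl | hk
      · simp [Finset.piecewise, hi]
      · simp [hk]
    have := h.isFiniteMeasure (isPos_update hpos i (hx i))
    have := h.isFiniteMeasure (isPos_update hpos i (x i).isPos_negP)
    rw [e1, e2, h.add _ _ _ _ hpos (hx i) (x i).isPos_negP,
      integral_add_measure (integrable_of_abs_le hφ hc) (integrable_of_abs_le hφ hc),
      Finset.card_insert_of_notMem hit]
    conv_rhs => rw [e3]
    ring

theorem ext_of_isPos (h : IsProductLaw law) {φ : Ω → ℝ} (hφ : Measurable φ) {c : ℝ}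
    (hc : ∀ ω, |φ ω| ≤ c) {x : Fin n → TraceClass H} (hx : ∀ k, (x k).IsPos) :
    ext law φ x = ∫ ω, φ ω ∂law x := by
  rw [← h.sum_parts_of_isPos hφ hc hx Finset.univ]
  simp [ext]

end IsProductLaw

end

/-! ### Tangents and scores -/

section

theorem exists_density {μ w : Measure Ω} [IsFiniteMeasure μ] [IsFiniteMeasure w] (h : μ ≪ w) :
    ∃ k : Ω → ℝ, Measurable k ∧ (∀ ω, 0 ≤ k ω) ∧ Integrable k w ∧
      μ = w.withDensity fun ω => ENNReal.ofReal (k ω) := by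
  refine ⟨fun ω => (μ.rnDeriv w ω).toReal, (Measure.measurable_rnDeriv μ w).ennreal_toReal,
    fun ω => ENNReal.toReal_nonneg, Measure.integrable_toReal_rnDeriv, ?_⟩
  rw [withDensity_congr_ae (g := μ.rnDeriv w), Measure.withDensity_rnDeriv_eq _ _ h]
  filter_upwards [Measure.rnDeriv_lt_top μ w] with ω hω
  rw [ENNReal.ofReal_toReal hω.ne]

theorem integral_withDensity_ofReal {w : Measure Ω} {k : Ω → ℝ} (hk : Measurable k)
    (h0 : ∀ ω, 0 ≤ k ω) (f : Ω → ℝ) :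
    ∫ ω, f ω ∂(w.withDensity fun ω => ENNReal.ofReal (k ω)) = ∫ ω, k ω * f ω ∂w := by
  rw [integral_withDensity_eq_integral_toReal_smul (by fun_prop)
    (Eventually.of_forall fun _ => ENNReal.ofReal_lt_top)]
  simp [ENNReal.toReal_ofReal (h0 _)]

/-- `X` is tangent to the cone of positive trace class operators at `σ`, with speed at most `Q`: `Q
+ 2 t X + t² σ ≥ 0` for all real `t`. Every POVM then has finite Fisher information at most `tr Q`
in the direction `X`. -/
structure IsTangent (σ Q X : TraceClass H) : Prop where
  pos : σ.IsPos
  quad : ∀ t : ℝ, (Q + (2 * t) • X + t ^ 2 • σ).IsPos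

theorem IsTangent.pos_quad {σ Q X : TraceClass H} (h : IsTangent σ Q X) : Q.IsPos := by
  simpa using h.quad 0

theorem IsTangent.pos_sum {σ Q X : TraceClass H} (h : IsTangent σ Q X) :
    (Q + (2 : ℝ) • X + σ).IsPos := by
  simpa using h.quad 1

/-- The logarithmic derivative of the laws of a POVM at `σ` in the direction `X`: the signed measure
that the POVM assigns to `X` has the density `ℓ` with respect to the law at `σ`. This is expressed
through the positive operators `Q + 2 X + σ` and `Q`, as an identity of positive measures. -/
structure IsScore (N : TraceClass H → Measure Ω) (σ Q X : TraceClass H) (ℓ : Ω → ℝ) : Prop where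
  measurable : Measurable ℓ
  memLp : MemLp ℓ 2 (N σ)
  identity : N (Q + (2 : ℝ) • X + σ) + (N σ).withDensity (fun ω => ENNReal.ofReal (-(2 * ℓ ω)))
    = N Q + N σ + (N σ).withDensity (fun ω => ENNReal.ofReal (2 * ℓ ω))

theorem discrim_of_rat {k d p : ℝ} (h : ∀ t : ℚ, 0 ≤ k + 2 * (t : ℝ) * d + (t : ℝ) ^ 2 * p) :
    d ^ 2 ≤ k * p := by
  have h1 : ∀ t : ℝ, 0 ≤ k + 2 * t * d + t ^ 2 * p := by
    intro t
    have hcl : IsClosed {t : ℝ | 0 ≤ k + 2 * t * d + t ^ 2 * p} :=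
      isClosed_le continuous_const (by fun_prop)
    have h2 : Set.range ((↑) : ℚ → ℝ) ⊆ {t : ℝ | 0 ≤ k + 2 * t * d + t ^ 2 * p} := by
      rintro _ ⟨q, rfl⟩; exact h q
    exact hcl.closure_subset_iff.2 h2 (Rat.denseRange_cast t)
  have h2 := discrim_le_zero (a := p) (b := 2 * d) (c := k) fun x => by
    have := h1 x; nlinarith
  rw [discrim] at h2
  nlinarith

/-- Every POVM has a score. With densities `k`, `d`, `p` of `Q`, `X`, `σ`, positivity of `Q + 2 t X
+ t² σ` for all `t` means `d² ≤ k p`, so `ℓ = d / p` is a density of `X` with respect to the law of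
`σ`, and the Fisher information `∫ ℓ² p` is at most `∫ k = tr Q`. -/
theorem IsPovm.exists_score {N : TraceClass H → Measure Ω} (hN : IsPovm N) {σ Q X : TraceClass H}
    (h : IsTangent σ Q X) :
    ∃ ℓ, IsScore N σ Q X ℓ ∧ ∫⁻ ω, ENNReal.ofReal (ℓ ω ^ 2) ∂N σ ≤ ENNReal.ofReal Q.tr.re := by
  set Y := Q + (2 : ℝ) • X + σ with hY
  have := hN.isFiniteMeasure h.pos
  have := hN.isFiniteMeasure h.pos_quad
  have := hN.isFiniteMeasure h.pos_sum
  set w := N Q + N σ + N Y with hw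
  have a1 : N Q ≪ w := Measure.absolutelyContinuous_of_le
    ((Measure.le_add_right le_rfl).trans (Measure.le_add_right le_rfl))
  have a2 : N σ ≪ w := Measure.absolutelyContinuous_of_le
    ((Measure.le_add_left le_rfl).trans (Measure.le_add_right le_rfl))
  have a3 : N Y ≪ w := Measure.absolutelyContinuous_of_le (Measure.le_add_left le_rfl)
  obtain ⟨k, km, k0, ki, hk⟩ := exists_density a1
  obtain ⟨p, pm, p0, pint, hp⟩ := exists_density a2
  obtain ⟨y, ym, y0, yi, hy⟩ := exists_density a3
  -- `y` is the density of `Q + 2 X + σ`, so that `d` is the one of `X`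
  set d : Ω → ℝ := fun ω => (y ω - k ω - p ω) / 2 with hd
  have di : Integrable d w := ((yi.sub ki).sub pint).div_const 2
  have hquad : ∀ t : ℝ, ∀ᵐ ω ∂w, 0 ≤ k ω + 2 * t * d ω + t ^ 2 * p ω := by
    intro t
    have hi : Integrable (fun ω => k ω + 2 * t * d ω + t ^ 2 * p ω) w :=
      (ki.add (di.const_mul _)).add (pint.const_mul _)
    refine ae_nonneg_of_forall_setIntegral_nonneg hi fun S hS _ => ?_
    have hm : Measurable (S.indicator fun _ => (1 : ℝ)) := measurable_const.indicator hS
    have hb : ∀ ω, |S.indicator (fun _ => (1 : ℝ)) ω| ≤ 1 := fun ω => by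
      by_cases hω : ω ∈ S <;> simp [hω]
    obtain ⟨F, hF⟩ := hN.exists_ext hm hb
    have hval : ∀ (x : TraceClass H) (f : Ω → ℝ), x.IsPos → Measurable f → (∀ ω, 0 ≤ f ω) →
        N x = w.withDensity (fun ω => ENNReal.ofReal (f ω)) → F x = ∫ ω in S, f ω ∂w := by
      intro x f hx hf h0 he
      rw [hF x hx, he, integral_withDensity_ofReal hf h0, ← integral_indicator hS]
      congr 1; ext ω
      by_cases hω : ω ∈ S <;> simp [hω]
    have hX : F Y = F Q + 2 * F X + F σ := by simp [hY]
    have hX' : F (Q + (2 * t) • X + t ^ 2 • σ) = F Q + 2 * t * F X + t ^ 2 * F σ := by simp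
    have hpos : 0 ≤ F (Q + (2 * t) • X + t ^ 2 • σ) := by
      rw [hF _ (h.quad t)]
      exact integral_nonneg fun ω => Set.indicator_nonneg (fun _ _ => zero_le_one) ω
    have e : ∫ ω in S, (k ω + 2 * t * d ω + t ^ 2 * p ω) ∂w
        = F Q + 2 * t * ((F Y - F Q - F σ) / 2) + t ^ 2 * F σ := by
      rw [hval Q k h.pos_quad km k0 hk, hval σ p h.pos pm p0 hp, hval Y y h.pos_sum ym y0 hy,
        integral_add (f := fun ω => k ω + 2 * t * d ω) (g := fun ω => t ^ 2 * p ω)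
          (ki.add (di.const_mul _)).integrableOn (pint.const_mul _).integrableOn,
        integral_add (f := k) (g := fun ω => 2 * t * d ω) ki.integrableOn
          (di.const_mul _).integrableOn, integral_const_mul, integral_const_mul, hd, integral_div,
        integral_sub (f := fun ω => y ω - k ω) (yi.sub ki).integrableOn pint.integrableOn,
        integral_sub yi.integrableOn ki.integrableOn]
    rw [e]
    have : (F Y - F Q - F σ) / 2 = F X := by rw [hX]; ring
    rw [this, ← hX']; exact hpos
  -- rational `t` suffice, for which the exceptional null sets can be united
  have hdisc : ∀ᵐ ω ∂w, d ω ^ 2 ≤ k ω * p ω := by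
    have : ∀ᵐ ω ∂w, ∀ t : ℚ, 0 ≤ k ω + 2 * (t : ℝ) * d ω + (t : ℝ) ^ 2 * p ω :=
      ae_all_iff.2 fun t => hquad t
    filter_upwards [this] with ω hω using discrim_of_rat hω
  have dm : Measurable d := ((ym.sub km).sub pm).div_const 2
  set ℓ : Ω → ℝ := fun ω => d ω / p ω with hℓ
  have lm : Measurable ℓ := dm.div pm
  have hpl : ∀ᵐ ω ∂w, p ω * ℓ ω = d ω := by
    filter_upwards [hdisc] with ω hω
    by_cases h0 : p ω = 0
    · have : d ω = 0 := by rw [h0, mul_zero] at hω; nlinarith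
      rw [h0, this, zero_mul]
    · rw [hℓ]; field_simp
  have hbound : ∫⁻ ω, ENNReal.ofReal (ℓ ω ^ 2) ∂N σ ≤ ENNReal.ofReal Q.tr.re := by
    rw [← hN.mass Q h.pos_quad, hp, lintegral_withDensity_eq_lintegral_mul _ (by fun_prop)
      (by fun_prop), hk, withDensity_apply _ MeasurableSet.univ, setLIntegral_univ]
    refine lintegral_mono_ae ?_
    filter_upwards [hdisc, hpl] with ω h1 h2
    rw [Pi.mul_apply, ← ENNReal.ofReal_mul (p0 ω)]
    refine ENNReal.ofReal_le_ofReal ?_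
    by_cases h0 : p ω = 0
    · rw [h0, zero_mul]; exact k0 ω
    · have h3 : 0 < p ω := lt_of_le_of_ne (p0 ω) (Ne.symm h0)
      have : p ω * (p ω * ℓ ω ^ 2) ≤ p ω * k ω := by
        calc p ω * (p ω * ℓ ω ^ 2) = (p ω * ℓ ω) ^ 2 := by ring
          _ = d ω ^ 2 := by rw [h2]
          _ ≤ k ω * p ω := h1
          _ = p ω * k ω := mul_comm _ _
      exact le_of_mul_le_mul_left this h3
  refine ⟨ℓ, ⟨lm, ?_, ?_⟩, hbound⟩
  · rw [memLp_two_iff_integrable_sq lm.aestronglyMeasurable]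
    refine ⟨(lm.pow_const 2).aestronglyMeasurable, ?_⟩
    rw [hasFiniteIntegral_iff_ofReal (Eventually.of_forall fun ω => sq_nonneg _)]
    exact hbound.trans_lt ENNReal.ofReal_lt_top
  · have e1 : ∀ f : Ω → ℝ, Measurable f → (N σ).withDensity (fun ω => ENNReal.ofReal (f ω))
        = w.withDensity (fun ω => ENNReal.ofReal (p ω) * ENNReal.ofReal (f ω)) := by
      intro f hf
      rw [hp, ← withDensity_mul _ (by fun_prop) (by fun_prop)]; rfl
    rw [e1 (fun ω => -(2 * ℓ ω)) (by fun_prop), e1 (fun ω => 2 * ℓ ω) (by fun_prop)]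
    change N Y + _ = _
    rw [hy, hk, hp, ← withDensity_add_left (by fun_prop), ← withDensity_add_left (by fun_prop),
      ← withDensity_add_left (by fun_prop)]
    refine withDensity_congr_ae ?_
    filter_upwards [hpl] with ω hω
    simp only [Pi.add_apply]
    rw [← ENNReal.ofReal_mul (p0 ω), ← ENNReal.ofReal_mul (p0 ω),
      ← ENNReal.ofReal_add (k0 ω) (p0 ω)]
    have h1 : y ω = k ω + p ω + 2 * (p ω * ℓ ω) := by rw [hω, hd]; ring
    rcases le_total 0 (ℓ ω) with h2 | h2
    · rw [ENNReal.ofReal_of_nonpos (p := p ω * -(2 * ℓ ω)) (by nlinarith [p0 ω]), add_zero,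
        ← ENNReal.ofReal_add (add_nonneg (k0 ω) (p0 ω))
          (mul_nonneg (p0 ω) (by linarith)), h1]
      congr 1; ring
    · rw [ENNReal.ofReal_of_nonpos (p := p ω * (2 * ℓ ω)) (by nlinarith [p0 ω]), add_zero,
        ← ENNReal.ofReal_add (y0 ω) (mul_nonneg (p0 ω) (by linarith)), h1]
      congr 1; ring

namespace IsScore

variable {N : TraceClass H → Measure Ω} {σ Q X : TraceClass H} {ℓ : Ω → ℝ}

theorem integrable (hN : IsPovm N) (h : IsTangent σ Q X) (hs : IsScore N σ Q X ℓ) :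
    Integrable ℓ (N σ) := by
  have := hN.isFiniteMeasure h.pos
  exact hs.memLp.integrable one_le_two

theorem integral_eq_of_isFiniteMeasure (hs : IsScore N σ Q X ℓ) [IsFiniteMeasure (N σ)]
    [IsFiniteMeasure (N Q)] [IsFiniteMeasure (N (Q + (2 : ℝ) • X + σ))] {φ : Ω → ℝ}
    (hφ : Measurable φ) {c : ℝ} (hc : ∀ ω, |φ ω| ≤ c) :
    ∫ ω, φ ω ∂N (Q + (2 : ℝ) • X + σ) - ∫ ω, φ ω ∂N Q - ∫ ω, φ ω ∂N σ
      = 2 * ∫ ω, φ ω * ℓ ω ∂N σ := by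
  have hi : Integrable ℓ (N σ) := hs.memLp.integrable one_le_two
  have hm := hs.measurable
  have f1 : IsFiniteMeasure ((N σ).withDensity (fun ω => ENNReal.ofReal (-(2 * ℓ ω)))) :=
    isFiniteMeasure_withDensity_ofReal (hi.const_mul 2).neg.2
  have f2 : IsFiniteMeasure ((N σ).withDensity (fun ω => ENNReal.ofReal (2 * ℓ ω))) :=
    isFiniteMeasure_withDensity_ofReal (hi.const_mul 2).2
  have e := congrArg (fun μ : Measure Ω => ∫ ω, φ ω ∂μ) hs.identity
  have hφi : ∀ μ : Measure Ω, IsFiniteMeasure μ → Integrable φ μ := fun μ _ =>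
    integrable_of_abs_le hφ hc
  have e2 : ∀ f : Ω → ℝ, Measurable f →
      ∫ ω, φ ω ∂(N σ).withDensity (fun ω => ENNReal.ofReal (f ω)) = ∫ ω, max (f ω) 0 * φ ω ∂N σ := by
    intro f hf
    rw [integral_withDensity_eq_integral_toReal_smul (by fun_prop)
      (Eventually.of_forall fun _ => ENNReal.ofReal_lt_top)]
    simp only [ENNReal.toReal_ofReal', smul_eq_mul]
  rw [integral_add_measure (hφi _ inferInstance) (hφi _ f1),
    integral_add_measure (hφi _ inferInstance) (hφi _ f2),
    integral_add_measure (hφi _ inferInstance) (hφi _ inferInstance),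
    e2 _ (by fun_prop), e2 _ (by fun_prop)] at e
  have hint : ∀ f : Ω → ℝ, Integrable f (N σ) → Integrable (fun ω => max (f ω) 0 * φ ω) (N σ) :=
    fun f hf => hf.pos_part.mul_bdd hφ.aestronglyMeasurable (Eventually.of_forall hc)
  have e3 : ∫ ω, max (2 * ℓ ω) 0 * φ ω ∂N σ - ∫ ω, max (-(2 * ℓ ω)) 0 * φ ω ∂N σ
      = 2 * ∫ ω, φ ω * ℓ ω ∂N σ := by
    rw [← integral_sub (hint _ (hi.const_mul 2)) (hint (fun ω => -(2 * ℓ ω)) (hi.const_mul 2).neg),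
      ← integral_const_mul]
    congr 1; ext ω
    rcases le_total 0 (ℓ ω) with h2 | h2
    · rw [max_eq_left (by linarith), max_eq_right (by linarith)]; ring
    · rw [max_eq_right (by linarith), max_eq_left (by linarith)]; ring
  rw [← e3]
  linarith

/-- Integrals of bounded functions against the signed measure assigned to `X`. -/
theorem integral_eq (hN : IsPovm N) (h : IsTangent σ Q X) (hs : IsScore N σ Q X ℓ) {φ : Ω → ℝ}
    (hφ : Measurable φ) {c : ℝ} (hc : ∀ ω, |φ ω| ≤ c) :
    ∫ ω, φ ω ∂N (Q + (2 : ℝ) • X + σ) - ∫ ω, φ ω ∂N Q - ∫ ω, φ ω ∂N σ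
      = 2 * ∫ ω, φ ω * ℓ ω ∂N σ := by
  have := hN.isFiniteMeasure h.pos
  have := hN.isFiniteMeasure h.pos_quad
  have := hN.isFiniteMeasure h.pos_sum
  exact hs.integral_eq_of_isFiniteMeasure hφ hc

/-- Scores are unique. -/
theorem ae_eq (hN : IsPovm N) (h : IsTangent σ Q X) (hs : IsScore N σ Q X ℓ) {ℓ' : Ω → ℝ}
    (hs' : IsScore N σ Q X ℓ') : ℓ =ᵐ[N σ] ℓ' := by
  refine Integrable.ae_eq_of_forall_setIntegral_eq _ _ (hs.integrable hN h) (hs'.integrable hN h)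
    fun S hS _ => ?_
  have hm : Measurable (S.indicator fun _ => (1 : ℝ)) := measurable_const.indicator hS
  have hb : ∀ ω, |S.indicator (fun _ => (1 : ℝ)) ω| ≤ 1 := fun ω => by
    by_cases hω : ω ∈ S <;> simp [hω]
  have e := (hs.integral_eq hN h hm hb).symm.trans (hs'.integral_eq hN h hm hb)
  have e2 : ∀ f : Ω → ℝ, ∫ ω in S, f ω ∂N σ = ∫ ω, S.indicator (fun _ => (1 : ℝ)) ω * f ω ∂N σ :=
    fun f => by
      rw [← integral_indicator hS]
      congr 1; ext ω
      by_cases hω : ω ∈ S <;> simp [hω]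
  rw [e2, e2]
  linarith

theorem ext_eq (hN : IsPovm N) (h : IsTangent σ Q X) (hs : IsScore N σ Q X ℓ) {φ : Ω → ℝ}
    (hφ : Measurable φ) {c : ℝ} (hc : ∀ ω, |φ ω| ≤ c) {F : TraceClass H →ₗ[ℝ] ℝ}
    (hF : ∀ x, x.IsPos → F x = ∫ ω, φ ω ∂N x) : F X = ∫ ω, φ ω * ℓ ω ∂N σ := by
  have e := hs.integral_eq hN h hφ hc
  rw [← hF _ h.pos, ← hF _ h.pos_quad, ← hF _ h.pos_sum, map_add, map_add, map_smul,
    smul_eq_mul] at e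
  linarith

/-- The integral of a bounded function is differentiable along a curve with tangent `X`. -/
theorem hasDerivAt (hN : IsPovm N) {ρ : ℝ → TraceClass H} (h : IsTangent (ρ 0) Q X)
    (hs : IsScore N (ρ 0) Q X ℓ) (hρ : HasDerivAt ρ X 0) (hpos : ∀ᶠ t in 𝓝 0, (ρ t).IsPos)
    {φ : Ω → ℝ} (hφ : Measurable φ) {c : ℝ} (hc : ∀ ω, |φ ω| ≤ c) :
    HasDerivAt (fun t => ∫ ω, φ ω ∂N (ρ t)) (∫ ω, φ ω * ℓ ω ∂N (ρ 0)) 0 := by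
  obtain ⟨F, hF⟩ := hN.exists_ext hφ hc
  rw [← hs.ext_eq hN h hφ hc (F := F.toLinearMap) hF]
  refine (F.hasFDerivAt.comp_hasDerivAt (0 : ℝ) hρ).congr_of_eventuallyEq ?_
  filter_upwards [hpos] with t ht
  exact (hF _ ht).symm

theorem integral_eq_zero (hN : IsPovm N) (h : IsTangent σ Q X) (hs : IsScore N σ Q X ℓ)
    (hX : X.tr.re = 0) : ∫ ω, ℓ ω ∂N σ = 0 := by
  have e := hs.integral_eq hN h (φ := fun _ => 1) measurable_const (c := 1) (by simp)
  simp only [integral_const, smul_eq_mul, mul_one, one_mul] at e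
  rw [hN.real_univ h.pos, hN.real_univ h.pos_quad, hN.real_univ h.pos_sum, tr_add, tr_add,
    Complex.add_re, Complex.add_re, tr_real_smul_re, hX] at e
  linarith

end IsScore

end

/-! ### Differentiation under the integral sign -/

section

theorem exists_density_of_le {μ w : Measure Ω} [IsFiniteMeasure μ] [IsFiniteMeasure w]
    (h : μ ≤ w) : ∃ k : Ω → ℝ, Measurable k ∧ (∀ ω, 0 ≤ k ω) ∧ (∀ ω, k ω ≤ 1) ∧
      μ = w.withDensity fun ω => ENNReal.ofReal (k ω) := by
  refine ⟨fun ω => min (μ.rnDeriv w ω).toReal 1,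
    (Measure.measurable_rnDeriv μ w).ennreal_toReal.min measurable_const,
    fun ω => le_min ENNReal.toReal_nonneg zero_le_one, fun ω => min_le_right _ _, ?_⟩
  rw [withDensity_congr_ae (g := μ.rnDeriv w),
    Measure.withDensity_rnDeriv_eq _ _ (Measure.absolutelyContinuous_of_le h)]
  filter_upwards [Measure.rnDeriv_le_one_of_le h] with ω hω
  rw [min_eq_left, ENNReal.ofReal_toReal (hω.trans_lt ENNReal.one_lt_top).ne]
  exact ENNReal.toReal_le_of_le_ofReal zero_le_one (by simpa using hω)

/-- The places where `|T|` exceeds `K`. -/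
def tailSet (T : Ω → ℝ) (K : ℝ) : Set Ω := {ω | K < |T ω|}

theorem measurableSet_tailSet {T : Ω → ℝ} (hT : Measurable T) (K : ℝ) :
    MeasurableSet (tailSet T K) := measurableSet_lt measurable_const hT.abs

theorem antitone_tailSet (T : Ω → ℝ) : Antitone fun n : ℕ => tailSet T n := fun a b hab ω hω => by
  have : (a : ℝ) ≤ b := by exact_mod_cast hab
  exact lt_of_le_of_lt this hω

theorem iInter_tailSet (T : Ω → ℝ) : ⋂ n : ℕ, tailSet T n = ∅ := by
  ext ω
  simp only [Set.mem_iInter, Set.mem_empty_iff_false, iff_false, not_forall]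
  obtain ⟨n, hn⟩ := exists_nat_ge |T ω|
  exact ⟨n, fun h => absurd hn (not_le.2 h)⟩

theorem tendsto_setIntegral_tailSet {μ : Measure Ω} {T : Ω → ℝ} (hT : Measurable T) {f : Ω → ℝ}
    (hf : Integrable f μ) : Tendsto (fun n : ℕ => ∫ ω in tailSet T n, f ω ∂μ) atTop (𝓝 0) := by
  have := tendsto_setIntegral_of_antitone (μ := μ) (f := f)
    (fun n : ℕ => measurableSet_tailSet hT n) (antitone_tailSet T) ⟨0, hf.integrableOn⟩
  simpa [iInter_tailSet] using this

/-- A family of functionals of test functions bounded by `1` that is uniformly small, near `t = 0`,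
on the test functions supported where `|T|` is large. -/
def UniformTail (T : Ω → ℝ) (W : ℝ → (Ω → ℝ) → ℝ) : Prop :=
  ∀ ε > 0, ∃ K : ℝ, ∀ᶠ t in 𝓝 (0 : ℝ), ∀ φ : Ω → ℝ, Measurable φ → (∀ ω, |φ ω| ≤ 1) →
    (∀ ω, |T ω| ≤ K → φ ω = 0) → |W t φ| ≤ ε

/-- Differentiation under the integral sign for a square integrable function along a curve of
measures that has a second order expansion in total variation. No domination is required: the
Hellinger-type estimate for `d(P t - P 0) / d(P t + P 0)` on the sets `|T| > K` replaces it. -/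
theorem hasDerivAt_integral_of_quadratic {P : ℝ → Measure Ω} {ℓ T : Ω → ℝ}
    (hfin : ∀ᶠ t in 𝓝 0, IsFiniteMeasure (P t)) (hℓ2 : MemLp ℓ 2 (P 0))
    (hT : Measurable T) {C : ℝ}
    (hC : ∀ᶠ t in 𝓝 0, Integrable (fun ω => T ω ^ 2) (P t) ∧ ∫ ω, T ω ^ 2 ∂P t ≤ C)
    {W : ℝ → (Ω → ℝ) → ℝ}
    (hW : ∀ᶠ t in 𝓝 0, ∀ φ : Ω → ℝ, Measurable φ → (∀ ω, |φ ω| ≤ 1) →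
      ∫ ω, φ ω ∂P t - ∫ ω, φ ω ∂P 0 - t * ∫ ω, φ ω * ℓ ω ∂P 0 = t ^ 2 * W t φ)
    (hbdd : ∃ A : ℝ, ∀ᶠ t in 𝓝 0, ∀ φ : Ω → ℝ, Measurable φ → (∀ ω, |φ ω| ≤ 1) → |W t φ| ≤ A)
    (htail : UniformTail T W) :
    HasDerivAt (fun t => ∫ ω, T ω ∂P t) (∫ ω, T ω * ℓ ω ∂P 0) 0 := by
  obtain ⟨A, hA⟩ := hbdd
  have hf0 : IsFiniteMeasure (P 0) := hfin.self_of_nhds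
  obtain ⟨hT0, hC0⟩ := hC.self_of_nhds
  have hCnn : 0 ≤ C := (integral_nonneg fun ω => sq_nonneg _).trans hC0
  have hT2 : MemLp T 2 (P 0) := (memLp_two_iff_integrable_sq hT.aestronglyMeasurable).2 hT0
  have hTℓ : Integrable (fun ω => T ω * ℓ ω) (P 0) := hT2.integrable_mul hℓ2
  have hℓsq : Integrable (fun ω => ℓ ω ^ 2) (P 0) := hℓ2.integrable_sq
  rw [hasDerivAt_iff_isLittleO, Asymptotics.isLittleO_iff]
  intro c hc
  set η : ℝ := c / (8 * (C + 1)) with hη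
  have hηpos : 0 < η := by positivity
  have hηC : η * C ≤ c / 4 := by
    rw [hη, div_mul_eq_mul_div, div_le_div_iff₀ (by positivity) (by norm_num)]
    nlinarith
  obtain ⟨K₁, hK₁⟩ := htail (η * c / 8) (by positivity)
  -- a cutoff beyond which the remainder, the score and the product with the score are small
  have hev : ∀ᶠ n : ℕ in atTop, K₁ ≤ n ∧ ∫ ω in tailSet T n, ℓ ω ^ 2 ∂P 0 ≤ η * c / 4
      ∧ |∫ ω in tailSet T n, T ω * ℓ ω ∂P 0| ≤ c / 4 ∧ (1 : ℝ) ≤ n := by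
    have h1 := (tendsto_setIntegral_tailSet hT hℓsq).eventually_le_const
      (show (0 : ℝ) < η * c / 4 by positivity)
    have h2 := (tendsto_setIntegral_tailSet hT hTℓ).abs.eventually_le_const
      (show |(0 : ℝ)| < c / 4 by rw [abs_zero]; positivity)
    filter_upwards [h1, h2, eventually_ge_atTop (Nat.ceil K₁), eventually_ge_atTop 1]
      with n a b d e
    exact ⟨(Nat.le_ceil _).trans (by exact_mod_cast d), a, b, by exact_mod_cast e⟩
  obtain ⟨n, hn1, hn2, hn3, hn4⟩ := hev.exists
  set K : ℝ := (n : ℝ) with hK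
  set S := tailSet T K with hS
  have hSm : MeasurableSet S := measurableSet_tailSet hT K
  have hsmall : ∀ᶠ t : ℝ in 𝓝 0, |t| * (K * |A|) ≤ c / 4 := by
    have : Tendsto (fun t : ℝ => |t| * (K * |A|)) (𝓝 0) (𝓝 0) := by
      have h : Continuous fun t : ℝ => |t| * (K * |A|) := by fun_prop
      simpa using h.tendsto 0
    exact this.eventually_le_const (by positivity)
  filter_upwards [hfin, hC, hW, hA, hK₁, hsmall] with t hft ⟨hTt, hCt⟩ hWt hAt hKt hst
  simp only [sub_zero, smul_eq_mul, Real.norm_eq_abs]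
  -- the part where `|T| ≤ K`
  set φ : Ω → ℝ := Sᶜ.indicator fun ω => T ω / K with hφ
  have hφm : Measurable φ := (hT.div_const K).indicator hSm.compl
  have hKpos : 0 < K := lt_of_lt_of_le one_pos hn4
  have hφ1 : ∀ ω, |φ ω| ≤ 1 := fun ω => by
    by_cases hω : ω ∈ S
    · simp [hφ, hω]
    · have : |T ω| ≤ K := not_lt.1 hω
      simp only [hφ, Set.indicator_of_mem (show ω ∈ Sᶜ from hω)]
      rw [abs_div, abs_of_pos hKpos]
      exact (div_le_one hKpos).2 this
  have hφT : ∀ ω, K * φ ω = Sᶜ.indicator T ω := fun ω => by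
    by_cases hω : ω ∈ S
    · simp [hφ, hω]
    · simp only [hφ, Set.indicator_of_mem (show ω ∈ Sᶜ from hω)]
      field_simp
  have hsplit : ∀ (μ : Measure Ω) (f : Ω → ℝ), Integrable f μ →
      ∫ ω, f ω ∂μ = ∫ ω, Sᶜ.indicator f ω ∂μ + ∫ ω in S, f ω ∂μ := fun μ f hf => by
    rw [integral_indicator hSm.compl, add_comm, integral_add_compl hSm hf]
  have hTi : ∀ (μ : Measure Ω), IsFiniteMeasure μ → Integrable (fun ω => T ω ^ 2) μ →
      Integrable T μ := fun μ _ h =>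
    ((memLp_two_iff_integrable_sq hT.aestronglyMeasurable).2 h).integrable one_le_two
  have hTt1 := hTi _ hft hTt
  have hT01 := hTi _ hf0 hT0
  have hbound1 : |∫ ω, Sᶜ.indicator T ω ∂P t - ∫ ω, Sᶜ.indicator T ω ∂P 0
      - t * ∫ ω, Sᶜ.indicator (fun ω => T ω * ℓ ω) ω ∂P 0| ≤ c / 4 * |t| := by
    have e1 : ∀ ω, Sᶜ.indicator (fun ω => T ω * ℓ ω) ω = K * (φ ω * ℓ ω) := fun ω => by
      rw [← mul_assoc, hφT]
      by_cases hω : ω ∈ S <;> simp [hω]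
    simp_rw [e1, ← hφT]
    rw [integral_const_mul, integral_const_mul, integral_const_mul]
    have e2 : K * ∫ ω, φ ω ∂P t - K * ∫ ω, φ ω ∂P 0 - t * (K * ∫ ω, φ ω * ℓ ω ∂P 0)
        = K * (t ^ 2 * W t φ) := by rw [← hWt φ hφm hφ1]; ring
    rw [e2, abs_mul, abs_mul, abs_of_pos hKpos, abs_pow]
    have h3 := (hAt φ hφm hφ1).trans (le_abs_self A)
    calc K * (|t| ^ 2 * |W t φ|) ≤ K * (|t| ^ 2 * |A|) := by gcongr
      _ = |t| * (K * |A|) * |t| := by ring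
      _ ≤ c / 4 * |t| := by gcongr
  -- the part where `|T| > K`
  set w := P t + P 0 with hw
  obtain ⟨p, pm, p0, p1, hp⟩ := exists_density_of_le (μ := P t) (w := w)
    (Measure.le_add_right le_rfl)
  obtain ⟨q, qm, q0, q1, hq⟩ := exists_density_of_le (μ := P 0) (w := w)
    (Measure.le_add_left le_rfl)
  set D : Ω → ℝ := fun ω => p ω - q ω with hD
  have hDm : Measurable D := pm.sub qm
  have hD1 : ∀ ω, |D ω| ≤ 1 := fun ω => by
    have := p0 ω; have := p1 ω; have := q0 ω; have := q1 ω
    exact abs_le.2 ⟨by simp only [hD]; linarith, by simp only [hD]; linarith⟩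
  have hDint : ∀ f : Ω → ℝ, Integrable f w →
      ∫ ω, f ω ∂P t - ∫ ω, f ω ∂P 0 = ∫ ω, D ω * f ω ∂w := by
    intro f hf
    have e1 : ∫ ω, f ω ∂P t = ∫ ω, p ω * f ω ∂w := by
      conv_lhs => rw [hp]
      exact integral_withDensity_ofReal pm p0 f
    have e2 : ∫ ω, f ω ∂P 0 = ∫ ω, q ω * f ω ∂w := by
      conv_lhs => rw [hq]
      exact integral_withDensity_ofReal qm q0 f
    have hb : ∀ g : Ω → ℝ, Measurable g → (∀ ω, 0 ≤ g ω) → (∀ ω, g ω ≤ 1) →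
        Integrable (fun ω => g ω * f ω) w := fun g hg h0 h1 =>
      hf.bdd_mul (c := 1) hg.aestronglyMeasurable (Eventually.of_forall fun ω => by
        rw [Real.norm_eq_abs, abs_of_nonneg (h0 ω)]; exact h1 ω)
    rw [e1, e2, ← integral_sub (hb p pm p0 p1) (hb q qm q0 q1)]
    congr 1; ext ω; simp only [hD]; ring
  have hD2i : Integrable (fun ω => D ω ^ 2) w := integrable_of_abs_le (hDm.pow_const 2) (c := 1)
    fun ω => by rw [abs_pow]; exact pow_le_one₀ (abs_nonneg _) (hD1 ω)
  have hTw : Integrable (fun ω => T ω ^ 2) w := integrable_add_measure.2 ⟨hTt, hT0⟩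
  have hTw1 : Integrable T w := integrable_add_measure.2 ⟨hTt1, hT01⟩
  set y : ℝ := ∫ ω in S, D ω ^ 2 ∂w with hy
  have hy1 : y ≤ t ^ 2 * (η * c / 2) := by
    set ψ : Ω → ℝ := S.indicator D with hψ
    have hψm : Measurable ψ := hDm.indicator hSm
    have hψ1 : ∀ ω, |ψ ω| ≤ 1 := fun ω => by
      by_cases hω : ω ∈ S
      · simpa [hψ, hω] using hD1 ω
      · simp [hψ, hω]
    have hψ0 : ∀ ω, |T ω| ≤ K₁ → ψ ω = 0 := fun ω hω => by
      have : ω ∉ S := fun h => absurd (hω.trans hn1) (not_le.2 h)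
      simp [hψ, this]
    have e1 := hWt ψ hψm hψ1
    rw [hDint ψ (integrable_of_abs_le hψm hψ1)] at e1
    have e2 : ∫ ω, D ω * ψ ω ∂w = y := by
      rw [hy, ← integral_indicator hSm]
      congr 1; ext ω
      by_cases hω : ω ∈ S <;> simp [hψ, hω, sq]
    have e3 : |∫ ω, t * (ψ ω * ℓ ω) ∂P 0| ≤ y / 2 + t ^ 2 / 2 * (η * c / 4) := by
      have i1 : Integrable (fun ω => S.indicator (fun ω => D ω ^ 2) ω) (P 0) :=
        ((integrable_add_measure.1 hD2i).2).indicator hSm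
      have i2 : Integrable (fun ω => S.indicator (fun ω => ℓ ω ^ 2) ω) (P 0) :=
        hℓsq.indicator hSm
      have h1 : |∫ ω, t * (ψ ω * ℓ ω) ∂P 0| ≤ ∫ ω, (S.indicator (fun ω => D ω ^ 2) ω / 2
          + t ^ 2 / 2 * S.indicator (fun ω => ℓ ω ^ 2) ω) ∂P 0 := by
        rw [← Real.norm_eq_abs]
        refine norm_integral_le_of_norm_le ((i1.div_const 2).add (i2.const_mul _))
          (Eventually.of_forall fun ω => ?_)
        rw [Real.norm_eq_abs]
        by_cases hω : ω ∈ S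
        · simp only [hψ, hω, Set.indicator_of_mem]
          rw [abs_le]
          constructor <;> nlinarith [sq_nonneg (D ω - t * ℓ ω), sq_nonneg (D ω + t * ℓ ω)]
        · simp [hψ, hω]
      refine h1.trans ?_
      rw [integral_add (i1.div_const 2) (i2.const_mul _), integral_div, integral_const_mul,
        integral_indicator hSm, integral_indicator hSm]
      have h2 : ∫ ω in S, D ω ^ 2 ∂P 0 ≤ y := by
        rw [hy, hw, Measure.restrict_add, integral_add_measure]
        · have : 0 ≤ ∫ ω in S, D ω ^ 2 ∂P t := integral_nonneg fun ω => sq_nonneg _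
          linarith
        · exact (integrable_add_measure.1 hD2i).1.integrableOn
        · exact (integrable_add_measure.1 hD2i).2.integrableOn
      gcongr
    rw [integral_const_mul] at e3
    have e4 := hKt ψ hψm hψ1 hψ0
    have e5 : t ^ 2 * W t ψ ≤ t ^ 2 * (η * c / 8) := by
      gcongr; exact (le_abs_self _).trans e4
    have e6 := (le_abs_self _).trans e3
    rw [e2] at e1
    linarith
  have hbound2 : |∫ ω in S, T ω ∂P t - ∫ ω in S, T ω ∂P 0| ≤ c / 2 * |t| := by
    rcases eq_or_ne t 0 with rfl | ht
    · simp
    have htp : 0 < |t| := abs_pos.2 ht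
    have e1 : ∫ ω in S, T ω ∂P t - ∫ ω in S, T ω ∂P 0 = ∫ ω in S, D ω * T ω ∂w := by
      rw [← integral_indicator hSm, ← integral_indicator hSm, hDint _ (hTw1.indicator hSm),
        ← integral_indicator hSm]
      congr 1; ext ω
      by_cases hω : ω ∈ S <;> simp [hω]
    rw [e1]
    have h1 : |∫ ω in S, D ω * T ω ∂w| ≤ ∫ ω in S, (η * |t| / 2 * T ω ^ 2
        + 1 / (2 * η * |t|) * D ω ^ 2) ∂w := by
      rw [← Real.norm_eq_abs]
      refine norm_integral_le_of_norm_le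
        (((hTw.integrableOn (s := S)).const_mul _).add
          ((hD2i.integrableOn (s := S)).const_mul _)) (Eventually.of_forall fun ω => ?_)
      have h2 : |D ω * T ω| * (2 * η * |t|) ≤ (η * |t|) ^ 2 * T ω ^ 2 + D ω ^ 2 := by
        rw [abs_mul]
        nlinarith [sq_nonneg (η * |t| * |T ω| - |D ω|), sq_abs (T ω), sq_abs (D ω)]
      have h3 : η * |t| / 2 * T ω ^ 2 + 1 / (2 * η * |t|) * D ω ^ 2
          = ((η * |t|) ^ 2 * T ω ^ 2 + D ω ^ 2) / (2 * η * |t|) := by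
        field_simp
      rw [Real.norm_eq_abs, h3, le_div_iff₀ (by positivity)]
      exact h2
    refine h1.trans ?_
    rw [integral_add (hTw.integrableOn.const_mul _) (hD2i.integrableOn.const_mul _),
      integral_const_mul, integral_const_mul, ← hy]
    have h4 : ∫ ω in S, T ω ^ 2 ∂w ≤ 2 * C := by
      refine (setIntegral_le_integral hTw (Eventually.of_forall fun ω => sq_nonneg _)).trans ?_
      rw [hw, integral_add_measure hTt hT0]
      linarith
    have h5 : 1 / (2 * η * |t|) * y ≤ c / 4 * |t| := by
      rw [div_mul_eq_mul_div, one_mul, div_le_iff₀ (by positivity)]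
      calc y ≤ t ^ 2 * (η * c / 2) := hy1
        _ = c / 4 * |t| * (2 * η * |t|) := by rw [← sq_abs]; ring
    have h6 : η * |t| / 2 * ∫ ω in S, T ω ^ 2 ∂w ≤ c / 4 * |t| := by
      calc η * |t| / 2 * ∫ ω in S, T ω ^ 2 ∂w ≤ η * |t| / 2 * (2 * C) := by gcongr
        _ = η * C * |t| := by ring
        _ ≤ c / 4 * |t| := by gcongr
    linarith
  have hbound3 : |t * ∫ ω in S, T ω * ℓ ω ∂P 0| ≤ c / 4 * |t| := by
    rw [abs_mul, mul_comm]; gcongr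
  rw [hsplit _ _ hTt1, hsplit _ _ hT01, hsplit _ _ hTℓ]
  have e : ∀ a b d a' b' d' : ℝ, (a + a') - (b + b') - t * (d + d')
      = (a - b - t * d) + (a' - b') - t * d' := fun a b d a' b' d' => by ring
  rw [e]
  refine (abs_sub _ _).trans ?_
  refine (add_le_add (abs_add_le _ _) le_rfl).trans ?_
  linarith

end

/-! ### Derivatives of expectations in product states -/

section

namespace UniformTail

theorem add {T : Ω → ℝ} {W W' : ℝ → (Ω → ℝ) → ℝ} (h : UniformTail T W) (h' : UniformTail T W') :
    UniformTail T fun t φ => W t φ + W' t φ := by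
  intro ε hε
  obtain ⟨K, hK⟩ := h (ε / 2) (by positivity)
  obtain ⟨K', hK'⟩ := h' (ε / 2) (by positivity)
  refine ⟨max K K', ?_⟩
  filter_upwards [hK, hK'] with t h1 h2 φ hφ hb h0
  have a := h1 φ hφ hb fun ω hω => h0 ω (hω.trans (le_max_left _ _))
  have b := h2 φ hφ hb fun ω hω => h0 ω (hω.trans (le_max_right _ _))
  exact (abs_add_le _ _).trans (by linarith)

theorem sum {T : Ω → ℝ} {ι : Type*} (s : Finset ι) {W : ι → ℝ → (Ω → ℝ) → ℝ}
    (h : ∀ i ∈ s, UniformTail T (W i)) : UniformTail T fun t φ => ∑ i ∈ s, W i t φ := by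
  classical
  induction s using Finset.induction_on with
  | empty => exact fun ε hε => ⟨0, Eventually.of_forall fun t φ _ _ _ => by simpa using hε.le⟩
  | insert i s hi ih =>
    simp_rw [Finset.sum_insert hi]
    exact (h i (Finset.mem_insert_self i s)).add (ih fun j hj => h j (Finset.mem_insert_of_mem hj))

theorem pow_mul {T : Ω → ℝ} {W : ℝ → (Ω → ℝ) → ℝ} (h : UniformTail T W) (k : ℕ) :
    UniformTail T fun t φ => t ^ k * W t φ := by
  intro ε hε
  obtain ⟨K, hK⟩ := h ε hε
  refine ⟨K, ?_⟩
  have h1 : ∀ᶠ t : ℝ in 𝓝 0, |t| ≤ 1 := by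
    have : Tendsto (fun t : ℝ => |t|) (𝓝 0) (𝓝 0) := by
      simpa using (continuous_abs (G := ℝ)).tendsto 0
    exact this.eventually_le_const one_pos
  filter_upwards [hK, h1] with t ht h1 φ hφ hb h0
  rw [abs_mul, abs_pow]
  calc |t| ^ k * |W t φ| ≤ 1 * ε :=
        mul_le_mul (pow_le_one₀ (abs_nonneg _) h1) (ht φ hφ hb h0) (abs_nonneg _) zero_le_one
    _ = ε := one_mul ε

end UniformTail

namespace IsProductLaw

variable {n : ℕ} {law : (Fin n → TraceClass H) → Measure Ω}

theorem uniformTail_ext (h : IsProductLaw law) {T : Ω → ℝ} (hT : Measurable T)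
    {y : ℝ → Fin n → TraceClass H} {y₀ : Fin n → TraceClass H} (hy : Tendsto y (𝓝 0) (𝓝 y₀)) :
    UniformTail T fun t φ => ext law φ (y t) := by
  intro ε hε
  have htail : Tendsto (fun k : ℕ => ∑ s : Finset (Fin n), (law (parts y₀ s)).real (tailSet T k))
      atTop (𝓝 0) := by
    rw [show (0 : ℝ) = ∑ s : Finset (Fin n), 0 by simp]
    refine tendsto_finsetSum _ fun s _ => ?_
    have := h.isFiniteMeasure (isPos_parts y₀ s)
    have h1 := tendsto_setIntegral_tailSet (μ := law (parts y₀ s)) hT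
      (integrable_const (1 : ℝ))
    simpa using h1
  obtain ⟨k, hk⟩ := (htail.eventually_le_const (show (0 : ℝ) < ε / 2 by positivity)).exists
  refine ⟨k, ?_⟩
  have hlim : Tendsto (fun t => 2 ^ n * 1 * Fintype.card (Fin n)
      * max ‖y t‖ ‖y₀‖ ^ (Fintype.card (Fin n) - 1) * ‖y t - y₀‖) (𝓝 0) (𝓝 0) := by
    have h1 : Tendsto (fun t => ‖y t - y₀‖) (𝓝 0) (𝓝 0) := by
      simpa using (hy.sub_const y₀).norm
    have h2 := ((((hy.norm.max (tendsto_const_nhds (x := ‖y₀‖))).pow (Fintype.card (Fin n) - 1)).const_mul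
      ((2 : ℝ) ^ n * 1 * Fintype.card (Fin n))).mul h1)
    simpa using h2
  filter_upwards [hlim.eventually_le_const (show (0 : ℝ) < ε / 2 by positivity)]
    with t ht φ hφ hb h0
  obtain ⟨Φ, hΦ⟩ := h.exists_multilinear hφ hb
  have e1 : |ext law φ (y t) - ext law φ y₀| ≤ ε / 2 := by
    rw [← hΦ, ← hΦ]
    refine (Φ.norm_image_sub_le_of_bound (C := 2 ^ n * 1) (by positivity) (fun m => ?_) _ _).trans ht
    rw [hΦ]; exact h.abs_ext_le_prod hb zero_le_one m
  have e2 : |ext law φ y₀| ≤ ε / 2 := by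
    refine (abs_ext_le _).trans (le_trans ?_ hk)
    refine Finset.sum_le_sum fun s _ => ?_
    have := h.isFiniteMeasure (isPos_parts y₀ s)
    calc ∫ ω, |φ ω| ∂law (parts y₀ s)
        ≤ ∫ ω, (tailSet T k).indicator (fun _ => (1 : ℝ)) ω ∂law (parts y₀ s) := by
          refine integral_mono (integrable_of_abs_le hφ hb).abs
            ((integrable_const 1).indicator (measurableSet_tailSet hT k)) fun ω => ?_
          by_cases hω : ω ∈ tailSet T k
          · simpa [hω] using hb ω
          · simp only [hω, not_false_eq_true, Set.indicator_of_notMem]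
            rw [h0 ω (not_lt.1 hω), abs_zero]
      _ = _ := by rw [integral_indicator (measurableSet_tailSet hT k)]; simp
  have e3 : ext law φ (y t) = ext law φ (y t) - ext law φ y₀ + ext law φ y₀ := by ring
  rw [e3]
  exact (abs_add_le _ _).trans (by linarith)

theorem bounded_ext (h : IsProductLaw law)
    {y : ℝ → Fin n → TraceClass H} {y₀ : Fin n → TraceClass H} (hy : Tendsto y (𝓝 0) (𝓝 y₀)) :
    ∃ A : ℝ, ∀ᶠ t in 𝓝 0, ∀ φ : Ω → ℝ, Measurable φ → (∀ ω, |φ ω| ≤ 1) → |ext law φ (y t)| ≤ A := by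
  have h1 : Tendsto (fun t => 2 ^ n * 1 * ∏ k, ‖y t k‖) (𝓝 0)
      (𝓝 (2 ^ n * 1 * ∏ k, ‖y₀ k‖)) :=
    (tendsto_finsetProd _ fun k _ => ((tendsto_pi_nhds.1 hy k).norm)).const_mul _
  refine ⟨2 ^ n * 1 * ∏ k, ‖y₀ k‖ + 1, ?_⟩
  filter_upwards [h1.eventually_le_const (lt_add_one _)] with t ht φ hφ hb
  exact (h.abs_ext_le_prod hb zero_le_one _).trans ht

/-- The expectation of a locally square integrable statistic of `n` samples along a smooth curve of
states is differentiable, with the derivative given by the sum of the scores of the samples. -/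
theorem hasDerivAt_integral (h : IsProductLaw law) {ρ r : ℝ → TraceClass H} {Q X : TraceClass H}
    (hρ : ∀ᶠ t in 𝓝 0, (ρ t).IsDensity) (hX : IsTangent (ρ 0) Q X)
    {r₀ : TraceClass H} (hr : Tendsto r (𝓝 0) (𝓝 r₀))
    (hexp : ∀ t, ρ t = ρ 0 + t • X + t ^ 2 • r t) {ℓ : Fin n → Ω → ℝ}
    (hℓ : ∀ κ, IsScore (fun x => law (Function.update (fun _ => ρ 0) κ x)) (ρ 0) Q X (ℓ κ))
    {T : Ω → ℝ} (hT : Measurable T) {C : ℝ}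
    (hC : ∀ᶠ t in 𝓝 0, Integrable (fun ω => T ω ^ 2) (law fun _ => ρ t) ∧
      ∫ ω, T ω ^ 2 ∂(law fun _ => ρ t) ≤ C) :
    HasDerivAt (fun t => ∫ ω, T ω ∂law fun _ => ρ t)
      (∫ ω, T ω * ∑ κ, ℓ κ ω ∂law fun _ => ρ 0) 0 := by
  have hd0 : (ρ 0).IsDensity := hρ.self_of_nhds
  have hup : ∀ κ : Fin n, Function.update (fun _ : Fin n => ρ 0) κ (ρ 0) = fun _ => ρ 0 :=
    fun κ => Function.update_eq_self κ _
  have hℓ2 : ∀ κ, MemLp (ℓ κ) 2 (law fun _ => ρ 0) := fun κ => by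
    have := (hℓ κ).memLp; simp only [hup] at this; exact this
  have := h.isProbabilityMeasure (τ := fun _ => ρ 0) fun _ => hd0
  set x₀ : Fin n → TraceClass H := fun _ => ρ 0 with hx₀
  set e : ℝ → Fin n → TraceClass H := fun t _ => X + t • r t with he
  have he_lim : Tendsto e (𝓝 0) (𝓝 fun _ => X) := by
    refine tendsto_pi_nhds.2 fun _ => ?_
    have : Tendsto (fun t : ℝ => X + t • r t) (𝓝 0) (𝓝 (X + (0 : ℝ) • r₀)) :=
      (tendsto_id.smul hr).const_add X
    simpa using this
  have y1_lim : ∀ κ, Tendsto (fun t => Function.update x₀ κ (r t)) (𝓝 0)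
      (𝓝 (Function.update x₀ κ r₀)) := fun κ => tendsto_const_nhds.update κ hr
  have y2_lim : ∀ s : Finset (Fin n), Tendsto (fun t => s.piecewise (e t) x₀) (𝓝 0)
      (𝓝 (s.piecewise (fun _ => X) x₀)) := fun s => by
    refine tendsto_pi_nhds.2 fun k => ?_
    by_cases hk : k ∈ s
    · simp only [Finset.piecewise_eq_of_mem _ _ _ hk]; exact tendsto_pi_nhds.1 he_lim k
    · simp only [Finset.piecewise_eq_of_notMem _ _ _ hk]; exact tendsto_const_nhds
  set W : ℝ → (Ω → ℝ) → ℝ := fun t φ => ∑ κ, ext law φ (Function.update x₀ κ (r t))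
    + ∑ s : Finset (Fin n) with 2 ≤ s.card, t ^ (s.card - 2) * ext law φ (s.piecewise (e t) x₀)
    with hW
  refine hasDerivAt_integral_of_quadratic (P := fun t => law fun _ => ρ t) (W := W) ?_
    (memLp_finsetSum _ fun κ _ => hℓ2 κ) hT hC ?_ ?_ ?_
  · filter_upwards [hρ] with t ht
    exact h.isFiniteMeasure fun _ => ht.1
  · filter_upwards [hρ] with t ht φ hφ hb
    obtain ⟨Φ, hΦ⟩ := h.exists_multilinear hφ hb
    have e0 : (fun _ : Fin n => ρ t) = x₀ + t • e t := by
      funext k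
      simp only [he, hx₀, Pi.add_apply, Pi.smul_apply, smul_add, smul_smul, ← sq]
      rw [← add_assoc]; exact hexp t
    have e1 : ∫ ω, φ ω ∂law (fun _ => ρ t) = Φ (x₀ + t • e t) := by
      rw [hΦ, ← e0, h.ext_of_isPos hφ hb fun _ => ht.1]
    have e2 : ∫ ω, φ ω ∂law (fun _ => ρ 0) = Φ x₀ := by
      rw [hΦ, h.ext_of_isPos hφ hb fun _ => hd0.1]
    have e3 : ∀ κ, Φ (Function.update x₀ κ X) = ∫ ω, φ ω * ℓ κ ω ∂law (fun _ => ρ 0) := fun κ => by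
      have := (hℓ κ).ext_eq (h.isPovm_slot (fun _ => hd0) κ) hX hφ hb
        (F := Φ.toLinearMap x₀ κ) (fun x hx => by
          rw [MultilinearMap.toLinearMap_apply, hΦ,
            h.ext_of_isPos hφ hb (isPos_update (fun _ => hd0.1) κ hx)])
      rw [Function.update_eq_self κ (fun _ => ρ 0)] at this
      exact this
    have e4 : Φ.linearDeriv x₀ (t • e t)
        = t * ∫ ω, φ ω * ∑ κ, ℓ κ ω ∂law (fun _ => ρ 0)
          + t ^ 2 * ∑ κ, ext law φ (Function.update x₀ κ (r t)) := by
      rw [MultilinearMap.linearDeriv_apply]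
      have : ∀ ω, φ ω * ∑ κ, ℓ κ ω = ∑ κ, φ ω * ℓ κ ω := fun ω => Finset.mul_sum _ _ _
      simp_rw [this]
      rw [integral_finsetSum _ fun κ _ => ((hℓ2 κ).integrable one_le_two).bdd_mul (c := 1)
        hφ.aestronglyMeasurable (Eventually.of_forall hb), Finset.mul_sum, Finset.mul_sum,
        ← Finset.sum_add_distrib]
      refine Finset.sum_congr rfl fun κ _ => ?_
      have : (t • e t) κ = t • X + t ^ 2 • r t := by
        simp only [he, Pi.smul_apply, smul_add, smul_smul, ← sq]
      rw [this, Φ.map_update_add, Φ.map_update_smul, Φ.map_update_smul, e3, hΦ, smul_eq_mul,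
        smul_eq_mul]
    have e5 : ∀ s : Finset (Fin n), 2 ≤ s.card → Φ (s.piecewise (t • e t) x₀)
        = t ^ 2 * (t ^ (s.card - 2) * ext law φ (s.piecewise (e t) x₀)) := fun s hs => by
      have : s.piecewise (t • e t) x₀
          = fun k => (s.piecewise (fun _ => t) (fun _ => (1 : ℝ)) k) • s.piecewise (e t) x₀ k := by
        funext k
        by_cases hk : k ∈ s <;> simp [hk]
      rw [this, Φ.map_smul_univ, hΦ, ← mul_assoc, ← pow_add, Nat.add_sub_cancel' hs,
        Finset.prod_piecewise]
      simp
    rw [e1, e2, Φ.map_add_eq_map_add_linearDeriv_add, e4, hW,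
      Finset.sum_congr rfl fun s hs => e5 s (Finset.mem_filter.1 hs).2, ← Finset.mul_sum]
    ring
  · choose A1 hA1 using fun κ => h.bounded_ext (y1_lim κ)
    choose A2 hA2 using fun s => h.bounded_ext (y2_lim s)
    refine ⟨∑ κ, A1 κ + ∑ s : Finset (Fin n) with 2 ≤ s.card, A2 s, ?_⟩
    have h1 : ∀ᶠ t : ℝ in 𝓝 0, |t| ≤ 1 := by
      have : Tendsto (fun t : ℝ => |t|) (𝓝 0) (𝓝 0) := by
        simpa using (continuous_abs (G := ℝ)).tendsto 0
      exact this.eventually_le_const one_pos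
    filter_upwards [eventually_all.2 hA1, eventually_all.2 hA2, h1] with t a b ht φ hφ hb
    refine (abs_add_le _ _).trans (add_le_add ?_ ?_)
    · exact (Finset.abs_sum_le_sum_abs _ _).trans (Finset.sum_le_sum fun κ _ => a κ φ hφ hb)
    · refine (Finset.abs_sum_le_sum_abs _ _).trans (Finset.sum_le_sum fun s _ => ?_)
      rw [abs_mul, abs_pow]
      calc |t| ^ (s.card - 2) * |ext law φ (s.piecewise (e t) x₀)| ≤ 1 * A2 s :=
            mul_le_mul (pow_le_one₀ (abs_nonneg _) ht) (b s φ hφ hb) (abs_nonneg _) zero_le_one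
        _ = A2 s := one_mul _
  · exact (UniformTail.sum _ fun κ _ => h.uniformTail_ext hT (y1_lim κ)).add
      (UniformTail.sum _ fun s _ => (h.uniformTail_ext hT (y2_lim s)).pow_mul _)

end IsProductLaw

end

/-! ### Smooth curves of states -/

section

/-- The second order Taylor expansion of a vector-valued function, under differentiability of the
derivative at the base point alone. -/
theorem exists_taylor_two {E : Type*} [NormedAddCommGroup E] [NormedSpace ℝ E] {f f' : ℝ → E}
    {f'' : E} (hf : ∀ᶠ t in 𝓝 0, HasDerivAt f (f' t) t) (hf' : HasDerivAt f' f'' 0) :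
    ∃ (r : ℝ → E) (r₀ : E), Tendsto r (𝓝 0) (𝓝 r₀) ∧
      ∀ t, f t = f 0 + t • f' 0 + t ^ 2 • r t := by
  set g : ℝ → E := fun t => f t - f 0 - t • f' 0 with hg
  refine ⟨fun t => if t = 0 then (2⁻¹ : ℝ) • f'' else (t ^ 2)⁻¹ • g t, (2⁻¹ : ℝ) • f'', ?_, ?_⟩
  · rw [Metric.tendsto_nhds_nhds]
    intro ε hε
    have h1 : ∀ᶠ t in 𝓝 (0 : ℝ), ‖f' t - f' 0 - (t - 0) • f''‖ ≤ ε / 2 * ‖t - 0‖ :=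
      (hasDerivAt_iff_isLittleO.1 hf').bound (by positivity)
    obtain ⟨δ, hδ, hb⟩ := Metric.eventually_nhds_iff_ball.1 (hf.and h1)
    refine ⟨δ, hδ, fun t ht => ?_⟩
    split_ifs with h0
    · simpa using hε
    have hder : ∀ s ∈ Set.uIcc 0 t, HasDerivWithinAt (fun s => g s - (s ^ 2 * 2⁻¹) • f'')
        (f' s - f' 0 - s • f'') (Set.uIcc 0 t) s := fun s hs => by
      have hs' : s ∈ Metric.ball (0 : ℝ) δ := by
        have : dist s 0 ≤ dist t 0 := by
          simpa [Real.dist_eq] using Set.abs_sub_left_of_mem_uIcc hs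
        exact this.trans_lt ht
      have a := (hb s hs').1
      have b : HasDerivAt (fun s : ℝ => s ^ 2 * 2⁻¹) s s := by
        have := (hasDerivAt_pow 2 s).mul_const (2⁻¹ : ℝ)
        exact this.congr_deriv (by norm_num; ring)
      have c := (((a.sub_const (f 0)).sub ((hasDerivAt_id s).smul_const (f' 0))).sub
        (b.smul_const f'')).hasDerivWithinAt (s := Set.uIcc 0 t)
      exact c.congr_deriv (by simp)
    have hbd : ∀ s ∈ Set.uIcc 0 t, ‖f' s - f' 0 - s • f''‖ ≤ ε / 2 * |t| := fun s hs => by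
      have hle : |s| ≤ |t| := by simpa using Set.abs_sub_left_of_mem_uIcc hs
      have hs' : s ∈ Metric.ball (0 : ℝ) δ := by
        have : dist s 0 ≤ dist t 0 := by simpa [Real.dist_eq] using hle
        exact this.trans_lt ht
      have := (hb s hs').2
      simp only [sub_zero, Real.norm_eq_abs] at this
      exact this.trans (by gcongr)
    have hmv := (convex_uIcc (0 : ℝ) t).norm_image_sub_le_of_norm_hasDerivWithin_le hder hbd
      Set.left_mem_uIcc Set.right_mem_uIcc
    have e0 : g 0 = 0 := by simp [hg]
    simp only [e0, ne_eq, OfNat.ofNat_ne_zero, not_false_eq_true, zero_pow, zero_mul, zero_smul,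
      sub_zero, Real.norm_eq_abs] at hmv
    have e1 : (t ^ 2)⁻¹ • g t - (2⁻¹ : ℝ) • f'' = (t ^ 2)⁻¹ • (g t - (t ^ 2 * 2⁻¹) • f'') := by
      rw [smul_sub (t ^ 2)⁻¹ (g t), smul_smul, ← mul_assoc, inv_mul_cancel₀ (by positivity), one_mul]
    rw [dist_eq_norm, e1, norm_smul, norm_inv, Real.norm_eq_abs, abs_of_nonneg (sq_nonneg t)]
    have ht2 : 0 < t ^ 2 := by positivity
    rw [inv_mul_lt_iff₀ ht2]
    refine hmv.trans_lt ?_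
    rw [mul_assoc, abs_mul_abs_self, ← sq]
    nlinarith
  · intro t
    rcases eq_or_ne t 0 with rfl | h0
    · simp
    · simp only [h0, if_false]
      rw [smul_smul, mul_inv_cancel₀ (by positivity), one_smul, hg]
      simp

/-- A curve of density operators that is twice differentiable at `0` with the derivative `X`, and a
positive trace class operator `Q` that plays the role of `L ρ L`, for the symmetric logarithmic
derivative `L` at `0`. -/
structure IsCurve (ρ : ℝ → TraceClass H) (Q X : TraceClass H) : Prop where
  density : ∀ᶠ t in 𝓝 0, (ρ t).IsDensity
  tangent : IsTangent (ρ 0) Q X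
  expansion : ∃ (r : ℝ → TraceClass H) (r₀ : TraceClass H), Tendsto r (𝓝 0) (𝓝 r₀) ∧
    ∀ t, ρ t = ρ 0 + t • X + t ^ 2 • r t

namespace IsCurve

variable {ρ : ℝ → TraceClass H} {Q X : TraceClass H}

theorem hasDerivAt (h : IsCurve ρ Q X) : HasDerivAt ρ X 0 := by
  obtain ⟨r, r₀, hr, he⟩ := h.expansion
  rw [hasDerivAt_iff_tendsto_slope_zero]
  have h1 : Tendsto (fun t : ℝ => X + t • r t) (𝓝[≠] 0) (𝓝 X) := by
    have : Tendsto (fun t : ℝ => X + t • r t) (𝓝 0) (𝓝 (X + (0 : ℝ) • r₀)) :=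
      (tendsto_id.smul hr).const_add X
    simpa using this.mono_left nhdsWithin_le_nhds
  refine h1.congr' ?_
  filter_upwards [self_mem_nhdsWithin] with t ht
  have ht : t ≠ 0 := ht
  rw [zero_add, he t, add_assoc, add_sub_cancel_left, smul_add, smul_smul, smul_smul,
    inv_mul_cancel₀ ht, one_smul, sq, ← mul_assoc, inv_mul_cancel₀ ht, one_mul]

theorem tr_re_eq_zero (h : IsCurve ρ Q X) : X.tr.re = 0 := by
  have h1 : HasDerivAt (fun t => (traceCLM H).restrictScalars ℝ (ρ t))
      ((traceCLM H).restrictScalars ℝ X) 0 :=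
    ((traceCLM H).restrictScalars ℝ).hasFDerivAt.comp_hasDerivAt (0 : ℝ) h.hasDerivAt
  have h2 : HasDerivAt (fun t => (traceCLM H).restrictScalars ℝ (ρ t)) 0 0 := by
    refine (hasDerivAt_const (0 : ℝ) (1 : ℂ)).congr_of_eventuallyEq ?_
    filter_upwards [h.density] with t ht using ht.2
  have h3 : X.tr = 0 := h1.unique h2
  rw [h3, Complex.zero_re]

end IsCurve

/-- With `K = L √σ` and `Q = K K*` the operator `Q + 2 t D + t² σ` is `(K + t √σ) (K + t √σ)*`. -/
theorem HasLogDerivative.exists_isTangent {σ D : TraceClass H} (hσ : σ.IsPos)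
    (h : HasLogDerivative σ D) : ∃ Q, IsTangent σ Q D := by
  obtain ⟨L, -, -, K, -, hK, hD⟩ := h
  refine ⟨ofSq K hK, hσ, fun t => ?_⟩
  set S := CFC.sqrt σ.op
  have hS : star S = S := (CFC.sqrt_nonneg _).isSelfAdjoint
  have hSS : S * S = σ.op := CFC.sqrt_mul_sqrt_self _ hσ
  have e : (ofSq K hK + (2 * t) • D + t ^ 2 • σ).op = (K + t • S) * star (K + t • S) := by
    rw [map_add, map_add, real_smul_op, real_smul_op, hD, ← hSS]
    change K * star K + (2 * t) • ((2⁻¹ : ℂ) • (K * S + S * star K)) + t ^ 2 • (S * S) = _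
    rw [star_add, star_smul, hS, star_trivial t, ← Complex.coe_smul (2 * t), smul_smul]
    have : ((2 * t : ℝ) : ℂ) * 2⁻¹ = (t : ℂ) := by push_cast; ring
    rw [this, Complex.coe_smul]
    simp only [add_mul, mul_add, smul_mul_assoc, mul_smul_comm, smul_add, smul_smul, sq]
    abel
  rw [IsPos, e]
  exact mul_star_nonneg _

theorem SmoothModel.exists_isCurve {m : ℕ} {Θ : Set (Param m)} {ρ : Param m → TraceClass H} {a₁ : ℝ}
    (h : SmoothModel Θ ρ a₁) (hΘ : IsOpen Θ) (hρ : ∀ θ ∈ Θ, (ρ θ).IsDensity)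
    (hlog : ∀ θ ∈ Θ, ∀ i, HasLogDerivative (ρ θ) (pderiv i ρ θ)) {θ : Param m} (hθ : θ ∈ Θ)
    (i : Fin m) : ∃ Q, IsCurve (fun t => ρ (θ + t • coordVec i)) Q (pderiv i ρ θ) := by
  obtain ⟨Q, hQ⟩ := (hlog θ hθ i).exists_isTangent (hρ θ hθ).1
  have hmem : ∀ᶠ t : ℝ in 𝓝 0, θ + t • coordVec i ∈ Θ := by
    have : Tendsto (fun t : ℝ => θ + t • coordVec i) (𝓝 0) (𝓝 (θ + (0 : ℝ) • coordVec i)) :=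
      Continuous.tendsto (by fun_prop) 0
    rw [zero_smul, add_zero] at this
    exact this.eventually (hΘ.mem_nhds hθ)
  refine ⟨Q, ?_, ?_, ?_⟩
  · filter_upwards [hmem] with t ht using hρ _ ht
  · simpa using hQ
  · have h1 : ∀ᶠ t : ℝ in 𝓝 0, HasDerivAt (fun t => ρ (θ + t • coordVec i))
        (pderiv i ρ (θ + t • coordVec i)) t := by
      filter_upwards [hmem] with t ht
      have := (h.differentiable _ ht i).hasLineDerivAt
      rw [HasLineDerivAt] at this
      have h2 : HasDerivAt (fun s : ℝ => s - t) 1 t := (hasDerivAt_id t).sub_const t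
      have h3 := HasDerivAt.scomp t (by simpa using this) h2
      rw [one_smul] at h3
      refine h3.congr_of_eventuallyEq (Eventually.of_forall fun s => ?_)
      change ρ (θ + s • coordVec i) = ρ (θ + t • coordVec i + (s - t) • coordVec i)
      rw [add_assoc, ← add_smul, add_sub_cancel]
    have h2 : HasDerivAt (fun t : ℝ => pderiv i ρ (θ + t • coordVec i))
        (pderiv i (pderiv i ρ) θ) 0 := (h.differentiable₂ θ hθ i i).hasLineDerivAt
    obtain ⟨r, r₀, hr, he⟩ := exists_taylor_two h1 h2
    refine ⟨r, r₀, hr, fun t => ?_⟩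
    have := he t
    simpa using this

namespace IsProductLaw

variable {n : ℕ} {law : (Fin n → TraceClass H) → Measure Ω}

theorem hasDerivAt_of_isCurve (h : IsProductLaw law) {ρ : ℝ → TraceClass H} {Q X : TraceClass H}
    (hc : IsCurve ρ Q X) {ℓ : Fin n → Ω → ℝ}
    (hℓ : ∀ κ, IsScore (fun x => law (Function.update (fun _ => ρ 0) κ x)) (ρ 0) Q X (ℓ κ))
    {T : Ω → ℝ} (hT : Measurable T) {C : ℝ}
    (hC : ∀ᶠ t in 𝓝 0, Integrable (fun ω => T ω ^ 2) (law fun _ => ρ t) ∧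
      ∫ ω, T ω ^ 2 ∂(law fun _ => ρ t) ≤ C) :
    HasDerivAt (fun t => ∫ ω, T ω ∂law fun _ => ρ t)
      (∫ ω, T ω * ∑ κ, ℓ κ ω ∂law fun _ => ρ 0) 0 := by
  obtain ⟨r, r₀, hr, he⟩ := hc.expansion
  exact h.hasDerivAt_integral hc.density hc.tangent hr he hℓ hT hC

end IsProductLaw

end

/-! ### Effects, and instruments with a given law -/

section

namespace IsPovm

variable {N : TraceClass H → Measure Ω}

theorem exists_effect (hN : IsPovm N) (Δ : Set Ω) : ∃ F : TraceClass H →L[ℝ] ℝ,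
    (∀ x, x.IsPos → F x = (N x).real Δ) ∧ ∀ x, F x = (N x.posP).real Δ - (N x.negP).real Δ := by
  refine TraceClass.exists_ext (fun x => (N x).real Δ) (fun x y hx hy => ?_) 1 fun x hx => ?_
  · have := hN.isFiniteMeasure hx
    have := hN.isFiniteMeasure hy
    rw [hN.add x y hx hy, measureReal_add_apply]
  · have := hN.isFiniteMeasure hx
    rw [abs_of_nonneg measureReal_nonneg, one_mul, ← hN.real_univ hx]
    exact measureReal_mono (Set.subset_univ _)

/-- The real-linear functional `τ ↦ tr (Re τ) N(Δ)` on the trace class. -/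
def effect (hN : IsPovm N) (Δ : Set Ω) : TraceClass H →L[ℝ] ℝ := (hN.exists_effect Δ).choose

theorem effect_of_isPos (hN : IsPovm N) (Δ : Set Ω) {x : TraceClass H} (hx : x.IsPos) :
    hN.effect Δ x = (N x).real Δ := (hN.exists_effect Δ).choose_spec.1 x hx

theorem effect_eq (hN : IsPovm N) (Δ : Set Ω) (x : TraceClass H) :
    hN.effect Δ x = (N x.posP).real Δ - (N x.negP).real Δ := (hN.exists_effect Δ).choose_spec.2 x

theorem effect_I_smul (hN : IsPovm N) (Δ : Set Ω) {x : TraceClass H} (hx : x.IsPos) :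
    hN.effect Δ (Complex.I • x) = 0 := by
  have h1 : (Complex.I • x).rePart = 0 := by
    apply op_injective
    rw [rePart, real_smul_op, map_add, op_adj, map_smul, star_smul, hx.isSelfAdjoint.star_eq,
      Complex.star_def, Complex.conj_I, neg_smul, add_neg_cancel, smul_zero, map_zero]
  rw [hN.effect_eq]
  simp only [posP, negP, h1, add_zero, sub_zero, sub_self]

/-- The complex-linear functional `τ ↦ tr τ N(Δ)` on the trace class. -/
def cEffect (hN : IsPovm N) (Δ : Set Ω) : TraceClass H →ₗ[ℂ] ℂ :=
  Module.Dual.extendRCLike (𝕜 := ℂ) (hN.effect Δ).toLinearMap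

theorem cEffect_apply (hN : IsPovm N) (Δ : Set Ω) (x : TraceClass H) : hN.cEffect Δ x
    = (hN.effect Δ x : ℂ) - Complex.I * (hN.effect Δ (Complex.I • x) : ℂ) := rfl

theorem cEffect_of_isPos (hN : IsPovm N) (Δ : Set Ω) {x : TraceClass H} (hx : x.IsPos) :
    hN.cEffect Δ x = (N x).real Δ := by
  rw [cEffect_apply, effect_I_smul hN Δ hx, effect_of_isPos hN Δ hx]
  simp

theorem effect_univ (hN : IsPovm N) (x : TraceClass H) : hN.effect Set.univ x = x.tr.re := by
  rw [effect_eq, hN.real_univ (isPos_posP x), hN.real_univ (isPos_negP x), ← Complex.sub_re,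
    ← tr_sub, posP_sub_negP, rePart, tr_real_smul_re, tr_add]
  have : x.adj.tr.re = x.tr.re := by
    change (opTrace _).re = (opTrace _).re
    unfold opTrace
    rw [Complex.re_tsum x.summable_trace.of_norm, Complex.re_tsum x.adj.summable_trace.of_norm]
    congr 1; funext k
    rw [op_adj, ContinuousLinearMap.star_eq_adjoint, ContinuousLinearMap.adjoint_inner_right,
      ← inner_conj_symm, Complex.conj_re]
  rw [Complex.add_re, this]; ring

theorem cEffect_univ (hN : IsPovm N) (x : TraceClass H) : hN.cEffect Set.univ x = x.tr := by
  rw [cEffect_apply, effect_univ, effect_univ, tr_smul]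
  apply Complex.ext <;> simp

theorem hasSum_real {μ : Measure Ω} [IsFiniteMeasure μ] {Δ : ℕ → Set Ω}
    (hΔ : ∀ j, MeasurableSet (Δ j)) (hd : Pairwise fun i j => Disjoint (Δ i) (Δ j)) :
    HasSum (fun j => μ.real (Δ j)) (μ.real (⋃ j, Δ j)) := by
  have h := measure_iUnion (μ := μ) hd hΔ
  have h1 : ∑' j, μ (Δ j) ≠ ⊤ := h ▸ measure_ne_top _ _
  have := (ENNReal.summable_toReal h1).hasSum
  rw [← ENNReal.tsum_toReal_eq (fun j => measure_ne_top μ (Δ j)), ← h] at this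
  exact this

theorem hasSum_cEffect (hN : IsPovm N) {Δ : ℕ → Set Ω}
    (hΔ : ∀ j, MeasurableSet (Δ j)) (hd : Pairwise fun i j => Disjoint (Δ i) (Δ j))
    (x : TraceClass H) : HasSum (fun j => hN.cEffect (Δ j) x) (hN.cEffect (⋃ j, Δ j) x) := by
  have h1 : ∀ y, HasSum (fun j => hN.effect (Δ j) y) (hN.effect (⋃ j, Δ j) y) := fun y => by
    have := hN.isFiniteMeasure (isPos_posP y)
    have := hN.isFiniteMeasure (isPos_negP y)
    simp only [effect_eq]
    exact (hasSum_real hΔ hd).sub (hasSum_real hΔ hd)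
  simp only [cEffect_apply]
  exact (Complex.hasSum_ofReal.2 (h1 x)).sub ((Complex.hasSum_ofReal.2 (h1 _)).mul_left _)

open scoped MatrixOrder Matrix.Norms.L2Operator in
/-- Complete positivity holds since a positive block operator with blocks `A i j` and a positive
semidefinite matrix `s i j = ⟨x i, σ₀ x j⟩` have positive contractions `∑ s i j A i j`. -/
theorem isCompletelyPositive_smulRight (hN : IsPovm N) (Δ : Set Ω) {σ₀ : TraceClass H}
    (hσ₀ : σ₀.IsPos) : IsCompletelyPositive ((hN.cEffect Δ).smulRight σ₀) := by
  intro k A hA x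
  set S := CFC.sqrt σ₀.op
  have hS : star S = S := (CFC.sqrt_nonneg _).isSelfAdjoint
  have hSS : S * S = σ₀.op := CFC.sqrt_mul_sqrt_self _ hσ₀
  have hps := Matrix.posSemidef_gram (𝕜 := ℂ) fun i => S (x i)
  obtain ⟨B, hB⟩ := (CStarAlgebra.nonneg_iff_eq_star_mul_self (a := Matrix.gram ℂ fun i => S (x i))).1
    (Matrix.nonneg_iff_posSemidef.2 hps)
  have hs : ∀ i j, inner ℂ (x i) (σ₀.op (x j)) = ∑ l, starRingEnd ℂ (B l i) * B l j := fun i j => by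
    have e1 : inner ℂ (x i) (σ₀.op (x j)) = inner ℂ (S (x i)) (S (x j)) := by
      rw [← hSS]
      change inner ℂ (x i) (S (S (x j))) = _
      rw [← ContinuousLinearMap.adjoint_inner_left, ← ContinuousLinearMap.star_eq_adjoint, hS]
    have e2 := congrFun (congrFun hB i) j
    rw [Matrix.gram_apply] at e2
    rw [e1, e2, Matrix.star_eq_conjTranspose, Matrix.mul_apply]
    rfl
  have key : ∑ i, ∑ j, inner ℂ (x i) ((((hN.cEffect Δ).smulRight σ₀) (A i j)).op (x j))
      = ∑ l, hN.cEffect Δ (∑ i, ∑ j, (starRingEnd ℂ (B l i) * B l j) • A i j) := by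
    simp only [LinearMap.smulRight_apply, map_smul, smul_apply, inner_smul_right, hs, map_sum,
      Finset.mul_sum, smul_eq_mul]
    have e : ∀ i, ∑ j, ∑ l, hN.cEffect Δ (A i j) * (starRingEnd ℂ (B l i) * B l j)
        = ∑ l, ∑ j, starRingEnd ℂ (B l i) * B l j * hN.cEffect Δ (A i j) := fun i => by
      rw [Finset.sum_comm]
      exact Finset.sum_congr rfl fun l _ => Finset.sum_congr rfl fun j _ => mul_comm _ _
    simp_rw [e]
    exact Finset.sum_comm
  rw [key]
  refine Finset.sum_nonneg fun l _ => ?_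
  rw [hN.cEffect_of_isPos Δ]
  · exact_mod_cast measureReal_nonneg
  · rw [isPos_iff_inner]
    intro v
    have := hA fun i => B l i • v
    refine this.trans_eq ?_
    simp only [map_sum, map_smul, inner_smul_left, inner_smul_right, sum_apply, inner_sum,
      smul_apply]
    refine Finset.sum_congr rfl fun i _ => Finset.sum_congr rfl fun j _ => by ring

/-- The instrument that carries out the measurement `N` and then prepares the state `σ₀`. -/
def prepare (hN : IsPovm N) {σ₀ : TraceClass H} (hσ₀ : σ₀.IsDensity) : Instrument H Ω where
  toFun Δ := (hN.cEffect Δ).smulRight σ₀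
  completelyPositive Δ _ := hN.isCompletelyPositive_smulRight Δ hσ₀.1
  tracePreserving τ := by
    rw [LinearMap.smulRight_apply, tr_smul, hσ₀.2, mul_one, hN.cEffect_univ]
  sigmaAdditive Δ hΔ hd τ := (hN.hasSum_cEffect hΔ hd τ).smul_const σ₀

end IsPovm

namespace Instrument

theorem outcome_apply (M : Instrument H Ω) {τ : TraceClass H} (hτ : τ.IsPos) {Δ : Set Ω}
    (hΔ : MeasurableSet Δ) : M.outcome τ Δ = ENNReal.ofReal (M.toFun Δ τ).tr.re := by
  rw [outcome, dif_pos hτ, Measure.ofMeasurable_apply _ hΔ]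

theorem isPovm_outcome (M : Instrument H Ω) : IsPovm M.outcome where
  add x y hx hy := by
    ext Δ hΔ
    rw [Measure.add_apply, M.outcome_apply hx hΔ, M.outcome_apply hy hΔ,
      M.outcome_apply (hx.add hy) hΔ, map_add, tr_add, Complex.add_re,
      ENNReal.ofReal_add (M.isPos_toFun hΔ hx).tr_re_nonneg (M.isPos_toFun hΔ hy).tr_re_nonneg]
  mass x hx := by rw [M.outcome_apply hx MeasurableSet.univ, M.tracePreserving]

end Instrument

theorem IsPovm.outcome_prepare {N : TraceClass H → Measure Ω} (hN : IsPovm N) {σ₀ : TraceClass H}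
    (hσ₀ : σ₀.IsDensity) {τ : TraceClass H} (hτ : τ.IsPos) :
    (hN.prepare hσ₀).outcome τ = N τ := by
  have := hN.isFiniteMeasure hτ
  ext Δ hΔ
  rw [Instrument.outcome_apply _ hτ hΔ]
  change ENNReal.ofReal (hN.cEffect Δ τ • σ₀).tr.re = _
  rw [tr_smul, hσ₀.2, mul_one, hN.cEffect_of_isPos Δ hτ, Complex.ofReal_re, ofReal_measureReal]

theorem IsPovm.map {N : TraceClass H → Measure Ω} (hN : IsPovm N) {Ω' : Type*}
    [MeasurableSpace Ω'] {f : Ω → Ω'} (hf : Measurable f) : IsPovm fun x => (N x).map f where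
  add x y hx hy := by rw [hN.add x y hx hy, Measure.map_add _ _ hf]
  mass x hx := by
    rw [Measure.map_apply hf MeasurableSet.univ, Set.preimage_univ, hN.mass x hx]

theorem IsPovm.isProductLaw {N : TraceClass H → Measure Ω} (hN : IsPovm N) :
    IsProductLaw fun τ : Fin 1 → TraceClass H => N (τ 0) where
  add τ κ x y _ hx hy := by
    rw [Subsingleton.elim κ 0]
    simpa using hN.add x y hx hy
  mass τ hτ := by simpa using hN.mass _ (hτ 0)

end

/-! ### Moments of local measurements on a single sample -/

section

variable {m : ℕ}

/-- The pairs `(B, V)` of the matrix of derivatives of the expectation and the matrix of second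
moments, both at `θ`, of the centered measurements with bounded outcomes in `ℝᵐ`. -/
def IsLocalMoment (ρ : Param m → TraceClass H) (θ : Param m) (B V : Matrix (Fin m) (Fin m) ℝ) :
    Prop :=
  ∃ N : TraceClass H → Measure (Param m), IsPovm N ∧
    (∃ K : ℝ, ∀ τ, τ.IsPos → ∀ᵐ x ∂N τ, ‖x‖ ≤ K) ∧
    (∀ i, ∫ x, x i ∂N (ρ θ) = 0) ∧
    (∀ i j, HasDerivAt (fun t : ℝ => ∫ x, x i ∂N (ρ (θ + t • coordVec j))) (B i j) 0) ∧
    ∀ i k, ∫ x, x i * x k ∂N (ρ θ) = V i k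

theorem measurable_coord (i : Fin m) : Measurable fun x : Param m => x i := by fun_prop

theorem abs_coord_le (x : Param m) (i : Fin m) : |x i| ≤ ‖x‖ := by
  simpa using PiLp.norm_apply_le x i

theorem integrable_coord {μ : Measure (Param m)} [IsFiniteMeasure μ] {K : ℝ}
    (h : ∀ᵐ x ∂μ, ‖x‖ ≤ K) (i : Fin m) : Integrable (fun x => x i) μ :=
  Integrable.of_bound (measurable_coord i).aestronglyMeasurable K (h.mono fun x hx =>
    (abs_coord_le x i).trans hx)

theorem integrable_coord_mul {μ : Measure (Param m)} [IsFiniteMeasure μ] {K : ℝ}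
    (h : ∀ᵐ x ∂μ, ‖x‖ ≤ K) (i k : Fin m) : Integrable (fun x => x i * x k) μ :=
  Integrable.of_bound ((measurable_coord i).mul (measurable_coord k)).aestronglyMeasurable (K * K)
    (h.mono fun x hx => by
      rw [Real.norm_eq_abs, abs_mul]
      exact mul_le_mul ((abs_coord_le x i).trans hx) ((abs_coord_le x k).trans hx) (abs_nonneg _)
        ((norm_nonneg x).trans hx))

namespace IsLocalMoment

variable {ρ : Param m → TraceClass H} {θ : Param m} {B V : Matrix (Fin m) (Fin m) ℝ}

theorem mul_left (hρ : ∀ j, ∀ᶠ t : ℝ in 𝓝 0, (ρ (θ + t • coordVec j)).IsPos) (hθ : (ρ θ).IsPos)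
    (h : IsLocalMoment ρ θ B V) (A : Matrix (Fin m) (Fin m) ℝ) :
    IsLocalMoment ρ θ (A * B) (A * V * A.transpose) := by
  obtain ⟨N, hN, ⟨K, hK⟩, h0, hd, hV⟩ := h
  set f : Param m →L[ℝ] Param m := (Matrix.toEuclideanLin A).toContinuousLinearMap with hf
  have hfm : Measurable f := f.continuous.measurable
  have hfi : ∀ x i, f x i = ∑ a, A i a * x a := fun x i => rfl
  have hint : ∀ τ, τ.IsPos → ∀ i, ∫ x, x i ∂(N τ).map f = ∑ a, A i a * ∫ x, x a ∂N τ :=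
    fun τ hτ i => by
      have := hN.isFiniteMeasure hτ
      rw [integral_map hfm.aemeasurable (measurable_coord i).aestronglyMeasurable]
      simp_rw [hfi]
      rw [integral_finsetSum _ fun a _ => (integrable_coord (hK τ hτ) a).const_mul _]
      simp_rw [integral_const_mul]
  refine ⟨fun τ => (N τ).map f, hN.map hfm, ⟨‖f‖ * K, fun τ hτ => ?_⟩, fun i => ?_, fun i j => ?_,
    fun i k => ?_⟩
  · refine (ae_map_iff hfm.aemeasurable (measurableSet_le measurable_norm measurable_const)).2 ?_
    filter_upwards [hK τ hτ] with x hx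
    exact (f.le_opNorm x).trans (by gcongr)
  · rw [hint _ hθ]; simp [h0]
  · rw [Matrix.mul_apply]
    have h1 : HasDerivAt (fun t : ℝ => ∑ a, A i a * ∫ x, x a ∂N (ρ (θ + t • coordVec j)))
        (∑ a, A i a * B a j) 0 := HasDerivAt.fun_sum fun a _ => (hd a j).const_mul _
    refine h1.congr_of_eventuallyEq ?_
    filter_upwards [hρ j] with t ht using hint _ ht i
  · have := hN.isFiniteMeasure hθ
    change ∫ x, x i * x k ∂(N (ρ θ)).map f = _
    rw [integral_map (f := fun x : Param m => x i * x k) hfm.aemeasurable (by fun_prop)]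
    have e : ∀ x : Param m, f x i * f x k = ∑ b, ∑ a, A i a * A k b * (x a * x b) := fun x => by
      rw [hfi, hfi, Finset.sum_mul_sum, Finset.sum_comm]
      exact Finset.sum_congr rfl fun b _ => Finset.sum_congr rfl fun a _ => by ring
    simp_rw [e]
    have hi : ∀ a b, Integrable (fun x : Param m => A i a * A k b * (x a * x b)) (N (ρ θ)) :=
      fun a b => (integrable_coord_mul (hK _ hθ) a b).const_mul _
    rw [integral_finsetSum _ fun b _ => integrable_finsetSum _ fun a _ => hi a b, Matrix.mul_apply]
    refine Finset.sum_congr rfl fun b _ => ?_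
    rw [integral_finsetSum _ fun a _ => hi a b, Matrix.mul_apply, Finset.sum_mul]
    refine Finset.sum_congr rfl fun a _ => ?_
    rw [integral_const_mul, hV, Matrix.transpose_apply]; ring

/-- Performing one of several measurements at random, with the outcome divided by the probability
with which the measurement was selected. -/
theorem mixture (hρ : ∀ j, ∀ᶠ t : ℝ in 𝓝 0, (ρ (θ + t • coordVec j)).IsPos) (hθ : (ρ θ).IsPos)
    {ι : Type*} [Fintype ι] {w : ι → ℝ} (hw : ∀ a, 0 < w a) (hw1 : ∑ a, w a = 1)
    {B V : ι → Matrix (Fin m) (Fin m) ℝ} (h : ∀ a, IsLocalMoment ρ θ (B a) (V a)) :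
    IsLocalMoment ρ θ (∑ a, B a) (∑ a, (w a)⁻¹ • V a) := by
  choose N hN hb h0 hd hV using h
  choose K hK using hb
  have hfm : ∀ a, Measurable fun x : Param m => (w a)⁻¹ • x := fun a => by fun_prop
  set N' : TraceClass H → Measure (Param m) := fun τ =>
    ∑ a, ENNReal.ofReal (w a) • (N a τ).map fun x => (w a)⁻¹ • x with hN'
  have hint : ∀ (τ) (φ : Param m → ℝ), Measurable φ →
      (∀ a, Integrable (fun x => φ ((w a)⁻¹ • x)) (N a τ)) →
      ∫ x, φ x ∂N' τ = ∑ a, w a * ∫ x, φ ((w a)⁻¹ • x) ∂N a τ := fun τ φ hφ hi => by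
    rw [hN', integral_finsetSum_measure fun a _ => by
      refine Integrable.smul_measure ?_ ENNReal.ofReal_ne_top
      exact (integrable_map_measure hφ.aestronglyMeasurable (hfm a).aemeasurable).2 (hi a)]
    refine Finset.sum_congr rfl fun a _ => ?_
    rw [integral_smul_measure, integral_map (hfm a).aemeasurable hφ.aestronglyMeasurable,
      ENNReal.toReal_ofReal (hw a).le, smul_eq_mul]
  have hint1 : ∀ τ, τ.IsPos → ∀ i, ∫ x, x i ∂N' τ = ∑ a, ∫ x, x i ∂N a τ := fun τ hτ i => by
    rw [hint τ (fun x => x i) (measurable_coord i) fun a => by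
      have := (hN a).isFiniteMeasure hτ
      simpa using (integrable_coord (hK a τ hτ) i).const_mul (w a)⁻¹]
    refine Finset.sum_congr rfl fun a _ => ?_
    simp only [PiLp.smul_apply, smul_eq_mul]
    rw [integral_const_mul, mul_inv_cancel_left₀ (hw a).ne']
  refine ⟨N', ⟨fun x y hx hy => ?_, fun x hx => ?_⟩, ⟨∑ a, (w a)⁻¹ * |K a|, fun τ hτ => ?_⟩,
    fun i => ?_, fun i j => ?_, fun i k => ?_⟩
  · rw [hN', ← Finset.sum_add_distrib]
    refine Finset.sum_congr rfl fun a _ => ?_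
    rw [(hN a).add x y hx hy, Measure.map_add _ _ (hfm a), smul_add]
  · rw [hN', Measure.finsetSum_apply]
    have : ∀ a, (ENNReal.ofReal (w a) • (N a x).map fun x => (w a)⁻¹ • x) Set.univ
        = ENNReal.ofReal (w a) * ENNReal.ofReal x.tr.re := fun a => by
      rw [Measure.smul_apply, Measure.map_apply (hfm a) MeasurableSet.univ, Set.preimage_univ,
        (hN a).mass x hx, smul_eq_mul]
    simp_rw [this]
    rw [← Finset.sum_mul, ← ENNReal.ofReal_sum_of_nonneg fun a _ => (hw a).le, hw1]
    simp
  · rw [ae_iff, hN', Measure.finsetSum_apply, Finset.sum_eq_zero]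
    intro a _
    have hs : MeasurableSet {x : Param m | ¬ ‖x‖ ≤ ∑ a, (w a)⁻¹ * |K a|} :=
      (measurableSet_le measurable_norm measurable_const).compl
    rw [Measure.smul_apply, Measure.map_apply (hfm a) hs, smul_eq_mul]
    have h1 : ∀ᵐ x ∂N a τ, ‖(w a)⁻¹ • x‖ ≤ ∑ a, (w a)⁻¹ * |K a| := by
      filter_upwards [hK a τ hτ] with x hx
      have hp : ∀ b ∈ Finset.univ, 0 ≤ (w b)⁻¹ * |K b| := fun b _ =>
        mul_nonneg (inv_nonneg.2 (hw b).le) (abs_nonneg _)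
      refine le_trans ?_ (Finset.single_le_sum hp (Finset.mem_univ a))
      rw [norm_smul, Real.norm_of_nonneg (inv_nonneg.2 (hw a).le)]
      exact mul_le_mul_of_nonneg_left (hx.trans (le_abs_self _)) (inv_nonneg.2 (hw a).le)
    exact mul_eq_zero_of_right _ (ae_iff.1 h1)
  · rw [hint1 _ hθ]; simp [h0]
  · rw [Matrix.sum_apply]
    refine (HasDerivAt.fun_sum fun a _ => hd a i j).congr_of_eventuallyEq ?_
    filter_upwards [hρ j] with t ht using hint1 _ ht i
  · have hi : ∀ a, Integrable (fun x : Param m => x i * x k) (N a (ρ θ)) := fun a => by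
      have := (hN a).isFiniteMeasure hθ
      exact integrable_coord_mul (hK a _ hθ) i k
    have e : ∀ a, (fun x : Param m => ((w a)⁻¹ • x) i * ((w a)⁻¹ • x) k)
        = fun x => (w a)⁻¹ * (w a)⁻¹ * (x i * x k) := fun a => by
      funext x; simp only [PiLp.smul_apply, smul_eq_mul]; ring
    rw [hint _ (fun x => x i * x k) ((measurable_coord i).mul (measurable_coord k)) fun a => by
      rw [e]; exact (hi a).const_mul _, Matrix.sum_apply]
    refine Finset.sum_congr rfl fun a _ => ?_
    rw [e, integral_const_mul, hV, Matrix.smul_apply, smul_eq_mul, mul_assoc,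
      mul_inv_cancel_left₀ (hw a).ne']

/-- A bounded centered measurement with the derivative `1` of the expectation gives a locally
unbiased estimator of finite diameter. -/
theorem singleSampleBound_le (hρ : ∀ j, ∀ᶠ t : ℝ in 𝓝 0, (ρ (θ + t • coordVec j)).IsDensity)
    (hθ : (ρ θ).IsDensity) (h : IsLocalMoment ρ θ 1 V) (G : Matrix (Fin m) (Fin m) ℝ) :
    singleSampleBound (fun _ e => e.BoundedRange) ρ G θ ≤ ((G * V).trace : ℝ) := by
  obtain ⟨N, hN, ⟨K, hK⟩, h0, hd, hV⟩ := h
  set f : Param m → Fin m → ℝ := fun x => x.ofLp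
  have hf : Measurable f := by fun_prop
  set c : (Fin m → ℝ) → Param m := fun y =>
    if ‖(WithLp.toLp 2 y : Param m)‖ ≤ K then WithLp.toLp 2 y else 0 with hc
  have hcm : Measurable c := by
    refine Measurable.ite (measurableSet_le ?_ measurable_const) ?_ measurable_const <;> fun_prop
  have hcf : ∀ τ, τ.IsPos → ∀ᵐ x ∂N τ, c (f x) = x := fun τ hτ => by
    filter_upwards [hK τ hτ] with x hx
    simp [hc, f, hx]
  set M : Instrument H (Fin m → ℝ) := (hN.map hf).prepare hθ
  have hM : ∀ τ, τ.IsPos → M.outcome τ = (N τ).map f := fun τ hτ =>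
    (hN.map hf).outcome_prepare hθ hτ
  set T : (Fin m → ℝ) → Param m := fun y => θ + c y
  have hT : Measurable T := hcm.const_add θ
  have hmean : ∀ θ', (ρ θ').IsDensity → ∀ i, (M.singleEstimator T hT).mean ρ θ' i
      = θ i + ∫ x, x i ∂N (ρ θ') := fun θ' hθ' i => by
    have := hN.isFiniteMeasure hθ'.1
    have hp : IsProbabilityMeasure (N (ρ θ')) := hN.isProbabilityMeasure hθ'
    change ∫ y, T y i ∂M.outcome (ρ θ') = _
    rw [hM _ hθ'.1, integral_map hf.aemeasurable (by fun_prop)]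
    have e : ∀ᵐ x ∂N (ρ θ'), T (f x) i = θ i + x i := by
      filter_upwards [hcf _ hθ'.1] with x hx
      simp [T, hx]
    rw [integral_congr_ae e, integral_add (integrable_const _) (integrable_coord (hK _ hθ'.1) i)]
    simp
  have hmean0 : ∀ i, (M.singleEstimator T hT).mean ρ θ i = θ i := fun i => by
    rw [hmean θ hθ, h0, add_zero]
  refine iInf_le_of_le m (iInf_le_of_le M (iInf_le_of_le T (iInf_le_of_le hT
    (iInf_le_of_le ⟨hmean0, fun i j => ?_⟩ (iInf_le_of_le ?_ (le_of_eq ?_))))))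
  · refine ((hd i j).const_add (θ i)).congr_of_eventuallyEq ?_
    filter_upwards [hρ j] with t ht using hmean _ ht i
  · refine ⟨|K| + |K|, fun ω ω' => ?_⟩
    have hcb : ∀ y, ‖c y‖ ≤ |K| := fun y => by
      simp only [hc]; split_ifs with h
      · exact h.trans (le_abs_self _)
      · simp
    change ‖θ + c ω - (θ + c ω')‖ ≤ _
    rw [add_sub_add_left_eq_sub]
    exact (norm_sub_le _ _).trans (add_le_add (hcb _) (hcb _))
  · have : (M.singleEstimator T hT).cov ρ θ = V := by
      ext i k
      rw [Estimator.cov, Matrix.of_apply, hmean0, hmean0, ← hV i k]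
      change ∫ y, (T y i - θ i) * (T y k - θ k) ∂M.outcome (ρ θ) = _
      rw [hM _ hθ.1, integral_map hf.aemeasurable (by fun_prop)]
      refine integral_congr_ae ?_
      filter_upwards [hcf _ hθ.1] with x hx
      simp [T, hx]
    rw [this]

end IsLocalMoment

end

/-! ### Approximation by bounded statistics -/

section

variable {m : ℕ}

theorem IsScore.hasDerivAt_of_isCurve {N : TraceClass H → Measure Ω} (hN : IsPovm N)
    {ρ : ℝ → TraceClass H} {σ Q X : TraceClass H} {ℓ : Ω → ℝ} (hc : IsCurve ρ Q X) (hσ : ρ 0 = σ)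
    (hs : IsScore N σ Q X ℓ) {φ : Ω → ℝ} (hφ : Measurable φ) {c : ℝ} (hb : ∀ ω, |φ ω| ≤ c) :
    HasDerivAt (fun t => ∫ ω, φ ω ∂N (ρ t)) (∫ ω, φ ω * ℓ ω ∂N σ) 0 := by
  subst hσ
  exact hs.hasDerivAt hN hc.tangent hc.hasDerivAt (hc.density.mono fun t ht => ht.1) hφ hb

theorem exists_norm_toLp_le (m : ℕ) : ∃ C : ℝ, 0 ≤ C ∧ ∀ y : Fin m → ℝ,
    ‖(WithLp.toLp 2 y : Param m)‖ ≤ C * ‖y‖ :=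
  ⟨_, norm_nonneg _, ((EuclideanSpace.equiv (Fin m) ℝ).symm : (Fin m → ℝ) →L[ℝ] Param m).le_opNorm⟩

namespace IsLocalMoment

variable {ρ : Param m → TraceClass H} {θ : Param m}

/-- Differentiation under the integral turns the derivatives of the expectation of a bounded
statistic into covariances with the scores. -/
theorem of_bounded {N : TraceClass H → Measure Ω} (hN : IsPovm N)
    {Q X : Fin m → TraceClass H}
    (hc : ∀ j, IsCurve (fun t : ℝ => ρ (θ + t • coordVec j)) (Q j) (X j)) {ℓ : Fin m → Ω → ℝ}
    (hℓ : ∀ j, IsScore N (ρ θ) (Q j) (X j) (ℓ j)) {v : Fin m → Ω → ℝ} (hv : ∀ i, Measurable (v i))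
    {K : ℝ} (hK : ∀ i ω, |v i ω| ≤ K) (h0 : ∀ i, ∫ ω, v i ω ∂N (ρ θ) = 0) :
    IsLocalMoment ρ θ (Matrix.of fun i j => ∫ ω, v i ω * ℓ j ω ∂N (ρ θ))
      (Matrix.of fun i k => ∫ ω, v i ω * v k ω ∂N (ρ θ)) := by
  set f : Ω → Param m := fun ω => WithLp.toLp 2 fun i => v i ω with hf
  have hfm : Measurable f := by
    have : Measurable fun ω => (fun i => v i ω) := measurable_pi_lambda _ hv
    fun_prop
  obtain ⟨C, hC0, hC⟩ := exists_norm_toLp_le m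
  have hint : ∀ τ (i : Fin m), ∫ x, x i ∂(N τ).map f = ∫ ω, v i ω ∂N τ := fun τ i =>
    integral_map hfm.aemeasurable (measurable_coord i).aestronglyMeasurable
  refine ⟨_, hN.map hfm, ⟨C * |K|, fun τ hτ => ?_⟩, fun i => ?_, fun i j => ?_, fun i k => ?_⟩
  · refine (ae_map_iff hfm.aemeasurable (measurableSet_le measurable_norm measurable_const)).2
      (Eventually.of_forall fun ω => (hC _).trans (mul_le_mul_of_nonneg_left ?_ hC0))
    exact (pi_norm_le_iff_of_nonneg (abs_nonneg K)).2 fun i => (hK i ω).trans (le_abs_self K)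
  · rw [hint, h0]
  · simp_rw [hint]
    exact (hℓ j).hasDerivAt_of_isCurve hN (hc j) (by simp) (hv i) (hK i)
  · exact integral_map (f := fun x : Param m => x i * x k) hfm.aemeasurable (by fun_prop)

/-- Square integrable centered statistics are approximated by bounded ones. -/
theorem exists_seq {N : TraceClass H → Measure Ω} (hN : IsPovm N) (hθ : (ρ θ).IsDensity)
    {Q X : Fin m → TraceClass H}
    (hc : ∀ j, IsCurve (fun t : ℝ => ρ (θ + t • coordVec j)) (Q j) (X j)) {ℓ : Fin m → Ω → ℝ}
    (hℓ : ∀ j, IsScore N (ρ θ) (Q j) (X j) (ℓ j)) {u : Fin m → Ω → ℝ} (hu : ∀ i, Measurable (u i))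
    (hu2 : ∀ i, MemLp (u i) 2 (N (ρ θ))) (h0 : ∀ i, ∫ ω, u i ω ∂N (ρ θ) = 0) :
    ∃ B V : ℕ → Matrix (Fin m) (Fin m) ℝ, (∀ k, IsLocalMoment ρ θ (B k) (V k)) ∧
      (∀ i j, Tendsto (fun k => B k i j) atTop (𝓝 (∫ ω, u i ω * ℓ j ω ∂N (ρ θ)))) ∧
      ∀ i j, Tendsto (fun k => V k i j) atTop (𝓝 (∫ ω, u i ω * u j ω ∂N (ρ θ))) := by
  have hp := hN.isProbabilityMeasure hθ
  set S : ℕ → Set Ω := fun k => {ω | ∀ i, |u i ω| ≤ k} with hS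
  have hSm : ∀ k, MeasurableSet (S k) := fun k => by
    have : S k = ⋂ i, {ω | |u i ω| ≤ k} := by ext; simp [hS]
    rw [this]
    exact MeasurableSet.iInter fun i => measurableSet_le (hu i).abs measurable_const
  have hlim : ∀ f : Ω → ℝ, Integrable f (N (ρ θ)) →
      Tendsto (fun k => ∫ ω, (S k).indicator f ω ∂N (ρ θ)) atTop (𝓝 (∫ ω, f ω ∂N (ρ θ))) := by
    intro f hf
    refine tendsto_integral_of_dominated_convergence (fun ω => ‖f ω‖)
      (fun k => hf.aestronglyMeasurable.indicator (hSm k)) hf.norm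
      (fun k => Eventually.of_forall fun ω => norm_indicator_le_norm_self _ _)
      (Eventually.of_forall fun ω => ?_)
    obtain ⟨k, hk⟩ := exists_nat_ge (∑ i, |u i ω|)
    refine tendsto_const_nhds.congr' ?_
    filter_upwards [eventually_ge_atTop k] with k' hk'
    rw [Set.indicator_of_mem]
    intro i
    refine (Finset.single_le_sum (fun i _ => abs_nonneg (u i ω)) (Finset.mem_univ i)).trans
      (hk.trans (by exact_mod_cast hk'))
  set c : ℕ → Fin m → ℝ := fun k i => ∫ ω, (S k).indicator (u i) ω ∂N (ρ θ) with hcdef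
  have hclim : ∀ i, Tendsto (fun k => c k i) atTop (𝓝 0) := fun i => by
    rw [← h0 i]; exact hlim _ ((hu2 i).integrable one_le_two)
  set v : ℕ → Fin m → Ω → ℝ := fun k i ω => (S k).indicator (u i) ω - c k i with hv
  have hb : ∀ k i ω, |(S k).indicator (u i) ω| ≤ k := fun k i ω => by
    by_cases h : ω ∈ S k
    · rw [Set.indicator_of_mem h]; exact h i
    · rw [Set.indicator_of_notMem h]; simp
  have hm : ∀ k i, Measurable ((S k).indicator (u i)) := fun k i => (hu i).indicator (hSm k)
  have hi : ∀ k i, Integrable ((S k).indicator (u i)) (N (ρ θ)) := fun k i =>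
    integrable_of_abs_le (hm k i) (hb k i)
  have hℓi : ∀ j, Integrable (ℓ j) (N (ρ θ)) := fun j => (hℓ j).memLp.integrable one_le_two
  refine ⟨fun k => Matrix.of fun i j => ∫ ω, v k i ω * ℓ j ω ∂N (ρ θ),
    fun k => Matrix.of fun i j => ∫ ω, v k i ω * v k j ω ∂N (ρ θ), fun k => ?_, fun i j => ?_,
    fun i j => ?_⟩
  · refine of_bounded (K := k + ∑ i, |c k i|) hN hc hℓ (fun i => (hm k i).sub_const _)
      (fun i ω => (abs_sub _ _).trans (add_le_add (hb k i ω) ?_)) fun i => ?_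
    · exact Finset.single_le_sum (f := fun i => |c k i|) (fun i _ => abs_nonneg _)
        (Finset.mem_univ i)
    · rw [hv, integral_sub (hi k i) (integrable_const _)]
      simp [hcdef]
  · have hprod : Integrable (fun ω => u i ω * ℓ j ω) (N (ρ θ)) :=
      (hu2 i).integrable_mul (hℓ j).memLp
    have h1 := (hlim _ hprod).sub ((hclim i).mul_const (∫ ω, ℓ j ω ∂N (ρ θ)))
    rw [zero_mul, sub_zero] at h1
    refine h1.congr fun k => ?_
    change _ = ∫ ω, v k i ω * ℓ j ω ∂N (ρ θ)
    rw [← integral_const_mul, ← integral_sub (hprod.indicator (hSm k))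
      ((hℓi j).const_mul _)]
    refine integral_congr_ae (Eventually.of_forall fun ω => ?_)
    by_cases h : ω ∈ S k <;> simp [hv, h] <;> ring
  · have hprod : Integrable (fun ω => u i ω * u j ω) (N (ρ θ)) :=
      (hu2 i).integrable_mul (hu2 j)
    have h1 := (hlim _ hprod).sub ((hclim i).mul (hclim j))
    rw [zero_mul, sub_zero] at h1
    refine h1.congr fun k => ?_
    have e : ∀ ω, v k i ω * v k j ω = (S k).indicator (fun ω => u i ω * u j ω) ω
        - (c k j * (S k).indicator (u i) ω + c k i * (S k).indicator (u j) ω - c k i * c k j) := by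
      intro ω
      by_cases h : ω ∈ S k <;> simp [hv, h] <;> ring
    change _ = ∫ ω, v k i ω * v k j ω ∂N (ρ θ)
    simp_rw [e]
    have i1 := (hi k i).const_mul (c k j)
    have i2 := (hi k j).const_mul (c k i)
    have i3 : Integrable (fun ω => c k j * (S k).indicator (u i) ω
        + c k i * (S k).indicator (u j) ω) (N (ρ θ)) := i1.add i2
    have i4 : Integrable (fun ω => c k j * (S k).indicator (u i) ω
        + c k i * (S k).indicator (u j) ω - c k i * c k j) (N (ρ θ)) := i3.sub (integrable_const _)
    rw [integral_sub (hprod.indicator (hSm k)) i4, integral_sub i3 (integrable_const _),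
      integral_add i1 i2, integral_const_mul, integral_const_mul]
    simp only [integral_const, probReal_univ, smul_eq_mul, one_mul]
    change _ = _ - (c k j * c k i + c k i * c k j - _)
    ring

/-- Approximate local unbiasedness suffices in order to bound `singleSampleBound`: the bias is
corrected by a measurement that is selected with a small probability. -/
theorem singleSampleBound_le_of_approx
    (hρ : ∀ j, ∀ᶠ t : ℝ in 𝓝 0, (ρ (θ + t • coordVec j)).IsDensity)
    (hθ : (ρ θ).IsDensity) (G : Matrix (Fin m) (Fin m) ℝ) {c : ℝ}
    (h : ∀ η : ℝ, 0 < η → ∃ B V, IsLocalMoment ρ θ B V ∧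
      (∀ i j, |B i j - (1 : Matrix (Fin m) (Fin m) ℝ) i j| < η) ∧ (G * V).trace ≤ c) :
    singleSampleBound (fun _ e => e.BoundedRange) ρ G θ ≤ (c : EReal) := by
  have hpos : ∀ j, ∀ᶠ t : ℝ in 𝓝 0, (ρ (θ + t • coordVec j)).IsPos := fun j =>
    (hρ j).mono fun t ht => ht.1
  choose B V hBV hB hV using fun k : ℕ => h (1 / ((k : ℝ) + 1)) (by positivity)
  have hlim : Tendsto B atTop (𝓝 1) := by
    refine tendsto_pi_nhds.2 fun i => tendsto_pi_nhds.2 fun j => ?_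
    refine tendsto_iff_norm_sub_tendsto_zero.2 (squeeze_zero (fun _ => norm_nonneg _)
      (fun k => (hB k i j).le) tendsto_one_div_add_atTop_nhds_zero_nat)
  have hdet : ∀ᶠ k in atTop, (B k).det ≠ 0 := by
    have h1 : Tendsto (fun k => (B k).det) atTop (𝓝 (1 : Matrix (Fin m) (Fin m) ℝ).det) :=
      (continuous_id.matrix_det.tendsto _).comp hlim
    rw [Matrix.det_one] at h1
    exact h1.eventually_ne one_ne_zero
  obtain ⟨k₀, hk₀⟩ := hdet.exists
  obtain ⟨W, hW⟩ : ∃ W, IsLocalMoment ρ θ 1 W := by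
    have := (hBV k₀).mul_left hpos hθ.1 (B k₀)⁻¹
    rw [Matrix.nonsing_inv_mul _ (isUnit_iff_ne_zero.2 hk₀)] at this
    exact ⟨_, this⟩
  have key : ∀ ε : ℝ, 0 < ε → ε < 1 → ∀ k,
      singleSampleBound (fun _ e => e.BoundedRange) ρ G θ
        ≤ (((1 - ε)⁻¹ * c + ε⁻¹ * (G * ((1 - B k) * W * (1 - B k).transpose)).trace : ℝ) : EReal) :=
    fun ε h0 h1 k => by
      have h2 := mixture (ι := Bool) (w := fun b => if b then ε else 1 - ε)
        (B := fun b => if b then (1 - B k) * 1 else B k)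
        (V := fun b => if b then (1 - B k) * W * (1 - B k).transpose else V k) hpos hθ.1
        (fun b => by cases b <;> simp [h0, h1]) (by simp) fun b => by
          cases b
          · simpa using hBV k
          · simpa only [if_true] using hW.mul_left hpos hθ.1 (1 - B k)
      simp only [Fintype.sum_bool, if_true, mul_one, Bool.false_eq_true, if_false,
        sub_add_cancel] at h2
      refine (h2.singleSampleBound_le hρ hθ G).trans (EReal.coe_le_coe_iff.2 ?_)
      rw [Matrix.mul_add, Matrix.trace_add, Matrix.mul_smul, Matrix.mul_smul, Matrix.trace_smul,
        Matrix.trace_smul, smul_eq_mul, smul_eq_mul, add_comm]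
      have : 0 ≤ (1 - ε)⁻¹ := inv_nonneg.2 (by linarith)
      have := mul_le_mul_of_nonneg_left (hV k) this
      linarith
  have key2 : ∀ ε : ℝ, 0 < ε → ε < 1 →
      singleSampleBound (fun _ e => e.BoundedRange) ρ G θ ≤ (((1 - ε)⁻¹ * c : ℝ) : EReal) :=
    fun ε h0 h1 => by
      have hcont : Continuous fun A : Matrix (Fin m) (Fin m) ℝ =>
          (1 - ε)⁻¹ * c + ε⁻¹ * (G * ((1 - A) * W * (1 - A).transpose)).trace := by fun_prop
      have h2 := (hcont.tendsto 1).comp hlim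
      simp only [sub_self, zero_mul, mul_zero, Matrix.trace_zero, add_zero] at h2
      exact ge_of_tendsto ((continuous_coe_real_ereal.tendsto _).comp h2)
        (Eventually.of_forall fun k => key ε h0 h1 k)
  have h3 : Tendsto (fun ε : ℝ => (1 - ε)⁻¹ * c) (𝓝[>] 0) (𝓝 c) := by
    have : ContinuousAt (fun ε : ℝ => (1 - ε)⁻¹ * c) 0 := by
      refine ContinuousAt.mul (ContinuousAt.inv₀ (by fun_prop) (by norm_num)) continuousAt_const
    have := this.tendsto
    simp only [sub_zero, inv_one, one_mul] at this
    exact this.mono_left nhdsWithin_le_nhds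
  refine ge_of_tendsto ((continuous_coe_real_ereal.tendsto _).comp h3) ?_
  filter_upwards [Ioo_mem_nhdsGT (show (0 : ℝ) < 1 by norm_num)] with ε hε
  exact key2 ε hε.1 hε.2

end IsLocalMoment

end

/-! ### Mixtures of measures -/

section

/-- Upper integrals that add up to the total mass force measurability. -/
theorem aemeasurable_of_lintegral_add_eq {Z : Type*} [MeasurableSpace Z] {μ : Measure Z}
    [IsFiniteMeasure μ] {f g : Z → ℝ≥0∞} (h : ∀ z, f z + g z = 1)
    (hi : ∫⁻ z, f z ∂μ + ∫⁻ z, g z ∂μ = μ Set.univ) : AEMeasurable f μ := by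
  obtain ⟨f', hf', hff, hfi⟩ := exists_measurable_le_lintegral_eq μ f
  obtain ⟨g', hg', hgg, hgi⟩ := exists_measurable_le_lintegral_eq μ g
  have hle : ∀ z, f' z + g' z ≤ 1 := fun z => (add_le_add (hff z) (hgg z)).trans_eq (h z)
  have hint : ∫⁻ z, (f' z + g' z) ∂μ = μ Set.univ := by
    rw [lintegral_add_left hf', ← hfi, ← hgi, hi]
  have he : (fun z => f' z + g' z) =ᵐ[μ] fun _ => 1 := by
    refine ae_eq_of_ae_le_of_lintegral_le (Eventually.of_forall hle) ?_ aemeasurable_const ?_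
    · rw [hint]; exact measure_ne_top _ _
    · rw [hint]; simp
  refine ⟨f', hf', ?_⟩
  filter_upwards [he] with z hz
  refine le_antisymm ?_ (hff z)
  have h1 : g' z ≠ ⊤ := ((le_add_self.trans (hle z)).trans_lt ENNReal.one_lt_top).ne
  have h2 : f z + g' z ≤ f' z + g' z := by
    rw [hz, ← h z]; exact add_le_add le_rfl (hgg z)
  exact (ENNReal.add_le_add_iff_right h1).1 h2

/-- `ν` is the mixture of the probability measures `K z` with respect to `μ`. Measurability of
`z ↦ K z S` is not part of the definition; almost everywhere measurability is a consequence. -/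
def IsMixture {Z Z' : Type*} [MeasurableSpace Z] [MeasurableSpace Z'] (μ : Measure Z)
    (K : Z → Measure Z') (ν : Measure Z') : Prop :=
  (∀ z, IsProbabilityMeasure (K z)) ∧ ∀ S, MeasurableSet S → ν S = ∫⁻ z, K z S ∂μ

namespace IsMixture

variable {Z Z' : Type*} [MeasurableSpace Z] [MeasurableSpace Z'] {μ : Measure Z}
  {K : Z → Measure Z'} {ν : Measure Z'}

theorem measure_univ (h : IsMixture μ K ν) : ν Set.univ = μ Set.univ := by
  have := h.1
  rw [h.2 _ MeasurableSet.univ]; simp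

theorem isFiniteMeasure (h : IsMixture μ K ν) [IsFiniteMeasure μ] : IsFiniteMeasure ν :=
  ⟨by rw [h.measure_univ]; exact measure_lt_top _ _⟩

theorem aemeasurable (h : IsMixture μ K ν) [IsFiniteMeasure μ] {S : Set Z'}
    (hS : MeasurableSet S) : AEMeasurable (fun z => K z S) μ := by
  have := h.1
  refine aemeasurable_of_lintegral_add_eq (g := fun z => K z Sᶜ)
    (fun z => prob_add_prob_compl hS) ?_
  rw [← h.2 S hS, ← h.2 Sᶜ hS.compl, measure_add_measure_compl hS, h.measure_univ]

theorem lintegral_eq (h : IsMixture μ K ν) [IsFiniteMeasure μ] {f : Z' → ℝ≥0∞}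
    (hf : Measurable f) : AEMeasurable (fun z => ∫⁻ x, f x ∂K z) μ ∧
      ∫⁻ x, f x ∂ν = ∫⁻ z, ∫⁻ x, f x ∂K z ∂μ := by
  refine Measurable.ennreal_induction (motive := fun f => AEMeasurable (fun z => ∫⁻ x, f x ∂K z) μ ∧
      ∫⁻ x, f x ∂ν = ∫⁻ z, ∫⁻ x, f x ∂K z ∂μ) (fun c S hS => ?_) (fun f g _ hf hg ihf ihg => ?_)
      (fun f hf hmono ih => ?_) hf
  · simp_rw [lintegral_indicator_const hS]
    exact ⟨(h.aemeasurable hS).const_mul c, by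
      rw [lintegral_const_mul'' _ (h.aemeasurable hS), h.2 S hS]⟩
  · simp only [Pi.add_apply]
    simp_rw [lintegral_add_left hf]
    exact ⟨ihf.1.add ihg.1, by rw [lintegral_add_left' ihf.1, ihf.2, ihg.2]⟩
  · simp_rw [lintegral_iSup hf hmono]
    refine ⟨AEMeasurable.iSup fun n => (ih n).1, ?_⟩
    rw [lintegral_iSup' (fun n => (ih n).1) (Eventually.of_forall fun z i j hij =>
      lintegral_mono (hmono hij))]
    exact iSup_congr fun n => (ih n).2

theorem ae_of_ae (h : IsMixture μ K ν) {p : Z' → Prop} (hp : MeasurableSet {x | p x})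
    (ha : ∀ᵐ z ∂μ, ∀ᵐ x ∂K z, p x) : ∀ᵐ x ∂ν, p x := by
  rw [ae_iff]
  have h1 : {x | ¬ p x} = {x | p x}ᶜ := rfl
  rw [h1, h.2 _ hp.compl, lintegral_eq_zero_of_ae_eq_zero]
  filter_upwards [ha] with z hz
  exact ae_iff.1 hz

end IsMixture

/-- Two mixtures over `z`, one of which dominates the other: the conditional laws given `z` have a
jointly measurable density. -/
theorem exists_density_of_isMixture {Z W : Type*} [MeasurableSpace Z] [MeasurableSpace W]
    [StandardBorelSpace W] {μ : Measure Z} [IsFiniteMeasure μ] {b : Z → NNReal} (hb : Measurable b)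
    (hbi : ∫⁻ z, (b z : ℝ≥0∞) ∂μ ≠ ⊤) {K₀ K₁ : Z → Measure W} {ν₀ ν₁ : Measure (Z × W)}
    (h₀ : IsMixture μ (fun z => (K₀ z).map (Prod.mk z)) ν₀)
    (h₁ : IsMixture (μ.withDensity fun z => b z) (fun z => (K₁ z).map (Prod.mk z)) ν₁) (hν : ν₁ ≪ ν₀) :
    ∃ β : Z × W → ℝ≥0∞, Measurable β ∧
      ∀ᵐ z ∂μ, (b z : ℝ≥0∞) • K₁ z = (K₀ z).withDensity fun w => β (z, w) := by
  have hfb : IsFiniteMeasure (μ.withDensity fun z => (b z : ℝ≥0∞)) := isFiniteMeasure_withDensity hbi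
  have := h₀.isFiniteMeasure
  have := h₁.isFiniteMeasure
  have hK1 : ∀ z, IsProbabilityMeasure (K₁ z) := fun z => by
    have := h₁.1 z
    exact Measure.isProbabilityMeasure_of_map (Prod.mk z)
  set β := ν₁.rnDeriv ν₀ with hβ
  have hβm : Measurable β := Measure.measurable_rnDeriv _ _
  have hβd : ν₀.withDensity β = ν₁ := Measure.withDensity_rnDeriv_eq _ _ hν
  refine ⟨β, hβm, ?_⟩
  have key : ∀ Δ : Set W, MeasurableSet Δ →
      ∀ᵐ z ∂μ, b z * K₁ z Δ = ∫⁻ w in Δ, β (z, w) ∂K₀ z := fun Δ hΔ => by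
    have m1 : ∀ A : Set Z, MeasurableSet A → ∀ z, (K₁ z).map (Prod.mk z) (A ×ˢ Δ)
        = A.indicator (fun z => K₁ z Δ) z := fun A hA z => by
      rw [Measure.map_apply measurable_prodMk_left (hA.prod hΔ)]
      by_cases hz : z ∈ A
      · simp [hz]
      · simp [hz]
    have m2 : ∀ A : Set Z, MeasurableSet A → ∀ z,
        ∫⁻ x, (A ×ˢ Δ).indicator β x ∂(K₀ z).map (Prod.mk z)
        = A.indicator (fun z => ∫⁻ w in Δ, β (z, w) ∂K₀ z) z := fun A hA z => by
      rw [lintegral_map (hβm.indicator (hA.prod hΔ)) measurable_prodMk_left]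
      by_cases hz : z ∈ A
      · rw [Set.indicator_of_mem hz, ← lintegral_indicator hΔ]
        refine lintegral_congr fun w => ?_
        by_cases hw : w ∈ Δ <;> simp [hz, hw]
      · rw [Set.indicator_of_notMem hz]
        simp [hz]
    have a1 : AEMeasurable (fun z => b z * K₁ z Δ) μ := by
      have := h₁.aemeasurable (MeasurableSet.univ.prod hΔ)
      simp only [m1 _ MeasurableSet.univ, Set.indicator_univ] at this
      exact (aemeasurable_withDensity_ennreal_iff hb).1 this
    have a2 : AEMeasurable (fun z => ∫⁻ w in Δ, β (z, w) ∂K₀ z) μ := by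
      have := (h₀.lintegral_eq (hβm.indicator (MeasurableSet.univ.prod hΔ))).1
      simpa only [m2 _ MeasurableSet.univ, Set.indicator_univ] using this
    refine ae_eq_of_forall_setLIntegral_eq_of_sigmaFinite₀ a1 a2 fun A hA _ => ?_
    have e1 : ν₁ (A ×ˢ Δ) = ∫⁻ z in A, b z * K₁ z Δ ∂μ := by
      rw [h₁.2 _ (hA.prod hΔ), lintegral_withDensity_eq_lintegral_mul_non_measurable₀ _
        (by fun_prop) (Eventually.of_forall fun _ => ENNReal.coe_lt_top), ← lintegral_indicator hA]
      refine lintegral_congr fun z => ?_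
      rw [Pi.mul_apply, m1 A hA]
      by_cases hz : z ∈ A <;> simp [hz]
    have e2 : ν₁ (A ×ˢ Δ) = ∫⁻ z in A, ∫⁻ w in Δ, β (z, w) ∂K₀ z ∂μ := by
      rw [← hβd, withDensity_apply _ (hA.prod hΔ), ← lintegral_indicator (hA.prod hΔ),
        (h₀.lintegral_eq (hβm.indicator (hA.prod hΔ))).2, ← lintegral_indicator hA]
      exact lintegral_congr fun z => m2 A hA z
    rw [← e1, e2]
  have hfin : ∀ᵐ z ∂μ, ∫⁻ w, β (z, w) ∂K₀ z ≠ ⊤ := by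
    filter_upwards [key Set.univ MeasurableSet.univ] with z hz
    rw [setLIntegral_univ] at hz
    rw [← hz]
    exact ENNReal.mul_ne_top ENNReal.coe_ne_top (measure_ne_top _ _)
  have hemb := measurableEmbedding_embeddingReal W
  have hall : ∀ᵐ z ∂μ, ∀ q : ℚ, b z * K₁ z (embeddingReal W ⁻¹' Set.Iic (q : ℝ))
      = ∫⁻ w in embeddingReal W ⁻¹' Set.Iic (q : ℝ), β (z, w) ∂K₀ z :=
    ae_all_iff.2 fun q => key _ (hemb.measurable measurableSet_Iic)
  filter_upwards [hall, key Set.univ MeasurableSet.univ, hfin] with z hz hu hf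
  have hf1 : IsFiniteMeasure ((b z : ℝ≥0∞) • K₁ z) := ⟨by
    rw [Measure.smul_apply, smul_eq_mul]; exact ENNReal.mul_lt_top ENNReal.coe_lt_top (measure_lt_top _ _)⟩
  refine ext_of_generate_finite (C := (fun s => embeddingReal W ⁻¹' s) '' ⋃ q : ℚ, {Set.Iic (q : ℝ)})
    ?_ ?_ ?_ ?_
  · rw [← MeasurableSpace.comap_generateFrom, ← Real.borel_eq_generateFrom_Iic_rat]
    exact hemb.comap_eq.symm
  · exact Real.isPiSystem_Iic_rat.comap _
  · rintro _ ⟨s, hs, rfl⟩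
    simp only [Set.mem_iUnion, Set.mem_singleton_iff] at hs
    obtain ⟨q, rfl⟩ := hs
    rw [Measure.smul_apply, smul_eq_mul, withDensity_apply _ (hemb.measurable measurableSet_Iic)]
    exact hz q
  · rw [Measure.smul_apply, smul_eq_mul, withDensity_apply _ MeasurableSet.univ]
    exact hu

theorem setLIntegral_pi_eval {ι : Type*} [Fintype ι] [DecidableEq ι] {W : Type*}
    [MeasurableSpace W] (μ : ι → Measure W) [∀ i, IsFiniteMeasure (μ i)] (κ : ι) {f : W → ℝ≥0∞}
    (hf : Measurable f) (s : ι → Set W) :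
    ∫⁻ u : ι → W in Set.univ.pi s, f (u κ) ∂Measure.pi μ
      = (∏ j ∈ Finset.univ.erase κ, μ j (s j)) * ∫⁻ x : W in s κ, f x ∂μ κ := by
  rw [Measure.restrict_pi_pi, ← lintegral_map hf (measurable_pi_apply κ)]
  change ∫⁻ x, f x ∂(Measure.map (Function.eval κ)
    (Measure.pi fun i => (μ i).restrict (s i) : Measure (ι → W))) = _
  rw [Measure.pi_map_eval, lintegral_smul_measure, smul_eq_mul]
  simp

theorem ext_of_pi {ι : Type*} [Fintype ι] {W : Type*} [MeasurableSpace W]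
    {μ ν : Measure (ι → W)} [IsFiniteMeasure μ]
    (h : ∀ s : ι → Set W, (∀ i, MeasurableSet (s i)) → μ (Set.univ.pi s) = ν (Set.univ.pi s)) :
    μ = ν := by
  refine ext_of_generate_finite _ generateFrom_pi.symm isPiSystem_pi ?_ ?_
  · rintro _ ⟨s, hs, rfl⟩
    exact h s fun i => hs i (Set.mem_univ i)
  · simpa using h (fun _ => Set.univ) fun _ => MeasurableSet.univ

end

/-! ### Functionals that test states -/

section

/-- The functionals `s ↦ tr (A s)`, with a bounded `A`, that are nonnegative on the positive cone.
-/
structure IsTest (t : TraceClass H →L[ℂ] ℂ) : Prop where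
  rep : ∃ A : H →L[ℂ] H, ∀ s : TraceClass H, t s = opTrace (A ∘L s.op)
  nonneg : ∀ s : TraceClass H, s.IsPos → 0 ≤ (t s).re

theorem isTest_trace : IsTest (traceCLM H) :=
  ⟨⟨ContinuousLinearMap.id ℂ H, fun s => by rw [ContinuousLinearMap.id_comp]; rfl⟩,
    fun _ hs => hs.tr_re_nonneg⟩

/-- The functional `s ↦ ⟨v, s v⟩`. -/
def vecTest (v : H) : TraceClass H →L[ℂ] ℂ :=
  LinearMap.mkContinuous
    { toFun := fun s => inner ℂ v (s.op v)
      map_add' := fun s s' => by rw [map_add, add_apply, inner_add_right]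
      map_smul' := fun c s => by
        rw [map_smul, smul_apply, inner_smul_right, RingHom.id_apply, smul_eq_mul] }
    (‖v‖ * ‖v‖) fun s => by
      refine (norm_inner_le_norm _ _).trans ?_
      rw [mul_assoc]
      refine mul_le_mul_of_nonneg_left ?_ (norm_nonneg _)
      rw [mul_comm]
      exact (s.op.le_opNorm v).trans (mul_le_mul_of_nonneg_right s.norm_op_le (norm_nonneg _))

theorem vecTest_apply (v : H) (s : TraceClass H) : vecTest v s = inner ℂ v (s.op v) := rfl

theorem isTest_vecTest (v : H) : IsTest (vecTest v) := by
  refine ⟨⟨InnerProductSpace.rankOne ℂ v v, fun s => ?_⟩, fun s hs => ?_⟩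
  · rw [vecTest_apply, opTrace]
    have : ∀ k, inner ℂ (onb H k) ((InnerProductSpace.rankOne ℂ v v ∘L s.op) (onb H k))
        = inner ℂ (star s.op v) (onb H k) * inner ℂ (onb H k) v := fun k => by
      rw [ContinuousLinearMap.comp_apply, InnerProductSpace.rankOne_apply, inner_smul_right,
        ContinuousLinearMap.star_eq_adjoint, ContinuousLinearMap.adjoint_inner_left]
    simp_rw [this]
    rw [(onb H).tsum_inner_mul_inner, ContinuousLinearMap.star_eq_adjoint,
      ContinuousLinearMap.adjoint_inner_left]
  · exact (Complex.nonneg_iff.1 (isPos_iff_inner.1 hs v)).1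

/-- The value of a test functional on a positive operator. -/
def testVal (t : TraceClass H →L[ℂ] ℂ) (s : TraceClass H) : ℝ≥0∞ := ENNReal.ofReal (t s).re

theorem measurable_testVal {Z : Type*} [MeasurableSpace Z] (t : TraceClass H →L[ℂ] ℂ)
    {f : Z → TraceClass H} (hf : StronglyMeasurable f) : Measurable fun z => testVal t (f z) :=
  (Complex.measurable_re.comp (t.continuous.comp_stronglyMeasurable hf).measurable).ennreal_ofReal

theorem testVal_le {t : TraceClass H →L[ℂ] ℂ} {s : TraceClass H} (hs : s.IsDensity) :
    testVal t s ≤ ENNReal.ofReal ‖t‖ := by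
  refine ENNReal.ofReal_le_ofReal ((Complex.re_le_norm _).trans ((t.le_opNorm s).trans ?_))
  rw [hs.1.norm_eq, hs.2]; simp

theorem testVal_trace {s : TraceClass H} (hs : s.IsDensity) : testVal (traceCLM H) s = 1 := by
  change ENNReal.ofReal s.tr.re = 1
  rw [hs.2]; simp

section Separable

variable [SeparableSpace H]

theorem eq_of_forall_vecTest {s s' : TraceClass H} (hs : s.IsPos) (hs' : s'.IsPos)
    (h : ∀ k, testVal (vecTest (denseSeq H k)) s
      = testVal (vecTest (denseSeq H k)) s') : s = s' := by
  have h1 : (fun v : H => (inner ℂ v (s.op v)).re) = fun v => (inner ℂ v (s'.op v)).re := by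
    refine Continuous.ext_on (TopologicalSpace.denseRange_denseSeq H) (by fun_prop) (by fun_prop) ?_
    rintro _ ⟨k, rfl⟩
    exact (ENNReal.ofReal_eq_ofReal_iff ((isTest_vecTest _).nonneg s hs)
      ((isTest_vecTest _).nonneg s' hs')).1 (h k)
  have h2 : ∀ v : H, inner ℂ v (s.op v) = inner ℂ v (s'.op v) := fun v => by
    apply Complex.ext (congrFun h1 v)
    rw [← (Complex.nonneg_iff.1 (isPos_iff_inner.1 hs v)).2,
      ← (Complex.nonneg_iff.1 (isPos_iff_inner.1 hs' v)).2]
  apply op_injective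
  refine ContinuousLinearMap.coe_injective ((ext_inner_map _ _).1 fun v => ?_)
  change inner ℂ (s.op v) v = inner ℂ (s'.op v) v
  rw [← inner_conj_symm, ← inner_conj_symm (s'.op v), h2 v]

end Separable

namespace SemiClassical

variable {n : ℕ} {M : SemiClassical H n}

theorem measurable_snoc {l r : ℕ} : Measurable fun x : History n l r × (Fin n → Fin l → ℝ) =>
    (Fin.snoc (α := fun _ => Fin n → Fin l → ℝ) x.1 x.2 : History n l (r + 1)) := by
  refine measurable_pi_iff.2 fun i => ?_
  refine Fin.lastCases ?_ (fun i => ?_) i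
  · simpa using measurable_snd
  · simp only [Fin.snoc_castSucc]
    exact (measurable_pi_apply i).comp measurable_fst

theorem measurable_snoc_right {l r : ℕ} (z : History n l r) :
    Measurable fun w => (Fin.snoc (α := fun _ => Fin n → Fin l → ℝ) z w : History n l (r + 1)) :=
  measurable_snoc.comp (measurable_const.prodMk measurable_id)

namespace Realization

variable {τ : Fin n → TraceClass H} (R : M.Realization τ)

/-- The law of the outcome for one sample in the next round, given the data. -/
def out (r : ℕ) (z : History n M.l r) (κ : Fin n) : Measure (Fin M.l → ℝ) :=
  (M.inst r z κ).outcome (R.state r z κ)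

/-- The law of the data after the next round, given the data of the first `r` rounds. -/
def next (r : ℕ) (z : History n M.l r) : Measure (History n M.l (r + 1)) :=
  (Measure.pi (R.out r z)).map (Fin.snoc (α := fun _ => Fin n → Fin M.l → ℝ) z)

theorem isProbabilityMeasure_out {r : ℕ} (hr : r ≤ M.rounds) (z : History n M.l r) (κ : Fin n) :
    IsProbabilityMeasure (R.out r z κ) :=
  (M.inst r z κ).isPovm_outcome.isProbabilityMeasure (R.isDensity_state r hr z κ)

theorem isMixture {r : ℕ} (hr : r < M.rounds) : IsMixture (R.law r) (R.next r) (R.law (r + 1)) := by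
  refine ⟨fun z => ?_, fun S hS => ?_⟩
  · have := R.isProbabilityMeasure_out hr.le z
    exact Measure.isProbabilityMeasure_map (measurable_snoc_right z).aemeasurable
  · rw [R.law_succ r hr S hS]
    refine lintegral_congr fun z => ?_
    rw [next, Measure.map_apply (measurable_snoc_right z) hS]
    rfl

theorem law_univ {r : ℕ} (hr : r ≤ M.rounds) :
    R.law r Set.univ = ENNReal.ofReal (∏ κ, (τ κ).tr.re) := by
  induction r with
  | zero => rw [R.law_zero]; simp
  | succ r ih => rw [(R.isMixture hr).measure_univ, ih (Nat.le_of_succ_le hr)]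

theorem isFiniteMeasure {r : ℕ} (hr : r ≤ M.rounds) : IsFiniteMeasure (R.law r) :=
  ⟨by rw [R.law_univ hr]; exact ENNReal.ofReal_lt_top⟩

/-- The a posteriori states of one sample, tested on positive functionals. -/
theorem ae_exists_posterior {r : ℕ} (hr : r < M.rounds) (κ : Fin n) :
    ∀ᵐ z ∂(R.law r), ∃ g : (Fin M.l → ℝ) → TraceClass H, StronglyMeasurable g ∧
      (∀ x, (g x).IsDensity) ∧
      (∀ w, R.state (r + 1) (Fin.snoc (α := fun _ => Fin n → Fin M.l → ℝ) z w) κ = g (w κ)) ∧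
      ∀ t, IsTest t → ∀ Δ, MeasurableSet Δ → ∫⁻ x in Δ, testVal t (g x) ∂(R.out r z κ)
        = testVal t ((M.inst r z κ).toFun Δ (R.state r z κ)) := by
  filter_upwards [R.state_succ r hr κ] with z hz
  obtain ⟨g, hg, hint⟩ := hz
  have hgs : ∀ x, g x = R.state (r + 1)
      (Fin.snoc (α := fun _ => Fin n → Fin M.l → ℝ) z fun _ => x) κ := fun x => by
    rw [hg fun _ => x]
  have hgm : StronglyMeasurable g := by
    have h1 : Measurable fun x : Fin M.l → ℝ =>
        (Fin.snoc (α := fun _ => Fin n → Fin M.l → ℝ) z fun _ => x : History n M.l (r + 1)) :=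
      (measurable_snoc_right z).comp (measurable_pi_lambda _ fun _ => measurable_id)
    have := (R.measurable_state (r + 1) hr κ).comp_measurable h1
    have e : g = (fun z => R.state (r + 1) z κ) ∘ fun x : Fin M.l → ℝ =>
        (Fin.snoc (α := fun _ => Fin n → Fin M.l → ℝ) z fun _ => x : History n M.l (r + 1)) :=
      funext hgs
    rw [e]; exact this
  have hgd : ∀ x, (g x).IsDensity := fun x => by
    rw [hgs]; exact R.isDensity_state (r + 1) hr _ κ
  refine ⟨g, hgm, hgd, hg, fun t ht Δ hΔ => ?_⟩
  have := R.isProbabilityMeasure_out hr.le z κ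
  obtain ⟨A, hA⟩ := ht.rep
  have hi := hint A Δ hΔ
  simp_rw [← hA] at hi
  have hti : Integrable (fun x => t (g x)) (R.out r z κ) :=
    Integrable.of_bound (t.continuous.comp_stronglyMeasurable hgm).aestronglyMeasurable ‖t‖
      (Eventually.of_forall fun x => (t.le_opNorm _).trans (by
        rw [(hgd x).1.norm_eq, (hgd x).2]; simp))
  have h2 : ∫ x in Δ, (t (g x)).re ∂(R.out r z κ)
      = (t ((M.inst r z κ).toFun Δ (R.state r z κ))).re := by
    rw [← hi]
    exact integral_re hti.integrableOn
  have hre : Integrable (fun x => (t (g x)).re) (R.out r z κ) := hti.re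
  rw [testVal, ← h2]
  exact (ofReal_integral_eq_lintegral_ofReal (f := fun x => (t (g x)).re) hre.integrableOn
    (Eventually.of_forall fun x => ht.nonneg _ (hgd x).1)).symm

end Realization

end SemiClassical

end

/-! ### Semi-classical measurements of a sum of inputs -/

section

theorem TraceClass.IsPos.tr_eq_re {x : TraceClass H} (hx : x.IsPos) : x.tr = (x.tr.re : ℂ) := by
  refine (Complex.ext rfl ?_)
  have h : ∀ k, (inner ℂ (onb H k) (x.op (onb H k)) : ℂ)
      = ((inner ℂ (onb H k) (x.op (onb H k)) : ℂ).re : ℂ) := fun k => by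
    exact Complex.eq_re_of_ofReal_le (r := 0) (by simpa using isPos_iff_inner.1 hx (onb H k))
  rw [Complex.ofReal_im]
  change (opTrace x.op).im = 0
  unfold opTrace
  rw [tsum_congr h, ← Complex.ofReal_tsum, Complex.ofReal_im]

namespace SemiClassical

namespace Realization

variable {n : ℕ} {M : SemiClassical H n}

/-- The law of the data after the next round, weighted with a test functional of the a posteriori
state of one sample, on product sets. -/
theorem ae_setLIntegral_testVal {τ : Fin n → TraceClass H} (R : M.Realization τ) {r : ℕ}
    (hr : r < M.rounds) (κ : Fin n) :
    ∀ᵐ z ∂(R.law r), ∀ t, IsTest t → ∀ s : Fin n → Set (Fin M.l → ℝ), (∀ i, MeasurableSet (s i)) →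
      ∫⁻ u in Set.univ.pi s, testVal t (R.state (r + 1)
          (Fin.snoc (α := fun _ => Fin n → Fin M.l → ℝ) z u) κ) ∂Measure.pi (R.out r z)
        = (∏ j ∈ Finset.univ.erase κ, R.out r z j (s j))
          * testVal t ((M.inst r z κ).toFun (s κ) (R.state r z κ)) := by
  filter_upwards [R.ae_exists_posterior hr κ] with z hz t ht s hs
  obtain ⟨g, hgm, -, hg, hint⟩ := hz
  have := R.isProbabilityMeasure_out hr.le z
  simp_rw [hg]
  rw [setLIntegral_pi_eval (R.out r z) κ (measurable_testVal t hgm), hint t ht (s κ) (hs κ)]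

/-- The law of the data of the round after `z`, weighted with a functional of the a posteriori
state of the sample `κ`. -/
def weighted {τ : Fin n → TraceClass H} (R : M.Realization τ) (t : TraceClass H →L[ℂ] ℂ) (r : ℕ)
    (κ : Fin n) (z : History n M.l r) : Measure (Fin n → Fin M.l → ℝ) :=
  (Measure.pi (R.out r z)).withDensity fun u =>
    testVal t (R.state (r + 1) (Fin.snoc (α := fun _ => Fin n → Fin M.l → ℝ) z u) κ)

/-- Relation between three realizations with the inputs `x + y`, `x` and `y` in the place `κ` and
identical inputs elsewhere, after `r` rounds: the unnormalized states of the sample `κ` are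
additive, and the states of the other samples are the same. -/
structure Splits {τ τ₁ τ₂ : Fin n → TraceClass H} (R : M.Realization τ) (R₁ : M.Realization τ₁)
    (R₂ : M.Realization τ₂) (κ : Fin n) (r : ℕ) : Prop where
  weight : ∀ t, IsTest t → (R.law r).withDensity (fun z => testVal t (R.state r z κ))
    = (R₁.law r).withDensity (fun z => testVal t (R₁.state r z κ))
      + (R₂.law r).withDensity (fun z => testVal t (R₂.state r z κ))
  left : ∀ j, j ≠ κ → ∀ᵐ z ∂(R₁.law r), R.state r z j = R₁.state r z j
  right : ∀ j, j ≠ κ → ∀ᵐ z ∂(R₂.law r), R.state r z j = R₂.state r z j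

namespace Splits

variable {τ τ₁ τ₂ : Fin n → TraceClass H} {R : M.Realization τ} {R₁ : M.Realization τ₁}
  {R₂ : M.Realization τ₂} {κ : Fin n} {r : ℕ}

theorem law (h : Splits R R₁ R₂ κ r) (hr : r ≤ M.rounds) : R.law r = R₁.law r + R₂.law r := by
  have := h.weight _ isTest_trace
  simp_rw [fun z => testVal_trace (R.isDensity_state r hr z κ),
    fun z => testVal_trace (R₁.isDensity_state r hr z κ),
    fun z => testVal_trace (R₂.isDensity_state r hr z κ)] at this
  simpa using this

/-- The state at the input `x + y` is a convex combination of those at `x` and `y`, with the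
probabilities of the two inputs given the data. -/
theorem exists_density (h : Splits R R₁ R₂ κ r) (hr : r ≤ M.rounds)
    [SeparableSpace H] : ∃ p q : History n M.l r → NNReal,
      Measurable p ∧ Measurable q ∧ R₁.law r = (R.law r).withDensity (fun z => p z) ∧
      R₂.law r = (R.law r).withDensity (fun z => q z) ∧
      ∀ᵐ z ∂(R.law r), R.state r z κ
        = (p z : ℝ) • R₁.state r z κ + (q z : ℝ) • R₂.state r z κ := by
  have := R.isFiniteMeasure hr
  have := R₁.isFiniteMeasure hr
  have := R₂.isFiniteMeasure hr
  have hlaw := h.law hr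
  obtain ⟨p, hp, hp0, -, hpd⟩ := exists_density_of_le (μ := R₁.law r) (w := R.law r)
    (by rw [hlaw]; exact Measure.le_add_right le_rfl)
  obtain ⟨q, hq, hq0, -, hqd⟩ := exists_density_of_le (μ := R₂.law r) (w := R.law r)
    (by rw [hlaw]; exact Measure.le_add_left le_rfl)
  refine ⟨fun z => (p z).toNNReal, fun z => (q z).toNNReal, hp.real_toNNReal, hq.real_toNNReal,
    hpd, hqd, ?_⟩
  have key : ∀ k, ∀ᵐ z ∂(R.law r), testVal (vecTest (denseSeq H k)) (R.state r z κ)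
      = ENNReal.ofReal (p z) * testVal (vecTest (denseSeq H k)) (R₁.state r z κ)
      + ENNReal.ofReal (q z) * testVal (vecTest (denseSeq H k)) (R₂.state r z κ) :=
    fun k => by
      have m0 := measurable_testVal (vecTest (denseSeq H k))
        (R.measurable_state r hr κ)
      have m1 := measurable_testVal (vecTest (denseSeq H k))
        (R₁.measurable_state r hr κ)
      have m2 := measurable_testVal (vecTest (denseSeq H k))
        (R₂.measurable_state r hr κ)
      have e := h.weight _ (isTest_vecTest (denseSeq H k))
      rw [hpd, hqd, ← withDensity_mul _ (by fun_prop) m1, ← withDensity_mul _ (by fun_prop) m2,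
        ← withDensity_add_left (by fun_prop)] at e
      exact (withDensity_eq_iff_of_sigmaFinite m0.aemeasurable (by fun_prop)).1 e
  filter_upwards [ae_all_iff.2 key] with z hz
  have p1 := (R₁.isDensity_state r hr z κ).1
  have p2 := (R₂.isDensity_state r hr z κ).1
  rw [Real.coe_toNNReal _ (hp0 z), Real.coe_toNNReal _ (hq0 z)]
  refine eq_of_forall_vecTest (R.isDensity_state r hr z κ).1
    ((p1.smul (hp0 z)).add (p2.smul (hq0 z))) fun k => ?_
  have t1 := (isTest_vecTest (denseSeq H k)).nonneg _ p1
  have t2 := (isTest_vecTest (denseSeq H k)).nonneg _ p2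
  rw [hz k, testVal, testVal, testVal, ← ENNReal.ofReal_mul (hp0 z), ← ENNReal.ofReal_mul (hq0 z),
    ← ENNReal.ofReal_add (mul_nonneg (hp0 z) t1) (mul_nonneg (hq0 z) t2), map_add,
    ← Complex.coe_smul, ← Complex.coe_smul, map_smul, map_smul]
  simp

theorem testVal_comb {t : TraceClass H →L[ℂ] ℂ} (ht : IsTest t) {Ω : Type*} [MeasurableSpace Ω]
    (I : Instrument H Ω) {Δ : Set Ω} (hΔ : MeasurableSet Δ) {s₁ s₂ : TraceClass H} (h₁ : s₁.IsPos)
    (h₂ : s₂.IsPos) (p q : NNReal) : testVal t (I.toFun Δ ((p : ℝ) • s₁ + (q : ℝ) • s₂))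
      = p * testVal t (I.toFun Δ s₁) + q * testVal t (I.toFun Δ s₂) := by
  have t1 := ht.nonneg _ (I.isPos_toFun hΔ h₁)
  have t2 := ht.nonneg _ (I.isPos_toFun hΔ h₂)
  rw [← ENNReal.ofReal_coe_nnreal, ← ENNReal.ofReal_coe_nnreal, testVal, testVal, testVal,
    ← ENNReal.ofReal_mul p.coe_nonneg, ← ENNReal.ofReal_mul q.coe_nonneg,
    ← ENNReal.ofReal_add (mul_nonneg p.coe_nonneg t1) (mul_nonneg q.coe_nonneg t2), map_add,
    ← Complex.coe_smul, ← Complex.coe_smul, map_smul, map_smul, map_add, map_smul, map_smul]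
  simp

/-- One more round preserves the additivity: instruments are linear in the state, which is the
convex combination of `exists_density`, and the other samples contribute the same factor to all
three laws. -/
theorem weight_succ (h : Splits R R₁ R₂ κ r) (hr : r < M.rounds)
    [SeparableSpace H] (t : TraceClass H →L[ℂ] ℂ) (ht : IsTest t) :
    (R.law (r + 1)).withDensity (fun z => testVal t (R.state (r + 1) z κ))
      = (R₁.law (r + 1)).withDensity (fun z => testVal t (R₁.state (r + 1) z κ))
        + (R₂.law (r + 1)).withDensity (fun z => testVal t (R₂.state (r + 1) z κ)) := by
  have := R.isFiniteMeasure hr.le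
  have := R₁.isFiniteMeasure hr.le
  have := R₂.isFiniteMeasure hr.le
  obtain ⟨p, q, hp, hq, hpd, hqd, hpq⟩ := h.exists_density hr.le
  -- the boxes of the next data suffice in order to identify the weighted conditional laws
  have b0 := R.ae_setLIntegral_testVal hr κ
  have b1 := (ae_withDensity_iff (by fun_prop)).1 (hpd ▸ R₁.ae_setLIntegral_testVal hr κ)
  have b2 := (ae_withDensity_iff (by fun_prop)).1 (hqd ▸ R₂.ae_setLIntegral_testVal hr κ)
  have c1 := (ae_withDensity_iff (by fun_prop)).1 (hpd ▸ (ae_all_iff.2 fun j =>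
    (ae_all_iff.2 fun hj : j ≠ κ => h.left j hj)))
  have c2 := (ae_withDensity_iff (by fun_prop)).1 (hqd ▸ (ae_all_iff.2 fun j =>
    (ae_all_iff.2 fun hj : j ≠ κ => h.right j hj)))
  have hDeq : ∀ᵐ z ∂(R.law r), R.weighted t r κ z
      = (p z : ℝ≥0∞) • R₁.weighted t r κ z + (q z : ℝ≥0∞) • R₂.weighted t r κ z := by
    filter_upwards [b0, b1, b2, c1, c2, hpq] with z b0 b1 b2 c1 c2 hs
    have hprob := R.isProbabilityMeasure_out hr.le z
    have hfin : IsFiniteMeasure (R.weighted t r κ z) := by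
      refine isFiniteMeasure_withDensity (ne_top_of_le_ne_top ?_ (lintegral_mono fun u =>
        testVal_le (R.isDensity_state (r + 1) hr _ κ)))
      simp
    refine ext_of_pi fun s hs' => ?_
    have hbox : MeasurableSet (Set.univ.pi s) := MeasurableSet.univ_pi hs'
    have d1 : (p z : ℝ≥0∞) * R₁.weighted t r κ z (Set.univ.pi s)
        = p z * ((∏ j ∈ Finset.univ.erase κ, R.out r z j (s j))
          * testVal t ((M.inst r z κ).toFun (s κ) (R₁.state r z κ))) := by
      rcases eq_or_ne (p z : ℝ≥0∞) 0 with h0 | h0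
      · rw [h0, zero_mul, zero_mul]
      · rw [weighted, withDensity_apply _ hbox, b1 h0 t ht s hs']
        congr 2
        refine Finset.prod_congr rfl fun j hj => ?_
        rw [out, out, c1 h0 j (Finset.ne_of_mem_erase hj)]
    have d2 : (q z : ℝ≥0∞) * R₂.weighted t r κ z (Set.univ.pi s)
        = q z * ((∏ j ∈ Finset.univ.erase κ, R.out r z j (s j))
          * testVal t ((M.inst r z κ).toFun (s κ) (R₂.state r z κ))) := by
      rcases eq_or_ne (q z : ℝ≥0∞) 0 with h0 | h0
      · rw [h0, zero_mul, zero_mul]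
      · rw [weighted, withDensity_apply _ hbox, b2 h0 t ht s hs']
        congr 2
        refine Finset.prod_congr rfl fun j hj => ?_
        rw [out, out, c2 h0 j (Finset.ne_of_mem_erase hj)]
    rw [Measure.add_apply, Measure.smul_apply, Measure.smul_apply, smul_eq_mul, smul_eq_mul, d1, d2,
      weighted, withDensity_apply _ hbox, b0 t ht s hs', hs,
      testVal_comb ht _ (hs' κ) (R₁.isDensity_state r hr.le z κ).1 (R₂.isDensity_state r hr.le z κ).1]
    ring
  have hDint : ∀ {τ : Fin n → TraceClass H} (R : M.Realization τ) [IsFiniteMeasure (R.law r)]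
      (S : Set (History n M.l (r + 1))), MeasurableSet S →
      AEMeasurable (fun z => R.weighted t r κ z ((Fin.snoc (α := fun _ => Fin n → Fin M.l → ℝ) z) ⁻¹' S))
        (R.law r) ∧
      (R.law (r + 1)).withDensity (fun z => testVal t (R.state (r + 1) z κ)) S
        = ∫⁻ z, R.weighted t r κ z ((Fin.snoc (α := fun _ => Fin n → Fin M.l → ℝ) z) ⁻¹' S) ∂(R.law r) := by
    intro τ R _ S hS
    have hm := (measurable_testVal t (R.measurable_state (r + 1) hr κ)).indicator hS
    have h1 := (R.isMixture hr).lintegral_eq hm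
    have e : ∀ z, ∫⁻ x, S.indicator (fun z => testVal t (R.state (r + 1) z κ)) x ∂(R.next r z)
        = R.weighted t r κ z ((Fin.snoc (α := fun _ => Fin n → Fin M.l → ℝ) z) ⁻¹' S) := fun z => by
      rw [next, lintegral_map hm (measurable_snoc_right z), weighted,
        withDensity_apply _ (measurable_snoc_right z hS), ← lintegral_indicator
          (measurable_snoc_right z hS)]
      rfl
    simp_rw [e] at h1
    refine ⟨h1.1, ?_⟩
    rw [withDensity_apply _ hS, ← lintegral_indicator hS, h1.2]
  ext S hS
  rw [Measure.add_apply, (hDint R S hS).2, (hDint R₁ S hS).2, (hDint R₂ S hS).2]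
  have a1 := (hDint R₁ S hS).1
  rw [hpd] at a1
  rw [hpd, hqd, lintegral_withDensity_eq_lintegral_mul_non_measurable₀ _ (by fun_prop)
      (Eventually.of_forall fun _ => ENNReal.coe_lt_top),
    lintegral_withDensity_eq_lintegral_mul_non_measurable₀ _ (by fun_prop)
      (Eventually.of_forall fun _ => ENNReal.coe_lt_top),
    ← lintegral_add_left' (show AEMeasurable ((fun z => (p z : ℝ≥0∞)) *
      fun z => R₁.weighted t r κ z ((Fin.snoc (α := fun _ => Fin n → Fin M.l → ℝ) z) ⁻¹' S))
      (R.law r) from (aemeasurable_withDensity_ennreal_iff hp).1 a1)]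
  refine lintegral_congr_ae ?_
  filter_upwards [hDeq] with z hz
  rw [hz]; rfl

/-- A posteriori states are unique. -/
theorem ae_state_succ_eq {τ τ' : Fin n → TraceClass H} {R : M.Realization τ}
    {R' : M.Realization τ'} (hr : r < M.rounds) [SeparableSpace H]
    (hac : R'.law r ≪ R.law r) {j : Fin n} (h : ∀ᵐ z ∂(R'.law r), R.state r z j = R'.state r z j) :
    ∀ᵐ z ∂(R'.law (r + 1)), R.state (r + 1) z j = R'.state (r + 1) z j := by
  have := R'.isFiniteMeasure hr.le
  refine (R'.isMixture hr).ae_of_ae (StronglyMeasurable.measurableSet_eq_fun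
    (R.measurable_state (r + 1) hr j) (R'.measurable_state (r + 1) hr j)) ?_
  filter_upwards [h, hac.ae_le (R.ae_exists_posterior hr j), R'.ae_exists_posterior hr j]
    with z hz h0 h1
  obtain ⟨g, hgm, hgd, hg, hint⟩ := h0
  obtain ⟨g', hgm', hgd', hg', hint'⟩ := h1
  have hprob := R'.isProbabilityMeasure_out hr.le z
  have hout : R.out r z j = R'.out r z j := by rw [out, out, hz]
  have hgg : ∀ᵐ x ∂(R'.out r z j), g x = g' x := by
    have : ∀ k, ∀ᵐ x ∂(R'.out r z j), testVal (vecTest (denseSeq H k)) (g x)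
        = testVal (vecTest (denseSeq H k)) (g' x) := fun k => by
      refine ae_eq_of_forall_setLIntegral_eq_of_sigmaFinite (measurable_testVal _ hgm)
        (measurable_testVal _ hgm') fun Δ hΔ _ => ?_
      rw [hint' _ (isTest_vecTest _) Δ hΔ, ← hout, hint _ (isTest_vecTest _) Δ hΔ, hz]
    filter_upwards [ae_all_iff.2 this] with x hx
    exact eq_of_forall_vecTest (hgd x).1 (hgd' x).1 hx
  have hpi : ∀ᵐ u ∂Measure.pi (R'.out r z), g (u j) = g' (u j) :=
    (Measure.quasiMeasurePreserving_eval (μ := R'.out r z) j).ae hgg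
  rw [next]
  refine (ae_map_iff (measurable_snoc_right z).aemeasurable
    (StronglyMeasurable.measurableSet_eq_fun (R.measurable_state (r + 1) hr j)
      (R'.measurable_state (r + 1) hr j))).2 ?_
  filter_upwards [hpi] with u hu
  rw [hg, hg', hu]

theorem succ (h : Splits R R₁ R₂ κ r) (hr : r < M.rounds)
    [SeparableSpace H] : Splits R R₁ R₂ κ (r + 1) where
  weight t ht := h.weight_succ hr t ht
  left j hj := ae_state_succ_eq hr (by
    rw [h.law hr.le]; exact Measure.AbsolutelyContinuous.rfl.add_right _) (h.left j hj)
  right j hj := ae_state_succ_eq hr (by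
    rw [h.law hr.le, add_comm]; exact Measure.AbsolutelyContinuous.rfl.add_right _) (h.right j hj)

end Splits

theorem law_zero_withDensity {τ : Fin n → TraceClass H} (hτ : ∀ j, (τ j).IsPos)
    (R : M.Realization τ) (κ : Fin n) {t : TraceClass H →L[ℂ] ℂ} :
    (R.law 0).withDensity (fun z => testVal t (R.state 0 z κ))
      = (ENNReal.ofReal (∏ j ∈ Finset.univ.erase κ, (τ j).tr.re) * testVal t (τ κ))
        • Measure.dirac default := by
  have htr : (τ κ).tr = ((τ κ).tr.re : ℂ) := by
    exact (hτ κ).tr_eq_re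
  have e1 : testVal t (τ κ) = ENNReal.ofReal (τ κ).tr.re * testVal t (R.state 0 default κ) := by
    conv_lhs => rw [R.state_zero κ, htr, testVal, map_smul, smul_eq_mul, Complex.re_ofReal_mul]
    rw [ENNReal.ofReal_mul (hτ κ).tr_re_nonneg]; rfl
  have e2 : (fun z => testVal t (R.state 0 z κ)) = fun _ => testVal t (R.state 0 default κ) := by
    funext z; rw [Subsingleton.elim z default]
  rw [e2, withDensity_const, R.law_zero, e1, smul_smul]
  congr 1
  rw [← Finset.mul_prod_erase _ _ (Finset.mem_univ κ), ENNReal.ofReal_mul (hτ κ).tr_re_nonneg]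
  ring

theorem state_zero_eq {τ τ' : Fin n → TraceClass H} (R : M.Realization τ) (R' : M.Realization τ')
    {j : Fin n} (h : τ j = τ' j) : ∀ᵐ z ∂(R'.law 0), R.state 0 z j = R'.state 0 z j := by
  by_cases h0 : (τ' j).tr = 0
  · have : R'.law 0 = 0 := by
      rw [R'.law_zero, Finset.prod_eq_zero (Finset.mem_univ j) (by rw [h0]; rfl)]
      simp
    rw [this]; simp
  · refine Eventually.of_forall fun z => ?_
    rw [Subsingleton.elim z default]
    have e := (R.state_zero j).symm.trans (h.trans (R'.state_zero j))
    rw [h] at e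
    exact smul_right_injective _ h0 e

theorem splits [SeparableSpace H] {τ : Fin n → TraceClass H}
    (hτ : ∀ j, (τ j).IsPos) {κ : Fin n} {x y : TraceClass H} (hx : x.IsPos) (hy : y.IsPos)
    (R : M.Realization (Function.update τ κ (x + y))) (R₁ : M.Realization (Function.update τ κ x))
    (R₂ : M.Realization (Function.update τ κ y)) {r : ℕ} (hr : r ≤ M.rounds) :
    Splits R R₁ R₂ κ r := by
  induction r with
  | zero =>
    refine ⟨fun t ht => ?_, fun j hj => R.state_zero_eq R₁ (by simp [hj]),
      fun j hj => R.state_zero_eq R₂ (by simp [hj])⟩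
    rw [law_zero_withDensity (isPos_update hτ κ (hx.add hy)), law_zero_withDensity
      (isPos_update hτ κ hx), law_zero_withDensity (isPos_update hτ κ hy), ← add_smul]
    congr 1
    have e : ∀ a, ∏ j ∈ Finset.univ.erase κ, (Function.update τ κ a j).tr.re
        = ∏ j ∈ Finset.univ.erase κ, (τ j).tr.re := fun a =>
      Finset.prod_congr rfl fun j hj => by
        rw [Function.update_of_ne (Finset.ne_of_mem_erase hj)]
    rw [e, e, e, ← mul_add]
    simp only [Function.update_self]
    rw [testVal, testVal, testVal, ← ENNReal.ofReal_add (ht.nonneg x hx) (ht.nonneg y hy), map_add,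
      Complex.add_re]
  | succ r ih => exact (ih (Nat.le_of_succ_le hr)).succ hr

end Realization

end SemiClassical

end

/-! ### Semi-classical measurements use local operations -/

section

theorem IsMixture.map {Z Z' Z'' : Type*} [MeasurableSpace Z] [MeasurableSpace Z']
    [MeasurableSpace Z''] {μ : Measure Z} {K : Z → Measure Z'} {ν : Measure Z'}
    (h : IsMixture μ K ν) {f : Z' → Z''} (hf : Measurable f) :
    IsMixture μ (fun z => (K z).map f) (ν.map f) := by
  refine ⟨fun z => ?_, fun S hS => ?_⟩
  · have := h.1 z
    exact Measure.isProbabilityMeasure_map hf.aemeasurable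
  · rw [Measure.map_apply hf hS, h.2 _ (hf hS)]
    simp_rw [Measure.map_apply hf hS]

/-- The input with `x` in the place `κ` and `y` in the place `κ'`. -/
abbrev input {n : ℕ} (τ : Fin n → TraceClass H) (κ κ' : Fin n) (x y : TraceClass H) : Fin n → TraceClass H :=
  Function.update (Function.update τ κ x) κ' y

theorem input_eq {n : ℕ} {τ : Fin n → TraceClass H} {κ κ' : Fin n} (hκ : κ ≠ κ') (x y : TraceClass H) :
    input τ κ κ' x y = Function.update (Function.update τ κ' y) κ x :=
  Function.update_comm hκ x y τ

theorem isPos_input {n : ℕ} {τ : Fin n → TraceClass H} {κ κ' : Fin n} (hτ : ∀ j, (τ j).IsPos)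
    {x y : TraceClass H} (hx : x.IsPos) (hy : y.IsPos)
    (j : Fin n) : (input τ κ κ' x y j).IsPos :=
  isPos_update (isPos_update hτ κ hx) κ' hy j

namespace SemiClassical

namespace Realization

variable {n : ℕ} {M : SemiClassical H n}

/-- Splitting off the datum of the sample `κ` in the last round. -/
def lastDatum (r : ℕ) (κ : Fin n) (h : History n M.l (r + 1)) : History n M.l r × (Fin M.l → ℝ) :=
  (Fin.init (α := fun _ => Fin n → Fin M.l → ℝ) h, h (Fin.last r) κ)

theorem measurable_lastDatum (r : ℕ) (κ : Fin n) : Measurable (lastDatum (M := M) r κ) := by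
  refine Measurable.prodMk (measurable_pi_lambda _ fun i => measurable_pi_apply _) ?_
  exact (measurable_pi_apply κ).comp (measurable_pi_apply (Fin.last r))

theorem lastDatum_snoc (r : ℕ) (κ : Fin n) (z : History n M.l r) (u : Fin n → Fin M.l → ℝ) :
    lastDatum (M := M) r κ (Fin.snoc (α := fun _ => Fin n → Fin M.l → ℝ) z u) = (z, u κ) := by
  unfold lastDatum
  simp

theorem map_lastDatum_next {τ : Fin n → TraceClass H} (R : M.Realization τ) {r : ℕ}
    (hr : r < M.rounds) (κ : Fin n) (z : History n M.l r) :
    (R.next r z).map (lastDatum r κ) = (R.out r z κ).map (Prod.mk z) := by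
  have := R.isProbabilityMeasure_out hr.le z
  rw [next, Measure.map_map (measurable_lastDatum r κ) (measurable_snoc_right z)]
  have e : lastDatum (M := M) r κ ∘ (Fin.snoc (α := fun _ => Fin n → Fin M.l → ℝ) z)
      = Prod.mk z ∘ Function.eval κ := by
    funext u; exact lastDatum_snoc r κ z u
  have e2 : (Measure.pi (R.out r z)).map (Function.eval κ) = R.out r z κ := by
    rw [Measure.pi_map_eval]; simp
  rw [e, ← e2]
  exact (Measure.map_map measurable_prodMk_left (measurable_pi_apply κ)).symm

theorem isMixture_lastDatum {τ : Fin n → TraceClass H} (R : M.Realization τ) {r : ℕ}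
    (hr : r < M.rounds) (κ : Fin n) : IsMixture (R.law r)
      (fun z => (R.out r z κ).map (Prod.mk z)) ((R.law (r + 1)).map (lastDatum r κ)) := by
  have := (R.isMixture hr).map (measurable_lastDatum (M := M) r κ)
  simp_rw [R.map_lastDatum_next hr κ] at this
  exact this

section Change

variable [SeparableSpace H] {τ : Fin n → TraceClass H} {κ κ' : Fin n}
  {w y y' : TraceClass H}

/-- Replacing `y + y'` by `y` in one place changes the law of the data by a density. -/
theorem exists_density_input (hτ : ∀ j, (τ j).IsPos) (hκ : κ ≠ κ') (hy : y.IsPos) (hy' : y'.IsPos)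
    (hw : w.IsPos) (R : ∀ τ : Fin n → TraceClass H, (∀ j, (τ j).IsPos) → M.Realization τ) {r : ℕ}
    (hr : r ≤ M.rounds) : ∃ b : History n M.l r → NNReal, Measurable b ∧
      ∀ (x x' : TraceClass H) (hx : x.IsPos), x'.IsPos → x + x' = w →
        (R (input τ κ κ' x y) (isPos_input hτ hx hy)).law r
          = ((R (input τ κ κ' x (y + y')) (isPos_input hτ hx (hy.add hy'))).law r).withDensity
            fun z => b z := by
  have splitL : ∀ (x x' v : TraceClass H) (hx : x.IsPos) (hx' : x'.IsPos) (hv : v.IsPos)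
      (he : x + x' = w) {s : ℕ} (hs : s ≤ M.rounds),
      Splits (R (input τ κ κ' w v) (isPos_input hτ hw hv))
        (R (input τ κ κ' x v) (isPos_input hτ hx hv))
        (R (input τ κ κ' x' v) (isPos_input hτ hx' hv)) κ s := by
    intro x x' v hx hx' hv he s hs
    have e : ∀ a, input τ κ κ' a v = Function.update (Function.update τ κ' v) κ a := fun a =>
      input_eq hκ a v
    have hs' : ∀ (τ₀ τ₁ τ₂ : Fin n → TraceClass H) (h₀ : ∀ j, (τ₀ j).IsPos)
        (h₁ : ∀ j, (τ₁ j).IsPos) (h₂ : ∀ j, (τ₂ j).IsPos),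
        τ₀ = Function.update (Function.update τ κ' v) κ (x + x') →
        τ₁ = Function.update (Function.update τ κ' v) κ x →
        τ₂ = Function.update (Function.update τ κ' v) κ x' →
        Splits (R τ₀ h₀) (R τ₁ h₁) (R τ₂ h₂) κ s := by
      rintro τ₀ τ₁ τ₂ h₀ h₁ h₂ rfl rfl rfl
      exact Realization.splits (isPos_update hτ κ' hv) hx hx' _ _ _ hs
    exact hs' _ _ _ _ _ _ (he ▸ e w) (e x) (e x')
  have splitR : ∀ (x : TraceClass H) (hx : x.IsPos) {s : ℕ} (hs : s ≤ M.rounds),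
      Splits (R (input τ κ κ' x (y + y')) (isPos_input hτ hx (hy.add hy')))
        (R (input τ κ κ' x y) (isPos_input hτ hx hy))
        (R (input τ κ κ' x y') (isPos_input hτ hx hy')) κ' s := fun x hx s hs =>
    Realization.splits (isPos_update hτ κ hx) (κ := κ') hy hy' _ _ _ hs
  have hyy := hy.add hy'
  induction r with
  | zero =>
    refine ⟨fun _ => (y.tr.re / (y + y').tr.re).toNNReal, measurable_const, fun x x' hx hx' he => ?_⟩
    rw [law_zero, law_zero, withDensity_const, smul_smul]
    congr 1
    have e : ∀ a : TraceClass H, ∏ j, (input τ κ κ' x a j).tr.re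
        = a.tr.re * ∏ j ∈ Finset.univ.erase κ', (Function.update τ κ x j).tr.re := fun a => by
      rw [← Finset.mul_prod_erase _ _ (Finset.mem_univ κ')]
      congr 1
      · simp
      · exact Finset.prod_congr rfl fun j hj => by
          rw [input, Function.update_of_ne (Finset.ne_of_mem_erase hj)]
    have h0 := hy.tr_re_nonneg
    have h1 := hy'.tr_re_nonneg
    rw [e, e, ← ENNReal.ofReal, ← ENNReal.ofReal_mul (by
      rw [tr_add, Complex.add_re]; positivity), ← mul_assoc]
    congr 2
    rcases eq_or_ne (y + y').tr.re 0 with h | h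
    · rw [h]; rw [tr_add, Complex.add_re] at h; simp; linarith
    · field_simp
  | succ r ih =>
    have hr' : r < M.rounds := hr
    obtain ⟨b, hb, hbx⟩ := ih hr'.le
    have hww : w + 0 = w := add_zero w
    have h0 : (0 : TraceClass H).IsPos := by simp [IsPos]
    have e0 := hbx w 0 hw h0 hww
    set R00 := R (input τ κ κ' w (y + y')) (isPos_input hτ hw hyy)
    set R01 := R (input τ κ κ' w y) (isPos_input hτ hw hy)
    have f00 := R00.isFiniteMeasure hr'.le
    have f01 := R01.isFiniteMeasure hr'.le
    have f01' := R01.isFiniteMeasure hr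
    have f00' := R00.isFiniteMeasure hr
    obtain ⟨β, hβ, hβe⟩ := exists_density_of_isMixture hb (by
        have := measure_lt_top (R01.law r) Set.univ
        rw [e0, withDensity_apply _ MeasurableSet.univ, Measure.restrict_univ] at this
        exact this.ne)
      (R00.isMixture_lastDatum hr' κ') (e0 ▸ R01.isMixture_lastDatum hr' κ')
      ((Measure.absolutelyContinuous_of_le (by
        rw [(splitR w hw hr).law hr]; exact Measure.le_add_right le_rfl)).map
          (measurable_lastDatum r κ'))
    -- the density of the laws of all data, at first with values in `[0, ∞]`
    have key : ∀ (x x' : TraceClass H) (hx : x.IsPos), x'.IsPos → x + x' = w →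
        (R (input τ κ κ' x y) (isPos_input hτ hx hy)).law (r + 1)
          = ((R (input τ κ κ' x (y + y')) (isPos_input hτ hx hyy)).law (r + 1)).withDensity
            fun z => β (lastDatum r κ' z) := by
      intro x x' hx hx' he
      have s1 := splitL x x' (y + y') hx hx' hyy he hr'.le
      have s2 := splitL x x' y hx hx' hy he hr'.le
      have s3 := splitR x hx hr'.le
      have ex := hbx x x' hx hx' he
      set R10 := R (input τ κ κ' x (y + y')) (isPos_input hτ hx hyy)
      set R11 := R (input τ κ κ' x y) (isPos_input hτ hx hy)
      have f10 := R10.isFiniteMeasure hr'.le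
      have f11 := R11.isFiniteMeasure hr'.le
      have hle : R10.law r ≪ R00.law r := Measure.absolutelyContinuous_of_le (by
        rw [s1.law hr'.le]; exact Measure.le_add_right le_rfl)
      have a1 := s1.left κ' hκ.symm
      have a2 := (ae_withDensity_iff (by fun_prop)).1 (ex ▸ s2.left κ' hκ.symm)
      have a3 := (ae_withDensity_iff (by fun_prop)).1 (ex ▸ (ae_all_iff.2 fun j =>
        (ae_all_iff.2 fun hj : j ≠ κ' => s3.left j hj)))
      have hpi : ∀ᵐ z ∂(R10.law r), (b z : ℝ≥0∞) • Measure.pi (R11.out r z)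
          = (Measure.pi (R10.out r z)).withDensity fun u => β (z, u κ') := by
        filter_upwards [a1, a2, a3, hle.ae_le hβe] with z a1 a2 a3 a4
        have p10 := R10.isProbabilityMeasure_out hr'.le z
        have p11 := R11.isProbabilityMeasure_out hr'.le z
        have o1 : R00.out r z κ' = R10.out r z κ' := by rw [out, out, a1]
        have : IsFiniteMeasure ((b z : ℝ≥0∞) • Measure.pi (R11.out r z)) := ⟨by simp⟩
        refine ext_of_pi fun s hs => ?_
        rw [withDensity_apply _ (MeasurableSet.univ_pi hs),
          setLIntegral_pi_eval (R10.out r z) κ' (f := fun x => β (z, x))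
            (hβ.comp measurable_prodMk_left) s, ← o1, ← withDensity_apply _ (hs κ'), ← a4,
            Measure.smul_apply, Measure.smul_apply,
          Measure.pi_pi, smul_eq_mul, smul_eq_mul]
        rcases eq_or_ne (b z : ℝ≥0∞) 0 with hz | hz
        · rw [hz]; simp
        · have o2 : R01.out r z κ' = R11.out r z κ' := by rw [out, out, a2 hz]
          have o3 : ∏ j ∈ Finset.univ.erase κ', R10.out r z j (s j)
              = ∏ j ∈ Finset.univ.erase κ', R11.out r z j (s j) :=
            Finset.prod_congr rfl fun j hj => by
              rw [out, out, a3 hz j (Finset.ne_of_mem_erase hj)]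
          rw [o2, o3, ← Finset.mul_prod_erase _ _ (Finset.mem_univ κ')]
          ring
      ext S hS
      have hm : Measurable fun z => S.indicator (fun z => β (lastDatum (M := M) r κ' z)) z :=
        (hβ.comp (measurable_lastDatum r κ')).indicator hS
      rw [(R11.isMixture hr').2 S hS, withDensity_apply _ hS, ← lintegral_indicator hS,
        ((R10.isMixture hr').lintegral_eq hm).2, ex,
        lintegral_withDensity_eq_lintegral_mul_non_measurable₀ _ (by fun_prop)
          (Eventually.of_forall fun _ => ENNReal.coe_lt_top)]
      refine lintegral_congr_ae ?_
      filter_upwards [hpi] with z hz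
      rw [next, lintegral_map hm (measurable_snoc_right z)]
      have := congrArg (fun m : Measure _ => m ((Fin.snoc (α := fun _ => Fin n → Fin M.l → ℝ) z) ⁻¹' S)) hz
      rw [Measure.smul_apply, smul_eq_mul, withDensity_apply _ (measurable_snoc_right z hS),
        ← lintegral_indicator (measurable_snoc_right z hS)] at this
      rw [Pi.mul_apply, next, Measure.map_apply (measurable_snoc_right z) hS, this]
      refine lintegral_congr fun u => ?_
      by_cases hu : Fin.snoc (α := fun _ => Fin n → Fin M.l → ℝ) z u ∈ S
      · rw [Set.indicator_of_mem hu, Set.indicator_of_mem (by exact hu), lastDatum_snoc]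
      · rw [Set.indicator_of_notMem hu, Set.indicator_of_notMem (by exact hu)]
    have hfin : ∀ᵐ z ∂(R00.law (r + 1)), β (lastDatum r κ' z) < ⊤ := by
      refine ae_lt_top (hβ.comp (measurable_lastDatum r κ')) ?_
      have := measure_lt_top (R01.law (r + 1)) Set.univ
      rw [key w 0 hw h0 hww, withDensity_apply _ MeasurableSet.univ, Measure.restrict_univ] at this
      exact this.ne
    refine ⟨fun z => (β (lastDatum r κ' z)).toNNReal,
      (hβ.comp (measurable_lastDatum r κ')).ennreal_toNNReal, fun x x' hx hx' he => ?_⟩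
    rw [key x x' hx hx' he]
    refine withDensity_congr_ae ?_
    have hle := Measure.absolutelyContinuous_of_le (show (R (input τ κ κ' x (y + y'))
        (isPos_input hτ hx hyy)).law (r + 1) ≤ R00.law (r + 1) by
      rw [(splitL x x' (y + y') hx hx' hyy he hr).law hr]; exact Measure.le_add_right le_rfl)
    filter_upwards [hle.ae_le hfin] with z hz
    rw [ENNReal.coe_toNNReal hz.ne]

end Change

end Realization

end SemiClassical

end

/-! ### Orthogonality of the scores of different samples -/

section

/-- The laws of a measurement that uses only local operations: if the input `y + y'` in the place
`κ'` is replaced by `y`, then the law of the data is multiplied by a density that does not depend on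
the input in another place `κ`. -/
structure IsLocalLaw {n : ℕ} (law : (Fin n → TraceClass H) → Measure Ω) : Prop
    extends IsProductLaw law where
  density : ∀ (τ : Fin n → TraceClass H) (κ κ' : Fin n) (w y y' : TraceClass H),
    (∀ j, (τ j).IsPos) → κ ≠ κ' → w.IsPos → y.IsPos → y'.IsPos → ∃ b : Ω → NNReal, Measurable b ∧
      ∀ x x' : TraceClass H, x.IsPos → x'.IsPos → x + x' = w →
        law (input τ κ κ' x y) = (law (input τ κ κ' x (y + y'))).withDensity fun ω => b ω

/-- Semi-classical measurements use only local operations. -/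
theorem _root_.QuantumEstimation.SemiClassicalEstimator.isLocalLaw
    [SeparableSpace H] {n m : ℕ} (e : SemiClassicalEstimator H n m) :
    IsLocalLaw e.law where
  add τ κ x y hτ hx hy := by
    obtain ⟨R, hR⟩ := e.isLaw _ (isPos_update hτ κ (hx.add hy))
    obtain ⟨R₁, hR₁⟩ := e.isLaw _ (isPos_update hτ κ hx)
    obtain ⟨R₂, hR₂⟩ := e.isLaw _ (isPos_update hτ κ hy)
    rw [← hR, ← hR₁, ← hR₂]
    exact (SemiClassical.Realization.splits hτ hx hy R R₁ R₂ le_rfl).law le_rfl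
  mass τ hτ := by
    obtain ⟨R, hR⟩ := e.isLaw _ hτ
    rw [← hR, R.law_univ le_rfl, ENNReal.ofReal_prod_of_nonneg fun j _ => (hτ j).tr_re_nonneg]
  density τ κ κ' w y y' hτ hκ hw hy hy' := by
    choose R hR using e.isLaw
    obtain ⟨b, hb, h⟩ := SemiClassical.Realization.exists_density_input hτ hκ hy hy' hw R le_rfl
    refine ⟨b, hb, fun x x' hx hx' he => ?_⟩
    rw [← hR _ (isPos_input hτ hx hy), ← hR _ (isPos_input hτ hx (hy.add hy'))]
    exact h x x' hx hx' he

theorem tendsto_integral_indicator_tailSet {μ : Measure Ω} {T : Ω → ℝ} (hT : Measurable T)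
    {g : Ω → ℝ} (hg : Integrable (fun ω => T ω * g ω) μ) :
    Tendsto (fun k : ℕ => ∫ ω, (tailSet T k)ᶜ.indicator T ω * g ω ∂μ) atTop
      (𝓝 (∫ ω, T ω * g ω ∂μ)) := by
  have h := (tendsto_setIntegral_tailSet hT hg).const_sub (∫ ω, T ω * g ω ∂μ)
  rw [sub_zero] at h
  refine h.congr fun k => ?_
  rw [← integral_add_compl (measurableSet_tailSet hT k) hg, add_sub_cancel_left,
    ← integral_indicator (measurableSet_tailSet hT k).compl]
  congr 1; ext ω
  by_cases hω : ω ∈ (tailSet T k)ᶜ <;> simp [hω]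

theorem abs_indicator_tailSet_le (T : Ω → ℝ) (k : ℕ) (ω : Ω) :
    |(tailSet T k)ᶜ.indicator T ω| ≤ k := by
  by_cases hω : ω ∈ (tailSet T k)ᶜ
  · rw [Set.indicator_of_mem hω]; exact not_lt.1 hω
  · rw [Set.indicator_of_notMem hω]; simp

namespace IsLocalLaw

variable {n : ℕ} {law : (Fin n → TraceClass H) → Measure Ω}

/-- The logarithmic derivatives with respect to two different samples are orthogonal. -/
theorem integral_score_mul_score (h : IsLocalLaw law) {σ : Fin n → TraceClass H}
    (hσ : ∀ j, (σ j).IsDensity) {κ κ' : Fin n} (hκ : κ ≠ κ') {Q X Q' X' : TraceClass H}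
    (ht : IsTangent (σ κ) Q X) (ht' : IsTangent (σ κ') Q' X') (hX : X.tr.re = 0) {ℓ ℓ' : Ω → ℝ}
    (hℓ : IsScore (fun x => law (Function.update σ κ x)) (σ κ) Q X ℓ)
    (hℓ' : IsScore (fun x => law (Function.update σ κ' x)) (σ κ') Q' X' ℓ') :
    ∫ ω, ℓ ω * ℓ' ω ∂law σ = 0 := by
  have hσp : ∀ j, (σ j).IsPos := fun j => (hσ j).1
  have p1 := ht.pos_quad
  have p2 := ht.pos_sum
  have p1' := ht'.pos_quad
  have p2' := ht'.pos_sum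
  set Y := Q + (2 : ℝ) • X + σ κ with hY
  set Y' := Q' + (2 : ℝ) • X' + σ κ' with hY'
  set w := Y + (Q + σ κ) with hw
  set y₀ := Y' + (Q' + σ κ') with hy₀
  have pw : w.IsPos := p2.add (p1.add (hσp κ))
  have py : y₀.IsPos := p2'.add (p1'.add (hσp κ'))
  set c := y₀.tr.re with hc
  have c1 : 1 ≤ c := by
    have : c = Y'.tr.re + (Q'.tr.re + (σ κ').tr.re) := by
      rw [hc, hy₀, tr_add Y', tr_add Q' (σ κ'), Complex.add_re, Complex.add_re]
    rw [this, (hσ κ').2, Complex.one_re]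
    linarith [p2'.tr_re_nonneg, p1'.tr_re_nonneg]
  have c0 : ENNReal.ofReal c ≠ 0 := by
    rw [Ne, ENNReal.ofReal_eq_zero, not_le]; linarith
  have hmass : ∀ x y, x.IsPos → y.IsPos → law (input σ κ κ' x y) Set.univ
      = ENNReal.ofReal x.tr.re * ENNReal.ofReal y.tr.re := by
    intro x y hx hy
    rw [h.mass _ (isPos_input hσp hx hy), ← Finset.mul_prod_erase _ _ (Finset.mem_univ κ),
      ← Finset.mul_prod_erase _ _ (Finset.mem_erase.2 ⟨hκ.symm, Finset.mem_univ κ'⟩),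
      Finset.prod_eq_one fun j hj => ?_]
    · simp [hκ]
    · have j1 := Finset.ne_of_mem_erase hj
      have j2 := Finset.ne_of_mem_erase (Finset.mem_of_mem_erase hj)
      rw [input, Function.update_of_ne j1, Function.update_of_ne j2, (hσ j).2]
      simp
  have hfin : ∀ {x y : TraceClass H}, x.IsPos → y.IsPos → IsFiniteMeasure (law (input σ κ κ' x y)) :=
    fun hx hy => h.isFiniteMeasure (isPos_input hσp hx hy)
  -- the POVM of the sample `κ` if the other one is in a state that dominates all those in question
  have hN : IsPovm fun x => (ENNReal.ofReal c)⁻¹ • law (input σ κ κ' x y₀) := by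
    refine ⟨fun x y hx hy => ?_, fun x hx => ?_⟩
    · rw [input_eq hκ, h.add _ _ _ _ (isPos_update hσp κ' py) hx hy, smul_add, input_eq hκ,
        input_eq hκ]
    · rw [Measure.smul_apply, hmass x y₀ hx py, smul_eq_mul, mul_comm (ENNReal.ofReal x.tr.re),
        ← mul_assoc, ENNReal.inv_mul_cancel c0 ENNReal.ofReal_ne_top, one_mul]
  obtain ⟨s, hs, -⟩ := hN.exists_score ht
  have hNc : ∀ x, law (input σ κ κ' x y₀)
      = ENNReal.ofReal c • ((ENNReal.ofReal c)⁻¹ • law (input σ κ κ' x y₀)) := fun x => by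
    rw [smul_smul, ENNReal.mul_inv_cancel c0 ENNReal.ofReal_ne_top, one_smul]
  have hscore : ∀ y y', y.IsPos → y'.IsPos → y + y' = y₀ →
      IsScore (fun x => law (input σ κ κ' x y)) (σ κ) Q X s := by
    intro y y' hy hy' hyy
    obtain ⟨b, hb, hbx⟩ := h.density σ κ κ' w y y' hσp hκ pw hy hy'
    rw [hyy] at hbx
    have eY := hbx Y (Q + σ κ) p2 (p1.add (hσp κ)) rfl
    have eQ := hbx Q (Y + σ κ) p1 (p2.add (hσp κ)) (by rw [hw]; abel)
    have eσ := hbx (σ κ) (Y + Q) (hσp κ) (p2.add p1) (by rw [hw]; abel)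
    refine ⟨hs.measurable, ?_, ?_⟩
    · have hle : law (input σ κ κ' (σ κ) y) ≤ law (input σ κ κ' (σ κ) y₀) := by
        rw [← hyy, input, input, h.add _ _ _ _ (isPos_update hσp κ (hσp κ)) hy hy']
        exact Measure.le_add_right le_rfl
      refine MemLp.mono_measure hle ?_
      rw [hNc]
      exact hs.memLp.smul_measure ENNReal.ofReal_ne_top
    · have hid := congrArg (fun μ : Measure Ω => ENNReal.ofReal c • (μ.withDensity fun ω => b ω))
        hs.identity
      have hcomm : ∀ (μ : Measure Ω) (f : Ω → ℝ≥0∞), Measurable f →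
          (μ.withDensity f).withDensity (fun ω => (b ω : ℝ≥0∞))
            = (μ.withDensity fun ω => (b ω : ℝ≥0∞)).withDensity f := fun μ f hf => by
        rw [← withDensity_mul _ hf (by fun_prop), ← withDensity_mul _ (by fun_prop) hf, mul_comm]
      have hm := hs.measurable
      simp only [withDensity_add_measure] at hid
      rw [hcomm _ _ (by fun_prop), hcomm _ _ (by fun_prop), smul_add, smul_add, smul_add,
        ← withDensity_smul_measure, ← withDensity_smul_measure, ← withDensity_smul_measure,
        ← withDensity_smul_measure, ← withDensity_smul_measure, ← withDensity_smul_measure, ← hNc,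
        ← hNc, ← hNc, ← eQ, ← eσ] at hid
      change law (input σ κ κ' Y y) + _ = _
      rw [eY]
      exact hid
  -- the integral of the score vanishes whatever the input of the other sample is
  have hint : ∀ y y', y.IsPos → y'.IsPos → y + y' = y₀ →
      Integrable s (law (input σ κ κ' (σ κ) y)) ∧ ∫ ω, s ω ∂law (input σ κ κ' (σ κ) y) = 0 := by
    intro y y' hy hy' hyy
    have hsy := hscore y y' hy hy' hyy
    have f1 := hfin (hσp κ) hy
    have f2 := hfin p1 hy
    have f3 := hfin p2 hy
    refine ⟨hsy.memLp.integrable one_le_two, ?_⟩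
    have e := hsy.integral_eq_of_isFiniteMeasure (φ := fun _ => 1) measurable_const (c := 1) (by simp)
    simp only [integral_const, smul_eq_mul, mul_one, one_mul] at e
    rw [Measure.real, Measure.real, Measure.real, hmass _ _ p2 hy, hmass _ _ p1 hy,
      hmass _ _ (hσp κ) hy, ENNReal.toReal_mul, ENNReal.toReal_mul, ENNReal.toReal_mul,
      ENNReal.toReal_ofReal p2.tr_re_nonneg, ENNReal.toReal_ofReal p1.tr_re_nonneg,
      ENNReal.toReal_ofReal (hσp κ).tr_re_nonneg, hY, tr_add, tr_add, Complex.add_re,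
      Complex.add_re, tr_real_smul_re, hX] at e
    linarith
  obtain ⟨iY, zY⟩ := hint Y' (Q' + σ κ') p2' (p1'.add (hσp κ')) rfl
  obtain ⟨iQ, zQ⟩ := hint Q' (Y' + σ κ') p1' (p2'.add (hσp κ')) (by rw [hy₀]; abel)
  obtain ⟨iσ, zσ⟩ := hint (σ κ') (Y' + Q') (hσp κ') (p2'.add p1') (by rw [hy₀]; abel)
  have hsσ := hscore (σ κ') (Y' + Q') (hσp κ') (p2'.add p1') (by rw [hy₀]; abel)
  have eκ : ∀ x, input σ κ κ' x (σ κ') = Function.update σ κ x := fun x => by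
    rw [input_eq hκ, Function.update_eq_self]
  have eκ' : ∀ y, input σ κ κ' (σ κ) y = Function.update σ κ' y := fun x => by
    rw [input, Function.update_eq_self]
  simp only [eκ] at hsσ
  simp only [eκ'] at iY zY iQ zQ iσ zσ
  have hss := hsσ.ae_eq (h.isPovm_slot hσ κ) ht hℓ
  simp only [Function.update_eq_self] at hss
  have hae : ∫ ω, ℓ ω * ℓ' ω ∂law σ = ∫ ω, s ω * ℓ' ω ∂law σ := by
    refine integral_congr_ae ?_
    filter_upwards [hss] with ω hω
    rw [hω]
  have m1 := hsσ.memLp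
  have m2 := hℓ'.memLp
  simp only [Function.update_eq_self] at m1 m2 iσ zσ
  rw [hae]
  have hlim := tendsto_integral_indicator_tailSet hs.measurable (m1.integrable_mul m2)
  have hlim1 : ∀ {y}, Integrable s (law (Function.update σ κ' y)) →
      ∫ ω, s ω ∂law (Function.update σ κ' y) = 0 →
      Tendsto (fun k : ℕ => ∫ ω, (tailSet s k)ᶜ.indicator s ω ∂law (Function.update σ κ' y)) atTop
      (𝓝 0) := fun hi hz => by
    have := tendsto_integral_indicator_tailSet hs.measurable (g := fun _ => 1) (by simpa using hi)
    simpa [hz] using this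
  have iσ' : Integrable s (law (Function.update σ κ' (σ κ'))) := by simpa using iσ
  have zσ' : ∫ ω, s ω ∂law (Function.update σ κ' (σ κ')) = 0 := by simpa using zσ
  have hl := ((hlim1 iY zY).sub (hlim1 iQ zQ)).sub (hlim1 iσ' zσ')
  rw [sub_zero, sub_zero] at hl
  have hl2 := hlim.const_mul 2
  have := tendsto_nhds_unique (hl.congr fun k => ?_) hl2
  · linarith
  · have e := hℓ'.integral_eq (h.isPovm_slot hσ κ') ht'
      (hs.measurable.indicator (measurableSet_tailSet hs.measurable k).compl)
      (abs_indicator_tailSet_le s k)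
    simp only [Function.update_eq_self] at e ⊢
    exact e

end IsLocalLaw

end

/-! ### Projection on the scores -/

section

variable {m : ℕ}

theorem _root_.MeasureTheory.MemLp.integrable_fun_mul {μ : Measure Ω} {f g : Ω → ℝ}
    (hf : MemLp f 2 μ) (hg : MemLp g 2 μ) : Integrable (fun ω => f ω * g ω) μ :=
  hf.integrable_mul hg

theorem inner_toLp_eq_integral {μ : Measure Ω} {f g : Ω → ℝ} (hf : MemLp f 2 μ) (hg : MemLp g 2 μ) :
    inner ℝ (hf.toLp f) (hg.toLp g) = ∫ ω, f ω * g ω ∂μ := by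
  rw [L2.inner_def]
  refine integral_congr_ae ?_
  filter_upwards [hf.coeFn_toLp, hg.coeFn_toLp] with ω h1 h2
  rw [h1, h2, RCLike.inner_apply, conj_trivial, mul_comm]

theorem sq_integral_mul_le {μ : Measure Ω} {f g : Ω → ℝ} (hf : MemLp f 2 μ) (hg : MemLp g 2 μ) :
    (∫ ω, f ω * g ω ∂μ) ^ 2 ≤ (∫ ω, f ω ^ 2 ∂μ) * ∫ ω, g ω ^ 2 ∂μ := by
  have h := real_inner_mul_inner_self_le (hf.toLp f) (hg.toLp g)
  rw [inner_toLp_eq_integral, inner_toLp_eq_integral, inner_toLp_eq_integral] at h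
  simp_rw [pow_two]
  exact h

/-- The orthogonal projection in `L²` on the span of finitely many functions. -/
theorem exists_projection {μ : Measure Ω} {g : Fin m → Ω → ℝ} (hg : ∀ j, MemLp (g j) 2 μ)
    {f : Ω → ℝ} (hf : MemLp f 2 μ) :
    ∃ c : Fin m → ℝ, ∀ k, ∫ ω, (f ω - ∑ j, c j * g j ω) * g k ω ∂μ = 0 := by
  set K := Submodule.span ℝ (Set.range fun j => (hg j).toLp (g j)) with hK
  have : FiniteDimensional ℝ K := FiniteDimensional.span_of_finite ℝ (Set.finite_range _)
  obtain ⟨c, hc⟩ := (Submodule.mem_span_range_iff_exists_fun ℝ).1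
    (K.starProjection_apply_mem (hf.toLp f))
  refine ⟨c, fun k => ?_⟩
  have h := K.starProjection_inner_eq_zero (hf.toLp f) ((hg k).toLp (g k))
    (Submodule.subset_span ⟨k, rfl⟩)
  rw [← hc, inner_sub_left, sum_inner, inner_toLp_eq_integral] at h
  simp_rw [real_inner_smul_left, inner_toLp_eq_integral] at h
  simp_rw [sub_mul, Finset.sum_mul, mul_assoc]
  rw [integral_sub (hf.integrable_fun_mul (hg k)) (integrable_finsetSum _ fun j _ =>
    ((hg j).integrable_fun_mul (hg k)).const_mul _), integral_finsetSum _ fun j _ =>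
    ((hg j).integrable_fun_mul (hg k)).const_mul _]
  simp_rw [integral_const_mul]
  exact h

theorem trace_mul_gram_nonneg {μ : Measure Ω} {G : Matrix (Fin m) (Fin m) ℝ} (hG : G.PosSemidef)
    {f : Fin m → Ω → ℝ} (hf : ∀ j, MemLp (f j) 2 μ) :
    0 ≤ (G * Matrix.of fun i j => ∫ ω, f i ω * f j ω ∂μ).trace := by
  have e : (G * Matrix.of fun i j => ∫ ω, f i ω * f j ω ∂μ).trace
      = ∫ ω, ∑ i, ∑ j, G i j * (f j ω * f i ω) ∂μ := by
    have hi : ∀ i, Integrable (fun ω => ∑ j, G i j * (f j ω * f i ω)) μ := fun i =>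
      integrable_finsetSum _ fun j _ => ((hf j).integrable_fun_mul (hf i)).const_mul _
    rw [integral_finsetSum _ fun i _ => hi i]
    simp only [Matrix.trace, Matrix.diag, Matrix.mul_apply, Matrix.of_apply]
    refine Finset.sum_congr rfl fun i _ => ?_
    rw [integral_finsetSum _ fun j _ => ((hf j).integrable_fun_mul (hf i)).const_mul _]
    simp_rw [integral_const_mul]
  rw [e]
  refine integral_nonneg fun ω => ?_
  refine (hG.dotProduct_mulVec_nonneg fun i => f i ω).trans_eq ?_
  simp only [dotProduct, Matrix.mulVec, Finset.mul_sum, Pi.star_apply, star_trivial]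
  exact Finset.sum_congr rfl fun i _ => Finset.sum_congr rfl fun j _ => by ring

/-- An orthogonal projection in `L²` does not increase the weighted second moments. -/
theorem trace_mul_gram_le_of_orthogonal {μ : Measure Ω} {G : Matrix (Fin m) (Fin m) ℝ} (hG : G.PosSemidef)
    {u f : Fin m → Ω → ℝ} (hu : ∀ j, MemLp (u j) 2 μ) (hf : ∀ j, MemLp (f j) 2 μ)
    (h : ∀ i j, ∫ ω, (f i ω - u i ω) * u j ω ∂μ = 0) :
    (G * Matrix.of fun i j => ∫ ω, u i ω * u j ω ∂μ).trace
      ≤ (G * Matrix.of fun i j => ∫ ω, f i ω * f j ω ∂μ).trace := by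
  have e : (Matrix.of fun i j => ∫ ω, f i ω * f j ω ∂μ)
      = (Matrix.of fun i j => ∫ ω, u i ω * u j ω ∂μ)
        + Matrix.of fun i j => ∫ ω, (f i ω - u i ω) * (f j ω - u j ω) ∂μ := by
    ext i j
    simp only [Matrix.add_apply, Matrix.of_apply]
    have d : ∀ i, MemLp (fun ω => f i ω - u i ω) 2 μ := fun i => (hf i).sub (hu i)
    have i1 : Integrable (fun ω => (f i ω - u i ω) * (f j ω - u j ω)) μ := (d i).integrable_fun_mul (d j)
    have i2 : Integrable (fun ω => (f i ω - u i ω) * u j ω) μ := (d i).integrable_fun_mul (hu j)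
    have i3 : Integrable (fun ω => (f j ω - u j ω) * u i ω) μ := (d j).integrable_fun_mul (hu i)
    have i4 : Integrable (fun ω => u i ω * u j ω) μ := (hu i).integrable_fun_mul (hu j)
    have : ∀ ω, f i ω * f j ω = u i ω * u j ω + (f i ω - u i ω) * (f j ω - u j ω)
        + (f i ω - u i ω) * u j ω + (f j ω - u j ω) * u i ω := fun ω => by ring
    simp_rw [this]
    rw [integral_add (show Integrable (fun ω => u i ω * u j ω
      + (f i ω - u i ω) * (f j ω - u j ω) + (f i ω - u i ω) * u j ω) μ from (i4.add i1).add i2) i3,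
      integral_add (show Integrable (fun ω => u i ω * u j ω
      + (f i ω - u i ω) * (f j ω - u j ω)) μ from i4.add i1) i2, integral_add i4 i1, h, h]
    ring
  rw [e, mul_add, Matrix.trace_add]
  exact le_add_of_nonneg_right (trace_mul_gram_nonneg hG fun i => (hf i).sub (hu i))

namespace IsLocalLaw

variable {n : ℕ} {law : (Fin n → TraceClass H) → Measure Ω} {σ : TraceClass H}

theorem memLp_score {Q X : TraceClass H} {ℓ : Ω → ℝ} {κ : Fin n}
    (hℓ : IsScore (fun x => law (Function.update (fun _ => σ) κ x)) σ Q X ℓ) :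
    MemLp ℓ 2 (law fun _ => σ) := by
  have := hℓ.memLp
  rwa [Function.update_eq_self] at this

/-- The Fisher information of all samples is at most additive. -/
theorem sq_integral_mul_sum_score_le (h : IsLocalLaw law) (hσ : σ.IsDensity) {Q X : TraceClass H}
    (ht : IsTangent σ Q X) (hX : X.tr.re = 0) {ℓ : Fin n → Ω → ℝ}
    (hℓ : ∀ κ, IsScore (fun x => law (Function.update (fun _ => σ) κ x)) σ Q X (ℓ κ)) {q : ℝ}
    (hq : ∀ κ, ∫ ω, ℓ κ ω ^ 2 ∂(law fun _ => σ) ≤ q) {f : Ω → ℝ} (hf : MemLp f 2 (law fun _ => σ)) :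
    (∫ ω, f ω * ∑ κ, ℓ κ ω ∂(law fun _ => σ)) ^ 2 ≤ (∫ ω, f ω ^ 2 ∂(law fun _ => σ)) * (n * q) := by
  have hm : ∀ κ, MemLp (ℓ κ) 2 (law fun _ => σ) := fun κ => memLp_score (hℓ κ)
  refine (sq_integral_mul_le hf (memLp_finsetSum _ fun κ _ => hm κ)).trans
    (mul_le_mul_of_nonneg_left ?_ (integral_nonneg fun ω => sq_nonneg _))
  have e : ∀ ω, (∑ κ, ℓ κ ω) ^ 2 = ∑ κ, ∑ κ', ℓ κ ω * ℓ κ' ω := fun ω => by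
    rw [pow_two, Finset.sum_mul_sum]
  simp_rw [e]
  rw [integral_finsetSum _ fun κ _ => integrable_finsetSum _ fun κ' _ =>
    (hm κ).integrable_fun_mul (hm κ')]
  calc ∑ κ, ∫ ω, ∑ κ', ℓ κ ω * ℓ κ' ω ∂(law fun _ => σ)
      = ∑ κ, ∫ ω, ℓ κ ω ^ 2 ∂(law fun _ => σ) := by
        refine Finset.sum_congr rfl fun κ _ => ?_
        rw [integral_finsetSum _ fun κ' _ => (hm κ).integrable_fun_mul (hm κ'),
          Finset.sum_eq_single κ (fun κ' _ hκ => h.integral_score_mul_score (fun _ => hσ) hκ.symm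
            ht ht hX (hℓ κ) (hℓ κ')) (by simp)]
        simp_rw [pow_two]
    _ ≤ ∑ _κ : Fin n, q := Finset.sum_le_sum fun κ _ => hq κ
    _ = n * q := by simp

/-- The best local estimators of the single samples, as good together as the given statistic. -/
theorem exists_isLocalMoment_seq (h : IsLocalLaw law) (hn : 0 < n) {ρ : Param m → TraceClass H}
    {θ : Param m} (hθ : (ρ θ).IsDensity) {Q X : Fin m → TraceClass H}
    (hc : ∀ j, IsCurve (fun t : ℝ => ρ (θ + t • coordVec j)) (Q j) (X j)) {ℓ : Fin n → Fin m → Ω → ℝ}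
    (hℓ : ∀ κ j, IsScore (fun x => law (Function.update (fun _ => ρ θ) κ x)) (ρ θ) (Q j) (X j)
      (ℓ κ j))
    {G : Matrix (Fin m) (Fin m) ℝ} (hG : G.PosSemidef) {f : Fin m → Ω → ℝ}
    (hf : ∀ i, MemLp (f i) 2 (law fun _ => ρ θ)) :
    ∃ (B V : ℕ → Matrix (Fin m) (Fin m) ℝ) (c : ℝ), (∀ k, IsLocalMoment ρ θ (B k) (V k)) ∧
      (∀ i j, Tendsto (fun k => B k i j) atTop
        (𝓝 (∫ ω, f i ω * ∑ κ, ℓ κ j ω ∂(law fun _ => ρ θ)))) ∧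
      Tendsto (fun k => (G * V k).trace) atTop (𝓝 c) ∧
      c ≤ n * (G * Matrix.of fun i j => ∫ ω, f i ω * f j ω ∂(law fun _ => ρ θ)).trace := by
  have htan : ∀ j, IsTangent (ρ θ) (Q j) (X j) := fun j => by simpa using (hc j).tangent
  have hpos : ∀ j, ∀ᶠ t : ℝ in 𝓝 0, (ρ (θ + t • coordVec j)).IsPos := fun j =>
    ((hc j).density).mono fun t ht => ht.1
  have hN := fun κ => h.isPovm_slot (τ := fun _ => ρ θ) (fun _ => hθ) κ
  have hm : ∀ κ j, MemLp (ℓ κ j) 2 (law fun _ => ρ θ) := fun κ j => memLp_score (hℓ κ j)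
  have hgm : ∀ j, MemLp (fun ω => ∑ κ, ℓ κ j ω) 2 (law fun _ => ρ θ) := fun j =>
    memLp_finsetSum _ fun κ _ => hm κ j
  choose c hcp using fun i => exists_projection hgm (hf i)
  set u : Fin m → Ω → ℝ := fun i ω => ∑ j, c i j * ∑ κ, ℓ κ j ω with hu
  set v : Fin n → Fin m → Ω → ℝ := fun κ i ω => ∑ j, c i j * ℓ κ j ω with hv
  have hvm : ∀ κ i, Measurable (v κ i) := fun κ i =>
    Finset.measurable_sum _ fun j _ => (hℓ κ j).measurable.const_mul _
  have hv2 : ∀ κ i, MemLp (v κ i) 2 (law fun _ => ρ θ) := fun κ i =>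
    memLp_finsetSum _ fun j _ => (hm κ j).const_mul _
  have hu2 : ∀ i, MemLp (u i) 2 (law fun _ => ρ θ) := fun i =>
    memLp_finsetSum _ fun j _ => (hgm j).const_mul _
  have huv : ∀ i ω, u i ω = ∑ κ, v κ i ω := fun i ω => by
    simp only [hu, hv, Finset.mul_sum]
    exact Finset.sum_comm
  have hprob := h.isProbabilityMeasure (τ := fun _ => ρ θ) fun _ => hθ
  have hℓ0 : ∀ κ j, ∫ ω, ℓ κ j ω ∂(law fun _ => ρ θ) = 0 := fun κ j => by
    have := (hℓ κ j).integral_eq_zero (hN κ) (htan j) (hc j).tr_re_eq_zero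
    rwa [Function.update_eq_self] at this
  have hv0 : ∀ κ i, ∫ ω, v κ i ω ∂(law fun _ => ρ θ) = 0 := fun κ i => by
    rw [integral_finsetSum _ fun j _ => ((hm κ j).integrable one_le_two).const_mul _]
    simp_rw [integral_const_mul, hℓ0]
    simp
  have hseq := fun κ => IsLocalMoment.exists_seq (hN κ) hθ hc (hℓ κ) (hvm κ)
    (by simpa only [Function.update_eq_self] using hv2 κ)
    (by simpa only [Function.update_eq_self] using hv0 κ)
  simp only [Function.update_eq_self] at hseq
  choose B V hBV hB hV using hseq
  have hn' : (0 : ℝ) < n := by exact_mod_cast hn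
  have horth : ∀ κ κ' j j', κ ≠ κ' → ∫ ω, ℓ κ j ω * ℓ κ' j' ω ∂(law fun _ => ρ θ) = 0 :=
    fun κ κ' j j' hκ => h.integral_score_mul_score (fun _ => hθ) hκ (htan j) (htan j')
      (hc j).tr_re_eq_zero (hℓ κ j) (hℓ κ' j')
  have hvℓ : ∀ κ κ' i j, κ ≠ κ' → ∫ ω, v κ i ω * ℓ κ' j ω ∂(law fun _ => ρ θ) = 0 := by
    intro κ κ' i j hκ
    simp only [hv, Finset.sum_mul, mul_assoc]
    rw [integral_finsetSum _ fun j' _ => ((hm κ j').integrable_fun_mul (hm κ' j)).const_mul _]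
    simp_rw [integral_const_mul, horth κ κ' _ _ hκ]
    simp
  have hvv : ∀ κ κ' i j, κ ≠ κ' → ∫ ω, v κ i ω * v κ' j ω ∂(law fun _ => ρ θ) = 0 := by
    intro κ κ' i j hκ
    have : ∀ ω, v κ i ω * v κ' j ω = ∑ j', c j j' * (v κ i ω * ℓ κ' j' ω) := fun ω => by
      simp only [hv, Finset.mul_sum]
      exact Finset.sum_congr rfl fun j' _ => by ring
    simp_rw [this]
    rw [integral_finsetSum _ fun j' _ => ((hv2 κ i).integrable_fun_mul (hm κ' j')).const_mul _]
    simp_rw [integral_const_mul, hvℓ κ κ' _ _ hκ]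
    simp
  have hproj : ∀ i k, ∫ ω, (f i ω - u i ω) * (∑ κ, ℓ κ k ω) ∂(law fun _ => ρ θ) = 0 :=
    fun i k => hcp i k
  have hfu : ∀ i j, ∫ ω, (f i ω - u i ω) * u j ω ∂(law fun _ => ρ θ) = 0 := by
    intro i j
    have : ∀ ω, (f i ω - u i ω) * u j ω
        = ∑ j', c j j' * ((f i ω - u i ω) * ∑ κ, ℓ κ j' ω) := fun ω => by
      rw [hu, Finset.mul_sum]
      exact Finset.sum_congr rfl fun j' _ => by ring
    simp_rw [this]
    have hd : MemLp (fun ω => f i ω - u i ω) 2 (law fun _ => ρ θ) := (hf i).sub (hu2 i)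
    rw [integral_finsetSum _ fun j' _ => (hd.integrable_fun_mul (hgm j')).const_mul _]
    simp_rw [integral_const_mul, hproj]
    simp
  have hBsum : ∀ i j, ∑ κ, ∫ ω, v κ i ω * ℓ κ j ω ∂(law fun _ => ρ θ)
      = ∫ ω, f i ω * ∑ κ, ℓ κ j ω ∂(law fun _ => ρ θ) := by
    intro i j
    have e1 : ∫ ω, f i ω * ∑ κ, ℓ κ j ω ∂(law fun _ => ρ θ)
        = ∫ ω, u i ω * ∑ κ, ℓ κ j ω ∂(law fun _ => ρ θ) := by
      have := hproj i j
      simp_rw [sub_mul] at this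
      rw [integral_sub ((hf i).integrable_fun_mul (hgm j)) ((hu2 i).integrable_fun_mul (hgm j))] at this
      linarith
    rw [e1]
    simp_rw [huv, Finset.sum_mul, Finset.mul_sum]
    rw [integral_finsetSum _ fun κ _ => integrable_finsetSum _ fun κ' _ =>
      (hv2 κ i).integrable_fun_mul (hm κ' j)]
    refine Finset.sum_congr rfl fun κ _ => ?_
    rw [integral_finsetSum _ fun κ' _ => (hv2 κ i).integrable_fun_mul (hm κ' j)]
    exact (Finset.sum_eq_single κ (fun κ' _ hκ => hvℓ κ κ' i j hκ.symm) (by simp)).symm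
  have hVsum : (∑ κ, Matrix.of fun i j => ∫ ω, v κ i ω * v κ j ω ∂(law fun _ => ρ θ))
      = Matrix.of fun i j => ∫ ω, u i ω * u j ω ∂(law fun _ => ρ θ) := by
    ext i j
    rw [Matrix.sum_apply]
    simp only [Matrix.of_apply]
    simp_rw [huv, Finset.sum_mul_sum]
    rw [integral_finsetSum _ fun κ _ => integrable_finsetSum _ fun κ' _ =>
      (hv2 κ i).integrable_fun_mul (hv2 κ' j)]
    refine Finset.sum_congr rfl fun κ _ => ?_
    rw [integral_finsetSum _ fun κ' _ => (hv2 κ i).integrable_fun_mul (hv2 κ' j)]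
    exact (Finset.sum_eq_single κ (fun κ' _ hκ => hvv κ κ' i j hκ.symm) (by simp)).symm
  refine ⟨fun k => ∑ κ, B κ k, fun k => ∑ κ, ((n : ℝ)⁻¹)⁻¹ • V κ k,
    n * (G * Matrix.of fun i j => ∫ ω, u i ω * u j ω ∂(law fun _ => ρ θ)).trace, fun k => ?_,
    fun i j => ?_, ?_, ?_⟩
  · exact IsLocalMoment.mixture hpos hθ.1 (w := fun _ => (n : ℝ)⁻¹) (fun _ => by positivity)
      (by simp [hn'.ne']) fun κ => hBV κ k
  · rw [← hBsum]
    simp_rw [Matrix.sum_apply]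
    exact tendsto_finsetSum _ fun κ _ => hB κ i j
  · have hlim : Tendsto (fun k => ∑ κ, ((n : ℝ)⁻¹)⁻¹ • V κ k) atTop
        (𝓝 (∑ κ, ((n : ℝ)⁻¹)⁻¹ • Matrix.of fun i j => ∫ ω, v κ i ω * v κ j ω ∂(law fun _ => ρ θ))) := by
      refine tendsto_finsetSum _ fun κ _ => Tendsto.const_smul ?_ _
      exact tendsto_pi_nhds.2 fun i => tendsto_pi_nhds.2 fun j => hV κ i j
    have hcont : Continuous fun V : Matrix (Fin m) (Fin m) ℝ => (G * V).trace := by fun_prop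
    have := (hcont.tendsto _).comp hlim
    rw [← Finset.smul_sum, hVsum, inv_inv, Matrix.mul_smul, Matrix.trace_smul, smul_eq_mul] at this
    exact this.congr fun k => by simp
  · exact mul_le_mul_of_nonneg_left (trace_mul_gram_le_of_orthogonal hG hu2 hf hfu) hn'.le

end IsLocalLaw

end

/-! ### The single-sample bound is a lower bound -/

section

variable {n m : ℕ}

theorem IsProductLaw.isLocalLaw {law : (Fin 1 → TraceClass H) → Measure Ω} (h : IsProductLaw law) :
    IsLocalLaw law :=
  ⟨h, fun _ κ κ' _ _ _ _ hκ => absurd (Subsingleton.elim κ κ') hκ⟩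

theorem memLp_coord_of_lintegral_le {μ : Measure Ω} {T : Ω → Param m} (hT : Measurable T)
    {θ : Param m} {a : ℝ} (h : ∫⁻ ω, ‖T ω - θ‖ₑ ^ 2 ∂μ ≤ ENNReal.ofReal a) (i : Fin m) :
    MemLp (fun ω => T ω i - θ i) 2 μ ∧ ∫ ω, (T ω i - θ i) ^ 2 ∂μ ≤ max a 0 := by
  have hm : Measurable fun ω => T ω i - θ i := ((measurable_coord i).comp hT).sub_const _
  have hle : ∫⁻ ω, ENNReal.ofReal ((T ω i - θ i) ^ 2) ∂μ ≤ ENNReal.ofReal a := by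
    refine (lintegral_mono fun ω => ?_).trans h
    rw [← ofReal_norm, ← ENNReal.ofReal_pow (norm_nonneg _)]
    refine ENNReal.ofReal_le_ofReal ?_
    rw [← sq_abs]
    exact pow_le_pow_left₀ (abs_nonneg _) (abs_coord_le (T ω - θ) i) 2
  refine ⟨(memLp_two_iff_integrable_sq hm.aestronglyMeasurable).2
    ⟨(hm.pow_const 2).aestronglyMeasurable, ?_⟩, ?_⟩
  · rw [hasFiniteIntegral_iff_ofReal (Eventually.of_forall fun ω => sq_nonneg _)]
    exact hle.trans_lt ENNReal.ofReal_lt_top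
  · rw [integral_eq_lintegral_of_nonneg_ae (Eventually.of_forall fun ω => sq_nonneg _)
      (hm.pow_const 2).aestronglyMeasurable, ← ENNReal.toReal_ofReal']
    exact ENNReal.toReal_mono ENNReal.ofReal_ne_top hle

namespace Estimator

variable {Θ : Set (Param m)} {ρ : Param m → TraceClass H} {a₁ : ℝ} {θ : Param m}

/-- The mean of an estimator with locally bounded second moments is differentiable. -/
theorem hasDerivAt_mean (e : Estimator H n m Ω) (hlaw : IsProductLaw e.law)
    (hΘ : IsOpen Θ) (hρ : ∀ θ ∈ Θ, (ρ θ).IsDensity) (hθ : θ ∈ Θ) {a : ℝ}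
    (ha : ∀ θ' ∈ Θ, ∫⁻ ω, ‖e.est ω - θ'‖ₑ ^ 2 ∂e.iidLaw (ρ θ') ≤ ENNReal.ofReal a)
    {Q X : TraceClass H} {j : Fin m} (hc : IsCurve (fun t : ℝ => ρ (θ + t • coordVec j)) Q X)
    {ℓ : Fin n → Ω → ℝ}
    (hℓ : ∀ κ, IsScore (fun x => e.law (Function.update (fun _ => ρ θ) κ x)) (ρ θ) Q X (ℓ κ))
    (i : Fin m) : HasDerivAt (fun t : ℝ => e.mean ρ (θ + t • coordVec j) i)
      (∫ ω, (e.est ω i - θ i) * ∑ κ, ℓ κ ω ∂(e.law fun _ => ρ θ)) 0 := by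
  have hmem : ∀ᶠ t : ℝ in 𝓝 0, θ + t • coordVec j ∈ Θ ∧ |t| < 1 := by
    have h1 : Tendsto (fun t : ℝ => θ + t • coordVec j) (𝓝 0) (𝓝 θ) := by
      have : Continuous fun t : ℝ => θ + t • (coordVec j : Param m) := by fun_prop
      simpa using this.tendsto 0
    refine (h1.eventually (hΘ.mem_nhds hθ)).and ?_
    have : Tendsto (fun t : ℝ => |t|) (𝓝 0) (𝓝 0) := by simpa using (continuous_abs.tendsto (0 : ℝ))
    exact this.eventually (gt_mem_nhds one_pos)
  have hm : Measurable fun ω => e.est ω i - θ i :=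
    ((measurable_coord i).comp e.measurable_est).sub_const _
  have key : ∀ t : ℝ, θ + t • coordVec j ∈ Θ ∧ |t| < 1 →
      Integrable (fun ω => (e.est ω i - θ i)) (e.law fun _ => ρ (θ + t • coordVec j)) ∧
      Integrable (fun ω => (e.est ω i - θ i) ^ 2) (e.law fun _ => ρ (θ + t • coordVec j)) ∧
      ∫ ω, (e.est ω i - θ i) ^ 2 ∂(e.law fun _ => ρ (θ + t • coordVec j)) ≤ 2 * max a 0 + 2 := by
    rintro t ⟨ht, ht1⟩
    have hp := hlaw.isProbabilityMeasure (τ := fun _ => ρ (θ + t • coordVec j)) fun _ => hρ _ ht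
    obtain ⟨h1, h2⟩ := memLp_coord_of_lintegral_le (μ := e.law fun _ => ρ (θ + t • coordVec j))
      e.measurable_est (ha _ ht) i
    set d : ℝ := (θ + t • coordVec j : Param m) i - θ i with hd
    have hd1 : |d| ≤ 1 := by
      have : d = (t • coordVec j : Param m) i := by simp [hd]
      rw [this]
      refine (abs_coord_le _ i).trans ?_
      rw [norm_smul, coordVec]
      simpa using ht1.le
    have e1 : ∀ ω, e.est ω i - θ i = (e.est ω i - (θ + t • coordVec j : Param m) i) + d :=
      fun ω => by rw [hd]; ring
    have hL : MemLp (fun ω => e.est ω i - θ i) 2 (e.law fun _ => ρ (θ + t • coordVec j)) := by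
      simp_rw [e1]
      exact h1.add (memLp_const d)
    refine ⟨hL.integrable one_le_two, hL.integrable_sq, ?_⟩
    have h3 : ∫ ω, (e.est ω i - θ i) ^ 2 ∂(e.law fun _ => ρ (θ + t • coordVec j))
        ≤ ∫ ω, (2 * (e.est ω i - (θ + t • coordVec j : Param m) i) ^ 2 + 2)
          ∂(e.law fun _ => ρ (θ + t • coordVec j)) := by
      refine integral_mono hL.integrable_sq ((h1.integrable_sq.const_mul 2).add
        (integrable_const _)) fun ω => ?_
      change (e.est ω i - θ i) ^ 2 ≤ 2 * (e.est ω i - (θ + t • coordVec j : Param m) i) ^ 2 + 2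
      rw [e1]
      have := (sq_le_one_iff_abs_le_one d).2 hd1
      nlinarith [sq_nonneg ((e.est ω i - (θ + t • coordVec j : Param m) i) - d)]
    rw [integral_add (h1.integrable_sq.const_mul 2) (integrable_const _), integral_const_mul] at h3
    simp only [integral_const, probReal_univ, smul_eq_mul, one_mul] at h3
    linarith
  have h0 : ρ (θ + (0 : ℝ) • coordVec j) = ρ θ := by simp
  have hder := hlaw.hasDerivAt_of_isCurve hc (ℓ := ℓ) (by simpa only [h0] using hℓ) hm
    (C := 2 * max a 0 + 2) (hmem.mono fun t ht => (key t ht).2)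
  simp only [h0] at hder
  refine (hder.add_const (θ i)).congr_of_eventuallyEq ?_
  filter_upwards [hmem] with t ht
  have hp := hlaw.isProbabilityMeasure (τ := fun _ => ρ (θ + t • coordVec j)) fun _ => hρ _ ht.1
  have hi := (key t ht).1
  have h2 := integral_add hi (integrable_const (θ i))
  simp only [sub_add_cancel, integral_const, probReal_univ, smul_eq_mul, one_mul] at h2
  exact h2

/-- An estimator on `n` samples yields a measurement on a single sample with nearly the same
derivatives of the mean and at most `n` times the mean square error. -/
theorem exists_isLocalMoment (e : Estimator H n m Ω) (hn : 0 < n) (hlaw : IsLocalLaw e.law)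
    (hΘ : IsOpen Θ) (hρ : ∀ θ ∈ Θ, (ρ θ).IsDensity) (h_smooth : SmoothModel Θ ρ a₁)
    (h_log : ∀ θ ∈ Θ, ∀ i, HasLogDerivative (ρ θ) (pderiv i ρ θ)) (hθ : θ ∈ Θ)
    {G : Matrix (Fin m) (Fin m) ℝ} (hG : G.PosSemidef) {B : Matrix (Fin m) (Fin m) ℝ}
    (hB : e.HasMeanDeriv ρ θ B) {a : ℝ}
    (ha : ∀ θ' ∈ Θ, ∫⁻ ω, ‖e.est ω - θ'‖ₑ ^ 2 ∂e.iidLaw (ρ θ') ≤ ENNReal.ofReal a) {c : ℝ}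
    (hc : n * (G * e.mse ρ θ).trace < c) {η : ℝ} (hη : 0 < η) :
    ∃ B' V, IsLocalMoment ρ θ B' V ∧ (∀ i j, |B' i j - B i j| < η) ∧ (G * V).trace ≤ c := by
  choose Q hQ using fun j => h_smooth.exists_isCurve hΘ hρ h_log hθ j
  have hN := fun κ => hlaw.isPovm_slot (τ := fun _ => ρ θ) (fun _ => hρ θ hθ) κ
  have htan : ∀ j, IsTangent (ρ θ) (Q j) (pderiv j ρ θ) := fun j => by simpa using (hQ j).tangent
  choose ℓ hℓ _ using fun κ j => (hN κ).exists_score (htan j)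
  obtain ⟨B', V, c', hBV, hB', hV, hc'⟩ := hlaw.exists_isLocalMoment_seq hn (hρ θ hθ) hQ hℓ hG
    (f := fun i ω => e.est ω i - θ i)
    fun i => (memLp_coord_of_lintegral_le e.measurable_est (ha θ hθ) i).1
  have hBeq : ∀ i j, B i j = ∫ ω, (e.est ω i - θ i) * ∑ κ, ℓ κ j ω ∂(e.law fun _ => ρ θ) :=
    fun i j => (hB i j).unique (e.hasDerivAt_mean hlaw.toIsProductLaw hΘ hρ hθ ha (hQ j)
      (fun κ => hℓ κ j) i)
  have h1 : ∀ᶠ k in atTop, ∀ i j, |B' k i j - B i j| < η := by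
    refine eventually_all.2 fun i => eventually_all.2 fun j => ?_
    have := hB' i j
    rw [← hBeq] at this
    exact (Metric.tendsto_nhds.1 this η hη)
  have h2 : ∀ᶠ k in atTop, (G * V k).trace < c := hV.eventually (gt_mem_nhds (hc'.trans_lt hc))
  obtain ⟨k, hk1, hk2⟩ := (h1.and h2).exists
  exact ⟨B' k, V k, hBV k, hk1, hk2.le⟩

end Estimator

section Bounds

variable {Θ : Set (Param m)} {ρ : Param m → TraceClass H} {a₁ : ℝ} {θ : Param m}

theorem eventually_isDensity (hΘ : IsOpen Θ) (hρ : ∀ θ ∈ Θ, (ρ θ).IsDensity) (hθ : θ ∈ Θ)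
    (j : Fin m) : ∀ᶠ t : ℝ in 𝓝 0, (ρ (θ + t • coordVec j)).IsDensity := by
  have h1 : Tendsto (fun t : ℝ => θ + t • coordVec j) (𝓝 0) (𝓝 θ) := by
    have : Continuous fun t : ℝ => θ + t • (coordVec j : Param m) := by fun_prop
    simpa using this.tendsto 0
  exact (h1.eventually (hΘ.mem_nhds hθ)).mono fun t ht => hρ _ ht

/-- No asymptotically unbiased sequence of semi-classical estimators is better than the estimators
on a single sample. -/
theorem singleSampleBound_le_semiClassicalBound [SeparableSpace H]
    (hΘ : IsOpen Θ) (hρ : ∀ θ ∈ Θ, (ρ θ).IsDensity) (h_smooth : SmoothModel Θ ρ a₁)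
    (h_log : ∀ θ ∈ Θ, ∀ i, HasLogDerivative (ρ θ) (pderiv i ρ θ)) (hθ : θ ∈ Θ)
    {G : Matrix (Fin m) (Fin m) ℝ} (hG : G.PosSemidef) (D : Fin m → Param m → TraceClass H) :
    singleSampleBound (fun _ e => e.BoundedRange) ρ G θ ≤ semiClassicalBound Θ ρ D a₁ G θ := by
  refine le_iInf fun e => le_iInf fun _ => le_iInf fun hu => le_iInf fun hm => ?_
  refine EReal.le_of_forall_lt_iff_le.1 fun c hc => ?_
  refine IsLocalMoment.singleSampleBound_le_of_approx (eventually_isDensity hΘ hρ hθ) (hρ θ hθ) G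
    fun η hη => ?_
  obtain ⟨-, B, hB, hBlim⟩ := hu θ hθ
  have h1 : ∀ᶠ n in atTop, ∀ i j, |B n i j - (1 : Matrix (Fin m) (Fin m) ℝ) i j| < η / 2 := by
    refine eventually_all.2 fun i => eventually_all.2 fun j => ?_
    exact Metric.tendsto_nhds.1 (tendsto_pi_nhds.1 (tendsto_pi_nhds.1 hBlim i) j) _ (half_pos hη)
  obtain ⟨n, ⟨hn1, hn2⟩, hn⟩ := ((h1.and (eventually_lt_of_limsup_lt hc)).and
    (eventually_gt_atTop 0)).exists
  obtain ⟨a, ha⟩ := hm n hn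
  obtain ⟨B', V, hBV, hB', hV⟩ := (e n).toEstimator.exists_isLocalMoment hn (e n).isLocalLaw hΘ hρ
    h_smooth h_log hθ hG (hB n hn) (fun θ' hθ' => (ha θ' hθ').2) (EReal.coe_lt_coe_iff.1 hn2)
    (half_pos hη)
  refine ⟨B', V, hBV, fun i j => ?_, hV⟩
  have := abs_sub_le (B' i j) (B n i j) ((1 : Matrix (Fin m) (Fin m) ℝ) i j)
  linarith [hB' i j, hn1 i j]

/-- The reduction of `n` samples to a single one, for `n = 1`, replaces an unbounded estimate by a
bounded one. -/
theorem singleSampleBound_boundedRange_le (hΘ : IsOpen Θ) (hρ : ∀ θ ∈ Θ, (ρ θ).IsDensity)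
    (h_smooth : SmoothModel Θ ρ a₁)
    (h_log : ∀ θ ∈ Θ, ∀ i, HasLogDerivative (ρ θ) (pderiv i ρ θ)) (hθ : θ ∈ Θ)
    {G : Matrix (Fin m) (Fin m) ℝ} (hG : G.PosSemidef) (D : Fin m → Param m → TraceClass H) :
    singleSampleBound (fun _ e => e.BoundedRange) ρ G θ
      ≤ singleSampleBound (fun _ e => e.MomentBound Θ ρ D a₁) ρ G θ := by
  refine le_iInf fun l => le_iInf fun M => le_iInf fun T => le_iInf fun hT => le_iInf fun hu =>
    le_iInf fun hm => ?_
  refine EReal.le_of_forall_lt_iff_le.1 fun c hc => ?_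
  refine IsLocalMoment.singleSampleBound_le_of_approx (eventually_isDensity hΘ hρ hθ) (hρ θ hθ) G
    fun η hη => ?_
  obtain ⟨a, ha⟩ := hm
  have hcov : (M.singleEstimator T hT).cov ρ θ = (M.singleEstimator T hT).mse ρ θ := by
    unfold Estimator.cov Estimator.mse
    simp_rw [hu.1]
  refine (M.singleEstimator T hT).exists_isLocalMoment one_pos
    (IsProductLaw.isLocalLaw M.isPovm_outcome.isProductLaw) hΘ hρ h_smooth h_log hθ hG hu.2
    (fun θ' hθ' => (ha θ' hθ').2) ?_ hη
  rw [← hcov]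
  simpa using EReal.coe_lt_coe_iff.1 hc

end Bounds

end

/-! ### Independent measurements as one-way measurements -/

section

theorem IsPovm.smul {N : TraceClass H → Measure Ω} (hN : IsPovm N) {x : TraceClass H} (hx : x.IsPos)
    {c : ℝ} (hc : 0 ≤ c) : N (c • x) = ENNReal.ofReal c • N x := by
  have := hN.isFiniteMeasure hx
  have := hN.isFiniteMeasure (hx.smul hc)
  have f : IsFiniteMeasure (ENNReal.ofReal c • N x) := Measure.smul_finite _ ENNReal.ofReal_ne_top
  ext Δ hΔ
  have h := hN.effect_of_isPos Δ (hx.smul hc)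
  rw [map_smul, hN.effect_of_isPos Δ hx, smul_eq_mul] at h
  rw [← ofReal_measureReal, ← h, Measure.smul_apply, smul_eq_mul, ENNReal.ofReal_mul hc,
    ofReal_measureReal]

namespace TraceClass

/-- The state proportional to a positive trace class operator, and `σ₀` if this operator is zero. -/
def normalize (σ₀ τ : TraceClass H) : TraceClass H := if τ.tr.re = 0 then σ₀ else (τ.tr.re)⁻¹ • τ

theorem isDensity_normalize {σ₀ τ : TraceClass H} (hσ₀ : σ₀.IsDensity) (hτ : τ.IsPos) :
    (normalize σ₀ τ).IsDensity := by
  unfold normalize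
  split_ifs with h
  · exact hσ₀
  · refine ⟨hτ.smul (inv_nonneg.2 hτ.tr_re_nonneg), ?_⟩
    rw [← Complex.coe_smul, tr_smul, hτ.tr_eq_re, Complex.ofReal_re, Complex.ofReal_inv,
      inv_mul_cancel₀ (by exact_mod_cast h)]

theorem eq_smul_normalize {σ₀ τ : TraceClass H} (hτ : τ.IsPos) :
    τ = τ.tr.re • normalize σ₀ τ := by
  unfold normalize
  split_ifs with h
  · rw [h, zero_smul, ← norm_eq_zero, hτ.norm_eq, h]
  · rw [smul_smul, mul_inv_cancel₀ h, one_smul]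

end TraceClass

open Classical in
variable (H) in
/-- The instrument that does nothing and reports `x₀`. -/
def Instrument.idle (x₀ : Ω) : Instrument H Ω where
  toFun Δ := if x₀ ∈ Δ then LinearMap.id else 0
  completelyPositive Δ _ k A hA x := by
    split_ifs
    · exact hA x
    · simp
  tracePreserving τ := by simp
  sigmaAdditive Δ _ hd τ := by
    by_cases h : x₀ ∈ ⋃ j, Δ j
    · obtain ⟨j, hj⟩ := Set.mem_iUnion.1 h
      rw [if_pos h]
      convert hasSum_single (f := fun j => (if x₀ ∈ Δ j then (LinearMap.id : _ →ₗ[ℂ] TraceClass H)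
        else 0) τ) j fun j' hj' => ?_ using 1
      · simp [hj]
      · have : x₀ ∉ Δ j' := fun h' => Set.disjoint_left.1 (hd hj') h' hj
        simp [this]
    · rw [if_neg h]
      have : ∀ j, x₀ ∉ Δ j := fun j hj => h (Set.mem_iUnion.2 ⟨j, hj⟩)
      simp only [this, if_false]
      exact hasSum_zero

theorem Instrument.isTrivial_idle (x₀ : Ω) : (Instrument.idle H x₀).IsTrivial :=
  ⟨x₀, fun Δ _ τ => ⟨fun h => by simp [idle, h], fun h => by simp [idle, h]⟩⟩

theorem Instrument.outcome_idle (x₀ : Ω) {τ : TraceClass H} (hτ : τ.IsDensity) :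
    (Instrument.idle H x₀).outcome τ = Measure.dirac x₀ := by
  ext Δ hΔ
  rw [Instrument.outcome_apply _ hτ.1 hΔ, Measure.dirac_apply' _ hΔ]
  by_cases h : x₀ ∈ Δ <;> simp [idle, h, hτ.2, tr_zero]

theorem cbMeasurable_const {Z : Type*} [MeasurableSpace Z]
    (Λ : TraceClass H →ₗ[ℂ] TraceClass H) : CbMeasurable fun _ : Z => Λ := by
  refine ⟨fun _ => SimpleFunc.const Z Λ, fun z => ?_⟩
  have h : cbNorm (Λ - Λ) = 0 := by
    simp [cbNorm, blockOp, traceNorm_zero]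
  simp only [SimpleFunc.const_apply, h]
  exact tendsto_const_nhds

theorem measurable_update_prod {ι : Type*} [DecidableEq ι] {W : Type*} [MeasurableSpace W] (r : ι) :
    Measurable fun p : (ι → W) × W => Function.update p.1 r p.2 := by
  refine measurable_pi_lambda _ fun i => ?_
  by_cases hi : i = r
  · subst hi; simpa using measurable_snd
  · simp only [Function.update_of_ne hi]
    exact (measurable_pi_apply i).comp measurable_fst

/-- A coordinate of a product measure can be replaced by an independent copy. -/
theorem map_update_pi {ι : Type*} [Fintype ι] [DecidableEq ι] {W : Type*} [MeasurableSpace W]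
    (μ : ι → Measure W) [∀ i, IsFiniteMeasure (μ i)] (r : ι) (ν : Measure W)
    [IsProbabilityMeasure ν] {c : ℝ≥0∞} (h : μ r = c • ν) :
    ((Measure.pi μ).prod ν).map (fun p => Function.update p.1 r p.2) = Measure.pi μ := by
  have hm : Measurable fun p : (ι → W) × W => Function.update p.1 r p.2 := measurable_update_prod r
  refine (Measure.pi_eq fun s hs => ?_).symm
  have e : (fun p : (ι → W) × W => Function.update p.1 r p.2) ⁻¹' Set.univ.pi s
      = (Set.univ.pi (Function.update s r Set.univ)) ×ˢ s r := by
    ext ⟨w, x⟩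
    simp only [Set.mem_preimage, Set.mem_univ_pi, Set.mem_prod]
    constructor
    · intro hh
      refine ⟨fun i => ?_, by simpa using hh r⟩
      by_cases hi : i = r
      · subst hi; simp
      · simpa [hi] using hh i
    · rintro ⟨h1, h2⟩ i
      by_cases hi : i = r
      · subst hi; simpa using h2
      · simpa [hi] using h1 i
  rw [Measure.map_apply hm (MeasurableSet.univ_pi hs), e, Measure.prod_prod, Measure.pi_pi,
    ← Finset.mul_prod_erase _ _ (Finset.mem_univ r), ← Finset.mul_prod_erase _ _ (Finset.mem_univ r)]
  have e2 : ∏ i ∈ Finset.univ.erase r, μ i (Function.update s r Set.univ i)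
      = ∏ i ∈ Finset.univ.erase r, μ i (s i) :=
    Finset.prod_congr rfl fun i hi => by rw [Function.update_of_ne (Finset.ne_of_mem_erase hi)]
  rw [e2, Function.update_self, h, Measure.smul_apply, Measure.smul_apply, measure_univ, smul_eq_mul,
    smul_eq_mul, mul_one]
  ring

section OneWay

variable {n l : ℕ} {N : Fin n → TraceClass H → Measure (Fin l → ℝ)} {σ₀ : TraceClass H}

/-- The one-way measurement that measures the sample `κ` with `N κ` in the round `κ`, without regard
to the previous data, and leaves it in the state `σ₀`. -/
def oneWay (hN : ∀ κ, IsPovm (N κ)) (hσ₀ : σ₀.IsDensity) : SemiClassical H n where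
  l := l
  rounds := n
  inst r _ κ := if (κ : ℕ) = r then (hN κ).prepare hσ₀ else Instrument.idle H 0
  measurable_inst _ _ _ _ _ := cbMeasurable_const _

theorem isOneWay_oneWay (hN : ∀ κ, IsPovm (N κ)) (hσ₀ : σ₀.IsDensity) :
    (oneWay hN hσ₀).IsOneWay :=
  ⟨rfl, fun r _ z κ hκ => by
    simp only [oneWay, hκ, if_false]
    exact Instrument.isTrivial_idle 0⟩

/-- The data of the first `r` rounds as a function of the outcomes for the single samples. -/
def record (n l r : ℕ) (w : Fin n → Fin l → ℝ) : History n l r :=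
  fun s κ => if (κ : ℕ) = s then w κ else 0

theorem measurable_record (n l r : ℕ) : Measurable (record n l r) := by
  refine measurable_pi_lambda _ fun s => measurable_pi_lambda _ fun κ => ?_
  unfold record
  split_ifs
  · exact measurable_pi_apply κ
  · exact measurable_const

theorem record_succ {r : ℕ} (hr : r < n) (w : Fin n → Fin l → ℝ) (x : Fin l → ℝ) :
    record n l (r + 1) (Function.update w ⟨r, hr⟩ x)
      = Fin.snoc (α := fun _ => Fin n → Fin l → ℝ) (record n l r w)
        (Function.update (0 : Fin n → Fin l → ℝ) ⟨r, hr⟩ x) := by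
  funext s
  refine Fin.lastCases ?_ (fun s => ?_) s
  · rw [Fin.snoc_last]
    funext κ
    simp only [record, Fin.val_last]
    by_cases h : κ = ⟨r, hr⟩
    · subst h; simp
    · have : (κ : ℕ) ≠ r := fun h' => h (Fin.ext h')
      simp [h, this]
  · rw [Fin.snoc_castSucc]
    funext κ
    simp only [record, Fin.val_castSucc]
    by_cases h : (κ : ℕ) = s
    · have : κ ≠ ⟨r, hr⟩ := fun h' => by
        have := congrArg Fin.val h'
        simp only at this
        omega
      simp [h, this]
    · simp [h]

/-- The law of the outcomes of one round. -/
theorem pi_round {r : ℕ} (hr : r < n) (ν : Measure (Fin l → ℝ)) [IsProbabilityMeasure ν] :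
    (Measure.pi fun κ : Fin n => if (κ : ℕ) = r then ν else Measure.dirac 0)
      = ν.map fun x => Function.update (0 : Fin n → Fin l → ℝ) ⟨r, hr⟩ x := by
  have : ∀ κ : Fin n, IsProbabilityMeasure (if (κ : ℕ) = r then ν else Measure.dirac 0) :=
    fun κ => by split_ifs <;> infer_instance
  have hm : Measurable fun x : Fin l → ℝ => Function.update (0 : Fin n → Fin l → ℝ) ⟨r, hr⟩ x :=
    measurable_update _
  refine Measure.pi_eq fun s hs => ?_
  rw [Measure.map_apply hm (MeasurableSet.univ_pi hs),
    ← Finset.mul_prod_erase _ _ (Finset.mem_univ (⟨r, hr⟩ : Fin n)), if_pos rfl]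
  have e : ∏ κ ∈ Finset.univ.erase (⟨r, hr⟩ : Fin n),
      (if (κ : ℕ) = r then ν else Measure.dirac 0) (s κ)
      = ∏ κ ∈ Finset.univ.erase (⟨r, hr⟩ : Fin n), Measure.dirac 0 (s κ) :=
    Finset.prod_congr rfl fun κ hκ => by
      rw [if_neg fun h => Finset.ne_of_mem_erase hκ (Fin.ext h)]
  rw [e]
  by_cases h : ∀ κ : Fin n, κ ≠ ⟨r, hr⟩ → (0 : Fin l → ℝ) ∈ s κ
  · rw [Finset.prod_eq_one fun κ hκ => by
      rw [Measure.dirac_apply' _ (hs κ), Set.indicator_of_mem (h κ (Finset.ne_of_mem_erase hκ))]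
      rfl, mul_one]
    congr 1
    ext x
    simp only [Set.mem_preimage, Set.mem_univ_pi]
    refine ⟨fun hx => by simpa using hx ⟨r, hr⟩, fun hx κ => ?_⟩
    by_cases hκ : κ = ⟨r, hr⟩
    · subst hκ; simpa using hx
    · simpa [hκ] using h κ hκ
  · push Not at h
    obtain ⟨κ, hκ, h0⟩ := h
    rw [Finset.prod_eq_zero (Finset.mem_erase.2 ⟨hκ, Finset.mem_univ κ⟩) (by
      rw [Measure.dirac_apply' _ (hs κ), Set.indicator_of_notMem h0]), mul_zero]
    refine (congrArg ν (Set.eq_empty_of_forall_notMem fun x hx => ?_)).trans measure_empty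
    have := Set.mem_univ_pi.1 hx κ
    simp only [Function.update_of_ne hκ] at this
    exact h0 this

theorem map_record_zero (hN : ∀ κ, IsPovm (N κ)) {τ : Fin n → TraceClass H}
    (hτ : ∀ κ, (τ κ).IsPos) :
    (Measure.pi fun κ => N κ (τ κ)).map (record n l 0)
      = ENNReal.ofReal (∏ κ, (τ κ).tr.re) • Measure.dirac default := by
  have := fun κ => (hN κ).isFiniteMeasure (hτ κ)
  ext S hS
  rw [Measure.map_apply (measurable_record n l 0) hS, Measure.smul_apply,
    Measure.dirac_apply' _ hS, smul_eq_mul]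
  by_cases h : default ∈ S
  · have e : record n l 0 ⁻¹' S = Set.univ := by
      ext w
      rw [Set.mem_preimage, Subsingleton.elim (record n l 0 w) default]
      exact ⟨fun _ => trivial, fun _ => h⟩
    rw [e, Measure.pi_univ, Set.indicator_of_mem h, Pi.one_apply, mul_one,
      ENNReal.ofReal_prod_of_nonneg fun κ _ => (hτ κ).tr_re_nonneg]
    exact Finset.prod_congr rfl fun κ _ => (hN κ).mass _ (hτ κ)
  · have e : record n l 0 ⁻¹' S = ∅ := by
      ext w
      rw [Set.mem_preimage, Subsingleton.elim (record n l 0 w) default]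
      exact ⟨fun h' => h h', fun h' => h'.elim⟩
    rw [e, Set.indicator_of_notMem h]; simp

/-- The states of the samples after `r` rounds. -/
def roundState (σ₀ : TraceClass H) (τ : Fin n → TraceClass H) (r : ℕ) (κ : Fin n) : TraceClass H :=
  if (κ : ℕ) < r then σ₀ else normalize σ₀ (τ κ)

theorem isDensity_roundState (hσ₀ : σ₀.IsDensity) {τ : Fin n → TraceClass H}
    (hτ : ∀ κ, (τ κ).IsPos) (r : ℕ) (κ : Fin n) : (roundState σ₀ τ r κ).IsDensity := by
  unfold roundState
  split_ifs
  · exact hσ₀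
  · exact isDensity_normalize hσ₀ (hτ κ)

/-- The instruments of the round `r`. -/
def roundInst (hN : ∀ κ, IsPovm (N κ)) (hσ₀ : σ₀.IsDensity) (r : ℕ) (κ : Fin n) :
    Instrument H (Fin l → ℝ) :=
  if (κ : ℕ) = r then (hN κ).prepare hσ₀ else Instrument.idle H 0

theorem map_record_succ (hN : ∀ κ, IsPovm (N κ)) (hσ₀ : σ₀.IsDensity) {τ : Fin n → TraceClass H}
    (hτ : ∀ κ, (τ κ).IsPos) {r : ℕ} (hr : r < n) {S : Set (History n l (r + 1))}
    (hS : MeasurableSet S) :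
    (Measure.pi fun κ => N κ (τ κ)).map (record n l (r + 1)) S
      = ∫⁻ z, (Measure.pi fun κ => (roundInst hN hσ₀ r κ).outcome (roundState σ₀ τ r κ))
        {w | Fin.snoc (α := fun _ => Fin n → Fin l → ℝ) z w ∈ S}
        ∂((Measure.pi fun κ => N κ (τ κ)).map (record n l r)) := by
  have hfin := fun κ => (hN κ).isFiniteMeasure (hτ κ)
  have hp : IsProbabilityMeasure (N ⟨r, hr⟩ (normalize σ₀ (τ ⟨r, hr⟩))) :=
    (hN _).isProbabilityMeasure (isDensity_normalize hσ₀ (hτ _))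
  have hup : Measurable fun x : Fin l → ℝ => Function.update (0 : Fin n → Fin l → ℝ) ⟨r, hr⟩ x :=
    measurable_update _
  have hout : (Measure.pi fun κ => (roundInst hN hσ₀ r κ).outcome (roundState σ₀ τ r κ))
      = (N ⟨r, hr⟩ (normalize σ₀ (τ ⟨r, hr⟩))).map fun x =>
        Function.update (0 : Fin n → Fin l → ℝ) ⟨r, hr⟩ x := by
    rw [← pi_round hr]
    congr 1; funext κ
    by_cases hκ : (κ : ℕ) = r
    · have : κ = ⟨r, hr⟩ := Fin.ext hκ
      subst this
      simp only [roundInst, roundState, lt_irrefl, if_true, if_false]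
      exact (hN _).outcome_prepare hσ₀ (isDensity_normalize hσ₀ (hτ _)).1
    · rw [if_neg hκ, roundInst, if_neg hκ]
      exact Instrument.outcome_idle _ (isDensity_roundState hσ₀ hτ r κ)
  have hS' : MeasurableSet {p : History n l r × (Fin n → Fin l → ℝ) |
      Fin.snoc (α := fun _ => Fin n → Fin l → ℝ) p.1 p.2 ∈ S} := SemiClassical.measurable_snoc hS
  have hfm : IsFiniteMeasure ((Measure.pi fun κ => N κ (τ κ)).map (record n l r)) := inferInstance
  have hpm := Measure.isProbabilityMeasure_map
    (μ := N ⟨r, hr⟩ (normalize σ₀ (τ ⟨r, hr⟩))) hup.aemeasurable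
  rw [hout]
  refine Eq.trans ?_ (Measure.prod_apply hS')
  rw [Measure.map_prod_map _ _ (measurable_record n l r) hup,
    Measure.map_apply ((measurable_record n l r).prodMap hup) hS']
  conv_lhs => rw [← map_update_pi (fun κ => N κ (τ κ)) ⟨r, hr⟩
    (N ⟨r, hr⟩ (normalize σ₀ (τ ⟨r, hr⟩))) (c := ENNReal.ofReal (τ ⟨r, hr⟩).tr.re) (by
      conv_lhs => rw [eq_smul_normalize (σ₀ := σ₀) (hτ ⟨r, hr⟩)]
      exact (hN _).smul (isDensity_normalize hσ₀ (hτ _)).1 (hτ _).tr_re_nonneg)]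
  have hm := measurable_update_prod (W := Fin l → ℝ) (⟨r, hr⟩ : Fin n)
  rw [Measure.map_map (measurable_record n l (r + 1)) hm,
    Measure.map_apply ((measurable_record n l (r + 1)).comp hm) hS]
  congr 1
  ext p
  simp only [Set.mem_preimage, Function.comp, record_succ hr]
  rfl

theorem roundState_succ (hN : ∀ κ, IsPovm (N κ)) (hσ₀ : σ₀.IsDensity) {τ : Fin n → TraceClass H}
    (hτ : ∀ κ, (τ κ).IsPos) (r : ℕ) (κ : Fin n) (A : H →L[ℂ] H) {Δ : Set (Fin l → ℝ)}
    (hΔ : MeasurableSet Δ) :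
    ∫ _ in Δ, opTrace (A ∘L (roundState σ₀ τ (r + 1) κ).op)
        ∂((roundInst hN hσ₀ r κ).outcome (roundState σ₀ τ r κ))
      = opTrace (A ∘L ((roundInst hN hσ₀ r κ).toFun Δ (roundState σ₀ τ r κ)).op) := by
  have hd := isDensity_roundState hσ₀ hτ r κ
  rw [integral_const, measureReal_restrict_apply_univ]
  by_cases hκ : (κ : ℕ) = r
  · have hn := isDensity_normalize hσ₀ (hτ κ)
    simp only [roundInst, roundState, hκ, lt_irrefl, if_true, if_false, Nat.lt_succ_self]
    rw [(hN κ).outcome_prepare hσ₀ hn.1]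
    change _ = opTrace (A ∘L (((hN κ).cEffect Δ _) • σ₀).op)
    rw [(hN κ).cEffect_of_isPos Δ hn.1]
    simp only [opTrace, map_smul, ContinuousLinearMap.comp_smul, smul_apply, inner_smul_right,
      tsum_mul_left, Complex.real_smul]
  · have e : roundState σ₀ τ (r + 1) κ = roundState σ₀ τ r κ := by
      have e : ((κ : ℕ) < r + 1) ↔ ((κ : ℕ) < r) := ⟨fun h => by omega, fun h => by omega⟩
      simp only [roundState, e]
    simp only [roundInst, hκ, if_false, e]
    rw [Instrument.outcome_idle _ hd, Measure.real, Measure.dirac_apply' _ hΔ]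
    by_cases h0 : (0 : Fin l → ℝ) ∈ Δ
    · simp [Instrument.idle, h0]
    · simp [Instrument.idle, h0, opTrace]

/-- The realization of `oneWay` for a product input. -/
def oneWayRealization (hN : ∀ κ, IsPovm (N κ)) (hσ₀ : σ₀.IsDensity) {τ : Fin n → TraceClass H}
    (hτ : ∀ κ, (τ κ).IsPos) : (oneWay hN hσ₀).Realization τ where
  law r := (Measure.pi fun κ => N κ (τ κ)).map (record n l r)
  state r _ κ := roundState σ₀ τ r κ
  measurable_state _ _ _ := stronglyMeasurable_const
  isDensity_state r _ _ κ := isDensity_roundState hσ₀ hτ r κ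
  law_zero := map_record_zero hN hτ
  state_zero κ := by
    have h : τ κ = (τ κ).tr.re • normalize σ₀ (τ κ) := eq_smul_normalize (hτ κ)
    rw [← Complex.coe_smul, ← (hτ κ).tr_eq_re] at h
    exact h
  law_succ _ hr _ hS := map_record_succ hN hσ₀ hτ hr hS
  state_succ r _ κ := Eventually.of_forall fun _ => ⟨fun _ => roundState σ₀ τ (r + 1) κ,
    fun _ => rfl, fun A _ hΔ => roundState_succ hN hσ₀ hτ r κ A hΔ⟩

/-- Independent measurements of the samples can be carried out as a one-way semi-classical
measurement, whose data `h` determine the outcomes `d h` for the single samples. -/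
theorem exists_oneWay (hN : ∀ κ, IsPovm (N κ)) (hσ₀ : σ₀.IsDensity) :
    ∃ (S : SemiClassical H n) (law : (Fin n → TraceClass H) → Measure (History n S.l S.rounds))
      (d : History n S.l S.rounds → Fin n → Fin l → ℝ), S.IsOneWay ∧
      (∀ τ, (∀ κ, (τ κ).IsPos) → S.IsLaw τ (law τ)) ∧ Measurable d ∧
      ∀ τ, (law τ).map d = Measure.pi fun κ => N κ (τ κ) := by
  have hd : Measurable fun h : History n l n => fun κ => h κ κ :=
    measurable_pi_lambda _ fun κ => (measurable_pi_apply κ).comp (measurable_pi_apply κ)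
  refine ⟨oneWay hN hσ₀, fun τ => (Measure.pi fun κ => N κ (τ κ)).map (record n l n),
    fun (h : History n l n) κ => h κ κ, isOneWay_oneWay hN hσ₀,
    fun τ hτ => ⟨oneWayRealization hN hσ₀ hτ, rfl⟩, hd, fun τ => ?_⟩
  refine (Measure.map_map hd (measurable_record n l n)).trans ?_
  convert Measure.map_id using 2
  funext w
  simp [record]

end OneWay

end

/-! ### Measurements of two blocks of samples -/

section

instance isFiniteMeasure_outcome (M : Instrument H Ω) (τ : TraceClass H) :
    IsFiniteMeasure (M.outcome τ) := by
  by_cases h : τ.IsPos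
  · exact M.isPovm_outcome.isFiniteMeasure h
  · rw [Instrument.outcome, dif_neg h]; infer_instance

/-- The measurement of a product of `N + k` samples that measures the first `N` samples with the
instrument `A` and the others with the instrument `B`; the outcomes are `d ω`. -/
structure IsBlockLaw {N k : ℕ} {W Z : Type*} [MeasurableSpace W] [MeasurableSpace Z]
    (A : Instrument H W) (B : Instrument H Z) (law : (Fin (N + k) → TraceClass H) → Measure Ω)
    (d : Ω → (Fin N → W) × (Fin k → Z)) : Prop extends IsLocalLaw law where
  measurable : Measurable d
  map_eq : ∀ τ, (law τ).map d = (Measure.pi fun κ => A.outcome (τ (Fin.castAdd k κ))).prod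
    (Measure.pi fun κ => B.outcome (τ (Fin.natAdd N κ)))

theorem map_append_prod_pi {N k : ℕ} {W : Type*} [MeasurableSpace W] (μ : Fin (N + k) → Measure W)
    [∀ κ, IsFiniteMeasure (μ κ)] :
    ((Measure.pi fun κ : Fin N => μ (Fin.castAdd k κ)).prod
      (Measure.pi fun κ : Fin k => μ (Fin.natAdd N κ))).map (fun p => Fin.append p.1 p.2)
      = Measure.pi μ := by
  have hm : Measurable fun p : (Fin N → W) × (Fin k → W) => Fin.append p.1 p.2 := by
    refine measurable_pi_lambda _ fun κ => ?_
    refine Fin.addCases (fun κ => ?_) (fun κ => ?_) κ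
    · simp only [Fin.append_left]
      exact (measurable_pi_apply κ).comp measurable_fst
    · simp only [Fin.append_right]
      exact (measurable_pi_apply κ).comp measurable_snd
  refine (Measure.pi_eq fun s hs => ?_).symm
  have e : (fun p : (Fin N → W) × (Fin k → W) => Fin.append p.1 p.2) ⁻¹' Set.univ.pi s
      = (Set.univ.pi fun κ => s (Fin.castAdd k κ)) ×ˢ (Set.univ.pi fun κ => s (Fin.natAdd N κ)) := by
    ext p
    simp only [Set.mem_preimage, Set.mem_univ_pi, Set.mem_prod]
    refine ⟨fun h => ⟨fun κ => by simpa using h (Fin.castAdd k κ),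
      fun κ => by simpa using h (Fin.natAdd N κ)⟩, fun h κ => ?_⟩
    refine Fin.addCases (fun κ => ?_) (fun κ => ?_) κ
    · simpa using h.1 κ
    · simpa using h.2 κ
  rw [Measure.map_apply hm (MeasurableSet.univ_pi hs), e, Measure.prod_prod, Measure.pi_pi,
    Measure.pi_pi, Fin.prod_univ_add]

/-- Two instruments that are each applied to its block of samples are a one-way measurement. -/
theorem exists_oneWay_isBlockLaw [SeparableSpace H] {lA lB : ℕ} (N k : ℕ)
    (A : Instrument H (Fin lA → ℝ)) (B : Instrument H (Fin lB → ℝ)) {σ₀ : TraceClass H}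
    (hσ₀ : σ₀.IsDensity) :
    ∃ (S : SemiClassical H (N + k))
      (law : (Fin (N + k) → TraceClass H) → Measure (History (N + k) S.l S.rounds))
      (d : History (N + k) S.l S.rounds → (Fin N → Fin lA → ℝ) × (Fin k → Fin lB → ℝ)),
      S.IsOneWay ∧ (∀ τ, (∀ κ, (τ κ).IsPos) → S.IsLaw τ (law τ)) ∧ IsBlockLaw A B law d := by
  -- both kinds of outcomes are embedded in `ℝ^(lA + lB)`
  have hi : Measurable fun x : Fin lA → ℝ => Fin.append x (0 : Fin lB → ℝ) := by
    refine measurable_pi_lambda _ fun j => ?_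
    refine Fin.addCases (fun j => ?_) (fun j => ?_) j
    · simpa using measurable_pi_apply j
    · simp
  have hj : Measurable fun x : Fin lB → ℝ => Fin.append (0 : Fin lA → ℝ) x := by
    refine measurable_pi_lambda _ fun j => ?_
    refine Fin.addCases (fun j => ?_) (fun j => ?_) j
    · simp
    · simpa using measurable_pi_apply j
  let P : Fin (N + k) → TraceClass H → Measure (Fin (lA + lB) → ℝ) := Fin.addCases
    (fun _ τ => (A.outcome τ).map fun x : Fin lA → ℝ => Fin.append x (0 : Fin lB → ℝ))
    (fun _ τ => (B.outcome τ).map fun x : Fin lB → ℝ => Fin.append (0 : Fin lA → ℝ) x)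
  have hP : ∀ κ, IsPovm (P κ) := fun κ => by
    refine Fin.addCases (fun κ => ?_) (fun κ => ?_) κ
    · simp only [P, Fin.addCases_left]
      exact A.isPovm_outcome.map hi
    · simp only [P, Fin.addCases_right]
      exact B.isPovm_outcome.map hj
  obtain ⟨S, law, d, hS, hlaw, hd, hmap⟩ := exists_oneWay hP hσ₀
  have hw : Measurable fun w : Fin (N + k) → Fin (lA + lB) → ℝ =>
      (fun (κ : Fin N) (j : Fin lA) => w (Fin.castAdd k κ) (Fin.castAdd lB j),
        fun (κ : Fin k) (j : Fin lB) => w (Fin.natAdd N κ) (Fin.natAdd lA j)) := by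
    fun_prop
  refine ⟨S, law, _, hS, hlaw, ⟨?_, hw.comp hd, fun τ => ?_⟩⟩
  · exact (⟨S, law, hlaw, fun _ => (0 : Param 0), measurable_const⟩ :
      SemiClassicalEstimator H (N + k) 0).isLocalLaw
  have hfin : ∀ κ, IsFiniteMeasure (P κ (τ κ)) := fun κ => by
    refine Fin.addCases (fun κ => ?_) (fun κ => ?_) κ
    · simp only [P, Fin.addCases_left]; infer_instance
    · simp only [P, Fin.addCases_right]; infer_instance
  have hm : Measurable fun p : (Fin N → Fin (lA + lB) → ℝ) × (Fin k → Fin (lA + lB) → ℝ) =>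
      Fin.append p.1 p.2 := by
    refine measurable_pi_lambda _ fun κ => ?_
    refine Fin.addCases (fun κ => ?_) (fun κ => ?_) κ
    · simp only [Fin.append_left]
      exact (measurable_pi_apply κ).comp measurable_fst
    · simp only [Fin.append_right]
      exact (measurable_pi_apply κ).comp measurable_snd
  rw [← Measure.map_map hw hd, hmap, ← map_append_prod_pi, Measure.map_map hw hm]
  simp only [P, Fin.addCases_left, Fin.addCases_right]
  rw [← Measure.pi_map_pi (fun _ => hi.aemeasurable), ← Measure.pi_map_pi (fun _ => hj.aemeasurable)]
  have hI : Measurable fun (x : Fin N → Fin lA → ℝ) κ => Fin.append (x κ) (0 : Fin lB → ℝ) :=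
    measurable_pi_lambda _ fun κ => hi.comp (measurable_pi_apply κ)
  have hJ : Measurable fun (x : Fin k → Fin lB → ℝ) κ => Fin.append (0 : Fin lA → ℝ) (x κ) :=
    measurable_pi_lambda _ fun κ => hj.comp (measurable_pi_apply κ)
  rw [Measure.map_prod_map _ _ hI hJ, Measure.map_map (hw.comp hm) (hI.prodMap hJ)]
  convert Measure.map_id using 2
  funext p
  simp [Function.comp_def]

namespace IsBlockLaw

variable {N k : ℕ} {W Z : Type*} [MeasurableSpace W] [MeasurableSpace Z] {A : Instrument H W}
  {B : Instrument H Z} {law : (Fin (N + k) → TraceClass H) → Measure Ω}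
  {d : Ω → (Fin N → W) × (Fin k → Z)}

theorem map_fst (h : IsBlockLaw A B law d) {τ : Fin (N + k) → TraceClass H}
    (hτ : ∀ κ, (τ κ).IsPos) : (law τ).map (fun ω => (d ω).1)
      = (∏ κ, ENNReal.ofReal (τ (Fin.natAdd N κ)).tr.re) •
        Measure.pi fun κ => A.outcome (τ (Fin.castAdd k κ)) := by
  change (law τ).map (Prod.fst ∘ d) = _
  rw [← Measure.map_map measurable_fst h.measurable, h.map_eq, Measure.map_fst_prod, Measure.pi_univ]
  congr 1
  exact Finset.prod_congr rfl fun κ _ => B.isPovm_outcome.mass _ (hτ _)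

theorem map_snd (h : IsBlockLaw A B law d) {τ : Fin (N + k) → TraceClass H}
    (hτ : ∀ κ, (τ κ).IsPos) : (law τ).map (fun ω => (d ω).2)
      = (∏ κ, ENNReal.ofReal (τ (Fin.castAdd k κ)).tr.re) •
        Measure.pi fun κ => B.outcome (τ (Fin.natAdd N κ)) := by
  change (law τ).map (Prod.snd ∘ d) = _
  rw [← Measure.map_map measurable_snd h.measurable, h.map_eq, Measure.map_snd_prod, Measure.pi_univ]
  congr 1
  exact Finset.prod_congr rfl fun κ _ => A.isPovm_outcome.mass _ (hτ _)

theorem map_fst_iid (h : IsBlockLaw A B law d) {σ : TraceClass H} (hσ : σ.IsDensity) :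
    (law fun _ => σ).map (fun ω => (d ω).1) = Measure.pi fun _ => A.outcome σ := by
  rw [h.map_fst fun _ => hσ.1]; simp [hσ.2]

theorem map_snd_iid (h : IsBlockLaw A B law d) {σ : TraceClass H} (hσ : σ.IsDensity) :
    (law fun _ => σ).map (fun ω => (d ω).2) = Measure.pi fun _ => B.outcome σ := by
  rw [h.map_snd fun _ => hσ.1]; simp [hσ.2]

end IsBlockLaw

end

/-! ### Averages and hybrid estimates -/

section

variable {m n : ℕ}

theorem memLp_two_of_sq_le {μ : Measure Ω} {f : Ω → ℝ} (hf : Measurable f) {g : Ω → ℝ≥0∞} {b c : ℝ}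
    (hb : 0 ≤ b) (hc : 0 ≤ c)
    (hfg : ∀ ω, ENNReal.ofReal (f ω ^ 2) ≤ ENNReal.ofReal c * g ω)
    (hg : ∫⁻ ω, g ω ∂μ ≤ ENNReal.ofReal b) :
    MemLp f 2 μ ∧ ∫ ω, f ω ^ 2 ∂μ ≤ c * b := by
  have hle : ∫⁻ ω, ENNReal.ofReal (f ω ^ 2) ∂μ ≤ ENNReal.ofReal (c * b) := by
    refine (lintegral_mono hfg).trans ?_
    rw [lintegral_const_mul' _ _ ENNReal.ofReal_ne_top, ENNReal.ofReal_mul hc]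
    gcongr
  refine ⟨(memLp_two_iff_integrable_sq hf.aestronglyMeasurable).2
    ⟨(hf.pow_const 2).aestronglyMeasurable, ?_⟩, ?_⟩
  · rw [hasFiniteIntegral_iff_ofReal (Eventually.of_forall fun ω => sq_nonneg _)]
    exact hle.trans_lt ENNReal.ofReal_lt_top
  · rw [integral_eq_lintegral_of_nonneg_ae (Eventually.of_forall fun ω => sq_nonneg _)
      (hf.pow_const 2).aestronglyMeasurable]
    exact ENNReal.toReal_le_of_le_ofReal (mul_nonneg hc hb) hle

/-- The derivatives of the means of two estimators based on the same data differ by at most the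
square root of the Fisher information `n q` times their distance in `L²`. -/
theorem Estimator.exists_hasMeanDeriv {Θ : Set (Param m)} {ρ : Param m → TraceClass H} {a₁ : ℝ}
    {θ : Param m} (hΘ : IsOpen Θ) (hρ : ∀ θ ∈ Θ, (ρ θ).IsDensity) (h_smooth : SmoothModel Θ ρ a₁)
    (h_log : ∀ θ ∈ Θ, ∀ i, HasLogDerivative (ρ θ) (pderiv i ρ θ)) (hθ : θ ∈ Θ) :
    ∃ q : ℝ, 0 ≤ q ∧ ∀ {n : ℕ} {Ω : Type} [MeasurableSpace Ω]
      {law : (Fin n → TraceClass H) → Measure Ω} (_ : IsLocalLaw law) {f g : Ω → Param m}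
      (hf : Measurable f) (hg : Measurable g) {a : ℝ}
      (_ : ∀ θ' ∈ Θ, ∫⁻ ω, ‖f ω - θ'‖ₑ ^ 2 ∂(law fun _ => ρ θ') ≤ ENNReal.ofReal a) {b : ℝ}
      (_ : ∀ θ' ∈ Θ, ∫⁻ ω, ‖g ω - θ'‖ₑ ^ 2 ∂(law fun _ => ρ θ') ≤ ENNReal.ofReal b),
      ∃ B B', (Estimator.mk law f hf).HasMeanDeriv ρ θ B ∧
        (Estimator.mk law g hg).HasMeanDeriv ρ θ B' ∧
        ∀ i j, (B i j - B' i j) ^ 2 ≤ (∫ ω, (f ω i - g ω i) ^ 2 ∂(law fun _ => ρ θ)) * (n * q) := by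
  choose Q hQ using fun j => h_smooth.exists_isCurve hΘ hρ h_log hθ j
  have htan : ∀ j, IsTangent (ρ θ) (Q j) (pderiv j ρ θ) := fun j => by simpa using (hQ j).tangent
  have hq : ∀ j, 0 ≤ (Q j).tr.re := fun j => (htan j).pos_quad.tr_re_nonneg
  refine ⟨∑ j, (Q j).tr.re, Finset.sum_nonneg fun j _ => hq j, ?_⟩
  intro n Ω _ law hlaw f g hf hg a ha b hb
  have hN := fun κ => hlaw.isPovm_slot (τ := fun _ => ρ θ) (fun _ => hρ θ hθ) κ
  choose ℓ hℓ hℓq using fun κ j => (hN κ).exists_score (htan j)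
  refine ⟨fun i j => ∫ ω, (f ω i - θ i) * ∑ κ, ℓ κ j ω ∂(law fun _ => ρ θ),
    fun i j => ∫ ω, (g ω i - θ i) * ∑ κ, ℓ κ j ω ∂(law fun _ => ρ θ),
    fun i j => (Estimator.mk law f hf).hasDerivAt_mean hlaw.toIsProductLaw hΘ hρ hθ ha (hQ j)
      (fun κ => hℓ κ j) i,
    fun i j => (Estimator.mk law g hg).hasDerivAt_mean hlaw.toIsProductLaw hΘ hρ hθ hb (hQ j)
      (fun κ => hℓ κ j) i, fun i j => ?_⟩
  have hmf := (memLp_coord_of_lintegral_le hf (ha θ hθ) i).1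
  have hmg := (memLp_coord_of_lintegral_le hg (hb θ hθ) i).1
  have hms : MemLp (fun ω => ∑ κ, ℓ κ j ω) 2 (law fun _ => ρ θ) :=
    memLp_finsetSum _ fun κ _ => IsLocalLaw.memLp_score (hℓ κ j)
  have hmd : MemLp (fun ω => f ω i - g ω i) 2 (law fun _ => ρ θ) := by
    refine (hmf.sub hmg).congr_norm
      (((measurable_coord i).comp hf).sub ((measurable_coord i).comp hg)).aestronglyMeasurable
      (Eventually.of_forall fun ω => ?_)
    simp
  have key := hlaw.sq_integral_mul_sum_score_le (hρ θ hθ) (htan j) (hQ j).tr_re_eq_zero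
    (fun κ => hℓ κ j) (q := ∑ j, (Q j).tr.re) (fun κ => ?_) hmd
  · refine le_of_eq_of_le ?_ key
    rw [← integral_sub (hmf.integrable_fun_mul hms) (hmg.integrable_fun_mul hms)]
    congr 2
    funext ω
    ring
  · refine le_trans ?_ (Finset.single_le_sum (f := fun j => (Q j).tr.re) (fun j _ => hq j)
      (Finset.mem_univ j))
    have := hℓq κ j
    rw [Function.update_eq_self] at this
    rw [integral_eq_lintegral_of_nonneg_ae (Eventually.of_forall fun ω => sq_nonneg _)
      ((hℓ κ j).measurable.pow_const 2).aestronglyMeasurable]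
    exact ENNReal.toReal_le_of_le_ofReal (hq j) this

section Average

variable {Z : Type*} [MeasurableSpace Z] {k : ℕ} (ν : Measure Z) [IsProbabilityMeasure ν]

theorem integral_pi_sum {φ : Z → ℝ} (hφ : Measurable φ) {K : ℝ} (hK : ∀ z, |φ z| ≤ K) :
    ∫ z, ∑ κ, φ (z κ) ∂(Measure.pi fun _ : Fin k => ν) = k * ∫ z, φ z ∂ν := by
  have h : ∀ κ : Fin k, ∫ z, φ (z κ) ∂(Measure.pi fun _ : Fin k => ν) = ∫ z, φ z ∂ν := fun κ => by
    have := (measurePreserving_eval (fun _ : Fin k => ν) κ).map_eq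
    conv_rhs => rw [← this]
    exact (integral_map (measurable_pi_apply κ).aemeasurable hφ.aestronglyMeasurable).symm
  have hi : ∀ κ : Fin k, Integrable (fun z => φ (z κ)) (Measure.pi fun _ : Fin k => ν) := fun κ =>
    integrable_of_abs_le (φ := fun z : Fin k → Z => φ (z κ)) (hφ.comp (measurable_pi_apply κ))
      fun z => hK _
  rw [integral_finsetSum _ fun κ _ => hi κ]
  simp [h]

theorem integral_pi_sum_mul_sum {φ ψ : Z → ℝ} (hφ : Measurable φ) (hψ : Measurable ψ) {K : ℝ}
    (hK : ∀ z, |φ z| ≤ K) (hK' : ∀ z, |ψ z| ≤ K) (h0 : ∫ z, φ z ∂ν = 0) :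
    ∫ z, (∑ κ, φ (z κ)) * ∑ κ, ψ (z κ) ∂(Measure.pi fun _ : Fin k => ν)
      = k * ∫ z, φ z * ψ z ∂ν := by
  have hint : ∀ κ κ' : Fin k, Integrable (fun z => φ (z κ) * ψ (z κ'))
      (Measure.pi fun _ : Fin k => ν) := fun κ κ' =>
    integrable_of_abs_le (φ := fun z : Fin k → Z => φ (z κ) * ψ (z κ')) (c := K * K)
      ((hφ.comp (measurable_pi_apply κ)).mul
      (hψ.comp (measurable_pi_apply κ'))) fun z => by
        rw [abs_mul]
        exact mul_le_mul (hK _) (hK' _) (abs_nonneg _) ((abs_nonneg _).trans (hK (z κ)))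
  have hid := ProbabilityTheory.iIndepFun_pi (μ := fun _ : Fin k => ν)
    (X := fun _ z => z) fun _ => aemeasurable_id
  have h : ∀ κ κ' : Fin k, ∫ z, φ (z κ) * ψ (z κ') ∂(Measure.pi fun _ : Fin k => ν)
      = if κ = κ' then ∫ z, φ z * ψ z ∂ν else 0 := fun κ κ' => by
    split_ifs with hκ
    · subst hκ
      have := (measurePreserving_eval (fun _ : Fin k => ν) κ).map_eq
      conv_rhs => rw [← this]
      have hm : Measurable fun z => φ z * ψ z := hφ.mul hψ
      exact (integral_map (μ := Measure.pi fun _ : Fin k => ν) (φ := fun z => z κ)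
        (f := fun z => φ z * ψ z) (measurable_pi_apply κ).aemeasurable hm.aestronglyMeasurable).symm
    · have hi := (hid.indepFun hκ).comp hφ hψ
      have := hi.integral_fun_mul_eq_mul_integral
        (hφ.comp (measurable_pi_apply κ)).aestronglyMeasurable
        (hψ.comp (measurable_pi_apply κ')).aestronglyMeasurable
      refine this.trans ?_
      have h1 : ∫ z, φ (z κ) ∂(Measure.pi fun _ : Fin k => ν) = 0 := by
        rw [← h0]
        have := (measurePreserving_eval (fun _ : Fin k => ν) κ).map_eq
        conv_rhs => rw [← this]
        exact (integral_map (measurable_pi_apply κ).aemeasurable hφ.aestronglyMeasurable).symm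
      exact mul_eq_zero_of_left h1 _
  simp_rw [Finset.sum_mul_sum]
  rw [integral_finsetSum _ fun κ _ => integrable_finsetSum _ fun κ' _ => hint κ κ']
  simp_rw [integral_finsetSum _ fun κ' _ => hint _ κ', h]
  simp

/-- The average of the estimates `T (z κ)`, and `θ₀` if there are none. -/
def average (T : Z → Param m) (θ₀ : Param m) (z : Fin k → Z) : Param m :=
  θ₀ + (k : ℝ)⁻¹ • ∑ κ, (T (z κ) - θ₀)

variable {T : Z → Param m} {θ₀ : Param m} {K : ℝ}

theorem measurable_average (hT : Measurable T) : Measurable (average T θ₀ : (Fin k → Z) → Param m) := by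
  unfold average
  fun_prop

theorem norm_average_sub_le (hK : ∀ z, ‖T z - θ₀‖ ≤ K) (hK0 : 0 ≤ K) (z : Fin k → Z) :
    ‖average T θ₀ z - θ₀‖ ≤ K := by
  rw [average, add_sub_cancel_left, norm_smul, norm_inv, Real.norm_natCast]
  have h : ‖∑ κ, (T (z κ) - θ₀)‖ ≤ k * K := (norm_sum_le_of_le _ fun κ _ => hK (z κ)).trans (by simp)
  rcases Nat.eq_zero_or_pos k with rfl | hk
  · simpa using hK0
  · rw [inv_mul_le_iff₀ (by exact_mod_cast hk)]
    exact h

theorem average_apply (z : Fin k → Z) (i : Fin m) :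
    average T θ₀ z i - θ₀ i = (k : ℝ)⁻¹ * ∑ κ, (T (z κ) i - θ₀ i) := by
  simp [average]

theorem integral_average (hT : Measurable T) (hK : ∀ z, ‖T z - θ₀‖ ≤ K) (hk : 0 < k) (i : Fin m) :
    ∫ z, average T θ₀ z i ∂(Measure.pi fun _ : Fin k => ν) = ∫ z, T z i ∂ν := by
  have hm : Measurable fun z => T z i - θ₀ i := ((measurable_coord i).comp hT).sub_const _
  have hb : ∀ z, |T z i - θ₀ i| ≤ K := fun z => (abs_coord_le (T z - θ₀) i).trans (hK z)
  have h1 := integral_pi_sum (k := k) ν hm hb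
  have h2 : ∀ z : Fin k → Z, average T θ₀ z i = (k : ℝ)⁻¹ * ∑ κ, (T (z κ) i - θ₀ i) + θ₀ i :=
    fun z => by rw [← average_apply]; ring
  have h3 := integral_add (integrable_of_abs_le (μ := ν) hm hb) (integrable_const (θ₀ i))
  simp only [sub_add_cancel, integral_const, probReal_univ, smul_eq_mul, one_mul] at h3
  simp_rw [h2]
  rw [integral_add ?_ (integrable_const _), integral_const_mul, h1, h3, integral_const]
  · have : (k : ℝ) ≠ 0 := by positivity
    simp [this]
  · refine (integrable_finsetSum _ fun κ _ => ?_).const_mul _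
    exact integrable_of_abs_le (hm.comp (measurable_pi_apply κ)) fun z => hb _

theorem integral_average_mul_average (hT : Measurable T) (hK : ∀ z, ‖T z - θ₀‖ ≤ K)
    (h0 : ∀ i, ∫ z, T z i ∂ν = θ₀ i) (hk : 0 < k) (i j : Fin m) :
    ∫ z, (average T θ₀ z i - θ₀ i) * (average T θ₀ z j - θ₀ j) ∂(Measure.pi fun _ : Fin k => ν)
      = (∫ z, (T z i - θ₀ i) * (T z j - θ₀ j) ∂ν) / k := by
  have hm : ∀ i, Measurable fun z => T z i - θ₀ i := fun i =>
    ((measurable_coord i).comp hT).sub_const _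
  have hb : ∀ i z, |T z i - θ₀ i| ≤ K := fun i z => (abs_coord_le (T z - θ₀) i).trans (hK z)
  have h3 := integral_add (integrable_of_abs_le (μ := ν) (hm i) (hb i)) (integrable_const (θ₀ i))
  simp only [sub_add_cancel, integral_const, probReal_univ, smul_eq_mul, one_mul, h0] at h3
  have h1 := integral_pi_sum_mul_sum (k := k) ν (hm i) (hm j) (hb i) (hb j) (by linarith)
  simp_rw [average_apply]
  have e : ∀ z : Fin k → Z, ((k : ℝ)⁻¹ * ∑ κ, (T (z κ) i - θ₀ i)) * ((k : ℝ)⁻¹ *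
      ∑ κ, (T (z κ) j - θ₀ j)) = (k : ℝ)⁻¹ * (k : ℝ)⁻¹ * ((∑ κ, (T (z κ) i - θ₀ i)) *
      ∑ κ, (T (z κ) j - θ₀ j)) := fun z => by ring
  simp_rw [e]
  rw [integral_const_mul, h1]
  have : (k : ℝ) ≠ 0 := by positivity
  field_simp

end Average

section Hybrid

variable {θ₀ θ x z : Param m} {δ K : ℝ}

open Classical in
/-- The estimate `z` if the preliminary estimate `x` is near `θ₀`, and `x` itself otherwise. -/
def hybrid (θ₀ : Param m) (δ : ℝ) (x z : Param m) : Param m := if ‖x - θ₀‖ < δ then z else x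

theorem measurable_hybrid (θ₀ : Param m) (δ : ℝ) {f g : Ω → Param m} (hf : Measurable f)
    (hg : Measurable g) : Measurable fun ω => hybrid θ₀ δ (f ω) (g ω) := by
  unfold hybrid
  refine Measurable.ite ?_ hg hf
  exact measurableSet_lt (hf.sub_const _).norm measurable_const

theorem norm_hybrid_sub_le (hz : ‖z - θ₀‖ ≤ K) (hδ : 0 < δ) :
    ‖hybrid θ₀ δ x z - θ‖ ≤ K + δ + ‖x - θ‖ := by
  unfold hybrid
  have hK := (norm_nonneg _).trans hz
  split_ifs with h
  · have e : z - θ = (z - θ₀) - (x - θ₀) + (x - θ) := by abel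
    rw [e]
    refine (norm_add_le _ _).trans (add_le_add_left ?_ _)
    exact (norm_sub_le _ _).trans (add_le_add hz h.le)
  · linarith

/-- Near `θ₀` the hybrid estimate is the average, up to an error that the fourth moment of the
preliminary estimate controls. -/
theorem sq_norm_hybrid_sub_right_le (hz : ‖z - θ₀‖ ≤ K) (hδ : 0 < δ) (hδ1 : δ ≤ 1) :
    ‖hybrid θ₀ δ x z - z‖ ^ 2 ≤ (1 + K) ^ 2 / δ ^ 4 * ‖x - θ₀‖ ^ 4 := by
  unfold hybrid
  have hK := (norm_nonneg _).trans hz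
  split_ifs with h
  · rw [sub_self, norm_zero, zero_pow two_ne_zero]; positivity
  · push Not at h
    set s := ‖x - θ₀‖ / δ with hs
    have hs1 : 1 ≤ s := (one_le_div hδ).2 h
    have e : x - z = (x - θ₀) - (z - θ₀) := by abel
    have h1 : ‖x - z‖ ≤ (1 + K) * s := by
      rw [e]
      refine (norm_sub_le _ _).trans ?_
      have : ‖x - θ₀‖ = δ * s := by rw [hs]; field_simp
      nlinarith
    have e2 : (1 + K) ^ 2 / δ ^ 4 * ‖x - θ₀‖ ^ 4 = (1 + K) ^ 2 * s ^ 4 := by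
      rw [hs, div_pow]; ring
    rw [e2]
    calc ‖x - z‖ ^ 2 ≤ ((1 + K) * s) ^ 2 := by gcongr
      _ = (1 + K) ^ 2 * s ^ 2 := by ring
      _ ≤ (1 + K) ^ 2 * s ^ 4 :=
        mul_le_mul_of_nonneg_left (pow_le_pow_right₀ hs1 (by norm_num)) (sq_nonneg _)

/-- At a parameter other than `θ₀` the hybrid estimate is the preliminary one, up to a similar
error. -/
theorem sq_norm_hybrid_sub_left_le (hz : ‖z - θ₀‖ ≤ K) (hθ : θ ≠ θ₀) (hδ : 2 * δ ≤ ‖θ - θ₀‖) :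
    ‖hybrid θ₀ δ x z - x‖ ^ 2
      ≤ (K + ‖θ - θ₀‖) ^ 2 * (2 / ‖θ - θ₀‖) ^ 4 * ‖x - θ‖ ^ 4 := by
  unfold hybrid
  have hK := (norm_nonneg _).trans hz
  have hd : 0 < ‖θ - θ₀‖ := norm_pos_iff.2 (sub_ne_zero.2 hθ)
  split_ifs with h
  · have h1 : ‖z - x‖ ≤ K + ‖θ - θ₀‖ := by
      have e : z - x = (z - θ₀) - (x - θ₀) := by abel
      rw [e]
      refine (norm_sub_le _ _).trans (add_le_add hz ?_)
      linarith [norm_nonneg (x - θ₀)]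
    have h2 : 1 ≤ 2 / ‖θ - θ₀‖ * ‖x - θ‖ := by
      have e : θ - θ₀ = (x - θ₀) - (x - θ) := by abel
      have : ‖θ - θ₀‖ ≤ ‖x - θ₀‖ + ‖x - θ‖ := by
        conv_lhs => rw [e]
        exact norm_sub_le _ _
      rw [div_mul_eq_mul_div, one_le_div hd]
      linarith
    calc ‖z - x‖ ^ 2 ≤ (K + ‖θ - θ₀‖) ^ 2 * 1 := by rw [mul_one]; gcongr
      _ ≤ (K + ‖θ - θ₀‖) ^ 2 * (2 / ‖θ - θ₀‖ * ‖x - θ‖) ^ 4 := by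
        gcongr; exact one_le_pow₀ h2
      _ = _ := by ring
  · rw [sub_self, norm_zero, zero_pow two_ne_zero]; positivity

end Hybrid

end

/-! ### The moment condition for two blocks of samples -/

section

variable {m n : ℕ}

theorem lintegral_norm_le_of_sq {μ : Measure Ω} [IsProbabilityMeasure μ] {T : Ω → Param m}
    {θ : Param m} {b : ℝ≥0∞} (h : ∫⁻ ω, ‖T ω - θ‖ₑ ^ 2 ∂μ ≤ b) :
    ∫⁻ ω, ‖T ω - θ‖ₑ ∂μ ≤ 1 + b := by
  have h1 : ∀ x : ℝ≥0∞, x ≤ 1 + x ^ 2 := fun x => by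
    rcases le_total x 1 with hx | hx
    · exact hx.trans le_self_add
    · calc x = x * 1 := (mul_one x).symm
        _ ≤ x * x := by gcongr
        _ = x ^ 2 := (sq x).symm
        _ ≤ 1 + x ^ 2 := le_add_self
  calc ∫⁻ ω, ‖T ω - θ‖ₑ ∂μ ≤ ∫⁻ ω, (1 + ‖T ω - θ‖ₑ ^ 2) ∂μ := lintegral_mono fun ω => h1 _
    _ = 1 + ∫⁻ ω, ‖T ω - θ‖ₑ ^ 2 ∂μ := by
      rw [lintegral_add_left measurable_const, lintegral_const, measure_univ, mul_one]
    _ ≤ _ := by gcongr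

theorem enorm_le_ofReal_add {x y : Param m} {K : ℝ} (h : ‖x‖ ≤ K + ‖y‖) :
    ‖x‖ₑ ≤ ENNReal.ofReal K + ‖y‖ₑ := by
  rw [← ofReal_norm, ← ofReal_norm]
  exact (ENNReal.ofReal_le_ofReal h).trans ENNReal.ofReal_add_le

theorem enorm_sq_le_add {x y : Param m} {K : ℝ} (h : ‖x‖ ≤ K + ‖y‖) :
    ‖x‖ₑ ^ 2 ≤ ENNReal.ofReal (2 * K ^ 2) + 2 * ‖y‖ₑ ^ 2 := by
  have e : ‖x‖ ^ 2 ≤ 2 * K ^ 2 + 2 * ‖y‖ ^ 2 := by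
    nlinarith [norm_nonneg x, norm_nonneg y, sq_nonneg (K - ‖y‖)]
  rw [← ofReal_norm, ← ofReal_norm, ← ENNReal.ofReal_pow (norm_nonneg _),
    ← ENNReal.ofReal_pow (norm_nonneg _)]
  have e2 : 2 * ENNReal.ofReal (‖y‖ ^ 2) = ENNReal.ofReal (2 * ‖y‖ ^ 2) := by
    rw [ENNReal.ofReal_mul zero_le_two]; simp
  rw [e2, ← ENNReal.ofReal_add (by positivity) (by positivity)]
  exact ENNReal.ofReal_le_ofReal e

/-- The moment condition is inherited by the estimators on `N + k` samples whose error exceeds the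
error of an estimator on the first `N` samples at most by a constant. -/
theorem IsBlockLaw.momentBound {N k : ℕ} {W Z : Type*} [MeasurableSpace W] [MeasurableSpace Z]
    {A : Instrument H W} {B : Instrument H Z} {law : (Fin (N + k) → TraceClass H) → Measure Ω}
    {d : Ω → (Fin N → W) × (Fin k → Z)} (h : IsBlockLaw A B law d) {Θ : Set (Param m)}
    {ρ : Param m → TraceClass H} {D : Fin m → Param m → TraceClass H} {a₁ c K : ℝ}
    (hρ : ∀ θ ∈ Θ, (ρ θ).IsDensity) (hN : 0 < N) (hc : 0 < c) (hK : 0 ≤ K)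
    (hD : ∀ θ ∈ Θ, ∀ i, (D i θ).IsPos ∧ (D i θ).tr.re ≤ a₁ * c)
    {T : (Fin N → W) → Param m} {hT : Measurable T}
    (hm : (A.repeatedEstimator T hT).MomentBound Θ ρ D a₁) {g : Ω → Param m} (hg : Measurable g)
    (hle : ∀ ω, ∀ θ ∈ Θ, ‖g ω - θ‖ ≤ K + ‖T (d ω).1 - θ‖) :
    (Estimator.mk law g hg).MomentBound Θ ρ D a₁ := by
  obtain ⟨a, ha⟩ := hm
  set b := K * c + 2 * |a| + c * (1 + N * a ^ 2) + 2 * K with hb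
  have hb0 : 0 ≤ b := by positivity
  have hd1 : Measurable fun ω => (d ω).1 := h.measurable.fst
  have hFm : ∀ θ, Measurable fun w => ‖T w - θ‖ₑ := fun θ => (hT.sub_const θ).enorm
  refine ⟨b, fun θ hθ => ⟨fun i => ?_, ?_⟩⟩
  · obtain ⟨hDp, hDt⟩ := hD θ hθ i
    have ha1 : 0 ≤ a₁ := by
      by_contra hneg
      push Not at hneg
      have := hDp.tr_re_nonneg
      nlinarith
    have hpos : ∀ κ : Fin (N + k), ∀ κ', (Function.update (fun _ => ρ θ) κ (D i θ) κ').IsPos :=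
      fun κ => isPos_update (fun _ => (hρ θ hθ).1) κ hDp
    have hmass : ∀ κ : Fin (N + k), law (Function.update (fun _ => ρ θ) κ (D i θ)) Set.univ
        = ENNReal.ofReal (D i θ).tr.re := fun κ => by
      rw [h.mass _ (hpos κ), ← Finset.mul_prod_erase _ _ (Finset.mem_univ κ), Function.update_self,
        Finset.prod_eq_one fun κ' hκ' => by
          rw [Function.update_of_ne (Finset.ne_of_mem_erase hκ'), (hρ θ hθ).2]; simp, mul_one]
    have hstep : ∀ κ : Fin (N + k),
        ∫⁻ ω, ‖g ω - θ‖ₑ ∂law (Function.update (fun _ => ρ θ) κ (D i θ))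
          ≤ ENNReal.ofReal K * ENNReal.ofReal (a₁ * c)
            + ∫⁻ ω, ‖T (d ω).1 - θ‖ₑ ∂law (Function.update (fun _ => ρ θ) κ (D i θ)) := fun κ => by
      refine (lintegral_mono fun ω => enorm_le_ofReal_add (hle ω θ hθ)).trans ?_
      rw [lintegral_add_left measurable_const, lintegral_const, hmass]
      gcongr
    have hleft : ∀ κ : Fin N,
        ∫⁻ ω, ‖T (d ω).1 - θ‖ₑ ∂law (Function.update (fun _ => ρ θ) (Fin.castAdd k κ) (D i θ))
          = ∫⁻ w, ‖T w - θ‖ₑ ∂(A.repeatedEstimator T hT).law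
              (Function.update (fun _ => ρ θ) κ (D i θ)) := fun κ => by
      have e := lintegral_map (μ := law (Function.update (fun _ => ρ θ) (Fin.castAdd k κ) (D i θ)))
        (hFm θ) hd1
      rw [← e, h.map_fst (hpos _)]
      have h1 : ∏ κ' : Fin k, ENNReal.ofReal (Function.update (fun _ => ρ θ) (Fin.castAdd k κ)
          (D i θ) (Fin.natAdd N κ')).tr.re = 1 := Finset.prod_eq_one fun κ' _ => by
        rw [Function.update_of_ne (by
          intro h'
          have := congrArg Fin.val h'
          simp only [Fin.val_natAdd, Fin.val_castAdd] at this
          omega), (hρ θ hθ).2]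
        simp
      rw [h1, one_smul]
      have h2 : ∀ κ' : Fin N, Function.update (fun _ => ρ θ) (Fin.castAdd k κ) (D i θ)
          (Fin.castAdd k κ') = Function.update (fun _ => ρ θ) κ (D i θ) κ' := fun κ' => by
        by_cases hκ : κ' = κ
        · subst hκ; simp
        · rw [Function.update_of_ne hκ, Function.update_of_ne fun h' =>
            hκ (Fin.castAdd_injective N k h')]
      simp_rw [h2]
      rfl
    have hright : ∀ κ : Fin k,
        ∫⁻ ω, ‖T (d ω).1 - θ‖ₑ ∂law (Function.update (fun _ => ρ θ) (Fin.natAdd N κ) (D i θ))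
          ≤ ENNReal.ofReal (a₁ * c) * (1 + ENNReal.ofReal (N * a ^ 2)) := fun κ => by
      have e := lintegral_map (μ := law (Function.update (fun _ => ρ θ) (Fin.natAdd N κ) (D i θ)))
        (hFm θ) hd1
      rw [← e, h.map_fst (hpos _)]
      have h1 : ∏ κ' : Fin k, ENNReal.ofReal (Function.update (fun _ => ρ θ) (Fin.natAdd N κ)
          (D i θ) (Fin.natAdd N κ')).tr.re = ENNReal.ofReal (D i θ).tr.re := by
        rw [← Finset.mul_prod_erase _ _ (Finset.mem_univ κ), Function.update_self,
          Finset.prod_eq_one fun κ' hκ' => by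
            rw [Function.update_of_ne fun h' => Finset.ne_of_mem_erase hκ'
              (Fin.natAdd_injective k N h'), (hρ θ hθ).2]; simp, mul_one]
      have h2 : ∀ κ' : Fin N, Function.update (fun _ => ρ θ) (Fin.natAdd N κ) (D i θ)
          (Fin.castAdd k κ') = ρ θ := fun κ' => by
        rw [Function.update_of_ne]
        intro h'
        have := congrArg Fin.val h'
        simp only [Fin.val_natAdd, Fin.val_castAdd] at this
        omega
      rw [h1, lintegral_smul_measure, smul_eq_mul]
      simp_rw [h2]
      have := A.isPovm_outcome.isProbabilityMeasure (hρ θ hθ)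
      gcongr
      exact lintegral_norm_le_of_sq (μ := Measure.pi fun _ : Fin N => A.outcome (ρ θ)) (ha θ hθ).2
    change ∑ κ, ∫⁻ ω, ‖g ω - θ‖ₑ ∂law (Function.update (fun _ => ρ θ) κ (D i θ)) ≤ _
    refine (Finset.sum_le_sum fun κ _ => hstep κ).trans ?_
    rw [Finset.sum_add_distrib, Fin.sum_univ_add (fun κ : Fin (N + k) =>
      ∫⁻ ω, ‖T (d ω).1 - θ‖ₑ ∂law (Function.update (fun _ => ρ θ) κ (D i θ)))]
    simp_rw [hleft]
    have hs := (ha θ hθ).1 i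
    calc _ ≤ (N + k : ℕ) * (ENNReal.ofReal K * ENNReal.ofReal (a₁ * c))
          + (ENNReal.ofReal (N * a₁ * a)
            + k * (ENNReal.ofReal (a₁ * c) * (1 + ENNReal.ofReal (N * a ^ 2)))) := by
          refine add_le_add (by simp) (add_le_add hs ?_)
          refine (Finset.sum_le_sum fun κ _ => hright κ).trans (by simp)
      _ ≤ (N + k : ℕ) * (ENNReal.ofReal K * ENNReal.ofReal (a₁ * c))
          + (ENNReal.ofReal (N * a₁ * |a|)
            + k * (ENNReal.ofReal (a₁ * c) * (1 + ENNReal.ofReal (N * a ^ 2)))) := by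
          gcongr; exact le_abs_self a
      _ = ENNReal.ofReal ((N + k : ℕ) * (K * (a₁ * c)) + (N * a₁ * |a|
            + k * ((a₁ * c) * (1 + N * a ^ 2)))) := by
          rw [ENNReal.ofReal_add (by positivity) (by positivity),
            ENNReal.ofReal_add (by positivity) (by positivity),
            ENNReal.ofReal_mul (p := ((N + k : ℕ) : ℝ)) (by positivity),
            ENNReal.ofReal_natCast, ENNReal.ofReal_mul (p := K) hK, ENNReal.ofReal_mul (p := (k : ℝ))
            (by positivity), ENNReal.ofReal_natCast, ENNReal.ofReal_mul (p := a₁ * c) (by positivity),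
            ENNReal.ofReal_add zero_le_one (by positivity), ENNReal.ofReal_one]
      _ ≤ _ := by
          refine ENNReal.ofReal_le_ofReal ?_
          rw [hb]
          push_cast
          have t1 : 0 ≤ k * a₁ * |a| := by positivity
          have t2 : 0 ≤ N * (a₁ * c * (1 + N * a ^ 2)) := by positivity
          have t3 : 0 ≤ (N + k) * a₁ * (2 * K) := by positivity
          have t4 : 0 ≤ (N + k) * a₁ * |a| := by positivity
          nlinarith
  · have hp : IsProbabilityMeasure (law fun _ => ρ θ) :=
      h.toIsProductLaw.isProbabilityMeasure fun _ => hρ θ hθ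
    change ∫⁻ ω, ‖g ω - θ‖ₑ ^ 2 ∂(law fun _ => ρ θ) ≤ _
    refine (lintegral_mono fun ω => enorm_sq_le_add (hle ω θ hθ)).trans ?_
    rw [lintegral_add_left measurable_const, lintegral_const, measure_univ, mul_one,
      lintegral_const_mul' _ _ (by simp)]
    have e := lintegral_map (μ := law fun _ => ρ θ) ((hFm θ).pow_const 2) hd1
    rw [← e, h.map_fst_iid (hρ θ hθ)]
    have e2 : (2 : ℝ≥0∞) = ENNReal.ofReal 2 := by simp
    have hs : ∫⁻ w, ‖T w - θ‖ₑ ^ 2 ∂(Measure.pi fun _ : Fin N => A.outcome (ρ θ))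
      ≤ ENNReal.ofReal (N * a ^ 2) := (ha θ hθ).2
    calc _ ≤ ENNReal.ofReal (2 * K ^ 2) + 2 * ENNReal.ofReal (N * a ^ 2) := by gcongr
      _ = ENNReal.ofReal (2 * K ^ 2 + 2 * (N * a ^ 2)) := by
        rw [ENNReal.ofReal_add (by positivity) (by positivity), e2,
          ← ENNReal.ofReal_mul zero_le_two]
      _ ≤ _ := by
        refine ENNReal.ofReal_le_ofReal ?_
        have h1 : 2 * K + 2 * |a| ≤ b := by
          have t1 : 0 ≤ K * c := by positivity
          have t2 : 0 ≤ c * (1 + N * a ^ 2) := by positivity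
          linarith
        have h2 : (2 * K + 2 * |a|) ^ 2 ≤ b ^ 2 := pow_le_pow_left₀ (by positivity) h1 2
        have h3 : (1 : ℝ) ≤ N := by exact_mod_cast hN
        have h4 : K ^ 2 + a ^ 2 ≤ (2 * K + 2 * |a|) ^ 2 / 2 := by
          nlinarith [sq_abs a, mul_nonneg hK (abs_nonneg a)]
        push_cast
        have h5 : (N : ℝ) * b ^ 2 ≤ (N + k) * b ^ 2 := by
          have : (0 : ℝ) ≤ k := Nat.cast_nonneg k
          gcongr
          linarith
        nlinarith [mul_le_mul_of_nonneg_left (h4.trans (by linarith : _ ≤ b ^ 2 / 2))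
          (Nat.cast_nonneg N : (0 : ℝ) ≤ N), mul_nonneg (sub_nonneg.2 h3) (sq_nonneg K)]

end

/-! ### The mean of the hybrid estimator -/

section

variable {m n : ℕ}

theorem sq_integral_le {μ : Measure Ω} [IsProbabilityMeasure μ] {f : Ω → ℝ} (hf : MemLp f 2 μ) :
    (∫ ω, f ω ∂μ) ^ 2 ≤ ∫ ω, f ω ^ 2 ∂μ := by
  have := sq_integral_mul_le hf (memLp_const (1 : ℝ))
  simpa using this

theorem sq_integral_coord_sub_le {μ : Measure Ω} [IsProbabilityMeasure μ] {f g : Ω → Param m}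
    (hf : Measurable f) {θ : Param m} {a : ℝ}
    (ha : ∫⁻ ω, ‖f ω - θ‖ₑ ^ 2 ∂μ ≤ ENNReal.ofReal a) {i : Fin m}
    (hfg : MemLp (fun ω => f ω i - g ω i) 2 μ) :
    (∫ ω, f ω i ∂μ - ∫ ω, g ω i ∂μ) ^ 2 ≤ ∫ ω, (f ω i - g ω i) ^ 2 ∂μ := by
  have h1 := ((memLp_coord_of_lintegral_le hf ha i).1.integrable one_le_two).add
    (integrable_const (θ i))
  have h2 : Integrable (fun ω => f ω i) μ := h1.congr (Eventually.of_forall fun ω => by simp)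
  have h3 : Integrable (fun ω => g ω i) μ :=
    (h2.sub (hfg.integrable one_le_two)).congr (Eventually.of_forall fun ω => by simp)
  rw [← integral_sub h2 h3]
  exact sq_integral_le hfg

theorem abs_integral_mul_le {μ : Measure Ω} {f g : Ω → ℝ} (hf : MemLp f 2 μ) (hg : MemLp g 2 μ)
    {a b : ℝ} (ha : ∫ ω, f ω ^ 2 ∂μ ≤ a) (hb : ∫ ω, g ω ^ 2 ∂μ ≤ b) :
    |∫ ω, f ω * g ω ∂μ| ≤ √(a * b) := by
  refine Real.abs_le_sqrt ((sq_integral_mul_le hf hg).trans ?_)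
  exact mul_le_mul ha hb (integral_nonneg fun ω => sq_nonneg _)
    ((integral_nonneg fun ω => sq_nonneg _).trans ha)

theorem abs_integral_add_mul_add_sub_le {μ : Measure Ω} {u u' v v' : Ω → ℝ} (hu : MemLp u 2 μ)
    (hu' : MemLp u' 2 μ) (hv : MemLp v 2 μ) (hv' : MemLp v' 2 μ) {a b : ℝ} (hb : 0 ≤ b)
    (hua : ∫ ω, u ω ^ 2 ∂μ ≤ a) (hua' : ∫ ω, u' ω ^ 2 ∂μ ≤ a) (hvb : ∫ ω, v ω ^ 2 ∂μ ≤ b)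
    (hvb' : ∫ ω, v' ω ^ 2 ∂μ ≤ b) :
    |∫ ω, (u ω + v ω) * (u' ω + v' ω) ∂μ - ∫ ω, u ω * u' ω ∂μ| ≤ 2 * √(a * b) + b := by
  have e : ∫ ω, (u ω + v ω) * (u' ω + v' ω) ∂μ = ∫ ω, u ω * u' ω ∂μ + ∫ ω, u ω * v' ω ∂μ
      + ∫ ω, v ω * u' ω ∂μ + ∫ ω, v ω * v' ω ∂μ := by
    have h1 : ∀ ω, (u ω + v ω) * (u' ω + v' ω)
        = u ω * u' ω + u ω * v' ω + v ω * u' ω + v ω * v' ω := fun ω => by ring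
    simp_rw [h1]
    have i1 : Integrable (fun ω => u ω * u' ω + u ω * v' ω) μ :=
      (hu.integrable_fun_mul hu').add (hu.integrable_fun_mul hv')
    have i2 : Integrable (fun ω => u ω * u' ω + u ω * v' ω + v ω * u' ω) μ :=
      i1.add (hv.integrable_fun_mul hu')
    rw [integral_add i2 (hv.integrable_fun_mul hv'), integral_add i1 (hv.integrable_fun_mul hu'),
      integral_add (hu.integrable_fun_mul hu') (hu.integrable_fun_mul hv')]
  have h1 := abs_integral_mul_le hu hv' hua hvb'
  have h2 := abs_integral_mul_le hv hu' hvb hua'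
  have h3 := abs_integral_mul_le hv hv' hvb hvb'
  rw [mul_comm b a] at h2
  rw [Real.sqrt_mul_self hb] at h3
  rw [e]
  rw [abs_le] at *
  constructor <;> linarith

theorem Estimator.HasMeanDeriv.congr {Ω' : Type*} [MeasurableSpace Ω'] {n' : ℕ} {Θ : Set (Param m)}
    {ρ : Param m → TraceClass H} {θ : Param m} {e : Estimator H n m Ω} {e' : Estimator H n' m Ω'}
    {B : Matrix (Fin m) (Fin m) ℝ} (h : e.HasMeanDeriv ρ θ B) (hΘ : IsOpen Θ) (hθ : θ ∈ Θ)
    (he : ∀ θ ∈ Θ, ∀ i, e'.mean ρ θ i = e.mean ρ θ i) : e'.HasMeanDeriv ρ θ B := fun i j => by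
  have h1 : Tendsto (fun t : ℝ => θ + t • coordVec j) (𝓝 0) (𝓝 θ) := by
    have : Continuous fun t : ℝ => θ + t • (coordVec j : Param m) := by fun_prop
    simpa using this.tendsto 0
  refine (h i j).congr_of_eventuallyEq ?_
  filter_upwards [h1.eventually (hΘ.mem_nhds hθ)] with t ht
  exact he _ ht i

theorem Estimator.HasMeanDeriv.unique {ρ : Param m → TraceClass H} {θ : Param m}
    {e : Estimator H n m Ω} {B B' : Matrix (Fin m) (Fin m) ℝ} (h : e.HasMeanDeriv ρ θ B)
    (h' : e.HasMeanDeriv ρ θ B') : B = B' := by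
  ext i j
  exact (h i j).unique (h' i j)

theorem memLp_coord_sub {μ : Measure Ω} {f g x : Ω → Param m} (hf : Measurable f)
    (hg : Measurable g) {θ : Param m} {b c : ℝ} (hb : 0 ≤ b) (hc : 0 ≤ c)
    (hfg : ∀ ω, ‖f ω - g ω‖ ^ 2 ≤ c * ‖x ω - θ‖ ^ 4)
    (hx : ∫⁻ ω, ‖x ω - θ‖ₑ ^ 4 ∂μ ≤ ENNReal.ofReal b) (i : Fin m) :
    MemLp (fun ω => f ω i - g ω i) 2 μ ∧ ∫ ω, (f ω i - g ω i) ^ 2 ∂μ ≤ c * b := by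
  refine memLp_two_of_sq_le (((measurable_coord i).comp hf).sub ((measurable_coord i).comp hg)) hb hc
    (fun ω => ?_) hx
  rw [← ofReal_norm, ← ENNReal.ofReal_pow (norm_nonneg _), ← ENNReal.ofReal_mul hc]
  refine ENNReal.ofReal_le_ofReal (le_trans ?_ (hfg ω))
  rw [← sq_abs]
  exact pow_le_pow_left₀ (abs_nonneg _) (abs_coord_le (f ω - g ω) i) 2

theorem SmoothModel.mono {Θ Θ' : Set (Param m)} {ρ : Param m → TraceClass H} {a₁ : ℝ}
    (h : SmoothModel Θ ρ a₁) (hΘ : Θ' ⊆ Θ) : SmoothModel Θ' ρ a₁ where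
  differentiable θ hθ := h.differentiable θ (hΘ hθ)
  differentiable₂ θ hθ := h.differentiable₂ θ (hΘ hθ)
  continuous i θ hθ := by
    obtain ⟨U, hU, hc⟩ := h.continuous i θ (hΘ hθ)
    exact ⟨U, hU, hc.mono (Set.inter_subset_inter_right U hΘ)⟩
  continuous₂ i j θ hθ := by
    obtain ⟨U, hU, hc⟩ := h.continuous₂ i j θ (hΘ hθ)
    exact ⟨U, hU, hc.mono (Set.inter_subset_inter_right U hΘ)⟩
  bound θ hθ := h.bound θ (hΘ hθ)
  bound₂ θ hθ := h.bound₂ θ (hΘ hθ)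

section

variable {Θ : Set (Param m)} {ρ : Param m → TraceClass H} {D : Fin m → Param m → TraceClass H}
  {a₁ c K δ : ℝ} {θ₀ : Param m} {N k : ℕ} {W Z : Type} [MeasurableSpace W] [MeasurableSpace Z]
  {A : Instrument H W} {B : Instrument H Z} {Ω : Type} [MeasurableSpace Ω]
  {law : (Fin (N + k) → TraceClass H) → Measure Ω} {d : Ω → (Fin N → W) × (Fin k → Z)}
  {x : (Fin N → W) → Param m} {T : Z → Param m}

/-- The estimate that averages `T` over the last `k` samples if the estimate `x` from the first `N`
samples is near `θ₀`, and otherwise is `x`. -/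
def hybridEstimator (law : (Fin (N + k) → TraceClass H) → Measure Ω)
    {d : Ω → (Fin N → W) × (Fin k → Z)} (hd : Measurable d) (hx : Measurable x) (hT : Measurable T)
    (θ₀ : Param m) (δ : ℝ) : Estimator H (N + k) m Ω where
  law := law
  est ω := hybrid θ₀ δ (x (d ω).1) (average T θ₀ (d ω).2)
  measurable_est := measurable_hybrid θ₀ δ (hx.comp hd.fst) ((measurable_average hT).comp hd.snd)

theorem momentBound_hybridEstimator (h : IsBlockLaw A B law d) (hρ : ∀ θ ∈ Θ, (ρ θ).IsDensity)
    (hN : 0 < N) (hc : 0 < c) (hD : ∀ θ ∈ Θ, ∀ i, (D i θ).IsPos ∧ (D i θ).tr.re ≤ a₁ * c)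
    (hx : Measurable x) (hT : Measurable T)
    (hm : (A.repeatedEstimator x hx).MomentBound Θ ρ D a₁) (hK0 : 0 ≤ K)
    (hK : ∀ z, ‖T z - θ₀‖ ≤ K) (hδ : 0 < δ) :
    (hybridEstimator law h.measurable hx hT θ₀ δ).MomentBound Θ ρ D a₁ :=
  h.momentBound hρ hN hc (add_nonneg hK0 hδ.le) hD hm _ fun _ _ _ =>
    norm_hybrid_sub_le (norm_average_sub_le hK hK0 _) hδ

theorem IsBlockLaw.integral_left (h : IsBlockLaw A B law d) {σ : TraceClass H} (hσ : σ.IsDensity)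
    {f : (Fin N → W) → ℝ} (hf : Measurable f) :
    ∫ ω, f (d ω).1 ∂(law fun _ => σ) = ∫ w, f w ∂(Measure.pi fun _ => A.outcome σ) := by
  rw [← h.map_fst_iid hσ]
  exact (integral_map h.measurable.fst.aemeasurable hf.aestronglyMeasurable).symm

theorem IsBlockLaw.integral_right (h : IsBlockLaw A B law d) {σ : TraceClass H} (hσ : σ.IsDensity)
    {f : (Fin k → Z) → ℝ} (hf : Measurable f) :
    ∫ ω, f (d ω).2 ∂(law fun _ => σ) = ∫ w, f w ∂(Measure.pi fun _ => B.outcome σ) := by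
  rw [← h.map_snd_iid hσ]
  exact (integral_map h.measurable.snd.aemeasurable hf.aestronglyMeasurable).symm

theorem IsBlockLaw.lintegral_left (h : IsBlockLaw A B law d) {σ : TraceClass H} (hσ : σ.IsDensity)
    {f : (Fin N → W) → ℝ≥0∞} (hf : Measurable f) :
    ∫⁻ ω, f (d ω).1 ∂(law fun _ => σ) = ∫⁻ w, f w ∂(Measure.pi fun _ => A.outcome σ) := by
  rw [← h.map_fst_iid hσ]
  exact (lintegral_map hf h.measurable.fst).symm

/-- At `θ ≠ θ₀` the mean of the hybrid estimator and its derivatives are close to those of the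
preliminary estimator. The constant `q` does not depend on the numbers of samples. -/
theorem exists_hasMeanDeriv_hybridEstimator (hΘ : IsOpen Θ) (hρ : ∀ θ ∈ Θ, (ρ θ).IsDensity)
    (h_smooth : SmoothModel Θ ρ a₁) (h_log : ∀ θ ∈ Θ, ∀ i, HasLogDerivative (ρ θ) (pderiv i ρ θ))
    (hK0 : 0 ≤ K) {θ : Param m} (hθ : θ ∈ Θ) :
    ∃ q : ℝ, 0 ≤ q ∧ ∀ {δ : ℝ} {N k : ℕ} {W Z : Type} [MeasurableSpace W] [MeasurableSpace Z]
      {A : Instrument H W} {B : Instrument H Z} {Ω : Type} [MeasurableSpace Ω]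
      {law : (Fin (N + k) → TraceClass H) → Measure Ω} {d : Ω → (Fin N → W) × (Fin k → Z)}
      {x : (Fin N → W) → Param m} {T : Z → Param m} (h : IsBlockLaw A B law d) (hx : Measurable x)
      (hT : Measurable T) (_ : (A.repeatedEstimator x hx).MomentBound Θ ρ D a₁)
      (_ : (hybridEstimator law h.measurable hx hT θ₀ δ).MomentBound Θ ρ D a₁)
      (_ : ∀ z, ‖T z - θ₀‖ ≤ K) (_ : 0 < δ) {b : ℝ} (_ : 0 ≤ b)
      (_ : ∫⁻ w, ‖x w - θ‖ₑ ^ 4 ∂(Measure.pi fun _ => A.outcome (ρ θ)) ≤ ENNReal.ofReal b),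
      ∃ E, (hybridEstimator law h.measurable hx hT θ₀ δ).HasMeanDeriv ρ θ E ∧
        (θ ≠ θ₀ → 2 * δ ≤ ‖θ - θ₀‖ → ∀ E', (A.repeatedEstimator x hx).HasMeanDeriv ρ θ E' →
          ∀ i, ((hybridEstimator law h.measurable hx hT θ₀ δ).mean ρ θ i
            - (A.repeatedEstimator x hx).mean ρ θ i) ^ 2
              ≤ (K + ‖θ - θ₀‖) ^ 2 * (2 / ‖θ - θ₀‖) ^ 4 * b ∧
          ∀ j, (E i j - E' i j) ^ 2
            ≤ (K + ‖θ - θ₀‖) ^ 2 * (2 / ‖θ - θ₀‖) ^ 4 * b * ((N + k : ℕ) * q)) := by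
  obtain ⟨q, hq, H⟩ := Estimator.exists_hasMeanDeriv hΘ hρ h_smooth h_log hθ
  refine ⟨q, hq, ?_⟩
  intro δ N k W Z _ _ A B Ω _ law d x T h hx hT hm hm' hK hδ b hb hb4
  obtain ⟨a, ha⟩ := hm
  obtain ⟨a', ha'⟩ := hm'
  have hxm : Measurable fun ω => x (d ω).1 := hx.comp h.measurable.fst
  have ha2 : ∀ θ' ∈ Θ, ∫⁻ ω, ‖x (d ω).1 - θ'‖ₑ ^ 2 ∂(law fun _ => ρ θ')
      ≤ ENNReal.ofReal (N * a ^ 2) := fun θ' hθ' => by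
    rw [h.lintegral_left (hρ θ' hθ') (f := fun w => ‖x w - θ'‖ₑ ^ 2)
      ((hx.sub_const θ').enorm.pow_const 2)]
    exact (ha θ' hθ').2
  obtain ⟨E, E', hE, hE', hEE⟩ := H h.toIsLocalLaw
    (hybridEstimator law h.measurable hx hT θ₀ δ).measurable_est hxm
    (fun θ' hθ' => (ha' θ' hθ').2) ha2
  have hmean : ∀ θ' ∈ Θ, ∀ i, (A.repeatedEstimator x hx).mean ρ θ' i
      = (Estimator.mk law _ hxm).mean ρ θ' i := fun θ' hθ' i =>
    (h.integral_left (hρ θ' hθ') ((measurable_coord i).comp hx)).symm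
  refine ⟨E, hE, fun hne hd E₁ hE₁ i => ?_⟩
  rw [hE₁.unique (hE'.congr hΘ hθ hmean)]
  have hp : IsProbabilityMeasure (law fun _ => ρ θ) :=
    h.toIsProductLaw.isProbabilityMeasure fun _ => hρ θ hθ
  have h4 : ∫⁻ ω, ‖x (d ω).1 - θ‖ₑ ^ 4 ∂(law fun _ => ρ θ) ≤ ENNReal.ofReal b := by
    rw [h.lintegral_left (hρ θ hθ) (f := fun w => ‖x w - θ‖ₑ ^ 4)
      ((hx.sub_const θ).enorm.pow_const 4)]
    exact hb4
  have hL := fun i => memLp_coord_sub (hybridEstimator law h.measurable hx hT θ₀ δ).measurable_est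
    hxm hb (by positivity : 0 ≤ (K + ‖θ - θ₀‖) ^ 2 * (2 / ‖θ - θ₀‖) ^ 4)
    (fun ω => sq_norm_hybrid_sub_left_le (norm_average_sub_le hK hK0 (d ω).2) hne hd) h4 i
  refine ⟨?_, fun j => (hEE i j).trans ?_⟩
  · rw [hmean θ hθ]
    exact (sq_integral_coord_sub_le (μ := law fun _ => ρ θ)
      (hybridEstimator law h.measurable hx hT θ₀ δ).measurable_est (ha' θ hθ).2 (hL i).1).trans
      (hL i).2
  · exact mul_le_mul_of_nonneg_right (hL i).2 (by positivity)

/-- At `θ₀` the hybrid estimator is nearly unbiased, and its mean square error is nearly the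
covariance of the single-sample estimator divided by the number `k` of samples that are averaged. -/
theorem exists_hasMeanDeriv_hybridEstimator_self (hΘ : IsOpen Θ)
    (hρ : ∀ θ ∈ Θ, (ρ θ).IsDensity) (h_smooth : SmoothModel Θ ρ a₁)
    (h_log : ∀ θ ∈ Θ, ∀ i, HasLogDerivative (ρ θ) (pderiv i ρ θ))
    (hK0 : 0 ≤ K) (hθ : θ₀ ∈ Θ) : ∃ q : ℝ, 0 ≤ q ∧ ∀ {δ : ℝ} {N k : ℕ}
      {W Z : Type} [MeasurableSpace W] [MeasurableSpace Z]
      {A : Instrument H W} {B : Instrument H Z} {Ω : Type} [MeasurableSpace Ω]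
      {law : (Fin (N + k) → TraceClass H) → Measure Ω} {d : Ω → (Fin N → W) × (Fin k → Z)}
      {x : (Fin N → W) → Param m} {T : Z → Param m} (h : IsBlockLaw A B law d) (hx : Measurable x)
      (hT : Measurable T)
      (_ : (hybridEstimator law h.measurable hx hT θ₀ δ).MomentBound Θ ρ D a₁)
      (_ : ∀ z, ‖T z - θ₀‖ ≤ K) (_ : (B.singleEstimator T hT).LocallyUnbiased ρ θ₀) (_ : 0 < δ)
      (_ : δ ≤ 1) {b : ℝ} (_ : 0 ≤ b)
      (_ : ∫⁻ w, ‖x w - θ₀‖ₑ ^ 4 ∂(Measure.pi fun _ => A.outcome (ρ θ₀)) ≤ ENNReal.ofReal b)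
      (_ : 0 < k),
      ∃ E, (hybridEstimator law h.measurable hx hT θ₀ δ).HasMeanDeriv ρ θ₀ E ∧
        ∀ i, ((hybridEstimator law h.measurable hx hT θ₀ δ).mean ρ θ₀ i - θ₀ i) ^ 2
              ≤ (1 + K) ^ 2 / δ ^ 4 * b ∧
          ∀ j, (E i j - (1 : Matrix (Fin m) (Fin m) ℝ) i j) ^ 2
              ≤ (1 + K) ^ 2 / δ ^ 4 * b * ((N + k : ℕ) * q) ∧
            |(hybridEstimator law h.measurable hx hT θ₀ δ).mse ρ θ₀ i j
              - (B.singleEstimator T hT).cov ρ θ₀ i j / k|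
              ≤ 2 * √(K ^ 2 / k * ((1 + K) ^ 2 / δ ^ 4 * b)) + (1 + K) ^ 2 / δ ^ 4 * b := by
  -- the average has bounded second moments only near `θ₀`
  have hΘ' : IsOpen (Θ ∩ Metric.ball θ₀ 1) := hΘ.inter Metric.isOpen_ball
  have hθ' : θ₀ ∈ Θ ∩ Metric.ball θ₀ 1 := ⟨hθ, Metric.mem_ball_self one_pos⟩
  obtain ⟨q, hq, H⟩ := Estimator.exists_hasMeanDeriv hΘ' (fun θ h => hρ θ h.1)
    (h_smooth.mono Set.inter_subset_left) (fun θ h => h_log θ h.1) hθ'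
  refine ⟨q, hq, ?_⟩
  intro δ N k W Z _ _ A B Ω _ law d x T h hx hT hm' hK hu hδ hδ1 b hb hb4 hk
  obtain ⟨a', ha'⟩ := hm'
  have ham : Measurable (average T θ₀ : (Fin k → Z) → Param m) := measurable_average hT
  have hzm : Measurable fun ω => average T θ₀ (d ω).2 := ham.comp h.measurable.snd
  have hpr : ∀ θ ∈ Θ, IsProbabilityMeasure (law fun _ => ρ θ) := fun θ hθ =>
    h.toIsProductLaw.isProbabilityMeasure fun _ => hρ θ hθ
  have hpr' : ∀ θ ∈ Θ, IsProbabilityMeasure (B.outcome (ρ θ)) := fun θ hθ =>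
    B.isPovm_outcome.isProbabilityMeasure (hρ θ hθ)
  have hmean : ∀ θ' ∈ Θ, ∀ i, (Estimator.mk law _ hzm).mean ρ θ' i
      = (B.singleEstimator T hT).mean ρ θ' i := fun θ' hθ' i => by
    have := hpr' θ' hθ'
    refine (h.integral_right (hρ θ' hθ') (f := fun z => average T θ₀ z i)
      ((measurable_coord i).comp ham)).trans ?_
    exact integral_average _ hT hK hk i
  have hp := hpr θ₀ hθ
  have hp' := hpr' θ₀ hθ
  have ha2 : ∀ θ' ∈ Θ ∩ Metric.ball θ₀ 1, ∫⁻ ω, ‖average T θ₀ (d ω).2 - θ'‖ₑ ^ 2 ∂(law fun _ => ρ θ')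
      ≤ ENNReal.ofReal ((K + 1) ^ 2) := fun θ' hθ' => by
    have := hpr θ' hθ'.1
    refine (lintegral_mono fun ω => ?_).trans_eq (b := ∫⁻ _, ENNReal.ofReal ((K + 1) ^ 2)
      ∂(law fun _ => ρ θ')) (by rw [lintegral_const, measure_univ, mul_one])
    rw [← ofReal_norm, ← ENNReal.ofReal_pow (norm_nonneg _)]
    refine ENNReal.ofReal_le_ofReal (pow_le_pow_left₀ (norm_nonneg _) ?_ 2)
    have e : average T θ₀ (d ω).2 - θ' = (average T θ₀ (d ω).2 - θ₀) + (θ₀ - θ') := by abel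
    rw [e]
    refine (norm_add_le _ _).trans (add_le_add (norm_average_sub_le hK hK0 _) ?_)
    have := Metric.mem_ball'.1 hθ'.2
    rw [dist_eq_norm] at this
    exact this.le
  obtain ⟨E, E', hE, hE', hEE⟩ := H h.toIsLocalLaw
    (hybridEstimator law h.measurable hx hT θ₀ δ).measurable_est hzm
    (fun θ' hθ' => (ha' θ' hθ'.1).2) ha2
  have h1 : E' = 1 := (hE'.congr hΘ hθ fun θ' hθ' i => (hmean θ' hθ' i).symm).unique hu.2
  have h4 : ∫⁻ ω, ‖x (d ω).1 - θ₀‖ₑ ^ 4 ∂(law fun _ => ρ θ₀) ≤ ENNReal.ofReal b := by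
    rw [h.lintegral_left (hρ θ₀ hθ) (f := fun w => ‖x w - θ₀‖ₑ ^ 4)
      ((hx.sub_const θ₀).enorm.pow_const 4)]
    exact hb4
  have hL := fun i => memLp_coord_sub (hybridEstimator law h.measurable hx hT θ₀ δ).measurable_est
    hzm hb (by positivity : 0 ≤ (1 + K) ^ 2 / δ ^ 4)
    (fun ω => sq_norm_hybrid_sub_right_le (norm_average_sub_le hK hK0 (d ω).2) hδ hδ1) h4 i
  refine ⟨E, hE, fun i => ⟨?_, fun j => ⟨?_, ?_⟩⟩⟩
  · have e : θ₀ i = (Estimator.mk law _ hzm).mean ρ θ₀ i := by rw [hmean θ₀ hθ, hu.1]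
    conv_lhs => rw [e]
    exact (sq_integral_coord_sub_le (μ := law fun _ => ρ θ₀)
      (hybridEstimator law h.measurable hx hT θ₀ δ).measurable_est (ha' θ₀ hθ).2 (hL i).1).trans
      (hL i).2
  · rw [← h1]
    exact (hEE i j).trans (mul_le_mul_of_nonneg_right (hL i).2 (by positivity))
  · have hbd : ∀ i ω, |average T θ₀ (d ω).2 i - θ₀ i| ≤ K := fun i ω =>
      (abs_coord_le (average T θ₀ (d ω).2 - θ₀) i).trans (norm_average_sub_le hK hK0 _)
    have hcoord : ∀ i, Measurable fun ω => average T θ₀ (d ω).2 i - θ₀ i := fun i =>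
      ((measurable_coord i).comp hzm).sub_const _
    have hcov : ∀ i j, ∫ ω, (average T θ₀ (d ω).2 i - θ₀ i) * (average T θ₀ (d ω).2 j - θ₀ j)
        ∂(law fun _ => ρ θ₀) = (B.singleEstimator T hT).cov ρ θ₀ i j / k := fun i j => by
      rw [h.integral_right (hρ θ₀ hθ) (f := fun z => (average T θ₀ z i - θ₀ i) *
        (average T θ₀ z j - θ₀ j)) ((((measurable_coord i).comp ham).sub_const _).mul
        (((measurable_coord j).comp ham).sub_const _))]
      refine (integral_average_mul_average (B.outcome (ρ θ₀)) hT hK (fun i => hu.1 i) hk i j).trans ?_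
      simp only [Estimator.cov, Matrix.of_apply, hu.1]
      rfl
    have hvar : ∀ i, ∫ ω, (average T θ₀ (d ω).2 i - θ₀ i) ^ 2 ∂(law fun _ => ρ θ₀) ≤ K ^ 2 / k :=
      fun i => by
      simp_rw [sq (_ - _)]
      rw [hcov]
      have hTb : ∀ z, |(T z i - θ₀ i) * (T z i - θ₀ i)| ≤ K ^ 2 := fun z => by
        rw [abs_mul, sq]
        have := (abs_coord_le (T z - θ₀) i).trans (hK z)
        exact mul_le_mul this this (abs_nonneg _) hK0
      have := abs_integral_le_of_abs_le (μ := B.outcome (ρ θ₀)) hTb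
      rw [probReal_univ, mul_one] at this
      have e : (B.singleEstimator T hT).cov ρ θ₀ i i
          = ∫ z, (T z i - θ₀ i) * (T z i - θ₀ i) ∂(B.outcome (ρ θ₀)) := by
        simp only [Estimator.cov, Matrix.of_apply, hu.1]
        rfl
      rw [e]
      gcongr
      exact (le_abs_self _).trans this
    have hmem : ∀ i, MemLp (fun ω => average T θ₀ (d ω).2 i - θ₀ i) 2 (law fun _ => ρ θ₀) := fun i =>
      MemLp.of_bound (hcoord i).aestronglyMeasurable K (Eventually.of_forall fun ω => hbd i ω)
    have key := abs_integral_add_mul_add_sub_le (hmem i) (hmem j) (hL i).1 (hL j).1 (by positivity)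
      (hvar i) (hvar j) (hL i).2 (hL j).2
    rw [hcov] at key
    refine le_of_eq_of_le ?_ key
    congr 2
    refine integral_congr_ae (Eventually.of_forall fun ω => ?_)
    simp only
    ring

end

end

/-! ### The sequence of one-way estimators -/

section

variable {m n : ℕ}

section Dominant

variable {Θ : Set (Param m)} {ρ : Param m → TraceClass H} {r : Param m → ℝ} {a₁ : ℝ}

variable (H) in
/-- The inclusion of the trace class into the bounded operators. -/
def TraceClass.opCLM : TraceClass H →L[ℂ] (H →L[ℂ] H) :=
  LinearMap.mkContinuous op 1 fun A => by rw [one_mul]; exact norm_op_le A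

theorem TraceClass.isPos_integral {α : Type*} [MeasurableSpace α] {μ : Measure α}
    {f : α → TraceClass H} (hf : ∀ᵐ t ∂μ, (f t).IsPos) : (∫ t, f t ∂μ).IsPos := by
  by_cases hi : Integrable f μ
  · refine isPos_iff_inner.2 fun v => ?_
    have e : inner ℂ v ((∫ t, f t ∂μ).op v) = ∫ t, inner ℂ v ((f t).op v) ∂μ := by
      have h := (((innerSL ℂ v).comp (ContinuousLinearMap.apply ℂ H v)).comp
        (opCLM H)).integral_comp_comm hi
      exact h.symm
    rw [e]
    refine integral_nonneg_of_ae ?_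
    filter_upwards [hf] with t ht
    exact isPos_iff_inner.1 ht v
  · rw [integral_undef hi]
    exact isPos_zero

theorem dominant_isPos_and_tr_le {R : ℝ} (hr : IsRadius Θ r) (h_smooth : SmoothModel Θ ρ a₁)
    (hR : ∀ θ ∈ Θ, r θ ≤ R) {θ : Param m} (hθ : θ ∈ Θ) (i : Fin m) :
    (dominant ρ r i θ).IsPos ∧ (dominant ρ r i θ).tr.re ≤ a₁ * (1 + 2 * |R|) := by
  have hr0 := hr.pos θ hθ
  have hmem : ∀ t ∈ Set.Icc (-r θ) (r θ), θ + t • coordVec i ∈ Θ := hr.mem θ hθ i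
  have ha : 0 ≤ a₁ := (norm_nonneg _).trans (h_smooth.bound θ hθ i)
  have hpos : (dominant ρ r i θ).IsPos := by
    refine (isPos_abs _).add ?_
    rw [intervalIntegral.integral_of_le (by linarith)]
    exact isPos_integral (Eventually.of_forall fun t => isPos_abs _)
  refine ⟨hpos, ?_⟩
  rw [← hpos.norm_eq]
  refine (norm_add_le _ _).trans ?_
  have h1 : ‖(pderiv i ρ (θ - r θ • coordVec i)).abs‖ ≤ a₁ := by
    rw [TraceClass.norm_abs]
    refine h_smooth.bound _ ?_ i
    have := hmem (-r θ) ⟨le_rfl, by linarith⟩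
    rwa [neg_smul, ← sub_eq_add_neg] at this
  have h2 : ‖∫ t in (-r θ)..(r θ), (pderiv i (pderiv i ρ) (θ + t • coordVec i)).abs‖
      ≤ a₁ * |r θ - -r θ| := by
    refine intervalIntegral.norm_integral_le_of_norm_le_const fun t ht => ?_
    rw [TraceClass.norm_abs]
    rw [Set.uIoc_of_le (by linarith)] at ht
    exact h_smooth.bound₂ _ (hmem t ⟨ht.1.le, ht.2⟩) i i
  have h3 : |r θ - -r θ| ≤ 2 * |R| := by
    rw [abs_of_nonneg (by linarith)]
    linarith [hR θ hθ, le_abs_self R]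
  nlinarith [mul_le_mul_of_nonneg_left h3 ha]

end Dominant

section Sequence

variable {Θ : Set (Param m)} {ρ : Param m → TraceClass H} {D : Fin m → Param m → TraceClass H}
  {a₁ c K : ℝ} {θ₀ : Param m} {lA lB : ℕ}

/-- One-way semi-classical estimators all of whose defects are controlled by `n / (N² δ⁴)`, where
the preliminary estimate uses `N` of the `n` samples and is trusted within the distance `δ`. -/
theorem exists_oneWay_hybrid [SeparableSpace H] (hΘ : IsOpen Θ)
    (hρ : ∀ θ ∈ Θ, (ρ θ).IsDensity)
    (h_smooth : SmoothModel Θ ρ a₁) (h_log : ∀ θ ∈ Θ, ∀ i, HasLogDerivative (ρ θ) (pderiv i ρ θ))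
    (hc : 0 < c) (hD : ∀ θ ∈ Θ, ∀ i, (D i θ).IsPos ∧ (D i θ).tr.re ≤ a₁ * c)
    (A : Instrument H (Fin lA → ℝ)) {x : ∀ N, (Fin N → Fin lA → ℝ) → Param m}
    (hx : ∀ N, Measurable (x N))
    (hm : ∀ N, 0 < N → (A.repeatedEstimator (x N) (hx N)).MomentBound Θ ρ D a₁)
    (h4 : ∀ θ ∈ Θ, ∃ C : ℝ, ∀ N : ℕ, 0 < N →
      ∫⁻ w, ‖x N w - θ‖ₑ ^ 4 ∂(A.repeatedEstimator (x N) (hx N)).iidLaw (ρ θ)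
        ≤ ENNReal.ofReal (C / N ^ 2))
    (B : Instrument H (Fin lB → ℝ)) {T : (Fin lB → ℝ) → Param m} (hT : Measurable T)
    (hθ₀ : θ₀ ∈ Θ) (hK0 : 0 ≤ K) (hK : ∀ z, ‖T z - θ₀‖ ≤ K)
    (hu : (B.singleEstimator T hT).LocallyUnbiased ρ θ₀) :
    ∃ C : Θ → ℝ, (∀ θ, 0 ≤ C θ) ∧ ∀ n N : ℕ, N ≤ n → ∀ δ : ℝ, 0 < δ → δ ≤ 1 →
      ∃ e : SemiClassicalEstimator H n m, e.meas.IsOneWay ∧ (0 < N →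
        e.toEstimator.MomentBound Θ ρ D a₁ ∧ ∀ θ : Θ, ∃ E, e.toEstimator.HasMeanDeriv ρ θ E ∧
        ((θ : Param m) ≠ θ₀ → 2 * δ ≤ ‖(θ : Param m) - θ₀‖ → ∀ E',
          (A.repeatedEstimator (x N) (hx N)).HasMeanDeriv ρ θ E' → ∀ i,
          (e.toEstimator.mean ρ θ i - (A.repeatedEstimator (x N) (hx N)).mean ρ θ i) ^ 2
              ≤ C θ * (n / (N ^ 2 * δ ^ 4)) ∧
            ∀ j, (E i j - E' i j) ^ 2 ≤ C θ * (n / (N ^ 2 * δ ^ 4))) ∧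
        ((θ : Param m) = θ₀ → N < n → ∀ i,
          (e.toEstimator.mean ρ θ i - θ₀ i) ^ 2 ≤ C θ * (n / (N ^ 2 * δ ^ 4)) ∧
            ∀ j, (E i j - (1 : Matrix (Fin m) (Fin m) ℝ) i j) ^ 2 ≤ C θ * (n / (N ^ 2 * δ ^ 4)) ∧
              |n * e.toEstimator.mse ρ θ i j
                - (n / (n - N)) * (B.singleEstimator T hT).cov ρ θ₀ i j|
              ≤ 2 * √(K ^ 2 * (n / (n - N)) * (C θ * (n / (N ^ 2 * δ ^ 4))))
                + C θ * (n / (N ^ 2 * δ ^ 4)))) := by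
  choose b hb using fun θ : Θ => h4 θ θ.2
  choose q hq Hq using fun θ : Θ => exists_hasMeanDeriv_hybridEstimator (D := D) (θ₀ := θ₀) hΘ hρ
    h_smooth h_log hK0 θ.2
  obtain ⟨q', hq', Hq'⟩ := exists_hasMeanDeriv_hybridEstimator_self (D := D) hΘ hρ h_smooth h_log hK0
    hθ₀
  set s : Θ → ℝ := fun θ => (K + ‖(θ : Param m) - θ₀‖) ^ 2 * (2 / ‖(θ : Param m) - θ₀‖) ^ 4 with hs
  have hs0 : ∀ θ, 0 ≤ s θ := fun θ => by positivity
  refine ⟨fun θ => (s θ + (1 + K) ^ 2) * |b θ| * (1 + q θ + q'), fun θ => ?_, ?_⟩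
  · have := hq θ; have := hs0 θ; positivity
  rintro n N hNn δ hδ hδ1
  obtain ⟨k, rfl⟩ := Nat.exists_eq_add_of_le hNn
  obtain ⟨S, law, d, hS, hlaw, h⟩ := exists_oneWay_isBlockLaw N k A B (hρ θ₀ hθ₀)
  refine ⟨⟨S, law, hlaw, (hybridEstimator law h.measurable (hx N) hT θ₀ δ).est,
    (hybridEstimator law h.measurable (hx N) hT θ₀ δ).measurable_est⟩, hS, fun hN => ?_⟩
  have hmom := momentBound_hybridEstimator h hρ hN hc hD (hx N) hT (hm N hN) hK0 hK hδ
  have hN' : (1 : ℝ) ≤ N := by exact_mod_cast hN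
  have hδ4 : δ ^ 4 ≤ 1 := pow_le_one₀ hδ.le hδ1
  have hδ4' : 0 < δ ^ 4 := by positivity
  have hb' : ∀ θ : Θ, ∫⁻ w, ‖x N w - θ‖ₑ ^ 4 ∂(Measure.pi fun _ => A.outcome (ρ θ))
      ≤ ENNReal.ofReal (|b θ| / N ^ 2) := fun θ => (hb θ N hN).trans
    (ENNReal.ofReal_le_ofReal (by gcongr; exact le_abs_self _))
  have hbn : ∀ θ : Θ, 0 ≤ |b θ| / (N : ℝ) ^ 2 := fun θ => by positivity
  have hw : ∀ t y : ℝ, 0 ≤ t → 0 ≤ y → ∀ θ : Θ, t ≤ s θ + (1 + K) ^ 2 → y ≤ 1 + q θ + q' →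
      t / δ ^ 4 * (|b θ| / N ^ 2) * ((N + k : ℕ) * y)
        ≤ (s θ + (1 + K) ^ 2) * |b θ| * (1 + q θ + q') * ((N + k : ℕ) / (N ^ 2 * δ ^ 4)) := by
    intro t y ht hy θ hts hyq
    have e : t / δ ^ 4 * (|b θ| / N ^ 2) * ((N + k : ℕ) * y)
        = t * |b θ| * y * ((N + k : ℕ) / (N ^ 2 * δ ^ 4)) := by
      field_simp
    rw [e]
    have := hs0 θ
    gcongr
  have hn1 : (1 : ℝ) ≤ (N + k : ℕ) := by exact_mod_cast Nat.le_add_right_of_le hN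
  refine ⟨hmom, fun θ => ?_⟩
  by_cases hne : (θ : Param m) = θ₀
  · rcases Nat.eq_zero_or_pos k with rfl | hk
    · obtain ⟨E, hE, -⟩ := Hq θ h (hx N) hT (hm N hN) hmom hK hδ (hbn θ) (hb' θ)
      exact ⟨E, hE, fun h' => absurd hne h', fun _ h' => absurd h' (by simp)⟩
    · have hθ' : θ = ⟨θ₀, hθ₀⟩ := Subtype.ext hne
      subst hθ'
      obtain ⟨E, hE, hE'⟩ := Hq' h (hx N) hT hmom hK hu hδ hδ1 (hbn _) (hb' ⟨θ₀, hθ₀⟩) hk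
      refine ⟨E, hE, fun h' => absurd rfl h', fun _ _ i => ?_⟩
      obtain ⟨e1, e2⟩ := hE' i
      have hC1 := hw ((1 + K) ^ 2) 1 (by positivity) zero_le_one ⟨θ₀, hθ₀⟩
        (by linarith [hs0 ⟨θ₀, hθ₀⟩]) (by linarith [hq ⟨θ₀, hθ₀⟩])
      have hC2 := hw ((1 + K) ^ 2) q' (by positivity) hq' ⟨θ₀, hθ₀⟩
        (by linarith [hs0 ⟨θ₀, hθ₀⟩]) (by linarith [hq ⟨θ₀, hθ₀⟩])
      set ε := (1 + K) ^ 2 / δ ^ 4 * (|b ⟨θ₀, hθ₀⟩| / N ^ 2) with hε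
      have hε0 : 0 ≤ ε := by positivity
      refine ⟨e1.trans (le_trans ?_ hC1), fun j => ⟨(e2 j).1.trans hC2, ?_⟩⟩
      · rw [mul_one]; exact le_mul_of_one_le_right hε0 hn1
      · have e3 := (e2 j).2
        have hk' : (k : ℝ) ≠ 0 := by positivity
        have hnk : ((N + k : ℕ) : ℝ) - N = k := by push_cast; ring
        rw [hnk]
        rw [mul_one] at hC1
        set nn : ℝ := ((N + k : ℕ) : ℝ) with hnn
        have e4 : ∀ p v : ℝ, nn * p - nn / k * v = nn * (p - v / k) := fun p v => by
          field_simp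
        rw [e4, abs_mul, abs_of_nonneg (by linarith)]
        refine (mul_le_mul_of_nonneg_left e3 (by linarith)).trans ?_
        rw [mul_add]
        have e5 : nn * (2 * √(K ^ 2 / k * ε)) = 2 * √(K ^ 2 * (nn / k) * (ε * nn)) := by
          have : K ^ 2 * (nn / k) * (ε * nn) = nn ^ 2 * (K ^ 2 / k * ε) := by
            field_simp
          rw [this, Real.sqrt_mul (sq_nonneg _), Real.sqrt_sq (by linarith)]
          ring
        rw [e5]
        have h0 : 0 ≤ K ^ 2 * (nn / k) := by positivity
        refine add_le_add (mul_le_mul_of_nonneg_left (Real.sqrt_le_sqrt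
          (mul_le_mul_of_nonneg_left hC1 h0)) zero_le_two) ?_
        rw [mul_comm]
        exact hC1
  · obtain ⟨E, hE, hE'⟩ := Hq θ h (hx N) hT (hm N hN) hmom hK hδ (hbn θ) (hb' θ)
    refine ⟨E, hE, fun _ hd E' hEE i => ?_, fun h' => absurd h' hne⟩
    obtain ⟨e1, e2⟩ := hE' hne hd E' hEE i
    have hC1 := hw (s θ) 1 (hs0 θ) zero_le_one θ
        (by linarith [sq_nonneg (1 + K)]) (by linarith [hq θ])
    have hC2 := hw (s θ) (q θ) (hs0 θ) (hq θ) θ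
        (by linarith [sq_nonneg (1 + K)]) (by linarith [hq θ])
    have hδs : s θ ≤ s θ / δ ^ 4 := (le_div_iff₀ hδ4').2 (mul_le_of_le_one_right (hs0 θ) hδ4)
    refine ⟨e1.trans (le_trans ?_ hC1), fun j => (e2 j).trans (le_trans ?_ hC2)⟩
    · rw [mul_one]
      refine le_trans ?_ (le_mul_of_one_le_right (by have := hs0 θ; positivity) hn1)
      gcongr
    · have := hq θ
      gcongr

end Sequence

end

/-! ### The single-sample bound is attained -/

section

variable {m : ℕ}

/-- The number of samples for the preliminary estimate, and the distance within which it is trusted: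
`N ∼ n ^ (2 / 3)` and `δ ∼ n ^ (-1 / 24)`. -/
theorem exists_blockSize_radius : ∃ (N : ℕ → ℕ) (δ : ℕ → ℝ), (∀ n, N n ≤ n) ∧
    (∀ n, 0 < n → 0 < N n) ∧ Tendsto N atTop atTop ∧ (∀ᶠ n in atTop, N n < n) ∧
    Tendsto (fun n : ℕ => (n : ℝ) / (n - N n)) atTop (𝓝 1) ∧ (∀ n, 0 < δ n) ∧ (∀ n, δ n ≤ 1) ∧
    Tendsto δ atTop (𝓝 0) ∧
    Tendsto (fun n : ℕ => (n : ℝ) / ((N n : ℝ) ^ 2 * δ n ^ 4)) atTop (𝓝 0) := by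
  have hN : ∀ n : ℕ, (n : ℝ) ^ (2 / 3 : ℝ) ≤ (⌈(n : ℝ) ^ (2 / 3 : ℝ)⌉₊ : ℝ) := fun n => Nat.le_ceil _
  have hlim : ∀ s : ℝ, 0 < s → Tendsto (fun n : ℕ => (n : ℝ) ^ (-s)) atTop (𝓝 0) := fun s hs =>
    (tendsto_rpow_neg_atTop hs).comp tendsto_natCast_atTop_atTop
  have hquot : Tendsto (fun n : ℕ => ((⌈(n : ℝ) ^ (2 / 3 : ℝ)⌉₊ : ℕ) : ℝ) / n) atTop (𝓝 0) := by
    have h1 : Tendsto (fun n : ℕ => (n : ℝ) ^ (-(1 / 3) : ℝ) + (n : ℝ) ^ (-1 : ℝ)) atTop (𝓝 0) := by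
      simpa using (hlim (1 / 3) (by norm_num)).add (hlim 1 one_pos)
    refine squeeze_zero' (Eventually.of_forall fun n => by positivity) ?_ h1
    filter_upwards [eventually_gt_atTop 0] with n hn
    have hn' : (0 : ℝ) < n := by exact_mod_cast hn
    rw [div_le_iff₀ hn', add_mul, ← Real.rpow_add_one hn'.ne', ← Real.rpow_add_one hn'.ne']
    refine (Nat.ceil_lt_add_one (by positivity)).le.trans_eq ?_
    norm_num
  refine ⟨fun n => ⌈(n : ℝ) ^ (2 / 3 : ℝ)⌉₊, fun n => ((n : ℝ) + 1) ^ (-(1 / 24) : ℝ), fun n => ?_,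
    fun n hn => ?_, ?_, ?_, ?_, fun n => by positivity, fun n => ?_, ?_, ?_⟩
  · rcases Nat.eq_zero_or_pos n with rfl | hn
    · simp
    · refine Nat.ceil_le.2 ?_
      have hn' : (1 : ℝ) ≤ n := by exact_mod_cast hn
      calc (n : ℝ) ^ (2 / 3 : ℝ) ≤ (n : ℝ) ^ (1 : ℝ) :=
            Real.rpow_le_rpow_of_exponent_le hn' (by norm_num)
        _ = n := Real.rpow_one _
  · have hn' : (0 : ℝ) < n := by exact_mod_cast hn
    exact Nat.ceil_pos.2 (by positivity)
  · exact (tendsto_nat_ceil_atTop.comp ((tendsto_rpow_atTop (by norm_num)).comp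
      tendsto_natCast_atTop_atTop))
  · filter_upwards [hquot.eventually (gt_mem_nhds one_pos), eventually_gt_atTop 0] with n h hn
    have hn' : (0 : ℝ) < n := by exact_mod_cast hn
    rw [div_lt_one hn'] at h
    exact_mod_cast h
  · have h1 : Tendsto (fun n : ℕ => (1 - ((⌈(n : ℝ) ^ (2 / 3 : ℝ)⌉₊ : ℕ) : ℝ) / n)⁻¹) atTop (𝓝 1) := by
      simpa using (hquot.const_sub 1).inv₀ (by norm_num)
    refine h1.congr' ?_
    filter_upwards [eventually_gt_atTop 0] with n hn
    have hn' : (n : ℝ) ≠ 0 := by positivity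
    rw [one_sub_div hn', inv_div]
  · exact Real.rpow_le_one_of_one_le_of_nonpos (by linarith [(Nat.cast_nonneg n : (0 : ℝ) ≤ n)])
      (by norm_num)
  · exact (tendsto_rpow_neg_atTop (by norm_num)).comp
      (tendsto_atTop_add_const_right _ _ tendsto_natCast_atTop_atTop)
  · have h1 : Tendsto (fun n : ℕ => 2 * (n : ℝ) ^ (-(1 / 6) : ℝ)) atTop (𝓝 0) := by
      simpa using (hlim (1 / 6) (by norm_num)).const_mul 2
    refine squeeze_zero' (Eventually.of_forall fun n => by positivity) ?_ h1
    filter_upwards [eventually_gt_atTop 0] with n hn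
    have hn' : (0 : ℝ) < n := by exact_mod_cast hn
    have hn1 : (1 : ℝ) ≤ n := by exact_mod_cast hn
    have e1 : (n : ℝ) ^ (4 / 3 : ℝ) ≤ ((⌈(n : ℝ) ^ (2 / 3 : ℝ)⌉₊ : ℕ) : ℝ) ^ 2 := by
      calc (n : ℝ) ^ (4 / 3 : ℝ) = ((n : ℝ) ^ (2 / 3 : ℝ)) ^ 2 := by
            rw [← Real.rpow_natCast, ← Real.rpow_mul hn'.le]; norm_num
        _ ≤ _ := pow_le_pow_left₀ (by positivity) (hN n) 2
    have e2 : (2 * n : ℝ) ^ (-(1 / 6) : ℝ) ≤ (((n : ℝ) + 1) ^ (-(1 / 24) : ℝ)) ^ 4 := by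
      rw [← Real.rpow_natCast, ← Real.rpow_mul (by positivity)]
      norm_num
      exact Real.rpow_le_rpow_of_nonpos (by positivity) (by linarith) (by norm_num)
    have e3 : (2 : ℝ) ^ (1 / 6 : ℝ) ≤ 2 := by
      calc (2 : ℝ) ^ (1 / 6 : ℝ) ≤ (2 : ℝ) ^ (1 : ℝ) :=
            Real.rpow_le_rpow_of_exponent_le (by norm_num) (by norm_num)
        _ = 2 := Real.rpow_one _
    calc (n : ℝ) / (((⌈(n : ℝ) ^ (2 / 3 : ℝ)⌉₊ : ℕ) : ℝ) ^ 2 * (((n : ℝ) + 1) ^ (-(1 / 24) : ℝ)) ^ 4)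
        ≤ (n : ℝ) / ((n : ℝ) ^ (4 / 3 : ℝ) * (2 * n : ℝ) ^ (-(1 / 6) : ℝ)) := by gcongr
      _ = (2 : ℝ) ^ (1 / 6 : ℝ) * (n : ℝ) ^ (-(1 / 6) : ℝ) := by
        rw [Real.mul_rpow zero_le_two hn'.le, Real.rpow_neg zero_le_two, div_eq_iff (by positivity)]
        have : (n : ℝ) ^ (-(1 / 6) : ℝ) * (n : ℝ) ^ (4 / 3 : ℝ) * (n : ℝ) ^ (-(1 / 6) : ℝ) = n := by
          rw [← Real.rpow_add hn', ← Real.rpow_add hn']; norm_num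
        have h2 : (0 : ℝ) < 2 ^ (1 / 6 : ℝ) := by positivity
        field_simp
        linarith
      _ ≤ _ := by gcongr

theorem tendsto_of_sq_sub_le {f g ε : ℕ → ℝ} {a : ℝ} (hg : Tendsto g atTop (𝓝 a))
    (hε : Tendsto ε atTop (𝓝 0)) (h : ∀ᶠ n in atTop, (f n - g n) ^ 2 ≤ ε n) :
    Tendsto f atTop (𝓝 a) := by
  have h1 : Tendsto (fun n => √(ε n)) atTop (𝓝 0) := by
    simpa [Function.comp_def] using (Real.continuous_sqrt.tendsto 0).comp hε
  have h2 : Tendsto (fun n => f n - g n) atTop (𝓝 0) :=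
    squeeze_zero_norm' (h.mono fun n hn => Real.abs_le_sqrt hn) h1
  simpa using h2.add hg

/-- A locally unbiased estimator on a single sample gives rise to a sequence of one-way
semi-classical estimators: a preliminary estimate decides whether the estimates from the other
samples are averaged. -/
theorem oneWayBound_le_singleSampleBound [SeparableSpace H] {Θ : Set (Param m)}
    {ρ : Param m → TraceClass H} {a₁ : ℝ} {r : Param m → ℝ} {θ₀ : Param m} (hΘ : IsOpen Θ)
    (hρ : ∀ θ ∈ Θ, (ρ θ).IsDensity) (hr : IsRadius Θ r) (h_smooth : SmoothModel Θ ρ a₁)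
    (h_log : ∀ θ ∈ Θ, ∀ i, HasLogDerivative (ρ θ) (pderiv i ρ θ))
    (h_pilot : HasPilotEstimator Θ ρ (dominant ρ r) a₁) (hθ₀ : θ₀ ∈ Θ)
    (G : Matrix (Fin m) (Fin m) ℝ) :
    oneWayBound Θ ρ (dominant ρ r) a₁ G θ₀
      ≤ singleSampleBound (fun _ e => e.BoundedRange) ρ G θ₀ := by
  refine le_iInf fun lB => le_iInf fun B => le_iInf fun T => le_iInf fun hT => le_iInf fun hu =>
    le_iInf fun hb => ?_
  obtain ⟨a, ha⟩ := hb
  have ha : ∀ z z', ‖T z - T z'‖ ≤ a := ha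
  have ha0 : 0 ≤ a := (norm_nonneg _).trans (ha 0 0)
  obtain ⟨lA, A, x, hx, hunb, hm, h4⟩ := h_pilot
  obtain ⟨R, hR⟩ := hr.bounded
  obtain ⟨C, hC, hseq⟩ := exists_oneWay_hybrid hΘ hρ h_smooth h_log
    (c := 1 + 2 * |R|) (by positivity) (fun θ hθ i => dominant_isPos_and_tr_le hr h_smooth hR hθ i)
    A hx hm h4 B hT hθ₀ (K := a + ‖T 0 - θ₀‖) (by positivity)
    (fun z => (norm_sub_le_norm_sub_add_norm_sub _ (T 0) _).trans (by gcongr; exact ha z 0)) hu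
  obtain ⟨N, δ, hNn, hN0, hNlim, hNlt, hratio, hδ0, hδ1, hδlim, hw⟩ := exists_blockSize_radius
  choose e hone he using fun n => hseq n (N n) (hNn n) (δ n) (hδ0 n) (hδ1 n)
  have hCw : ∀ θ : Θ, Tendsto (fun n : ℕ => C θ * (n / ((N n : ℝ) ^ 2 * δ n ^ 4))) atTop (𝓝 0) :=
    fun θ => by simpa using hw.const_mul (C θ)
  refine iInf_le_of_le e (iInf_le_of_le (fun n _ => hone n) (iInf_le_of_le (fun θ hθ => ?_)
    (iInf_le_of_le (fun n hn => (he n (hN0 n hn)).1) ?_)))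
  · have hE : ∀ n, ∃ E, 0 < n → (e n).toEstimator.HasMeanDeriv ρ θ E := fun n => by
      rcases Nat.eq_zero_or_pos n with h | h
      · exact ⟨0, fun h' => absurd h' (by omega)⟩
      · exact ⟨_, fun _ => ((he n (hN0 n h)).2 ⟨θ, hθ⟩).choose_spec.1⟩
    choose E hE using hE
    by_cases hne : θ = θ₀
    · have key : ∀ᶠ n in atTop, ∀ i, ((e n).toEstimator.mean ρ θ i - θ i) ^ 2
            ≤ C ⟨θ, hθ⟩ * (n / ((N n : ℝ) ^ 2 * δ n ^ 4)) ∧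
          ∀ j, (E n i j - (1 : Matrix (Fin m) (Fin m) ℝ) i j) ^ 2
            ≤ C ⟨θ, hθ⟩ * (n / ((N n : ℝ) ^ 2 * δ n ^ 4)) := by
        filter_upwards [hNlt, eventually_gt_atTop 0] with n h1 h2 i
        obtain ⟨E', hE', -, h3⟩ := (he n (hN0 n h2)).2 ⟨θ, hθ⟩
        rw [(hE n h2).unique hE']
        have h3 := h3 hne h1 i
        refine ⟨?_, fun j => (h3.2 j).1⟩
        have := h3.1
        rwa [← hne] at this
      refine ⟨fun i => tendsto_of_sq_sub_le tendsto_const_nhds (hCw ⟨θ, hθ⟩)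
        (key.mono fun n h => (h i).1), E, hE, ?_⟩
      refine tendsto_pi_nhds.2 fun i => tendsto_pi_nhds.2 fun j => ?_
      exact tendsto_of_sq_sub_le tendsto_const_nhds (hCw ⟨θ, hθ⟩) (key.mono fun n h => (h i).2 j)
    · obtain ⟨hmean, B', hB', hB'lim⟩ := hunb θ hθ
      have hd : ∀ᶠ n in atTop, 2 * δ n ≤ ‖θ - θ₀‖ := by
        have : Tendsto (fun n => 2 * δ n) atTop (𝓝 0) := by simpa using hδlim.const_mul 2
        exact (this.eventually (gt_mem_nhds (norm_pos_iff.2 (sub_ne_zero.2 hne)))).mono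
          fun n h => h.le
      have key : ∀ᶠ n in atTop, ∀ i, ((e n).toEstimator.mean ρ θ i
            - (A.repeatedEstimator (x (N n)) (hx (N n))).mean ρ θ i) ^ 2
            ≤ C ⟨θ, hθ⟩ * (n / ((N n : ℝ) ^ 2 * δ n ^ 4)) ∧
          ∀ j, (E n i j - B' (N n) i j) ^ 2
            ≤ C ⟨θ, hθ⟩ * (n / ((N n : ℝ) ^ 2 * δ n ^ 4)) := by
        filter_upwards [hd, eventually_gt_atTop 0] with n h1 h2 i
        obtain ⟨E', hE', h3, -⟩ := (he n (hN0 n h2)).2 ⟨θ, hθ⟩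
        rw [(hE n h2).unique hE']
        exact h3 hne h1 _ (hB' _ (hN0 n h2)) i
      refine ⟨fun i => tendsto_of_sq_sub_le ((hmean i).comp hNlim) (hCw ⟨θ, hθ⟩)
        (key.mono fun n h => (h i).1), E, hE, ?_⟩
      refine tendsto_pi_nhds.2 fun i => tendsto_pi_nhds.2 fun j => ?_
      have hlim := (tendsto_pi_nhds.1 (tendsto_pi_nhds.1 hB'lim i) j).comp hNlim
      exact tendsto_of_sq_sub_le hlim (hCw ⟨θ, hθ⟩) (key.mono fun n h => (h i).2 j)
  · set K := a + ‖T 0 - θ₀‖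
    have hmse : ∀ i j, Tendsto (fun n : ℕ => n * (e n).toEstimator.mse ρ θ₀ i j) atTop
        (𝓝 ((B.singleEstimator T hT).cov ρ θ₀ i j)) := fun i j => by
      have h1 : Tendsto (fun n : ℕ => 2 * √(K ^ 2 * (n / (n - N n)) *
          (C ⟨θ₀, hθ₀⟩ * (n / ((N n : ℝ) ^ 2 * δ n ^ 4))))
          + C ⟨θ₀, hθ₀⟩ * (n / ((N n : ℝ) ^ 2 * δ n ^ 4))) atTop (𝓝 0) := by
        have h2 := (hratio.const_mul (K ^ 2)).mul (hCw ⟨θ₀, hθ₀⟩)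
        have h3 := (((Real.continuous_sqrt.tendsto _).comp h2).const_mul 2).add (hCw ⟨θ₀, hθ₀⟩)
        simpa using h3
      have h2 : Tendsto (fun n : ℕ => n * (e n).toEstimator.mse ρ θ₀ i j
          - (n / (n - N n)) * (B.singleEstimator T hT).cov ρ θ₀ i j) atTop (𝓝 0) := by
        refine squeeze_zero_norm' ?_ h1
        filter_upwards [hNlt, eventually_gt_atTop 0] with n h3 h4
        obtain ⟨E', -, -, h5⟩ := (he n (hN0 n h4)).2 ⟨θ₀, hθ₀⟩
        exact ((h5 rfl h3 i).2 j).2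
      have h3 := h2.add (hratio.mul_const ((B.singleEstimator T hT).cov ρ θ₀ i j))
      simpa using h3
    have htr : Tendsto (fun n : ℕ => n * (G * (e n).toEstimator.mse ρ θ₀).trace) atTop
        (𝓝 (G * (B.singleEstimator T hT).cov ρ θ₀).trace) := by
      simp only [Matrix.trace, Matrix.diag_apply, Matrix.mul_apply, Finset.mul_sum]
      refine tendsto_finsetSum _ fun i _ => tendsto_finsetSum _ fun j _ => ?_
      have := (hmse j i).const_mul (G i j)
      refine this.congr fun n => by ring
    exact ((continuous_coe_real_ereal.tendsto _).comp htr).limsup_eq.le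

end

/-! ### Operators of effects -/

section

theorem hsSq_rankOne (u w : H) : hsSq (InnerProductSpace.rankOne ℂ u w) = ‖u‖ₑ ^ 2 * ‖w‖ₑ ^ 2 := by
  unfold hsSq
  rw [← tsum_enorm_inner_sq w, ← ENNReal.tsum_mul_left]
  refine tsum_congr fun k => ?_
  rw [InnerProductSpace.rankOne_apply, enorm_smul, mul_pow, mul_comm, ← inner_conj_symm,
    RCLike.enorm_conj]

theorem traceNorm_rankOne_le (u w : H) :
    traceNorm (InnerProductSpace.rankOne ℂ u w) ≤ ‖u‖ₑ * ‖w‖ₑ := by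
  rcases eq_or_ne u 0 with rfl | hu
  · simp [traceNorm_zero]
  rcases eq_or_ne w 0 with rfl | hw
  · simp [traceNorm_zero]
  have hu' : (‖u‖ : ℝ) ≠ 0 := norm_ne_zero_iff.2 hu
  have hw' : (‖w‖ : ℝ) ≠ 0 := norm_ne_zero_iff.2 hw
  -- the factors have equal Hilbert-Schmidt norms
  obtain ⟨c, hc, hcc⟩ : ∃ c : ℝ, 0 < c ∧ c ^ 2 = ‖w‖ ^ 3 / ‖u‖ :=
    ⟨√(‖w‖ ^ 3 / ‖u‖), by positivity, Real.sq_sqrt (by positivity)⟩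
  have e : InnerProductSpace.rankOne ℂ u w
      = InnerProductSpace.rankOne ℂ u (((c / ‖w‖ ^ 2 : ℝ) : ℂ) • w)
        * InnerProductSpace.rankOne ℂ (((c⁻¹ : ℝ) : ℂ) • w) w := by
    ext v
    simp only [mul_apply_eq_comp, InnerProductSpace.rankOne_apply, inner_smul_left, inner_smul_right,
      inner_self_eq_norm_sq_to_K, smul_smul, Complex.conj_ofReal]
    congr 1
    have : (c : ℂ) ≠ 0 := by exact_mod_cast hc.ne'
    have h2 : (‖w‖ : ℂ) ≠ 0 := by exact_mod_cast hw'
    push_cast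
    simp only [Complex.coe_algebraMap]
    field_simp
  rw [e]
  refine (traceNorm_mul_le_hsSq _ _).trans ?_
  rw [hsSq_rankOne, hsSq_rankOne]
  have e3 : ∀ y : H, ‖y‖ₑ = ENNReal.ofReal ‖y‖ := fun y => (ofReal_norm y).symm
  simp only [e3, norm_smul, Complex.norm_real, Real.norm_eq_abs]
  rw [← ENNReal.ofReal_pow (by positivity), ← ENNReal.ofReal_pow (by positivity),
    ← ENNReal.ofReal_pow (by positivity), ← ENNReal.ofReal_pow (by positivity),
    ← ENNReal.ofReal_mul (by positivity), ← ENNReal.ofReal_mul (by positivity),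
    ← ENNReal.ofReal_mul (by positivity),
    ← ENNReal.ofReal_add (by positivity) (by positivity)]
  refine ENNReal.div_le_of_le_mul ?_
  have e2 : (2 : ℝ≥0∞) = ENNReal.ofReal 2 := by simp
  conv_rhs => rw [e2, ← ENNReal.ofReal_mul (by positivity)]
  refine ENNReal.ofReal_le_ofReal (le_of_eq ?_)
  rw [abs_of_pos (by positivity), abs_of_pos (by positivity)]
  rw [mul_pow, mul_pow, div_pow, inv_pow, hcc]
  field_simp
  norm_num

/-- The operator `|u⟩⟨w|`. -/
def dyad (u w : H) : TraceClass H :=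
  ofOp (InnerProductSpace.rankOne ℂ u w)
    ((traceNorm_rankOne_le u w).trans_lt (ENNReal.mul_lt_top enorm_lt_top enorm_lt_top)).ne

theorem op_dyad (u w : H) : (dyad u w).op = InnerProductSpace.rankOne ℂ u w := rfl

theorem norm_dyad_le (u w : H) : ‖dyad u w‖ ≤ ‖u‖ * ‖w‖ := by
  have := ENNReal.toReal_mono (ENNReal.mul_ne_top enorm_ne_top enorm_ne_top)
    (traceNorm_rankOne_le u w)
  rwa [ENNReal.toReal_mul, toReal_enorm, toReal_enorm] at this

theorem inner_dyad_self (u v : H) : inner ℂ v ((dyad u u).op v) = ((‖inner ℂ u v‖ ^ 2 : ℝ) : ℂ) := by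
  rw [op_dyad, InnerProductSpace.rankOne_apply, inner_smul_right, ← inner_conj_symm v u,
    RCLike.mul_conj]
  norm_cast

theorem isPos_dyad (u : H) : (dyad u u).IsPos := by
  rw [isPos_iff_inner]
  intro v
  rw [inner_dyad_self]
  exact Complex.zero_le_real.2 (sq_nonneg _)

theorem tr_re_dyad (u : H) : (dyad u u).tr.re = ‖u‖ ^ 2 := by
  have h : ENNReal.ofReal (dyad u u).tr.re = ENNReal.ofReal (‖u‖ ^ 2) := by
    have h1 : (dyad u u).tr.re = ∑' k, (inner ℂ (onb H k) ((dyad u u).op (onb H k))).re :=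
      Complex.re_tsum (dyad u u).summable_trace.of_norm
    have h2 := (dyad u u).summable_trace
    rw [h1, ENNReal.ofReal_pow (norm_nonneg _), ofReal_norm, ← tsum_enorm_inner_sq u]
    simp only [inner_dyad_self, Complex.ofReal_re] at h2 ⊢
    rw [ENNReal.ofReal_tsum_of_nonneg (fun _ => sq_nonneg _)]
    · refine tsum_congr fun k => ?_
      rw [ENNReal.ofReal_pow (norm_nonneg _), ofReal_norm, ← inner_conj_symm, RCLike.enorm_conj]
    · simpa using h2
  exact (ENNReal.ofReal_eq_ofReal_iff (isPos_dyad u).tr_re_nonneg (sq_nonneg _)).1 h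

/-- The effect `x ↦ N x Δ` of a POVM is given by an operator `E`, characterized by its quadratic
form. -/
theorem IsPovm.exists_effectOp {N : TraceClass H → Measure Ω} (hN : IsPovm N) (Δ : Set Ω) :
    ∃ E : H →L[ℂ] H, ∀ u, inner ℂ u (E u) = (((N (dyad u u)).real Δ : ℝ) : ℂ) := by
  have hb : ∀ x, ‖hN.cEffect Δ x‖ ≤ 2 * ‖hN.effect Δ‖ * ‖x‖ := fun x => by
    rw [hN.cEffect_apply]
    refine (norm_sub_le _ _).trans ?_
    rw [norm_mul, Complex.norm_I, one_mul, Complex.norm_real, Complex.norm_real]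
    have h1 := (hN.effect Δ).le_opNorm x
    have h2 := (hN.effect Δ).le_opNorm (Complex.I • x)
    rw [norm_smul, Complex.norm_I, one_mul] at h2
    linarith
  let B : H →ₗ⋆[ℂ] H →ₗ[ℂ] ℂ := LinearMap.mk₂'ₛₗ (starRingEnd ℂ) (RingHom.id ℂ)
    (fun w u => hN.cEffect Δ (dyad u w))
    (fun w w' u => by
      rw [← map_add]; congr 1; apply op_injective; simp only [op_dyad, map_add])
    (fun c w u => by
      rw [← map_smul]; congr 1; apply op_injective; simp only [op_dyad, map_smulₛₗ]; rfl)
    (fun w u u' => by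
      rw [← map_add]; congr 1; apply op_injective; simp only [op_dyad, map_add, add_apply])
    (fun c w u => by
      rw [RingHom.id_apply, ← map_smul]; congr 1; apply op_injective
      simp only [op_dyad, map_smul, smul_apply])
  let B' : H →L⋆[ℂ] H →L[ℂ] ℂ := LinearMap.mkContinuous₂ B (2 * ‖hN.effect Δ‖) fun w u => by
    refine (hb _).trans ?_
    rw [mul_assoc (2 * ‖hN.effect Δ‖), mul_comm ‖w‖]
    exact mul_le_mul_of_nonneg_left (norm_dyad_le u w) (by positivity)
  refine ⟨InnerProductSpace.continuousLinearMapOfBilin B', fun u => ?_⟩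
  rw [← inner_conj_symm, InnerProductSpace.continuousLinearMapOfBilin_apply]
  change (starRingEnd ℂ) (hN.cEffect Δ (dyad u u)) = _
  rw [hN.cEffect_of_isPos _ (isPos_dyad u), Complex.conj_ofReal]

/-- A positive contraction satisfies `E² ≤ E`. -/
theorem norm_sq_le_inner {E : H →L[ℂ] H} (h0 : 0 ≤ E) (h1 : E ≤ 1) (u : H) :
    ‖E u‖ ^ 2 ≤ (inner ℂ u (E u)).re := by
  set S := CFC.sqrt E with hS
  have hs : star S = S := (CFC.sqrt_nonneg _).isSelfAdjoint
  have hSS : S * S = E := CFC.sqrt_mul_sqrt_self _ h0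
  have hn : ‖S‖ * ‖S‖ ≤ 1 := by
    have := CStarRing.norm_star_mul_self (x := S)
    rw [hs, hSS] at this
    rw [← this]
    exact (CStarAlgebra.norm_le_one_iff_of_nonneg E h0).2 h1
  have e : inner ℂ u (E u) = ((‖S u‖ ^ 2 : ℝ) : ℂ) := by
    rw [← hSS, mul_apply_eq_comp, ← ContinuousLinearMap.adjoint_inner_left,
      ← ContinuousLinearMap.star_eq_adjoint, hs, inner_self_eq_norm_sq_to_K]
    norm_cast
  rw [e, Complex.ofReal_re, ← hSS, mul_apply_eq_comp]
  have h2 := S.le_opNorm (S u)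
  nlinarith [norm_nonneg (S (S u)), norm_nonneg (S u), norm_nonneg S,
    mul_le_mul h2 h2 (norm_nonneg _) (by positivity),
    mul_le_mul_of_nonneg_right hn (sq_nonneg ‖S u‖)]

/-- The operators `√x |e_k⟩⟨e_k| √x` sum up to at most `x`. -/
theorem IsPovm.sum_dyad_le {N : TraceClass H → Measure Ω} (hN : IsPovm N) {x : TraceClass H}
    (hx : x.IsPos) (Δ : Set Ω) (F : Finset (onbIndex H)) :
    ∑ k ∈ F, N (dyad (CFC.sqrt x.op (onb H k)) (CFC.sqrt x.op (onb H k))) Δ ≤ N x Δ := by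
  set S := CFC.sqrt x.op with hS
  have hs : star S = S := (CFC.sqrt_nonneg _).isSelfAdjoint
  have hSS : S * S = x.op := CFC.sqrt_mul_sqrt_self _ hx
  have hpos : ∀ F : Finset (onbIndex H), (∑ k ∈ F, dyad (S (onb H k)) (S (onb H k))).IsPos ∧
      N (∑ k ∈ F, dyad (S (onb H k)) (S (onb H k))) Δ
        = ∑ k ∈ F, N (dyad (S (onb H k)) (S (onb H k))) Δ := fun F => by
    classical
    induction F using Finset.induction_on with
    | empty =>
      refine ⟨isPos_zero, ?_⟩
      have : N (0 : TraceClass H) = 0 := by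
        rw [← Measure.measure_univ_eq_zero, hN.mass _ isPos_zero, tr_zero]; simp
      simp [this]
    | insert k s hk ih =>
      rw [Finset.sum_insert hk, Finset.sum_insert hk, hN.add _ _ (isPos_dyad _) ih.1,
        Measure.add_apply, ih.2]
      exact ⟨(isPos_dyad _).add ih.1, rfl⟩
  have hrest : (x - ∑ k ∈ F, dyad (S (onb H k)) (S (onb H k))).IsPos := by
    rw [isPos_iff_inner]
    intro v
    have e1 : inner ℂ v (x.op v) = ((‖S v‖ ^ 2 : ℝ) : ℂ) := by
      rw [← hSS, mul_apply_eq_comp, ← ContinuousLinearMap.adjoint_inner_left,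
        ← ContinuousLinearMap.star_eq_adjoint, hs, inner_self_eq_norm_sq_to_K]
      norm_cast
    have e2 : ∀ k, ‖inner ℂ (S (onb H k)) v‖ = ‖inner ℂ (S v) (onb H k)‖ := fun k => by
      rw [← ContinuousLinearMap.adjoint_inner_right, ← ContinuousLinearMap.star_eq_adjoint, hs,
        norm_inner_symm]
    rw [map_sub, map_sum, sub_apply, inner_sub_right, e1, sum_apply, inner_sum]
    simp only [inner_dyad_self, e2]
    have h3 := (onb H).orthonormal.sum_inner_products_le (S v) (s := F)
    rw [← Complex.ofReal_sum, ← Complex.ofReal_sub]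
    refine Complex.zero_le_real.2 (sub_nonneg.2 ?_)
    simpa only [norm_inner_symm] using h3
  have e := hN.add _ _ hrest (hpos F).1
  rw [sub_add_cancel] at e
  rw [e, Measure.add_apply, (hpos F).2]
  exact le_add_self

/-- In other words, `tr E x E ≤ tr E x` for the operator `E` of an effect. -/
theorem IsPovm.hsSq_mul_sqrt_le {N : TraceClass H → Measure Ω} (hN : IsPovm N) {Δ : Set Ω}
    {E : H →L[ℂ] H} (h0 : 0 ≤ E) (h1 : E ≤ 1)
    (hE : ∀ u, inner ℂ u (E u) = (((N (dyad u u)).real Δ : ℝ) : ℂ)) {x : TraceClass H}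
    (hx : x.IsPos) : hsSq (E * CFC.sqrt x.op) ≤ N x Δ := by
  rw [hsSq, ENNReal.tsum_eq_iSup_sum]
  refine iSup_le fun F => (Finset.sum_le_sum fun k _ => ?_).trans (hN.sum_dyad_le hx Δ F)
  have := hN.isFiniteMeasure (isPos_dyad (CFC.sqrt x.op (onb H k)))
  have h := norm_sq_le_inner h0 h1 (CFC.sqrt x.op (onb H k))
  rw [hE, Complex.ofReal_re] at h
  rw [mul_apply_eq_comp, ← ofReal_norm, ← ENNReal.ofReal_pow (norm_nonneg _)]
  exact (ENNReal.ofReal_le_ofReal h).trans_eq (ofReal_measureReal (by finiteness))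

end

/-! ### Compression of states by effects -/

section

theorem traceNorm_mul_le {V : H →L[ℂ] H} (hV : ‖V‖ ≤ 1) (A : H →L[ℂ] H) :
    traceNorm (V * A) ≤ traceNorm A := by
  rw [traceNorm, ENNReal.tsum_eq_iSup_sum]
  refine iSup_le fun F => le_of_forall_card F.card fun ε hε => ?_
  obtain ⟨W, hW, -, hA⟩ := exists_approx_polar (V * A) hε
  have hU : ‖star V * W‖ ≤ 1 := (norm_mul_le _ _).trans (by
    rw [norm_star]; exact mul_le_one₀ hV (norm_nonneg _) hW)
  calc ∑ k ∈ F, ENNReal.ofReal (inner ℂ (onb H k) (CFC.abs (V * A) (onb H k))).re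
      ≤ ∑ k ∈ F, (‖inner ℂ ((star V * W) (onb H k)) (A (onb H k))‖ₑ + ENNReal.ofReal ε) := by
        refine Finset.sum_le_sum fun k _ => ?_
        have h1 : ENNReal.ofReal (inner ℂ (onb H k) (CFC.abs (V * A) (onb H k))).re
            ≤ ‖inner ℂ (onb H k) (CFC.abs (V * A) (onb H k))‖ₑ := by
          rw [← ofReal_norm]
          exact ENNReal.ofReal_le_ofReal (Complex.re_le_norm _)
        have h2 := enorm_inner_le_add (V := (1 : H →L[ℂ] H))
          (ContinuousLinearMap.norm_id_le) hA ((onb H).orthonormal.1 k)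
        refine h1.trans (h2.trans_eq ?_)
        congr 2
        simp only [mul_apply_eq_comp, one_apply_eq_self,
          ContinuousLinearMap.star_eq_adjoint, ContinuousLinearMap.adjoint_inner_right,
          ContinuousLinearMap.adjoint_inner_left]
    _ = ∑ k ∈ F, ‖inner ℂ ((star V * W) (onb H k)) (A (onb H k))‖ₑ
          + F.card * ENNReal.ofReal ε := by
        rw [Finset.sum_add_distrib, Finset.sum_const, nsmul_eq_mul]
    _ ≤ _ := by gcongr; exact sum_enorm_inner_le hU F

theorem traceNorm_star (A : H →L[ℂ] H) : traceNorm (star A) = traceNorm A :=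
  le_antisymm (traceNorm_star_le A) (by simpa using traceNorm_star_le (star A))

theorem traceNorm_mul_le_scaled (A B : H →L[ℂ] H) {c : ℝ} (hc : 0 < c) :
    traceNorm (A * B) ≤ ENNReal.ofReal c * hsSq A + ENNReal.ofReal c⁻¹ * hsSq B := by
  have hs : ∀ (a : ℝ) (A : H →L[ℂ] H), hsSq ((a : ℂ) • A) = ENNReal.ofReal (a ^ 2) * hsSq A :=
    fun a A => by
      unfold hsSq
      rw [← ENNReal.tsum_mul_left]
      refine tsum_congr fun k => ?_
      rw [smul_apply, enorm_smul, mul_pow, ← ofReal_norm (a : ℂ), ← ENNReal.ofReal_pow (norm_nonneg _),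
        Complex.norm_real, Real.norm_eq_abs, sq_abs]
  have hq : 0 < √c := Real.sqrt_pos.2 hc
  have e : A * B = (((√c : ℝ) : ℂ) • A) * ((((√c)⁻¹ : ℝ) : ℂ) • B) := by
    rw [smul_mul_smul_comm, ← Complex.ofReal_mul, mul_inv_cancel₀ hq.ne', Complex.ofReal_one,
      one_smul]
  rw [e]
  refine (traceNorm_mul_le_hsSq _ _).trans ?_
  rw [hs, hs, inv_pow, Real.sq_sqrt hc.le]
  exact ENNReal.half_le_self

/-- The map `x ↦ E x E*` for a contraction `E`. -/
def compress (E : H →L[ℂ] H) (hE : ‖E‖ ≤ 1) : TraceClass H →L[ℝ] TraceClass H :=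
  have h : ∀ A : H →L[ℂ] H, traceNorm (E * A * star E) ≤ traceNorm A := fun A => by
    rw [mul_assoc]
    refine (traceNorm_mul_le hE _).trans ?_
    rw [← traceNorm_star, star_mul, star_star]
    exact (traceNorm_mul_le hE _).trans (traceNorm_star_le _)
  LinearMap.mkContinuous
    { toFun := fun x => ofOp (E * x.op * star E) ((h x.op).trans_lt x.traceNorm_ne_top.lt_top).ne
      map_add' := fun x y => op_injective (by simp only [op_ofOp, map_add, mul_add, add_mul])
      map_smul' := fun c x => op_injective (by
        simp only [op_ofOp, real_smul_op, RingHom.id_apply, mul_smul_comm, smul_mul_assoc]) }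
    1 fun x => by
      rw [one_mul]
      exact ENNReal.toReal_mono x.traceNorm_ne_top (h x.op)

theorem op_compress (E : H →L[ℂ] H) (hE : ‖E‖ ≤ 1) (x : TraceClass H) :
    (compress E hE x).op = E * x.op * star E := rfl

theorem isPos_compress (E : H →L[ℂ] H) (hE : ‖E‖ ≤ 1) {x : TraceClass H} (hx : x.IsPos) :
    (compress E hE x).IsPos := by
  change 0 ≤ E * x.op * star E
  exact star_right_conjugate_nonneg hx E

theorem compress_eq_ofSq (E : H →L[ℂ] H) (hE : ‖E‖ ≤ 1) {x : TraceClass H} (hx : x.IsPos)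
    (h : hsSq (E * CFC.sqrt x.op) ≠ ⊤) : compress E hE x = ofSq (E * CFC.sqrt x.op) h := by
  have hs : star (CFC.sqrt x.op) = CFC.sqrt x.op := (CFC.sqrt_nonneg _).isSelfAdjoint
  have hSS : CFC.sqrt x.op * CFC.sqrt x.op = x.op := CFC.sqrt_mul_sqrt_self _ hx
  apply op_injective
  change E * x.op * star E = E * CFC.sqrt x.op * star (E * CFC.sqrt x.op)
  rw [star_mul, hs]
  conv_lhs => rw [← hSS]
  simp only [mul_assoc]

/-- A quantitative form of the gentle measurement principle: if the effect `E` is nearly certain in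
the state `x`, then `E x E` is near `x`. -/
theorem traceNorm_compress_sub_le {E : H →L[ℂ] H} (hE : ‖E‖ ≤ 1) (h0 : 0 ≤ E) {x : TraceClass H}
    (hx : x.IsPos) {c : ℝ} (hc : 0 < c) :
    traceNorm (compress E hE x - x).op ≤
      2 * (ENNReal.ofReal c * hsSq ((1 - E) * CFC.sqrt x.op) + ENNReal.ofReal c⁻¹ * traceNorm x.op) := by
  set S := CFC.sqrt x.op with hS
  have hs : star S = S := (CFC.sqrt_nonneg _).isSelfAdjoint
  have hEs : star E = E := h0.isSelfAdjoint
  have hSS : S * S = x.op := CFC.sqrt_mul_sqrt_self _ hx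
  have ht : hsSq S = traceNorm x.op := by
    rw [← hSS, ← traceNorm_mul_star, hs]
  have e : (compress E hE x - x).op = -((1 - E) * S * S + star (((1 - E) * S) * star (E * S))) := by
    have : ((1 - E) * S) * star (E * S) = (1 - E) * x.op * E := by
      rw [star_mul, hs, hEs, ← hSS]; simp only [mul_assoc]
    rw [this, map_sub, op_compress, mul_assoc _ S, hSS, star_mul, star_mul, star_sub, star_one, hEs,
      IsSelfAdjoint.star_eq hx.isSelfAdjoint]
    noncomm_ring
  rw [e, traceNorm_neg, two_mul]
  refine (traceNorm_add_le _ _).trans (add_le_add ?_ ?_)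
  · rw [← ht]
    exact traceNorm_mul_le_scaled _ _ hc
  · rw [traceNorm_star]
    refine (traceNorm_mul_le_scaled _ _ hc).trans ?_
    rw [hsSq_star, ← ht]
    gcongr
    exact hsSq_mul_le _ _ hE

/-- For sets `Δ R` that exhaust the outcomes of a POVM there are positive contractions `E R`, the
operators of the effects of `Δ R`, which converge to `1` and for which `E x E` is a part of `x` that
the POVM attributes to `Δ R`. -/
theorem IsPovm.exists_compress {N : TraceClass H → Measure Ω} (hN : IsPovm N) {Δ : ℕ → Set Ω}
    (hΔ : ∀ R, MeasurableSet (Δ R))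
    (hlim : ∀ x, x.IsPos → Tendsto (fun R => (N x).real (Δ R)ᶜ) atTop (𝓝 0)) :
    ∃ C : ℕ → TraceClass H →L[ℝ] TraceClass H, (∀ R x, x.IsPos → (C R x).IsPos) ∧
      (∀ R x, x.IsPos → (C R x).tr.re ≤ (N x).real (Δ R)) ∧
      ∀ x, x.IsPos → Tendsto (fun R => C R x) atTop (𝓝 x) := by
  choose E hE using fun R => hN.exists_effectOp (Δ R)
  have hfin : ∀ u : H, IsFiniteMeasure (N (dyad u u)) := fun u => hN.isFiniteMeasure (isPos_dyad u)
  have hE' : ∀ R u, inner ℂ u ((1 - E R) u) = (((N (dyad u u)).real (Δ R)ᶜ : ℝ) : ℂ) :=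
    fun R u => by
      have := hfin u
      rw [measureReal_compl (hΔ R), hN.real_univ (isPos_dyad u), tr_re_dyad, sub_apply,
        inner_sub_right, hE, one_apply_eq_self, inner_self_eq_norm_sq_to_K]
      push_cast; rfl
  have h0 : ∀ R, 0 ≤ E R := fun R => (nonneg_iff_inner _).2 fun u => by
    rw [hE]; exact Complex.zero_le_real.2 measureReal_nonneg
  have h0' : ∀ R, 0 ≤ 1 - E R := fun R => (nonneg_iff_inner _).2 fun u => by
    rw [hE']; exact Complex.zero_le_real.2 measureReal_nonneg
  have h1 : ∀ R, E R ≤ 1 := fun R => sub_nonneg.1 (h0' R)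
  have hn : ∀ R, ‖E R‖ ≤ 1 := fun R => (CStarAlgebra.norm_le_one_iff_of_nonneg (E R) (h0 R)).2 (h1 R)
  have hsq : ∀ R x, x.IsPos → hsSq (E R * CFC.sqrt x.op) ≤ N x (Δ R) := fun R x hx =>
    hN.hsSq_mul_sqrt_le (h0 R) (h1 R) (hE R) hx
  have hsq' : ∀ R x, x.IsPos → hsSq ((1 - E R) * CFC.sqrt x.op) ≤ N x (Δ R)ᶜ := fun R x hx =>
    hN.hsSq_mul_sqrt_le (h0' R) (by simpa using h0 R) (hE' R) hx
  refine ⟨fun R => compress (E R) (hn R), fun R x hx => isPos_compress _ _ hx, fun R x hx => ?_,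
    fun x hx => ?_⟩
  · have := hN.isFiniteMeasure hx
    have hfs : hsSq (E R * CFC.sqrt x.op) ≠ ⊤ := ((hsq R x hx).trans_lt (measure_lt_top _ _)).ne
    have h2 := hsq R x hx
    rw [← ofReal_tr_ofSq _ hfs, ← compress_eq_ofSq (E R) (hn R) hx] at h2
    exact (ENNReal.ofReal_le_iff_le_toReal (measure_ne_top _ _)).1 h2
  · have := hN.isFiniteMeasure hx
    rw [tendsto_iff_norm_sub_tendsto_zero]
    have hb : ∀ (c : ℝ), 0 < c → ∀ R, ‖compress (E R) (hn R) x - x‖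
        ≤ 2 * (c * (N x).real (Δ R)ᶜ + c⁻¹ * ‖x‖) := fun c hc R => by
      have h3 := (traceNorm_compress_sub_le (hn R) (h0 R) hx hc).trans
        (mul_le_mul_right (add_le_add_left (mul_le_mul_right (hsq' R x hx) _) _) _)
      have h4 := ENNReal.toReal_mono (by
        have := x.traceNorm_ne_top
        finiteness) h3
      have h5 := x.traceNorm_ne_top
      rw [ENNReal.toReal_mul, ENNReal.toReal_add (by finiteness) (by finiteness), ENNReal.toReal_mul,
        ENNReal.toReal_mul, ENNReal.toReal_ofReal hc.le, ENNReal.toReal_ofReal (inv_pos.2 hc).le] at h4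
      exact h4
    rw [Metric.tendsto_atTop]
    intro ε hε
    set c := 4 * (‖x‖ + 1) / ε with hc
    have hc0 : 0 < c := by positivity
    obtain ⟨R₀, hR₀⟩ := (Metric.tendsto_atTop.1 (hlim x hx)) (ε / (4 * c)) (by positivity)
    refine ⟨R₀, fun R hR => ?_⟩
    have h6 := hR₀ R hR
    rw [Real.dist_eq, sub_zero, abs_of_nonneg measureReal_nonneg, lt_div_iff₀ (by positivity)] at h6
    rw [Real.dist_eq, sub_zero, abs_of_nonneg (norm_nonneg _)]
    refine (hb c hc0 R).trans_lt ?_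
    have h7 : c⁻¹ * ‖x‖ < ε / 4 := by
      rw [hc, inv_div, div_mul_eq_mul_div, div_lt_div_iff₀ (by positivity) (by norm_num)]
      nlinarith [norm_nonneg x]
    linarith

end

/-! ### Spliced measurements -/

section

variable {Ω' : Type*} [MeasurableSpace Ω'] {m : ℕ}

/-- An affine correction `y ↦ A y + c` of an estimate, close to the identity, that restores local
unbiasedness in the presence of a small disturbance. -/
theorem exists_affine_correction {J φ : ℕ → Matrix (Fin m) (Fin m) ℝ} {a f π : ℕ → Fin m → ℝ}
    {p : ℕ → ℝ} (hJ : Tendsto J atTop (𝓝 1)) (hφ : Tendsto φ atTop (𝓝 0))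
    (ha : Tendsto a atTop (𝓝 0)) (hf : Tendsto f atTop (𝓝 0)) (hπ : Tendsto π atTop (𝓝 0))
    (hp : Tendsto p atTop (𝓝 1)) :
    ∃ (A : ℕ → Matrix (Fin m) (Fin m) ℝ) (c : ℕ → Fin m → ℝ), Tendsto A atTop (𝓝 1) ∧
      Tendsto c atTop (𝓝 0) ∧ ∀ᶠ n in atTop,
        (∀ i, ∑ k, A n i k * a n k + c n i * p n + f n i = 0) ∧
        ∀ i j, ∑ k, A n i k * J n k j + c n i * π n j + φ n i j
          = (1 : Matrix (Fin m) (Fin m) ℝ) i j := by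
  set D : ℕ → Matrix (Fin m) (Fin m) ℝ := fun n => J n - (p n)⁻¹ • Matrix.vecMulVec (a n) (π n) with hD
  set A : ℕ → Matrix (Fin m) (Fin m) ℝ :=
    fun n => (1 - φ n + (p n)⁻¹ • Matrix.vecMulVec (f n) (π n)) * (D n)⁻¹ with hA
  set c : ℕ → Fin m → ℝ := fun n => -((p n)⁻¹ • ((A n).mulVec (a n) + f n)) with hc
  have hpi : Tendsto (fun n => (p n)⁻¹) atTop (𝓝 1) := by simpa using hp.inv₀ one_ne_zero
  have hvec : ∀ u : ℕ → Fin m → ℝ, Tendsto u atTop (𝓝 0) →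
      Tendsto (fun n => (p n)⁻¹ • Matrix.vecMulVec (u n) (π n)) atTop (𝓝 0) := fun u hu => by
    have : Tendsto (fun n => Matrix.vecMulVec (u n) (π n)) atTop (𝓝 0) := by
      refine tendsto_pi_nhds.2 fun i => tendsto_pi_nhds.2 fun j => ?_
      simpa [Matrix.vecMulVec_apply] using
        ((tendsto_pi_nhds.1 hu i).mul (tendsto_pi_nhds.1 hπ j))
    simpa using hpi.smul this
  have hDl : Tendsto D atTop (𝓝 1) := by simpa using hJ.sub (hvec a ha)
  have hdet : Tendsto (fun n => (D n).det) atTop (𝓝 1) := by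
    have : Continuous fun M : Matrix (Fin m) (Fin m) ℝ => M.det := continuous_id.matrix_det
    simpa [Function.comp_def] using (this.tendsto 1).comp hDl
  have hDi : Tendsto (fun n => (D n)⁻¹) atTop (𝓝 1) := by
    have h1 : Continuous fun M : Matrix (Fin m) (Fin m) ℝ => M.adjugate :=
      continuous_id.matrix_adjugate
    have h2 : Tendsto (fun n => (D n).adjugate) atTop (𝓝 1) := by
      simpa [Function.comp_def] using (h1.tendsto 1).comp hDl
    have h3 := (hdet.inv₀ one_ne_zero).smul h2
    simp only [inv_one, one_smul] at h3
    refine h3.congr fun n => ?_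
    rw [Matrix.inv_def, Ring.inverse_eq_inv']
  have hAl : Tendsto A atTop (𝓝 1) := by
    simpa using (((tendsto_const_nhds (x := (1 : Matrix (Fin m) (Fin m) ℝ))).sub hφ).add
      (hvec f hf)).mul hDi
  refine ⟨A, c, hAl, ?_, ?_⟩
  · have h1 : Continuous fun q : Matrix (Fin m) (Fin m) ℝ × (Fin m → ℝ) => q.1.mulVec q.2 :=
      continuous_fst.matrix_mulVec continuous_snd
    have h2 : Tendsto (fun n => (A n).mulVec (a n)) atTop (𝓝 0) := by
      simpa [Function.comp_def] using (h1.tendsto (1, 0)).comp (hAl.prodMk_nhds ha)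
    have h3 := (hpi.smul (h2.add hf)).neg
    rwa [add_zero, smul_zero, neg_zero] at h3
  · filter_upwards [hp.eventually_ne one_ne_zero, hdet.eventually_ne one_ne_zero] with n h1 h2
    refine ⟨fun i => ?_, fun i j => ?_⟩
    · have : c n i = -((p n)⁻¹ * (∑ k, A n i k * a n k + f n i)) := rfl
      rw [this]
      field_simp
      ring
    · have e : A n * D n = 1 - φ n + (p n)⁻¹ • Matrix.vecMulVec (f n) (π n) := by
        rw [hA]
        exact Matrix.nonsing_inv_mul_cancel_right _ _ (isUnit_iff_ne_zero.2 h2)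
      have e2 : A n * D n = A n * J n - (p n)⁻¹ • Matrix.vecMulVec ((A n).mulVec (a n)) (π n) := by
        rw [hD, mul_sub, Matrix.mul_smul, Matrix.mul_vecMulVec]
      have e3 := congrFun (congrFun (e2.symm.trans e) i) j
      simp only [Matrix.sub_apply, Matrix.add_apply, Matrix.smul_apply, Matrix.vecMulVec_apply,
        smul_eq_mul, Matrix.mul_apply] at e3
      have : c n i = -((p n)⁻¹ * ((A n).mulVec (a n) i + f n i)) := rfl
      rw [this]
      linear_combination e3

/-- The laws of the measurement that performs `N`, followed by `g`, on the part `C x` of the state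
which `N'` attributes to the set `S`, performs `N'`, followed by `f`, outside of `S`, and has the
outcome `c` otherwise. -/
def splice (N : TraceClass H → Measure Ω) (N' : TraceClass H → Measure Ω')
    (C : TraceClass H →L[ℝ] TraceClass H) (S : Set Ω') (g : Ω → Param m) (c : Param m)
    (f : Ω' → Param m) (x : TraceClass H) : Measure (Param m) :=
  (N (C x)).map g + (ENNReal.ofReal ((N' x).real S - (C x).tr.re) • Measure.dirac c
    + ((N' x).restrict Sᶜ).map f)

section Splice

variable {N : TraceClass H → Measure Ω} {N' : TraceClass H → Measure Ω'}
  {C : TraceClass H →L[ℝ] TraceClass H} {S : Set Ω'} {g : Ω → Param m} {c : Param m}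
  {f : Ω' → Param m}

theorem IsPovm.splice (hN : IsPovm N) (hN' : IsPovm N') (hC : ∀ x, x.IsPos → (C x).IsPos)
    (hCS : ∀ x, x.IsPos → (C x).tr.re ≤ (N' x).real S) (hS : MeasurableSet S) (hg : Measurable g)
    (hf : Measurable f) : IsPovm (splice N N' C S g c f) where
  add x y hx hy := by
    have := hN'.isFiniteMeasure hx
    have := hN'.isFiniteMeasure hy
    unfold QuantumEstimation.splice
    have e : (N' (x + y)).real S - (C (x + y)).tr.re
        = ((N' x).real S - (C x).tr.re) + ((N' y).real S - (C y).tr.re) := by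
      rw [hN'.add x y hx hy, measureReal_add_apply, map_add, tr_add, Complex.add_re]; ring
    rw [e, ENNReal.ofReal_add (sub_nonneg.2 (hCS x hx)) (sub_nonneg.2 (hCS y hy)), map_add,
      hN.add _ _ (hC x hx) (hC y hy), hN'.add x y hx hy, Measure.map_add _ _ hg,
      Measure.restrict_add, Measure.map_add _ _ hf, add_smul]
    abel
  mass x hx := by
    have := hN'.isFiniteMeasure hx
    unfold QuantumEstimation.splice
    rw [Measure.add_apply, Measure.add_apply, Measure.map_apply hg MeasurableSet.univ,
      Measure.map_apply hf MeasurableSet.univ, Set.preimage_univ, Set.preimage_univ,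
      Measure.smul_apply, Measure.restrict_apply MeasurableSet.univ, Set.univ_inter,
      Measure.dirac_apply_of_mem (Set.mem_univ c), smul_eq_mul, mul_one, hN.mass _ (hC x hx), ← add_assoc,
      ← ENNReal.ofReal_add (hC x hx).tr_re_nonneg (sub_nonneg.2 (hCS x hx)), add_sub_cancel,
      ofReal_measureReal, measure_add_measure_compl hS, hN'.mass x hx]

theorem integral_splice {x : TraceClass H} {φ : Param m → ℝ} (hφ : Measurable φ) (hg : Measurable g)
    (hf : Measurable f) (hCS : (C x).tr.re ≤ (N' x).real S)
    (h1 : Integrable (fun ω => φ (g ω)) (N (C x)))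
    (h2 : IntegrableOn (fun ω => φ (f ω)) Sᶜ (N' x)) :
    ∫ y, φ y ∂splice N N' C S g c f x = ∫ ω, φ (g ω) ∂N (C x)
      + (((N' x).real S - (C x).tr.re) * φ c + ∫ ω in Sᶜ, φ (f ω) ∂N' x) := by
  have i1 : Integrable φ ((N (C x)).map g) :=
    (integrable_map_measure hφ.aestronglyMeasurable hg.aemeasurable).2 h1
  have i2 : Integrable φ (((N' x).restrict Sᶜ).map f) :=
    (integrable_map_measure hφ.aestronglyMeasurable hf.aemeasurable).2 h2
  have i3 : Integrable φ (ENNReal.ofReal ((N' x).real S - (C x).tr.re) • Measure.dirac c) :=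
    (integrable_dirac (by finiteness)).smul_measure ENNReal.ofReal_ne_top
  unfold splice
  rw [integral_add_measure i1 (i3.add_measure i2), integral_add_measure i3 i2,
    integral_map hg.aemeasurable hφ.aestronglyMeasurable,
    integral_map hf.aemeasurable hφ.aestronglyMeasurable, integral_smul_measure, integral_dirac,
    ENNReal.toReal_ofReal (sub_nonneg.2 hCS), smul_eq_mul]

/-- On the set `S` the estimate of `splice` is compared with the one of `N'` by a bound on all
values that `g` and `c` take. -/
theorem lintegral_splice_le (hN : IsPovm N) (hN' : IsPovm N') (hC : ∀ x, x.IsPos → (C x).IsPos)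
    (hCS : ∀ x, x.IsPos → (C x).tr.re ≤ (N' x).real S) (hS : MeasurableSet S) (hg : Measurable g)
    (hf : Measurable f) {x : TraceClass H} (hx : x.IsPos) {ψ : Param m → ℝ≥0∞} (hψ : Measurable ψ)
    {ψ' : Ω' → ℝ≥0∞} {b : ℝ≥0∞} (hgb : ∀ ω, ψ (g ω) ≤ b) (hcb : ψ c ≤ b) (hb : ∀ ω ∈ S, b ≤ ψ' ω)
    (hψ' : ∀ ω, ψ (f ω) ≤ ψ' ω) :
    ∫⁻ y, ψ y ∂splice N N' C S g c f x ≤ ∫⁻ ω, ψ' ω ∂N' x := by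
  have := hN'.isFiniteMeasure hx
  unfold splice
  rw [lintegral_add_measure, lintegral_add_measure, lintegral_map hψ hg, lintegral_map hψ hf,
    lintegral_smul_measure, lintegral_dirac' _ hψ, ← lintegral_add_compl ψ' hS, ← add_assoc, smul_eq_mul]
  refine add_le_add ?_ (lintegral_mono fun ω => hψ' ω)
  calc ∫⁻ ω, ψ (g ω) ∂N (C x) + ENNReal.ofReal ((N' x).real S - (C x).tr.re) * ψ c
      ≤ b * N (C x) Set.univ + ENNReal.ofReal ((N' x).real S - (C x).tr.re) * b := by
        gcongr
        rw [← lintegral_const]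
        exact lintegral_mono fun ω => hgb ω
    _ = b * N' x S := by
        rw [hN.mass _ (hC x hx), mul_comm _ b, ← mul_add,
          ← ENNReal.ofReal_add (hC x hx).tr_re_nonneg (sub_nonneg.2 (hCS x hx)), add_sub_cancel,
          ofReal_measureReal]
    _ = ∫⁻ ω in S, b ∂N' x := by rw [setLIntegral_const]
    _ ≤ _ := setLIntegral_mono' hS hb

end Splice

end

/-! ### Localization of an estimator -/

section

variable {m n : ℕ}

theorem IsTangent.eq_half_smul {σ Q X : TraceClass H} :
    X = (2⁻¹ : ℝ) • ((Q + (2 : ℝ) • X + σ) - Q - σ) := by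
  have : Q + (2 : ℝ) • X + σ - Q - σ = (2 : ℝ) • X := by abel
  rw [this, smul_smul]; norm_num

/-- Linear functions that converge at the positive operators converge at the derivatives of the
model. -/
theorem IsTangent.tendsto {σ Q X : TraceClass H} (h : IsTangent σ Q X) {E : Type*}
    [NormedAddCommGroup E] [NormedSpace ℝ E] {F : ℕ → TraceClass H →L[ℝ] E} {F₀ : TraceClass H →L[ℝ] E}
    (hF : ∀ x, x.IsPos → Tendsto (fun k => F k x) atTop (𝓝 (F₀ x))) :
    Tendsto (fun k => F k X) atTop (𝓝 (F₀ X)) := by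
  have e : ∀ L : TraceClass H →L[ℝ] E,
      L X = (2⁻¹ : ℝ) • (L (Q + (2 : ℝ) • X + σ) - L Q - L σ) := fun L => by
    rw [← map_sub, ← map_sub, ← map_smul, ← IsTangent.eq_half_smul]
  simp_rw [e]
  exact (((hF _ h.pos_sum).sub (hF _ h.pos_quad)).sub (hF _ h.pos)).const_smul _

/-- A measurement with outcomes in the parameter space as an instrument on a single sample. -/
theorem IsPovm.singleSampleBound_momentBound_le {Θ : Set (Param m)} {ρ : Param m → TraceClass H}
    {D : Fin m → Param m → TraceClass H} {a₁ : ℝ} {θ : Param m}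
    (hD : ∀ θ ∈ Θ, ∀ i, (D i θ).IsPos) (hρ : ∀ θ ∈ Θ, (ρ θ).IsDensity)
    (hnear : ∀ j, ∀ᶠ t : ℝ in 𝓝 0, (ρ (θ + t • coordVec j)).IsDensity) (hθ : θ ∈ Θ)
    {N : TraceClass H → Measure (Param m)} (hN : IsPovm N) (h0 : ∀ i, ∫ y, y i ∂N (ρ θ) = θ i)
    (hd : ∀ i j, HasDerivAt (fun t : ℝ => ∫ y, y i ∂N (ρ (θ + t • coordVec j)))
      ((1 : Matrix (Fin m) (Fin m) ℝ) i j) 0) {a : ℝ}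
    (ha : ∀ θ ∈ Θ, (∀ i, ∫⁻ y, ‖y - θ‖ₑ ∂N (D i θ) ≤ ENNReal.ofReal (a₁ * a)) ∧
      ∫⁻ y, ‖y - θ‖ₑ ^ 2 ∂N (ρ θ) ≤ ENNReal.ofReal (a ^ 2)) (G : Matrix (Fin m) (Fin m) ℝ) :
    singleSampleBound (fun _ e => e.MomentBound Θ ρ D a₁) ρ G θ
      ≤ ((G * Matrix.of fun i k => ∫ y, (y i - θ i) * (y k - θ k) ∂N (ρ θ)).trace : ℝ) := by
  set f : Param m → Fin m → ℝ := fun x => x.ofLp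
  have hf : Measurable f := by fun_prop
  set T : (Fin m → ℝ) → Param m := fun y => WithLp.toLp 2 y
  have hT : Measurable T := by fun_prop
  have hTf : ∀ y, T (f y) = y := fun y => rfl
  set M : Instrument H (Fin m → ℝ) := (hN.map hf).prepare (hρ θ hθ)
  have hM : ∀ τ, τ.IsPos → M.outcome τ = (N τ).map f := fun τ hτ =>
    (hN.map hf).outcome_prepare (hρ θ hθ) hτ
  have hmean : ∀ θ', (ρ θ').IsDensity → ∀ i, (M.singleEstimator T hT).mean ρ θ' i
      = ∫ x, x i ∂N (ρ θ') := fun θ' hθ' i => by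
    change ∫ y, T y i ∂M.outcome (ρ θ') = _
    rw [hM _ hθ'.1, integral_map hf.aemeasurable (by fun_prop)]
  have hmean0 : ∀ i, (M.singleEstimator T hT).mean ρ θ i = θ i := fun i => by
    rw [hmean θ (hρ θ hθ), h0]
  refine iInf_le_of_le m (iInf_le_of_le M (iInf_le_of_le T (iInf_le_of_le hT
    (iInf_le_of_le ⟨hmean0, fun i j => ?_⟩ (iInf_le_of_le ⟨a, fun θ' hθ' => ⟨fun i => ?_, ?_⟩⟩
      (le_of_eq ?_))))))
  · refine (hd i j).congr_of_eventuallyEq ?_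
    filter_upwards [hnear j] with t ht using hmean _ ht i
  · rw [Fin.sum_univ_one]
    change ∫⁻ y, ‖T y - θ'‖ₑ ∂M.outcome (Function.update (fun _ => ρ θ') 0 (D i θ') 0) ≤ _
    rw [Function.update_self, hM _ (hD θ' hθ' i), lintegral_map (by fun_prop) hf]
    simpa [hTf] using (ha θ' hθ').1 i
  · change ∫⁻ y, ‖T y - θ'‖ₑ ^ 2 ∂M.outcome (ρ θ') ≤ _
    rw [hM _ (hρ θ' hθ').1, lintegral_map (by fun_prop) hf]
    simpa [hTf] using (ha θ' hθ').2
  · have : (M.singleEstimator T hT).cov ρ θ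
        = Matrix.of fun i k => ∫ y, (y i - θ i) * (y k - θ k) ∂N (ρ θ) := by
      ext i k
      rw [Estimator.cov, Matrix.of_apply, hmean0, hmean0, Matrix.of_apply]
      change ∫ y, (T y i - θ i) * (T y k - θ k) ∂M.outcome (ρ θ) = _
      rw [hM _ (hρ θ hθ).1, integral_map (f := fun y => (T y i - θ i) * (T y k - θ k))
        hf.aemeasurable (by fun_prop)]
    rw [this]

namespace Estimator

/-- The data for which the estimate differs from `θ` by more than `R`. -/
def farSet (e : Estimator H n m Ω) (θ : Param m) (R : ℕ) : Set Ω :=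
  tailSet (fun ω => ‖e.est ω - θ‖) R

theorem measurableSet_farSet (e : Estimator H n m Ω) (θ : Param m) (R : ℕ) :
    MeasurableSet (e.farSet θ R) :=
  measurableSet_tailSet (e.measurable_est.sub_const θ).norm R

theorem norm_sub_le_of_notMem_farSet {e : Estimator H n m Ω} {θ : Param m} {R : ℕ} {ω : Ω}
    (h : ω ∉ e.farSet θ R) : ‖e.est ω - θ‖ ≤ R := by
  simpa [farSet, tailSet] using h

open Classical in
/-- The estimator with the estimate `θ` in place of those that differ from `θ` by at most `R`. -/
def localized (e : Estimator H n m Ω) (θ : Param m) (R : ℕ) : Estimator H n m Ω where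
  law := e.law
  est ω := if ω ∈ e.farSet θ R then e.est ω else θ
  measurable_est := Measurable.ite (e.measurableSet_farSet θ R) e.measurable_est measurable_const

theorem localized_est_sub (e : Estimator H n m Ω) (θ : Param m) (R : ℕ) (ω : Ω) (i : Fin m) :
    (e.localized θ R).est ω i - θ i = (e.farSet θ R).indicator (fun ω => e.est ω i - θ i) ω := by
  classical
  change (if ω ∈ e.farSet θ R then e.est ω else θ) i - θ i = _
  by_cases h : ω ∈ e.farSet θ R <;> simp [h]

theorem norm_localized_sub_le (e : Estimator H n m Ω) (θ θ' : Param m) (R : ℕ) (ω : Ω) :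
    ‖(e.localized θ R).est ω - θ'‖ ≤ R + ‖e.est ω - θ'‖ := by
  classical
  change ‖(if ω ∈ e.farSet θ R then e.est ω else θ) - θ'‖ ≤ _
  split_ifs with h
  · linarith [(Nat.cast_nonneg R : (0 : ℝ) ≤ R)]
  · have h1 := norm_sub_le_of_notMem_farSet h
    have h2 := norm_sub_le_norm_sub_add_norm_sub θ (e.est ω) θ'
    rw [norm_sub_rev θ (e.est ω)] at h2
    linarith

theorem mean_localized (e : Estimator H n m Ω) {ρ : Param m → TraceClass H} {θ θ' : Param m} (R : ℕ)
    {i : Fin m} [IsFiniteMeasure (e.iidLaw (ρ θ'))]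
    (h : Integrable (fun ω => e.est ω i) (e.iidLaw (ρ θ'))) :
    (e.localized θ R).mean ρ θ' i = ∫ ω in e.farSet θ R, e.est ω i ∂e.iidLaw (ρ θ')
      + (e.iidLaw (ρ θ')).real (e.farSet θ R)ᶜ * θ i := by
  classical
  have hS := e.measurableSet_farSet θ R
  have h1 := integral_add (h.indicator hS)
    ((integrable_const (μ := e.iidLaw (ρ θ')) (θ i)).indicator hS.compl)
  rw [integral_indicator hS, integral_indicator hS.compl, setIntegral_const, smul_eq_mul] at h1
  rw [← h1]
  refine integral_congr_ae (Eventually.of_forall fun ω => ?_)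
  change (if ω ∈ e.farSet θ R then e.est ω else θ) i = _
  by_cases hω : ω ∈ e.farSet θ R <;> simp [hω]

/-- Localization far away from `θ` has no effect in the limit. -/
theorem exists_hasMeanDeriv_localized (e : Estimator H n m Ω) (hlaw : IsProductLaw e.law)
    {Θ : Set (Param m)} {ρ : Param m → TraceClass H} {a₁ : ℝ} {θ : Param m}
    (hΘ : IsOpen Θ) (hρ : ∀ θ ∈ Θ, (ρ θ).IsDensity) (h_smooth : SmoothModel Θ ρ a₁)
    (h_log : ∀ θ ∈ Θ, ∀ i, HasLogDerivative (ρ θ) (pderiv i ρ θ)) (hθ : θ ∈ Θ) {a : ℝ} (ha0 : 0 ≤ a)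
    (ha : ∀ θ' ∈ Θ, ∫⁻ ω, ‖e.est ω - θ'‖ₑ ^ 2 ∂e.iidLaw (ρ θ') ≤ ENNReal.ofReal a) :
    ∃ φ : ℕ → Matrix (Fin m) (Fin m) ℝ, Tendsto φ atTop (𝓝 0) ∧
      (∀ R, (e.localized θ R).HasMeanDeriv ρ θ (φ R)) ∧
      (∀ i, Tendsto (fun R => (e.localized θ R).mean ρ θ i) atTop (𝓝 (θ i))) ∧
      ∀ i k, Tendsto (fun R => ∫ ω in e.farSet θ R, (e.est ω i - θ i) * (e.est ω k - θ k)
        ∂e.iidLaw (ρ θ)) atTop (𝓝 0) := by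
  choose Q hQ using fun j => h_smooth.exists_isCurve hΘ hρ h_log hθ j
  have htan : ∀ j, IsTangent (ρ θ) (Q j) (pderiv j ρ θ) := fun j => by simpa using (hQ j).tangent
  have hN := fun κ => hlaw.isPovm_slot (τ := fun _ => ρ θ) (fun _ => hρ θ hθ) κ
  choose ℓ hℓ _ using fun κ j => (hN κ).exists_score (htan j)
  have hp := hlaw.isProbabilityMeasure (τ := fun _ => ρ θ) fun _ => hρ θ hθ
  have hp' : IsProbabilityMeasure (e.iidLaw (ρ θ)) := hp
  have hmem := fun i => (memLp_coord_of_lintegral_le e.measurable_est (ha θ hθ) i).1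
  have hms : ∀ j, MemLp (fun ω => ∑ κ, ℓ κ j ω) 2 (e.law fun _ => ρ θ) := fun j =>
    memLp_finsetSum _ fun κ _ => IsLocalLaw.memLp_score (hℓ κ j)
  have hlim : ∀ {u : Ω → ℝ}, Integrable u (e.law fun _ => ρ θ) →
      Tendsto (fun R => ∫ ω in e.farSet θ R, u ω ∂(e.law fun _ => ρ θ)) atTop (𝓝 0) := fun hu =>
    tendsto_setIntegral_tailSet (e.measurable_est.sub_const θ).norm hu
  refine ⟨fun R i j => ∫ ω, ((e.localized θ R).est ω i - θ i) * ∑ κ, ℓ κ j ω ∂(e.law fun _ => ρ θ),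
    ?_, fun R i j => ?_, fun i => ?_, fun i k => hlim ((hmem i).integrable_fun_mul (hmem k))⟩
  · refine tendsto_pi_nhds.2 fun i => tendsto_pi_nhds.2 fun j => ?_
    refine (hlim ((hmem i).integrable_fun_mul (hms j))).congr fun R => ?_
    rw [← integral_indicator (e.measurableSet_farSet θ R)]
    refine integral_congr_ae (Eventually.of_forall fun ω => ?_)
    change _ = ((e.localized θ R).est ω i - θ i) * ∑ κ, ℓ κ j ω
    rw [localized_est_sub, Set.indicator_mul_left]
  · refine (e.localized θ R).hasDerivAt_mean (a := 2 * (R : ℝ) ^ 2 + 2 * a) hlaw hΘ hρ hθ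
      (fun θ' hθ' => ?_) (hQ j) (fun κ => hℓ κ j) i
    have := hlaw.isProbabilityMeasure (τ := fun _ => ρ θ') fun _ => hρ θ' hθ'
    have : IsProbabilityMeasure (e.iidLaw (ρ θ')) := this
    calc ∫⁻ ω, ‖(e.localized θ R).est ω - θ'‖ₑ ^ 2 ∂e.iidLaw (ρ θ')
        ≤ ∫⁻ ω, (ENNReal.ofReal (2 * (R : ℝ) ^ 2) + 2 * ‖e.est ω - θ'‖ₑ ^ 2) ∂e.iidLaw (ρ θ') :=
          lintegral_mono fun ω => enorm_sq_le_add (e.norm_localized_sub_le θ θ' R ω)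
      _ = ENNReal.ofReal (2 * (R : ℝ) ^ 2) + 2 * ∫⁻ ω, ‖e.est ω - θ'‖ₑ ^ 2 ∂e.iidLaw (ρ θ') := by
          rw [lintegral_add_left measurable_const, lintegral_const, measure_univ, mul_one,
            lintegral_const_mul' _ _ (by simp)]
      _ ≤ ENNReal.ofReal (2 * (R : ℝ) ^ 2) + 2 * ENNReal.ofReal a := by
          gcongr; exact ha θ' hθ'
      _ = ENNReal.ofReal (2 * (R : ℝ) ^ 2 + 2 * a) := by
          rw [ENNReal.ofReal_add (by positivity) (by positivity), ENNReal.ofReal_mul (p := 2) zero_le_two,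
            ENNReal.ofReal_mul (p := 2) zero_le_two]
          simp
  · have h1 := (hlim ((hmem i).integrable one_le_two)).add_const (θ i)
    rw [zero_add] at h1
    refine h1.congr fun R => ?_
    have hi : Integrable ((e.farSet θ R).indicator fun ω => e.est ω i - θ i) (e.law fun _ => ρ θ) :=
      ((hmem i).integrable one_le_two).indicator (e.measurableSet_farSet θ R)
    have h2 := integral_add hi (integrable_const (θ i))
    simp only [integral_const, probReal_univ, smul_eq_mul, one_mul] at h2
    rw [← integral_indicator (e.measurableSet_farSet θ R), ← h2]
    refine integral_congr_ae (Eventually.of_forall fun ω => ?_)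
    change _ = (e.localized θ R).est ω i
    have := e.localized_est_sub θ R ω i
    change (e.farSet θ R).indicator (fun ω => e.est ω i - θ i) ω + θ i = _
    rw [← this, sub_add_cancel]

end Estimator

end

/-! ### Moments of spliced measurements -/

section

variable {Ω' : Type*} [MeasurableSpace Ω'] {m : ℕ}

theorem integral_affine {μ : Measure Ω} [IsFiniteMeasure μ] {z : Fin m → Ω → ℝ}
    (hz : ∀ k, Integrable (z k) μ) (v : Fin m → ℝ) (c : ℝ) :
    ∫ ω, (∑ k, v k * z k ω + c) ∂μ = ∑ k, v k * ∫ ω, z k ω ∂μ + c * μ.real Set.univ := by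
  rw [integral_add (integrable_finsetSum _ fun k _ => (hz k).const_mul _) (integrable_const c),
    integral_finsetSum _ fun k _ => (hz k).const_mul _]
  simp_rw [integral_const_mul, integral_const, smul_eq_mul]
  rw [mul_comm c]

theorem integral_affine_mul {μ : Measure Ω} [IsFiniteMeasure μ] {z : Fin m → Ω → ℝ}
    (hz : ∀ k, Integrable (z k) μ) (hzz : ∀ k l, Integrable (fun ω => z k ω * z l ω) μ)
    (v w : Fin m → ℝ) (c d : ℝ) :
    ∫ ω, (∑ k, v k * z k ω + c) * (∑ l, w l * z l ω + d) ∂μ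
      = ∑ k, v k * (∑ l, w l * ∫ ω, z k ω * z l ω ∂μ + d * ∫ ω, z k ω ∂μ)
        + c * (∑ l, w l * ∫ ω, z l ω ∂μ + d * μ.real Set.univ) := by
  have h1 : ∀ k, Integrable (fun ω => ∑ l, w l * (z k ω * z l ω) + d * z k ω) μ := fun k =>
    (integrable_finsetSum _ fun l _ => (hzz k l).const_mul _).add ((hz k).const_mul d)
  have h2 : Integrable (fun ω => ∑ l, w l * z l ω + d) μ :=
    (integrable_finsetSum _ fun l _ => (hz l).const_mul _).add (integrable_const d)
  have e : ∀ ω, (∑ k, v k * z k ω + c) * (∑ l, w l * z l ω + d)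
      = ∑ k, v k * (∑ l, w l * (z k ω * z l ω) + d * z k ω) + c * (∑ l, w l * z l ω + d) := fun ω => by
    rw [add_mul, Finset.sum_mul]
    congr 1
    refine Finset.sum_congr rfl fun k _ => ?_
    rw [mul_assoc, mul_add, Finset.mul_sum, mul_comm (z k ω) d]
    congr 2
    exact Finset.sum_congr rfl fun l _ => by ring
  simp_rw [e]
  rw [integral_add (integrable_finsetSum _ fun k _ => (h1 k).const_mul _) (h2.const_mul c),
    integral_finsetSum _ fun k _ => (h1 k).const_mul _]
  simp_rw [integral_const_mul]
  rw [integral_affine hz]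
  congr 1
  refine Finset.sum_congr rfl fun k _ => ?_
  rw [integral_add (integrable_finsetSum _ fun l _ => (hzz k l).const_mul _) ((hz k).const_mul d),
    integral_finsetSum _ fun l _ => (hzz k l).const_mul _]
  simp_rw [integral_const_mul]

/-- The moment condition is inherited by the measurement that departs from a given one only when
that has an outcome within a bounded distance of `θ`, and is then itself within a bounded
distance. -/
theorem exists_moment_splice {N : TraceClass H → Measure Ω} {N' : TraceClass H → Measure Ω'}
    {C : TraceClass H →L[ℝ] TraceClass H} {S : Set Ω'} {g : Ω → Param m} {c : Param m}
    {f : Ω' → Param m} (hN : IsPovm N) (hN' : IsPovm N') (hC : ∀ x, x.IsPos → (C x).IsPos)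
    (hCS : ∀ x, x.IsPos → (C x).tr.re ≤ (N' x).real S) (hS : MeasurableSet S) (hg : Measurable g)
    (hf : Measurable f) {Θ : Set (Param m)} {ρ : Param m → TraceClass H}
    {D : Fin m → Param m → TraceClass H} {a₁ c₀ K R a : ℝ} {θ : Param m} (hc₀ : 1 ≤ c₀) (hK0 : 0 ≤ K)
    (hR0 : 0 ≤ R) (hρ : ∀ θ ∈ Θ, (ρ θ).IsDensity)
    (hD : ∀ θ ∈ Θ, ∀ i, (D i θ).IsPos ∧ (D i θ).tr.re ≤ a₁ * c₀)
    (hgK : ∀ ω, ‖g ω - θ‖ ≤ K) (hcK : ‖c - θ‖ ≤ K) (hSR : ∀ ω ∈ S, ‖f ω - θ‖ ≤ R)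
    (ha : ∀ θ ∈ Θ, (∀ i, ∫⁻ ω, ‖f ω - θ‖ₑ ∂N' (D i θ) ≤ ENNReal.ofReal (a₁ * a)) ∧
      ∫⁻ ω, ‖f ω - θ‖ₑ ^ 2 ∂N' (ρ θ) ≤ ENNReal.ofReal (a ^ 2)) :
    ∃ a' : ℝ, ∀ θ ∈ Θ,
      (∀ i, ∫⁻ y, ‖y - θ‖ₑ ∂splice N N' C S g c f (D i θ) ≤ ENNReal.ofReal (a₁ * a')) ∧
      ∫⁻ y, ‖y - θ‖ₑ ^ 2 ∂splice N N' C S g c f (ρ θ) ≤ ENNReal.ofReal (a' ^ 2) := by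
  have hb : ∀ θ' : Param m, ∀ ω ∈ S, K + ‖θ - θ'‖ ≤ (K + R) + ‖f ω - θ'‖ := fun θ' ω hω => by
    have h1 := hSR ω hω
    have h2 := norm_sub_le_norm_sub_add_norm_sub θ (f ω) θ'
    rw [norm_sub_rev θ (f ω)] at h2
    linarith
  have hy : ∀ θ' y : Param m, ‖y - θ‖ ≤ K → ‖y - θ'‖ ≤ K + ‖θ - θ'‖ := fun θ' y h =>
    (norm_sub_le_norm_sub_add_norm_sub y θ θ').trans (by linarith)
  refine ⟨2 * (K + R) * c₀ + 2 * |a|, fun θ' hθ' => ⟨fun i => ?_, ?_⟩⟩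
  · obtain ⟨hpos, htr⟩ := hD θ' hθ' i
    have ha₁ : 0 ≤ a₁ := nonneg_of_mul_nonneg_left (hpos.tr_re_nonneg.trans htr) (by linarith)
    calc ∫⁻ y, ‖y - θ'‖ₑ ∂splice N N' C S g c f (D i θ')
        ≤ ∫⁻ ω, (ENNReal.ofReal (K + R) + ‖f ω - θ'‖ₑ) ∂N' (D i θ') := by
          refine lintegral_splice_le hN hN' hC hCS hS hg hf hpos (by fun_prop)
            (b := ENNReal.ofReal (K + ‖θ - θ'‖)) (fun ω => ?_) ?_ (fun ω hω => ?_) fun ω => le_add_self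
          · rw [← ofReal_norm]; exact ENNReal.ofReal_le_ofReal (hy _ _ (hgK ω))
          · rw [← ofReal_norm]; exact ENNReal.ofReal_le_ofReal (hy _ _ hcK)
          · rw [← ofReal_norm]
            exact (ENNReal.ofReal_le_ofReal (hb θ' ω hω)).trans ENNReal.ofReal_add_le
      _ = ENNReal.ofReal (K + R) * ENNReal.ofReal (D i θ').tr.re + ∫⁻ ω, ‖f ω - θ'‖ₑ ∂N' (D i θ') := by
          rw [lintegral_add_left measurable_const, lintegral_const, hN'.mass _ hpos]
      _ ≤ ENNReal.ofReal (K + R) * ENNReal.ofReal (a₁ * c₀) + ENNReal.ofReal (a₁ * |a|) := by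
          gcongr
          refine ((ha θ' hθ').1 i).trans (ENNReal.ofReal_le_ofReal ?_)
          exact mul_le_mul_of_nonneg_left (le_abs_self a) ha₁
      _ = ENNReal.ofReal ((K + R) * (a₁ * c₀) + a₁ * |a|) := by
          rw [← ENNReal.ofReal_mul (by positivity), ← ENNReal.ofReal_add (by positivity) (by positivity)]
      _ ≤ _ := by
          refine ENNReal.ofReal_le_ofReal ?_
          have h1 : 0 ≤ (K + R) * (a₁ * c₀) := by positivity
          have h2 : 0 ≤ a₁ * |a| := by positivity
          linarith
  · have hp := hN'.isProbabilityMeasure (hρ θ' hθ')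
    have esq : ∀ y : Param m, ‖y‖ₑ ^ 2 = ENNReal.ofReal (‖y‖ ^ 2) := fun y => by
      rw [ENNReal.ofReal_pow (norm_nonneg _), ofReal_norm]
    have e2 : ∀ y : Param m, 2 * ‖y‖ₑ ^ 2 = ENNReal.ofReal (2 * ‖y‖ ^ 2) := fun y => by
      rw [ENNReal.ofReal_mul (p := 2) zero_le_two, esq]; simp
    calc ∫⁻ y, ‖y - θ'‖ₑ ^ 2 ∂splice N N' C S g c f (ρ θ')
        ≤ ∫⁻ ω, (ENNReal.ofReal (2 * (K + R) ^ 2) + 2 * ‖f ω - θ'‖ₑ ^ 2) ∂N' (ρ θ') := by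
          refine lintegral_splice_le hN hN' hC hCS hS hg hf (hρ θ' hθ').1 (by fun_prop)
            (b := ENNReal.ofReal ((K + ‖θ - θ'‖) ^ 2)) (fun ω => ?_) ?_ (fun ω hω => ?_)
            fun ω => enorm_sq_le_add (by linarith)
          · rw [esq]
            exact ENNReal.ofReal_le_ofReal (pow_le_pow_left₀ (norm_nonneg _) (hy _ _ (hgK ω)) 2)
          · rw [esq]
            exact ENNReal.ofReal_le_ofReal (pow_le_pow_left₀ (norm_nonneg _) (hy _ _ hcK) 2)
          · rw [e2, ← ENNReal.ofReal_add (by positivity) (by positivity)]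
            refine ENNReal.ofReal_le_ofReal ?_
            have h1 := pow_le_pow_left₀ (by positivity) (hb θ' ω hω) 2
            nlinarith [sq_nonneg (K + R - ‖f ω - θ'‖)]
      _ = ENNReal.ofReal (2 * (K + R) ^ 2) + 2 * ∫⁻ ω, ‖f ω - θ'‖ₑ ^ 2 ∂N' (ρ θ') := by
          rw [lintegral_add_left measurable_const, lintegral_const, measure_univ, mul_one,
            lintegral_const_mul' _ _ (by simp)]
      _ ≤ ENNReal.ofReal (2 * (K + R) ^ 2) + 2 * ENNReal.ofReal (a ^ 2) := by
          gcongr; exact (ha θ' hθ').2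
      _ = ENNReal.ofReal (2 * (K + R) ^ 2 + 2 * a ^ 2) := by
          rw [ENNReal.ofReal_add (by positivity) (by positivity), ENNReal.ofReal_mul (p := 2) (q := a ^ 2)
            zero_le_two]
          simp
      _ ≤ _ := by
          refine ENNReal.ofReal_le_ofReal ?_
          have h1 : (K + R) * 1 ≤ (K + R) * c₀ := mul_le_mul_of_nonneg_left hc₀ (by positivity)
          have h2 : 0 ≤ (K + R) * c₀ * |a| := by positivity
          rw [← sq_abs a]
          nlinarith [abs_nonneg a, mul_self_le_mul_self (by positivity) h1]

theorem exists_isPovm_repeatedEstimator_one {Ω : Type*} [MeasurableSpace Ω] (M : Instrument H Ω)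
    {T : (Fin 1 → Ω) → Param m} (hT : Measurable T) :
    ∃ N : TraceClass H → Measure (Fin 1 → Ω), IsPovm N ∧
      ∀ τ, (M.repeatedEstimator T hT).law τ = N (τ 0) := by
  have hc : Measurable fun (w : Ω) (_ : Fin 1) => w := by fun_prop
  refine ⟨fun x => (M.outcome x).map fun w _ => w, M.isPovm_outcome.map hc, fun τ => ?_⟩
  change (Measure.pi fun κ : Fin 1 => M.outcome (τ κ)) = _
  have e : (fun κ : Fin 1 => M.outcome (τ κ)) = fun _ => M.outcome (τ 0) := by
    funext κ; rw [Subsingleton.elim κ 0]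
  rw [e]
  exact ((measurePreserving_funUnique (M.outcome (τ 0)) (Fin 1)).symm _).map_eq.symm

end

/-! ### Estimators on a single sample with bounded moments -/

section

variable {m : ℕ}

/-- Outside of a bounded range a bounded estimate can be replaced by the preliminary one, at an
arbitrarily small cost in the covariance. -/
theorem singleSampleBound_momentBound_le_boundedRange {Θ : Set (Param m)}
    {ρ : Param m → TraceClass H} {a₁ : ℝ} {r : Param m → ℝ} {θ : Param m} (hΘ : IsOpen Θ)
    (hρ : ∀ θ ∈ Θ, (ρ θ).IsDensity) (hr : IsRadius Θ r) (h_smooth : SmoothModel Θ ρ a₁)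
    (h_log : ∀ θ ∈ Θ, ∀ i, HasLogDerivative (ρ θ) (pderiv i ρ θ))
    (h_pilot : HasPilotEstimator Θ ρ (dominant ρ r) a₁) (hθ : θ ∈ Θ)
    (G : Matrix (Fin m) (Fin m) ℝ) :
    singleSampleBound (fun _ e => e.MomentBound Θ ρ (dominant ρ r) a₁) ρ G θ
      ≤ singleSampleBound (fun _ e => e.BoundedRange) ρ G θ := by
  refine le_iInf fun l => le_iInf fun M => le_iInf fun T => le_iInf fun hT => le_iInf fun hu =>
    le_iInf fun hb => ?_
  obtain ⟨b, hb⟩ := hb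
  have hb : ∀ z z', ‖T z - T z'‖ ≤ b := hb
  set K := b + ‖T 0 - θ‖ with hKdef
  have hK0 : 0 ≤ K := add_nonneg ((norm_nonneg _).trans (hb 0 0)) (norm_nonneg _)
  have hK : ∀ z, ‖T z - θ‖ ≤ K := fun z =>
    (norm_sub_le_norm_sub_add_norm_sub _ (T 0) _).trans (add_le_add (hb z 0) le_rfl)
  obtain ⟨l', M', x, hx, -, hm, -⟩ := h_pilot
  obtain ⟨R₀, hR₀⟩ := hr.bounded
  obtain ⟨a, ha⟩ := hm 1 one_pos
  obtain ⟨N', hN', he⟩ := exists_isPovm_repeatedEstimator_one M' (hx 1)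
  set e := M'.repeatedEstimator (x 1) (hx 1) with hedef
  have hlaw : IsProductLaw e.law := by
    have : e.law = fun τ => N' (τ 0) := funext he
    rw [this]; exact hN'.isProductLaw
  have heiid : ∀ σ, e.iidLaw σ = N' σ := fun σ => he fun _ => σ
  have ha' : ∀ θ ∈ Θ, (∀ i, ∫⁻ ω, ‖e.est ω - θ‖ₑ ∂N' (dominant ρ r i θ) ≤ ENNReal.ofReal (a₁ * a)) ∧
      ∫⁻ ω, ‖e.est ω - θ‖ₑ ^ 2 ∂N' (ρ θ) ≤ ENNReal.ofReal (a ^ 2) := fun θ' hθ' => by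
    have h := ha θ' hθ'
    refine ⟨fun i => ?_, ?_⟩
    · have h1 := h.1 i
      rw [Fin.sum_univ_one, he, Function.update_self, Nat.cast_one, one_mul] at h1
      exact h1
    · have h1 := h.2
      rwa [heiid, Nat.cast_one, one_mul] at h1
  have hN := M.isPovm_outcome
  have hp := hN.isProbabilityMeasure (hρ θ hθ)
  have hp' := hN'.isProbabilityMeasure (hρ θ hθ)
  choose Q hQ using fun j => h_smooth.exists_isCurve hΘ hρ h_log hθ j
  have htan : ∀ j, IsTangent (ρ θ) (Q j) (pderiv j ρ θ) := fun j => by simpa using (hQ j).tangent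
  have hmem : ∀ j, ∀ᶠ t : ℝ in 𝓝 0, θ + t • coordVec j ∈ Θ := fun j => by
    have h1 : Tendsto (fun t : ℝ => θ + t • coordVec j) (𝓝 0) (𝓝 θ) := by
      have : Continuous fun t : ℝ => θ + t • (coordVec j : Param m) := by fun_prop
      simpa using this.tendsto 0
    exact h1.eventually (hΘ.mem_nhds hθ)
  have hcurve : ∀ j (L : TraceClass H →L[ℝ] ℝ),
      HasDerivAt (fun t : ℝ => L (ρ (θ + t • coordVec j))) (L (pderiv j ρ θ)) 0 := fun j L =>
    L.hasFDerivAt.comp_hasDerivAt (0 : ℝ) (hQ j).hasDerivAt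
  -- the functionals given by the moments of the bounded estimate
  set z : Fin m → (Fin l → ℝ) → ℝ := fun i ω => T ω i - θ i with hz
  have hzm : ∀ i, Measurable (z i) := fun i => ((measurable_coord i).comp hT).sub_const _
  have hzK : ∀ i ω, |z i ω| ≤ K := fun i ω => (abs_coord_le (T ω - θ) i).trans (hK ω)
  have hzzK : ∀ i k ω, |z i ω * z k ω| ≤ K * K := fun i k ω => by
    rw [abs_mul]; exact mul_le_mul (hzK i ω) (hzK k ω) (abs_nonneg _) hK0
  choose F hF using fun i => hN.exists_ext (hzm i) (hzK i)
  choose F₂ hF₂ using fun i k => hN.exists_ext ((hzm i).mul (hzm k)) (hzzK i k)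
  have hF0 : ∀ i, F i (ρ θ) = 0 := fun i => by
    have h1 : ∫ ω, T ω i ∂M.outcome (ρ θ) = θ i := hu.1 i
    have h2 := integral_add (integrable_of_abs_le (μ := M.outcome (ρ θ)) (hzm i) (hzK i))
      (integrable_const (θ i))
    simp only [hz, sub_add_cancel, integral_const, probReal_univ, smul_eq_mul, one_mul] at h2
    rw [hF i _ (hρ θ hθ).1]
    linarith
  have hFd : ∀ i j, F i (pderiv j ρ θ) = (1 : Matrix (Fin m) (Fin m) ℝ) i j := fun i j => by
    refine HasDerivAt.unique (((hcurve j (F i)).const_add (θ i))) ((hu.2 i j).congr_of_eventuallyEq ?_)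
    filter_upwards [hmem j] with t ht
    have := hN.isProbabilityMeasure (hρ _ ht)
    have h2 := integral_add (integrable_of_abs_le (μ := M.outcome (ρ (θ + t • coordVec j))) (hzm i)
      (hzK i)) (integrable_const (θ i))
    simp only [hz, sub_add_cancel, integral_const, probReal_univ, smul_eq_mul, one_mul] at h2
    rw [hF i _ (hρ _ ht).1, add_comm]
    exact h2.symm
  have hcov : ∀ i k, (M.singleEstimator T hT).cov ρ θ i k = F₂ i k (ρ θ) := fun i k => by
    rw [Estimator.cov, Matrix.of_apply, hu.1, hu.1, hF₂ i k _ (hρ θ hθ).1]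
    rfl
  -- the part of the state that the preliminary measurement finds near `θ`
  have hfar : ∀ y, y.IsPos → Tendsto (fun R => (N' y).real (e.farSet θ R)) atTop (𝓝 0) :=
    fun y hy => by
      have := hN'.isFiniteMeasure hy
      have h1 := tendsto_setIntegral_tailSet (μ := N' y) (e.measurable_est.sub_const θ).norm
        (integrable_const (1 : ℝ))
      simpa [Estimator.farSet] using h1
  have hnearSet : ∀ R, MeasurableSet (e.farSet θ R)ᶜ := fun R => (e.measurableSet_farSet θ R).compl
  have hnear : ∀ y, y.IsPos →
      Tendsto (fun R => (N' y).real (e.farSet θ R)ᶜ) atTop (𝓝 y.tr.re) := fun y hy => by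
    have := hN'.isFiniteMeasure hy
    have h1 := (tendsto_const_nhds (x := y.tr.re)).sub (hfar y hy)
    rw [sub_zero] at h1
    refine h1.congr fun R => ?_
    rw [measureReal_compl (e.measurableSet_farSet θ R), hN'.real_univ hy]
  obtain ⟨C, hC, hCS, hClim⟩ := hN'.exists_compress hnearSet fun y hy => by
    simpa only [compl_compl] using hfar y hy
  obtain ⟨φ, hφ, hφd, hφm, hφ2⟩ := e.exists_hasMeanDeriv_localized hlaw hΘ hρ h_smooth h_log hθ
    (sq_nonneg a) (fun θ' hθ' => by rw [heiid]; exact (ha' θ' hθ').2)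
  simp only [heiid] at hφ2
  have hCρ : Tendsto (fun R => C R (ρ θ)) atTop (𝓝 (ρ θ)) := hClim _ (hρ θ hθ).1
  have hcomp : ∀ L : TraceClass H →L[ℝ] ℝ,
      Tendsto (fun R => L (C R (ρ θ))) atTop (𝓝 (L (ρ θ))) := fun L =>
    (L.continuous.tendsto _).comp hCρ
  set p : ℕ → ℝ := fun R => (N' (ρ θ)).real (e.farSet θ R)ᶜ with hpdef
  have hplim : Tendsto p atTop (𝓝 1) := by
    have := hnear _ (hρ θ hθ).1
    rwa [(hρ θ hθ).2, Complex.one_re] at this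
  have htr : Tendsto (fun R => (C R (ρ θ)).tr.re) atTop (𝓝 1) := by
    have h1 : Continuous fun y : TraceClass H => y.tr.re :=
      Complex.continuous_re.comp (traceCLM H).continuous
    have := (h1.tendsto _).comp hCρ
    rwa [(hρ θ hθ).2, Complex.one_re] at this
  have hJlim : Tendsto (fun R => (Matrix.of fun i j => F i (C R (pderiv j ρ θ)) :
      Matrix (Fin m) (Fin m) ℝ)) atTop (𝓝 1) := by
    refine tendsto_pi_nhds.2 fun i => tendsto_pi_nhds.2 fun j => ?_
    rw [← hFd]
    exact ((F i).continuous.tendsto _).comp ((htan j).tendsto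
      (F₀ := ContinuousLinearMap.id ℝ (TraceClass H)) hClim)
  have hπlim : Tendsto (fun R j => hN'.effect (e.farSet θ R)ᶜ (pderiv j ρ θ)) atTop (𝓝 0) := by
    refine tendsto_pi_nhds.2 fun j => ?_
    have h1 := (htan j).tendsto (F := fun R => hN'.effect (e.farSet θ R)ᶜ)
      (F₀ := hN'.effect Set.univ) fun y hy => by
        simp only [hN'.effect_of_isPos _ hy, hN'.real_univ hy]
        exact hnear y hy
    rwa [hN'.effect_univ, (hQ j).tr_re_eq_zero] at h1
  have hflim : Tendsto (fun R i => (e.localized θ R).mean ρ θ i - θ i) atTop (𝓝 0) := by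
    refine tendsto_pi_nhds.2 fun i => ?_
    simpa using (hφm i).sub_const (θ i)
  have halim : Tendsto (fun R i => F i (C R (ρ θ))) atTop (𝓝 0) := by
    refine tendsto_pi_nhds.2 fun i => ?_
    have := hcomp (F i)
    rwa [hF0] at this
  obtain ⟨A, c, hA, hc, hev⟩ := exists_affine_correction hJlim hφ halim hflim hπlim hplim
  set W : ℕ → Matrix (Fin m) (Fin m) ℝ := fun R => Matrix.of fun i k =>
    ∑ u, A R i u * (∑ v, A R k v * F₂ u v (C R (ρ θ)) + c R k * F u (C R (ρ θ)))
      + c R i * (∑ v, A R k v * F v (C R (ρ θ)) + c R k * (C R (ρ θ)).tr.re)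
      + ((p R - (C R (ρ θ)).tr.re) * (c R i * c R k)
        + ∫ ω in e.farSet θ R, (e.est ω i - θ i) * (e.est ω k - θ k) ∂N' (ρ θ)) with hW
  have hWlim : Tendsto W atTop (𝓝 ((M.singleEstimator T hT).cov ρ θ)) := by
    refine tendsto_pi_nhds.2 fun i => tendsto_pi_nhds.2 fun k => ?_
    have hAe : ∀ i k, Tendsto (fun R => A R i k) atTop (𝓝 ((1 : Matrix (Fin m) (Fin m) ℝ) i k)) :=
      fun i k => tendsto_pi_nhds.1 (tendsto_pi_nhds.1 hA i) k
    have hce : ∀ i, Tendsto (fun R => c R i) atTop (𝓝 0) := fun i => tendsto_pi_nhds.1 hc i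
    have h1 := tendsto_finsetSum Finset.univ fun (u : Fin m) _ => (hAe i u).mul
      ((tendsto_finsetSum Finset.univ fun (v : Fin m) _ => (hAe k v).mul (hcomp (F₂ u v))).add
        ((hce k).mul (hcomp (F u))))
    have h2 := (hce i).mul ((tendsto_finsetSum Finset.univ fun (v : Fin m) _ =>
      (hAe k v).mul (hcomp (F v))).add ((hce k).mul htr))
    have h3 := ((hplim.sub htr).mul ((hce i).mul (hce k))).add (hφ2 i k)
    have h4 := (h1.add h2).add h3
    rw [hcov]
    have h5 : Tendsto (fun R => W R i k) atTop (𝓝 _) := h4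
    convert h5 using 2
    simp [Matrix.one_apply]
  have hlim : Tendsto (fun R => (((G * W R).trace : ℝ) : EReal)) atTop
      (𝓝 ((G * (M.singleEstimator T hT).cov ρ θ).trace : ℝ)) := by
    refine (continuous_coe_real_ereal.tendsto _).comp ?_
    have h1 : Continuous fun B : Matrix (Fin m) (Fin m) ℝ => (G * B).trace :=
      (continuous_const.matrix_mul continuous_id).matrix_trace
    exact (h1.tendsto _).comp hWlim
  -- the cutoff `R` tends to infinity; for large `R` there is an estimator with the covariance `W R`
  refine ge_of_tendsto hlim (hev.mono fun R hR => ?_)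
  -- the affine correction of the bounded estimate
  set L : Param m →L[ℝ] Param m := (Matrix.toEuclideanLin (A R)).toContinuousLinearMap with hL
  have hLi : ∀ y i, L y i = ∑ k, A R i k * y k := fun y i => rfl
  set d : Param m := WithLp.toLp 2 (c R) with hd
  have hdi : ∀ i, d i = c R i := fun i => rfl
  set g : (Fin l → ℝ) → Param m := fun ω => θ + (L (T ω - θ) + d) with hg
  have hgm : Measurable g := by
    have := L.continuous.measurable.comp (hT.sub_const θ)
    exact (this.add_const d).const_add θ
  have hgi : ∀ ω i, g ω i = ∑ k, A R i k * z k ω + (c R i + θ i) := fun ω i => by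
    simp only [hg, PiLp.add_apply, hLi, hdi, PiLp.sub_apply, hz]; ring
  have hgi' : ∀ ω i, g ω i - θ i = ∑ k, A R i k * z k ω + c R i := fun ω i => by
    rw [hgi]; ring
  have hgK : ∀ ω, ‖g ω - θ‖ ≤ ‖L‖ * K + ‖d‖ := fun ω => by
    rw [hg, add_sub_cancel_left]
    exact (norm_add_le _ _).trans (add_le_add ((L.le_opNorm _).trans
      (mul_le_mul_of_nonneg_left (hK ω) (norm_nonneg _))) le_rfl)
  have hdK : ‖θ + d - θ‖ ≤ ‖L‖ * K + ‖d‖ := by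
    rw [add_sub_cancel_left]
    have : 0 ≤ ‖L‖ * K := by positivity
    linarith
  have hgint : ∀ {μ : Measure (Fin l → ℝ)} [IsFiniteMeasure μ] (i : Fin m),
      Integrable (fun ω => g ω i - θ i) μ := fun {μ} _ i => by
    refine integrable_of_abs_le (((measurable_coord i).comp hgm).sub_const _) (c := ‖L‖ * K + ‖d‖)
      fun ω => (abs_coord_le (g ω - θ) i).trans (hgK ω)
  obtain ⟨a', hmom⟩ := exists_moment_splice (S := (e.farSet θ R)ᶜ) (c := θ + d) (a₁ := a₁)
    (c₀ := 1 + 2 * |R₀|) (R := R) hN hN' (hC R) (hCS R) (hnearSet R) hgm e.measurable_est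
    (by linarith [abs_nonneg R₀]) ((norm_nonneg _).trans hdK) (Nat.cast_nonneg R) hρ
    (fun θ hθ i => dominant_isPos_and_tr_le hr h_smooth hR₀ hθ i) hgK hdK
    (fun ω hω => Estimator.norm_sub_le_of_notMem_farSet hω) ha'
  have hsp := hN.splice hN' (g := g) (c := θ + d) (hC R) (hCS R) (hnearSet R) hgm e.measurable_est
  have hmean : ∀ θ' ∈ Θ, ∀ i, ∫ y, y i ∂splice M.outcome N' (C R) (e.farSet θ R)ᶜ g (θ + d) e.est (ρ θ')
      = ∑ k, A R i k * F k (C R (ρ θ')) + c R i * hN'.effect (e.farSet θ R)ᶜ (ρ θ')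
        + (e.localized θ R).mean ρ θ' i := fun θ' hθ' i => by
    have hfin := hN.isFiniteMeasure (hC R _ (hρ θ' hθ').1)
    have hprob' := hN'.isProbabilityMeasure (hρ θ' hθ')
    have hprob : IsFiniteMeasure (e.iidLaw (ρ θ')) := by rw [heiid]; infer_instance
    have hi : Integrable (fun ω => e.est ω i) (N' (ρ θ')) := by
      have h1 := ((memLp_coord_of_lintegral_le e.measurable_est (ha' θ' hθ').2 i).1.integrable
        one_le_two).add (integrable_const (θ' i))
      refine h1.congr (Eventually.of_forall fun ω => ?_)
      exact sub_add_cancel _ _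
    have hgi1 : Integrable (fun ω => g ω i) (M.outcome (C R (ρ θ'))) := by
      refine ((hgint i).add (integrable_const (θ i))).congr (Eventually.of_forall fun ω => ?_)
      exact sub_add_cancel _ _
    rw [integral_splice (measurable_coord i) hgm e.measurable_est (hCS R _ (hρ θ' hθ').1) hgi1
      hi.integrableOn, compl_compl, e.mean_localized R (by rw [heiid]; exact hi), heiid]
    simp_rw [hgi]
    rw [integral_affine (fun k => integrable_of_abs_le (hzm k) (hzK k)),
      hN.real_univ (hC R _ (hρ θ' hθ').1), hN'.effect_of_isPos _ (hρ θ' hθ').1]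
    simp_rw [hF _ _ (hC R _ (hρ θ' hθ').1)]
    have : (θ + d) i = θ i + c R i := rfl
    rw [this]
    ring
  have hpR : hN'.effect (e.farSet θ R)ᶜ (ρ θ) = p R := hN'.effect_of_isPos _ (hρ θ hθ).1
  have hVR : (Matrix.of fun i k => ∫ y, (y i - θ i) * (y k - θ k)
      ∂splice M.outcome N' (C R) (e.farSet θ R)ᶜ g (θ + d) e.est (ρ θ)) = W R := by
    ext i k
    have hfin := hN.isFiniteMeasure (hC R _ (hρ θ hθ).1)
    have hmemLp := fun i => (memLp_coord_of_lintegral_le e.measurable_est (ha' θ hθ).2 i).1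
    have hg2 : Integrable (fun ω => (g ω i - θ i) * (g ω k - θ k)) (M.outcome (C R (ρ θ))) := by
      refine integrable_of_abs_le ((((measurable_coord i).comp hgm).sub_const _).mul
        (((measurable_coord k).comp hgm).sub_const _))
        (c := (‖L‖ * K + ‖d‖) * (‖L‖ * K + ‖d‖)) fun ω => ?_
      change |(g ω i - θ i) * (g ω k - θ k)| ≤ _
      rw [abs_mul]
      exact mul_le_mul ((abs_coord_le (g ω - θ) i).trans (hgK ω))
        ((abs_coord_le (g ω - θ) k).trans (hgK ω)) (abs_nonneg _) ((norm_nonneg _).trans hdK)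
    rw [Matrix.of_apply, integral_splice (φ := fun y : Param m => (y i - θ i) * (y k - θ k))
      (by fun_prop) hgm e.measurable_est (hCS R _ (hρ θ hθ).1) hg2
      ((hmemLp i).integrable_fun_mul (hmemLp k)).integrableOn, compl_compl]
    simp_rw [hgi']
    rw [integral_affine_mul (fun k => integrable_of_abs_le (hzm k) (hzK k))
      (fun u v => integrable_of_abs_le ((hzm u).mul (hzm v)) (hzzK u v)),
      hN.real_univ (hC R _ (hρ θ hθ).1)]
    simp only [hW, Matrix.of_apply, hF _ _ (hC R _ (hρ θ hθ).1), hF₂ _ _ _ (hC R _ (hρ θ hθ).1),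
      PiLp.add_apply, add_sub_cancel_left, hdi, hpdef]
    rfl
  rw [← hVR]
  refine hsp.singleSampleBound_momentBound_le
    (fun θ hθ i => (dominant_isPos_and_tr_le hr h_smooth hR₀ hθ i).1) hρ
    (fun j => eventually_isDensity hΘ hρ hθ j) hθ (fun i => ?_) (fun i j => ?_) hmom G
  · rw [hmean θ hθ, hpR]
    linarith [hR.1 i]
  · have h1 := ((HasDerivAt.fun_sum fun k (_ : k ∈ Finset.univ) =>
      (hcurve j ((F k).comp (C R))).const_mul (A R i k)).add
        ((hcurve j (hN'.effect (e.farSet θ R)ᶜ)).const_mul (c R i))).add (hφd R i j)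
    rw [← hR.2 i j]
    refine h1.congr_of_eventuallyEq ?_
    filter_upwards [hmem j] with t ht using hmean _ ht i

end

end QuantumEstimation

end

theorem mainTheorem2 {H : Type*} [NormedAddCommGroup H] [InnerProductSpace ℂ H] [CompleteSpace H]
    [TopologicalSpace.SeparableSpace H] {m : ℕ} (Θ : Set (Param m)) (hΘ_open : IsOpen Θ)
    (hΘ_convex : Convex ℝ Θ) (ρ : Param m → TraceClass H) (hρ : ∀ θ ∈ Θ, (ρ θ).IsDensity)
    (a₁ : ℝ) (r : Param m → ℝ) (hr : IsRadius Θ r)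
    (h_smooth : SmoothModel Θ ρ a₁)
    (h_log : ∀ θ ∈ Θ, ∀ i, HasLogDerivative (ρ θ) (pderiv i ρ θ))
    (h_pilot : HasPilotEstimator Θ ρ (dominant ρ r) a₁)
    (θ : Param m) (hθ : θ ∈ Θ) (G : Matrix (Fin m) (Fin m) ℝ) (hG : G.PosSemidef) :
    semiClassicalBound Θ ρ (dominant ρ r) a₁ G θ
        = singleSampleBound (fun _ e => e.BoundedRange) ρ G θ ∧
      semiClassicalBound Θ ρ (dominant ρ r) a₁ G θ
        = singleSampleBound (fun _ e => e.MomentBound Θ ρ (dominant ρ r) a₁) ρ G θ ∧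
      oneWayBound Θ ρ (dominant ρ r) a₁ G θ = semiClassicalBound Θ ρ (dominant ρ r) a₁ G θ := by
  have hlow := singleSampleBound_le_semiClassicalBound (a₁ := a₁) hΘ_open hρ h_smooth h_log hθ hG
    (dominant ρ r)
  have hone : semiClassicalBound Θ ρ (dominant ρ r) a₁ G θ ≤ oneWayBound Θ ρ (dominant ρ r) a₁ G θ :=
    iInf_mono fun e => le_iInf fun _ => iInf_le_of_le (fun _ _ => trivial) le_rfl
  have hup := oneWayBound_le_singleSampleBound hΘ_open hρ hr h_smooth h_log h_pilot hθ G
  have hb : semiClassicalBound Θ ρ (dominant ρ r) a₁ G θ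
      = singleSampleBound (fun _ e => e.BoundedRange) ρ G θ := le_antisymm (hone.trans hup) hlow
  refine ⟨hb, hb.trans (le_antisymm ?_ ?_), le_antisymm (hup.trans hlow) hone⟩
  · exact singleSampleBound_boundedRange_le hΘ_open hρ h_smooth h_log hθ hG (dominant ρ r)
  · exact singleSampleBound_momentBound_le_boundedRange hΘ_open hρ hr h_smooth h_log h_pilot hθ G
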